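/- **Setting.** Let $\Sigma$ be a compact connected Riemann surface of genus $\mathfrak g$ with a canonical (symplectic) basis of cycles $\mathcal A_1,\dots,\mathcal A_{\mathfrak g},\mathcal B_1,\dots,\mathcal B_{\mathfrak g}$, given as the sides of a canonical dissection of $\Sigma$ into a $4\mathfrak g$-gon (no cycles if $\mathfrak g=0$). Let $dx$ be a meromorphic 1-form on $\Sigma$ (its primitive $x$ may be multivalued) whose zeros $a_1,\dots,a_b$, the branchpoints, are all simple, and let $\zeta_i=\sqrt{x-x(a_i)}$ be a local coordinate at $a_i$, so that $\zeta_i(a_i)=0$ and $dx=2\zeta_i\,d\zeta_i$. Let $B$ be the fundamental bidifferential of the second kind normalized on the $\mathcal A$-cycles: $B$ is symmetric, holomorphic off the diagonal, $B(z,z')=\big(\frac{1}{(w-w')^2}+\text{holomorphic}\big)\,dw\otimes dw'$ near the diagonal, where $w,w'$ are the values at $z,z'$ of any local coordinate, and $\oint_{z'\in\mathcal A_j}B(z,z')=0$ for all $j$ and all $z\notin\mathcal A_j$. **Coefficients and series.** Near $(a_i,a_j)$ write $$B(z,z')=\Big(\frac{\delta_{ij}}{(\zeta_i(z)-\zeta_j(z'))^2}+\sum_{d,d'\ge0}B_{a_i,d;a_j,d'}\,\zeta_i(z)^d\zeta_j(z')^{d'}\Big)d\zeta_i(z)\otimes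 d\zeta_j(z'),$$ $$\hat B_{a_i,k;a_j,l}=(2k-1)!!\,(2l-1)!!\,2^{-k-l-1}B_{a_i,2k;a_j,2l}\qquad((-1)!!=1),$$ and define the formal power series in $1/u$, $1/v$ $$\check B_{a_i,a_j}(u,v)=\sum_{k,l\ge0}\hat B_{a_i,k;a_j,l}\,u^{-k}v^{-l},\qquad f_{i,j}(u)=\delta_{ij}-\sum_{k\ge0}\hat B_{a_j,0;a_i,k}\,u^{-k-1}.$$ **Laplace transforms.** Let $d\xi_{a_j,0}(z)=-\operatorname{Res}_{z'\to a_j}B(z,z')\,\zeta_j(z')^{-1}$. A steepest-descent path $\gamma_{a_i}$ is a path $s\mapsto\gamma_{a_i}(s)$ through $a_i=\gamma_{a_i}(0)$, with $\zeta_i(\gamma_{a_i}(s))=s$ near $s=0$ and $x(\gamma_{a_i}(s))-x(a_i)=s^2$; it is a finite arc if $s\in[-r,r]$, $r>0$, and complete if $s\in\mathbb R$. Along $\gamma_{a_i}$ let $\xi_{a_j,0}$ be a primitive of $d\xi_{a_j,0}$ with $\xi_{a_j,0}-\delta_{ij}/s$ convergent as $s\to0$. For $u,v>0$ put $$f^{\gamma}_{i,j}(u)=\frac{\sqrt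 u\,e^{ux(a_i)}}{2\sqrt\pi}\int_{\gamma_{a_i}}e^{-ux}\,\xi_{a_j,0}\,dx,$$ $$\check B^{\gamma}_{a_i,a_j}(u,v)=\delta_{ij}\frac{uv}{u+v}+\frac{\sqrt{uv}\,e^{ux(a_i)+vx(a_j)}}{2\pi}\int_{z\in\gamma_{a_i}}\int_{z'\in\gamma_{a_j}}B(z,z')\,e^{-ux(z)-vx(z')},$$ where for $i=j$ the double integral is regularized by giving the integral of the double pole $ds\,ds'/(s-s')^2$ the value $-2\pi\sqrt{uv}/(u+v)$. Equivalently, $\check B^\gamma_{a_i,a_j}$ is the second term alone, with the double pole $\delta_{ij}\,ds\,ds'/(s-s')^2$ subtracted from $B$. **Claim.** For all $i,j$: 1. The above expansions of $B$ near $(a_i,a_j)$ exist, and, as an identity of formal power series in $1/u$ and $1/v$, $$\check B_{a_i,a_j}(u,v)=\frac{uv}{u+v}\Big(\delta_{ij}-\sum_{k=1}^{b}f_{i,k}(u)\,f_{j,k}(v)\Big),$$ that is, $\big(\tfrac1u+\tfrac1v\big)\check B_{a_i,a_j}(u,v)=\delta_{ij}-\sum_k f_{i,k}(u)f_{j,k}(v)$.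 2. These series are the asymptotic expansions of the Laplace transforms along finite arcs $s\in[-r,r]$ of the steepest-descent paths. For every $N\ge0$, $f^\gamma_{i,j}(u)$ equals the sum of the terms $u^{-n}$, $n<N$, of $f_{i,j}(u)$ up to $O(u^{-N})$ as $u\to+\infty$, and $\check B^\gamma_{a_i,a_j}(u,v)$ equals the sum of the terms $u^{-k}v^{-l}$, $k,l<N$, of $\check B_{a_i,a_j}(u,v)$ up to $O(u^{-N}+v^{-N})$ as $u,v\to+\infty$. 3. If $\gamma_{a_i}$ and $\gamma_{a_j}$ are complete, $u,v>0$, and the integrals defining $\check B^\gamma_{a_i,a_j}(u,v)$ (with the double pole subtracted), $f^\gamma_{i,k}(u)$ and $f^\gamma_{j,k}(v)$ $(1\le k\le b)$ converge absolutely, then $$\check B^\gamma_{a_i,a_j}(u,v)=\frac{uv}{u+v}\Big(\delta_{ij}-\sum_{k=1}^{b}f^\gamma_{i,k}(u)\,f^\gamma_{j,k}(v)\Big).$$ -/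

import Mathlib

open Set Filter Topology Asymptotics MeasureTheory
open scoped Manifold ContDiff

namespace SpectralCurve

noncomputable section

section Forms

variable {X : Type*} [TopologicalSpace X] [ChartedSpace ℂ X]

/-- The velocity at time `t` of a (real differentiable) path in the Riemann surface `X`. -/
def velocity (γ : ℝ → X) (t : ℝ) : TangentSpace 𝓘(ℂ, ℂ) (γ t) :=
  (mfderiv 𝓘(ℝ, ℝ) 𝓘(ℝ, ℂ) γ t (1 : ℝ) : ℂ)

/-- The coordinate vector field `∂/∂e` of the coordinate `e`, at the point with coordinate `w`. -/
def coordVec (e : OpenPartialHomeomorph X ℂ) (w : ℂ) : TangentSpace 𝓘(ℂ, ℂ) (e.symm w) :=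
  mfderiv 𝓘(ℂ, ℂ) 𝓘(ℂ, ℂ) e.symm w (1 : ℂ)

variable (X) in
/-- Differential 1-forms of type (1,0), not necessarily continuous. Meromorphic forms take a
conventional value at their poles. -/
abbrev OneForm : Type _ := ∀ p : X, TangentSpace 𝓘(ℂ, ℂ) p →ₗ[ℂ] ℂ

variable (X) in
/-- Bilinear differentials on `X × X`; the first tangent vector sits at the first point. -/
abbrev Bidifferential : Type _ :=
  ∀ p q : X, TangentSpace 𝓘(ℂ, ℂ) p →ₗ[ℂ] TangentSpace 𝓘(ℂ, ℂ) q →ₗ[ℂ] ℂ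

/-- The coefficient `h` in the expression `h(w) dw` of a 1-form in the coordinate `e`. -/
def OneForm.coeff (η : OneForm X) (e : OpenPartialHomeomorph X ℂ) (w : ℂ) : ℂ :=
  η (e.symm w) (coordVec e w)

/-- The coefficient `h` in the expression `h(w, z) dw ⊗ dz` of a bilinear differential, in the
coordinate `e` for the first and `f` for the second variable. -/
def Bidifferential.coeff (B : Bidifferential X) (e f : OpenPartialHomeomorph X ℂ) (w z : ℂ) : ℂ :=
  B (e.symm w) (f.symm z) (coordVec e w) (coordVec f z)

/-- Meromorphic 1-forms: the coefficient in every holomorphic coordinate is meromorphic. It is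
taken in normal form, so the form is holomorphic away from its poles and, by convention, has the
value zero at its poles. -/
def OneForm.IsMeromorphic (η : OneForm X) : Prop :=
  ∀ e ∈ IsManifold.maximalAtlas 𝓘(ℂ, ℂ) ω X, ∀ w ∈ e.target, MeromorphicNFAt (η.coeff e) w

/-- The order of vanishing of a meromorphic 1-form (negative at poles). -/
def OneForm.order (η : OneForm X) (p : X) : WithTop ℤ :=
  meromorphicOrderAt (η.coeff (chartAt ℂ p)) (chartAt ℂ p p)

/-- `B` is a Bergman kernel: a symmetric bilinear differential, holomorphic off the diagonal, and
equal to `dw ⊗ dz / (w - z) ^ 2 + holomorphic` near the diagonal in every coordinate. Its values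
on the diagonal are irrelevant. -/
structure Bidifferential.IsBergmanKernel (B : Bidifferential X) : Prop where
  symm : ∀ (p q : X) (v : TangentSpace 𝓘(ℂ, ℂ) p) (w : TangentSpace 𝓘(ℂ, ℂ) q),
    p ≠ q → B p q v w = B q p w v
  holo : ∀ e ∈ IsManifold.maximalAtlas 𝓘(ℂ, ℂ) ω X, ∀ f ∈ IsManifold.maximalAtlas 𝓘(ℂ, ℂ) ω X,
    ∀ w ∈ e.target, ∀ z ∈ f.target, e.symm w ≠ f.symm z →
      AnalyticAt ℂ (fun y : ℂ × ℂ => B.coeff e f y.1 y.2) (w, z)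
  diag : ∀ e ∈ IsManifold.maximalAtlas 𝓘(ℂ, ℂ) ω X, ∀ w ∈ e.target,
    ∃ h : ℂ × ℂ → ℂ, AnalyticAt ℂ h (w, w) ∧
      ∀ᶠ y in 𝓝 (w, w), y.1 ≠ y.2 → B.coeff e e y.1 y.2 = 1 / (y.1 - y.2) ^ 2 + h y

/-- All the periods of `B` (in its second variable) along the closed paths `A j`, parametrized by
`[0, 1]`, vanish. -/
def Bidifferential.IsNormalizedOn (B : Bidifferential X) {g : ℕ} (A : Fin g → ℝ → X) : Prop :=
  ∀ (j : Fin g) (p : X), p ∉ A j '' Icc 0 1 → ∀ v : TangentSpace 𝓘(ℂ, ℂ) p,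
    ∫ t in (0 : ℝ)..1, B p (A j t) v (velocity (A j) t) = 0

end Forms

section Cycles

/-- The vertices of the regular `4g`-gon, in counterclockwise order. -/
def vertex (g k : ℕ) : ℂ := Complex.exp (2 * Real.pi * Complex.I * k / (4 * g))

/-- The `k`-th side of the regular `4g`-gon, parametrized affinely by `[0, 1]`. -/
def side (g k : ℕ) (t : ℝ) : ℂ := AffineMap.lineMap (vertex g k) (vertex g (k + 1)) t

/-- The closed regular `4g`-gon. -/
def polygon (g : ℕ) : Set ℂ := convexHull ℝ (range (vertex g))

/-- The side pairing of the `4g`-gon with boundary word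
`A₁ B₁ A₁⁻¹ B₁⁻¹ ⋯ A_g B_g A_g⁻¹ B_g⁻¹`. -/
def SidePaired (g : ℕ) (z w : ℂ) : Prop :=
  ∃ j < g, ∃ t ∈ Icc (0 : ℝ) 1,
    (z = side g (4 * j) t ∧ w = side g (4 * j + 2) (1 - t)) ∨
    (z = side g (4 * j + 1) t ∧ w = side g (4 * j + 3) (1 - t))

variable {X : Type*} [TopologicalSpace X] [ChartedSpace ℂ X]

/-- The real derivative of a map from the plane to a Riemann surface `X`, as a real linear map from
`ℂ` to the tangent space of `X`, which is a copy of `ℂ`. -/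
def realDeriv (φ : ℂ → X) (z : ℂ) : ℂ →L[ℝ] ℂ :=
  mfderiv 𝓘(ℝ, ℂ) 𝓘(ℝ, ℂ) φ z

/-- A canonical dissection of a Riemann surface of genus `g ≥ 1`: a smooth map that presents the
surface as the `4g`-gon with its sides glued along `∏ [A_j, B_j]`, and that is an orientation
preserving local diffeomorphism inside the polygon. -/
structure IsCanonicalDissection (g : ℕ) (φ : ℂ → X) : Prop where
  smooth : ContMDiff 𝓘(ℝ, ℂ) 𝓘(ℝ, ℂ) ∞ φ
  orient : ∀ z ∈ interior (polygon g), 0 < (realDeriv φ z).det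
  onto : φ '' polygon g = univ
  fiber : ∀ z ∈ polygon g, ∀ w ∈ polygon g,
    φ z = φ w ↔ Relation.EqvGen (SidePaired g) z w

/-- `g` is the genus of the compact Riemann surface `X` and the closed paths `A j`, `C j`
(parametrized by `[0, 1]`) are the `𝒜`- and `ℬ`-cycles of a canonical (symplectic) homology basis:
they are the images of the sides of the polygon in a canonical dissection. In genus 0 there are no
cycles. -/
def IsCanonicalHomologyBasis (g : ℕ) (A C : Fin g → ℝ → X) : Prop :=
  (g = 0 ∧ SimplyConnectedSpace X) ∨
  (0 < g ∧ ∃ φ : ℂ → X, IsCanonicalDissection g φ ∧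
    ∀ j : Fin g, ∀ t ∈ Icc (0 : ℝ) 1,
      A j t = φ (side g (4 * j) t) ∧ C j t = φ (side g (4 * j + 1) t))

end Cycles

section Laplace

variable {X : Type*} [TopologicalSpace X] [ChartedSpace ℂ X]

/-- `e` is a coordinate `ζ = √(x - x(a))` near the branchpoint `a`: a holomorphic coordinate
centred at `a` in which `dx = d(ζ ^ 2) = 2 ζ dζ`. -/
structure IsBranchCoordinate (dx : OneForm X) (a : X) (e : OpenPartialHomeomorph X ℂ) : Prop where
  mem_maximalAtlas : e ∈ IsManifold.maximalAtlas 𝓘(ℂ, ℂ) ω X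
  mem_source : a ∈ e.source
  map_center : e a = 0
  coeff_eq : ∀ w ∈ e.target, dx.coeff e w = 2 * w

/-- The Kronecker symbol. -/
def kron {b : ℕ} (i j : Fin b) : ℂ := if i = j then 1 else 0

/-- The numbers `c d l` are the coefficients of the expansion
`B = (δ / (w - z) ^ 2 + ∑ c d l w ^ d z ^ l) dw ⊗ dz` near the centres of the coordinates
`e` (for `w`) and `f` (for `z`). -/
def Bidifferential.HasExpansion (B : Bidifferential X) (e f : OpenPartialHomeomorph X ℂ) (δ : ℂ)
    (c : ℕ → ℕ → ℂ) : Prop :=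
  ∃ ρ > 0, ∀ w z : ℂ, ‖w‖ < ρ → ‖z‖ < ρ → w ∈ e.target ∧ z ∈ f.target ∧
    (e.symm w ≠ f.symm z →
      HasSum (fun n : ℕ × ℕ => c n.1 n.2 * w ^ n.1 * z ^ n.2)
        (B.coeff e f w z - δ / (w - z) ^ 2))

open Classical in
/-- The coefficients `B_{a_i,d;a_j,l}` of the expansion of `B` near a pair of branchpoints, in the
coordinates `ζ i`, `ζ j`. -/
def bergmanCoeff {b : ℕ} (B : Bidifferential X) (ζ : Fin b → OpenPartialHomeomorph X ℂ)
    (i : Fin b) (d : ℕ) (j : Fin b) (l : ℕ) : ℂ :=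
  if h : ∃ c, B.HasExpansion (ζ i) (ζ j) (kron i j) c then h.choose d l else 0

/-- `B̂_{a_i,k;a_j,l} = (2k-1)!! (2l-1)!! 2^{-k-l-1} B_{a_i,2k;a_j,2l}`, where `(-1)!! = 1`. -/
def hatCoeff {b : ℕ} (B : Bidifferential X) (ζ : Fin b → OpenPartialHomeomorph X ℂ)
    (i : Fin b) (k : ℕ) (j : Fin b) (l : ℕ) : ℂ :=
  ((2 * k - 1).doubleFactorial * (2 * l - 1).doubleFactorial : ℕ) / 2 ^ (k + l + 1) * bergmanCoeff B ζ i (2 * k) j (2 * l)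

/-- The power series `∑ B̂_{a_i,k;a_j,l} u^{-k} v^{-l}`, in the variables `X 0 = u⁻¹`,
`X 1 = v⁻¹`. -/
def checkSeries {b : ℕ} (B : Bidifferential X) (ζ : Fin b → OpenPartialHomeomorph X ℂ)
    (i j : Fin b) : MvPowerSeries (Fin 2) ℂ :=
  fun m => hatCoeff B ζ i (m 0) j (m 1)

/-- The power series `δ_{ij} - ∑ B̂_{a_j,0;a_i,k} u^{-k-1}`, in the variable `u⁻¹`. -/
def fSeries {b : ℕ} (B : Bidifferential X) (ζ : Fin b → OpenPartialHomeomorph X ℂ)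
    (i j : Fin b) : PowerSeries ℂ :=
  PowerSeries.mk fun n => match n with
    | 0 => kron i j
    | k + 1 => - hatCoeff B ζ j 0 i k

/-- The 1-form `dξ_{a,0}(z) = - Res_{z' → a} B(z, z') ζ(z')⁻¹ = - B(z, a) / dζ(a)`, where `e` is the
coordinate `ζ` centred at `a`. -/
def dxi (B : Bidifferential X) (e : OpenPartialHomeomorph X ℂ) : OneForm X :=
  fun p => - (B p (e.symm 0)).flip (coordVec e 0)

/-- `γ` is a steepest descent path through the branchpoint at the centre of the coordinate `e`,
over the interval `I ∋ 0`, parametrized by `s = √(x - x(a))`: it is the real axis of the coordinate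
`e` near the branchpoint, and `d(x(γ(s))) = d(s ^ 2)`, that is `x(γ(s)) - x(a) = s ^ 2 ∈ ℝ₊`. For
`I = univ` this is a complete steepest descent path, on which `x - x(a)` covers all of `ℝ₊`. -/
structure IsSteepestDescent (dx : OneForm X) (e : OpenPartialHomeomorph X ℂ) (I : Set ℝ)
    (γ : ℝ → X) : Prop where
  near : ∀ᶠ s : ℝ in 𝓝 0, γ s = e.symm (s : ℂ)
  diff : ∀ s ∈ I, MDifferentiableAt 𝓘(ℝ, ℝ) 𝓘(ℝ, ℂ) γ s
  deriv_x : ∀ s ∈ I, dx (γ s) (velocity γ s) = 2 * s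

/-- The function `s ↦ ξ s` is a determination along the steepest descent path `γ` of the primitive
`ξ_{a,0}` of `dξ_{a,0}`, where `e` is the coordinate at `a`. Here `δ` is 1 if `γ` passes through
`a`, where `ξ_{a,0}` is `1 / ζ + analytic`, and 0 otherwise. -/
structure IsXiAlong (B : Bidifferential X) (e : OpenPartialHomeomorph X ℂ) (I : Set ℝ)
    (γ : ℝ → X) (δ : ℂ) (ξ : ℝ → ℂ) : Prop where
  deriv : ∀ s ∈ I, s ≠ 0 → HasDerivWithinAt ξ (dxi B e (γ s) (velocity γ s)) I s
  polar : ∃ c : ℂ, Tendsto (fun s : ℝ => ξ s - δ / s) (𝓝[≠] 0) (𝓝 c)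

/-- The integrand `e^{-u (x - x(a))} ξ dx` along a steepest descent path, where
`x(γ(s)) - x(a) = s ^ 2`. -/
def fIntegrand (dx : OneForm X) (γ : ℝ → X) (ξ : ℝ → ℂ) (u s : ℝ) : ℂ :=
  Real.exp (-u * s ^ 2) * ξ s * dx (γ s) (velocity γ s)

/-- The Laplace transform `√u / (2 √π) e^{u x(a)} ∫ e^{-u x} ξ dx` along the part of the path `γ`
over the interval `I`. -/
def fLaplace (dx : OneForm X) (γ : ℝ → X) (ξ : ℝ → ℂ) (I : Set ℝ) (u : ℝ) : ℂ :=
  (√u / (2 * √Real.pi) : ℝ) * ∫ s in I, fIntegrand dx γ ξ u s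

/-- The integrand of the double Laplace transform of `B` on a pair of steepest descent paths, with
the double pole `δ dζ dζ' / (ζ - ζ') ^ 2` subtracted (`δ = 1` if the paths are the same). -/
def checkIntegrand (B : Bidifferential X) (γ η : ℝ → X) (δ : ℂ) (u v : ℝ) (y : ℝ × ℝ) : ℂ :=
  Real.exp (-u * y.1 ^ 2 - v * y.2 ^ 2) *
    (B (γ y.1) (η y.2) (velocity γ y.1) (velocity η y.2) - δ / ((y.1 : ℂ) - y.2) ^ 2)

/-- The regularized double Laplace transform
`δ u v / (u + v) + √(u v) / (2 π) e^{u x(a) + v x(a')} ∫∫ B(z, z') e^{-u x(z) - v x(z')}`.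
If `δ = 1` the integral of `dζ dζ' / (ζ - ζ') ^ 2` diverges on the diagonal and is given its
regularized value `- 2 π √(u v) / (u + v)`, which cancels the first term. -/
def checkLaplace (B : Bidifferential X) (γ η : ℝ → X) (δ : ℂ) (I : Set ℝ) (u v : ℝ) : ℂ :=
  (√(u * v) / (2 * Real.pi) : ℝ) * ∫ y in I ×ˢ I, checkIntegrand B γ η δ u v y

end Laplace

end

end SpectralCurve

open SpectralCurve

/-!
# Factorization of the Laplace transforms of the fundamental bidifferential

Everything rests on one identity on the surface, `Bidifferential.IsBergmanKernel.deriv_div_add_deriv_div`: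
the derivative of `B` along the vector field `∂/∂x + ∂/∂x'` is minus half of
`∑ₖ B(·, aₖ) B(·', aₖ)`, where the arguments `aₖ` are evaluated in the coordinates `ζₖ`. (In coordinates
in which `x` is a square plus a constant, the field is `½ (w⁻¹ ∂_w + z⁻¹ ∂_z)`, and the factors `½`
cancel.) For a fixed second point `q` the difference of the two sides is a 1-form in the first point. The
double pole of `B` at `q` is killed by the derivative, being a function of `x - x'` to leading order, and
the poles at the branchpoints, which come from dividing by `dx`, cancel against the sum, so that the form
is holomorphic (`keyCoeff_removable`). Its `𝒜`-periods vanish (`integral_keyForm_eq_zero`): it is the sum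
of an exact form, a derivative of the normalized `B(·, q)`, and the normalized second kind differentials
`B(·, aₖ)`. The cycles may pass through branchpoints, where the poles of the single terms lie, and there
the poles are first removed by subtracting the differential of a cut-off pole, which does not affect
periods (`exists_regularization`). A holomorphic form with vanishing `𝒜`-periods is zero
(`OneForm.eq_zero_of_periods_eq_zero`): pulled back to the polygon it has a primitive `F`, the boundary
integral of `conj F dF` is zero because the sides are paired, and by Green's formula this integral is
the integral of a Jacobian of constant sign. In genus zero the primitive lives on the compact surface
and is constant.

The formal factorization (`formal_factorization`) is the comparison of Taylor coefficients in this
identity at a pair of branchpoints: it gives a recurrence relating the coefficients with indices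
`(d + 2, l)` and `(d, l + 2)` to the products of the coefficients of the two differentials, and the
double factorials in `hatCoeff` are made to absorb its integer factors.

For the integrals, a steepest descent path follows, near each of its points other than the branchpoint,
the real axis of a coordinate in which `dx = 2 w dw` (`IsSteepestDescent.exists_follows`), and two such
paths meet only in the trivial case (`IsSteepestDescent.eq_of_apply_eq`), as can be seen by continuing
both back to the branchpoint. Therefore `B` along a pair of paths is the double pole plus a smooth kernel,
which satisfies the identity above as a partial differential equation (`exists_smooth_kernel`). Integrated
against `e ^ (-u s² - v s'²)` over boxes, the left-hand side becomes `u + v` times the double transform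
plus boundary terms, and the right-hand side a sum of products of single transforms. Absolute convergence
yields a sequence of boxes along which the boundary terms vanish (`laplace_factorization`,
`checkLaplace_factorization`).

The asymptotic expansions along finite arcs are instances of Watson's lemma, in one variable
(`isBigO_integral_gauss`) and in two (`isBigO_integral_gauss_gauss`): the Gaussian moments of even powers
are the double factorials in `hatCoeff`, those of odd powers vanish, and the ends of the arc contribute
only exponentially small terms.
-/

namespace SpectralCurve

noncomputable section

/-! ### Coordinates and directional derivatives -/

section Coordinates

variable {X : Type*} [TopologicalSpace X] [ChartedSpace ℂ X]

/-- The derivative of the function `F` in the direction of the tangent vector `v`, as a complex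
number. -/
def dirDeriv (F : X → ℂ) (p : X) (v : TangentSpace 𝓘(ℂ, ℂ) p) : ℂ :=
  mfderiv 𝓘(ℂ, ℂ) 𝓘(ℂ, ℂ) F p v

theorem HasMFDerivAt.complexToReal {f : X → ℂ} {p : X} {f' : ℂ →L[ℂ] ℂ}
    (h : HasMFDerivAt 𝓘(ℂ, ℂ) 𝓘(ℂ, ℂ) f p f') :
    HasMFDerivAt 𝓘(ℝ, ℂ) 𝓘(ℝ, ℂ) f p (f'.restrictScalars ℝ : ℂ →L[ℝ] ℂ) :=
  ⟨h.1, HasFDerivWithinAt.restrictScalars ℝ (f' := f') h.2⟩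

variable {e f : OpenPartialHomeomorph X ℂ}

theorem mdifferentiableAt_coord (he : e ∈ IsManifold.maximalAtlas 𝓘(ℂ, ℂ) ω X) {p : X}
    (hp : p ∈ e.source) : MDifferentiableAt 𝓘(ℂ, ℂ) 𝓘(ℂ, ℂ) e p :=
  ((contMDiffOn_of_mem_maximalAtlas he).contMDiffAt (e.open_source.mem_nhds hp)).mdifferentiableAt
    (by simp)

theorem mdifferentiableAt_coord_symm (he : e ∈ IsManifold.maximalAtlas 𝓘(ℂ, ℂ) ω X) {w : ℂ}
    (hw : w ∈ e.target) : MDifferentiableAt 𝓘(ℂ, ℂ) 𝓘(ℂ, ℂ) e.symm w :=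
  ((contMDiffOn_symm_of_mem_maximalAtlas he).contMDiffAt
    (e.open_target.mem_nhds hw)).mdifferentiableAt (by simp)

theorem hasDerivAt_comp_symm (he : e ∈ IsManifold.maximalAtlas 𝓘(ℂ, ℂ) ω X) {w : ℂ}
    (hw : w ∈ e.target) {F : X → ℂ} (hF : MDifferentiableAt 𝓘(ℂ, ℂ) 𝓘(ℂ, ℂ) F (e.symm w)) :
    HasDerivAt (F ∘ e.symm) (dirDeriv F (e.symm w) (coordVec e w)) w := by
  have h := hF.hasMFDerivAt.comp w (mdifferentiableAt_coord_symm he hw).hasMFDerivAt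
  exact HasFDerivAt.hasDerivAt (f' := (_ : ℂ →L[ℂ] ℂ)) (hasMFDerivAt_iff_hasFDerivAt.1 h)

theorem dirDeriv_coordVec (he : e ∈ IsManifold.maximalAtlas 𝓘(ℂ, ℂ) ω X) {w : ℂ}
    (hw : w ∈ e.target) : dirDeriv e (e.symm w) (coordVec e w) = 1 := by
  have h := hasDerivAt_comp_symm he hw (mdifferentiableAt_coord he (e.map_target hw))
  refine h.unique ((hasDerivAt_id w).congr_of_eventuallyEq ?_)
  filter_upwards [e.open_target.mem_nhds hw] with y hy using e.right_inv hy

theorem eq_smul_coordVec (he : e ∈ IsManifold.maximalAtlas 𝓘(ℂ, ℂ) ω X) {w : ℂ}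
    (hw : w ∈ e.target) (v : TangentSpace 𝓘(ℂ, ℂ) (e.symm w)) :
    v = dirDeriv e (e.symm w) v • coordVec e w := by
  have h1 := dirDeriv_coordVec he hw
  have key : ∀ (L : ℂ →L[ℂ] ℂ) (c v : ℂ), L c = 1 → v = L v • c := by
    intro L c v h1
    have e1 : ∀ z : ℂ, L z = z * L 1 := fun z => by
      simpa using L.map_smul z 1
    rw [smul_eq_mul, e1 v, mul_assoc, mul_comm (L 1), ← e1 c, h1, mul_one]
  exact key (mfderiv 𝓘(ℂ, ℂ) 𝓘(ℂ, ℂ) e (e.symm w)) (coordVec e w) v h1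

theorem OneForm.apply_eq (η : OneForm X) (he : e ∈ IsManifold.maximalAtlas 𝓘(ℂ, ℂ) ω X) {p : X}
    (hp : p ∈ e.source) (v : TangentSpace 𝓘(ℂ, ℂ) p) :
    η p v = dirDeriv e p v * η.coeff e (e p) := by
  obtain ⟨w, hw, rfl⟩ : ∃ w ∈ e.target, p = e.symm w := ⟨e p, e.map_source hp, (e.left_inv hp).symm⟩
  rw [e.right_inv hw]
  conv_lhs => rw [eq_smul_coordVec he hw v]
  exact map_smul (η (e.symm w)) _ _

theorem Bidifferential.apply_eq (B : Bidifferential X)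
    (he : e ∈ IsManifold.maximalAtlas 𝓘(ℂ, ℂ) ω X) (hf : f ∈ IsManifold.maximalAtlas 𝓘(ℂ, ℂ) ω X)
    {p q : X} (hp : p ∈ e.source) (hq : q ∈ f.source) (v : TangentSpace 𝓘(ℂ, ℂ) p)
    (v' : TangentSpace 𝓘(ℂ, ℂ) q) :
    B p q v v' = dirDeriv e p v * (dirDeriv f q v' * B.coeff e f (e p) (f q)) := by
  obtain ⟨w, hw, rfl⟩ : ∃ w ∈ e.target, p = e.symm w := ⟨e p, e.map_source hp, (e.left_inv hp).symm⟩
  obtain ⟨z, hz, rfl⟩ : ∃ w ∈ f.target, q = f.symm w := ⟨f q, f.map_source hq, (f.left_inv hq).symm⟩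
  rw [e.right_inv hw, f.right_inv hz]
  conv_lhs => rw [eq_smul_coordVec he hw v, eq_smul_coordVec hf hz v']
  rw [map_smul, map_smul, LinearMap.smul_apply, smul_eq_mul, smul_eq_mul]
  exact mul_left_comm _ _ _

theorem hasDerivAt_comp_path {γ : ℝ → X} {t : ℝ}
    (hγ : MDifferentiableAt 𝓘(ℝ, ℝ) 𝓘(ℝ, ℂ) γ t) {F : X → ℂ}
    (hF : MDifferentiableAt 𝓘(ℂ, ℂ) 𝓘(ℂ, ℂ) F (γ t)) :
    HasDerivAt (F ∘ γ) (dirDeriv F (γ t) (velocity γ t)) t := by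
  have h := (HasMFDerivAt.complexToReal hF.hasMFDerivAt).comp t hγ.hasMFDerivAt
  exact HasFDerivAt.hasDerivAt (f' := (_ : ℝ →L[ℝ] ℂ)) (hasMFDerivAt_iff_hasFDerivAt.1 h)

theorem velocity_congr {γ η : ℝ → X} {t : ℝ} (h : γ =ᶠ[𝓝 t] η) :
    (velocity γ t : ℂ) = (velocity η t : ℂ) := by
  unfold velocity
  rw [h.mfderiv_eq]
  rfl

/-- The coordinate change `f ∘ e⁻¹` is analytic. -/
theorem analyticAt_coordChange (he : e ∈ IsManifold.maximalAtlas 𝓘(ℂ, ℂ) ω X)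
    (hf : f ∈ IsManifold.maximalAtlas 𝓘(ℂ, ℂ) ω X) {w : ℂ} (hw : w ∈ e.target)
    (hw' : e.symm w ∈ f.source) : AnalyticAt ℂ (f ∘ e.symm) w := by
  have h1 := ((contMDiffOn_of_mem_maximalAtlas hf).contMDiffAt (f.open_source.mem_nhds hw')).comp w
    ((contMDiffOn_symm_of_mem_maximalAtlas he).contMDiffAt (e.open_target.mem_nhds hw))
  exact (contMDiffAt_iff_contDiffAt.1 h1).analyticAt

theorem OneForm.coeff_eq_deriv_mul (η : OneForm X) (he : e ∈ IsManifold.maximalAtlas 𝓘(ℂ, ℂ) ω X)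
    (hf : f ∈ IsManifold.maximalAtlas 𝓘(ℂ, ℂ) ω X) {w : ℂ} (hw : w ∈ e.target)
    (hw' : e.symm w ∈ f.source) :
    η.coeff e w = deriv (f ∘ e.symm) w * η.coeff f (f (e.symm w)) := by
  rw [(hasDerivAt_comp_symm he hw (mdifferentiableAt_coord hf hw')).deriv]
  exact η.apply_eq hf hw' _

theorem Bidifferential.coeff_eq_deriv_mul (B : Bidifferential X) {e' f' : OpenPartialHomeomorph X ℂ}
    (he : e ∈ IsManifold.maximalAtlas 𝓘(ℂ, ℂ) ω X) (hf : f ∈ IsManifold.maximalAtlas 𝓘(ℂ, ℂ) ω X)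
    (he' : e' ∈ IsManifold.maximalAtlas 𝓘(ℂ, ℂ) ω X)
    (hf' : f' ∈ IsManifold.maximalAtlas 𝓘(ℂ, ℂ) ω X) {w z : ℂ} (hw : w ∈ e.target)
    (hz : z ∈ f.target) (hw' : e.symm w ∈ e'.source) (hz' : f.symm z ∈ f'.source) :
    B.coeff e f w z = deriv (e' ∘ e.symm) w *
      (deriv (f' ∘ f.symm) z * B.coeff e' f' (e' (e.symm w)) (f' (f.symm z))) := by
  rw [(hasDerivAt_comp_symm he hw (mdifferentiableAt_coord he' hw')).deriv,
    (hasDerivAt_comp_symm hf hz (mdifferentiableAt_coord hf' hz')).deriv]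
  exact B.apply_eq he' hf' hw' hz' _ _

/-- The coordinate change has nonzero derivative. -/
theorem deriv_coordChange_ne_zero (he : e ∈ IsManifold.maximalAtlas 𝓘(ℂ, ℂ) ω X)
    (hf : f ∈ IsManifold.maximalAtlas 𝓘(ℂ, ℂ) ω X) {w : ℂ} (hw : w ∈ e.target)
    (hw' : e.symm w ∈ f.source) : deriv (f ∘ e.symm) w ≠ 0 := by
  intro h0
  have h1 := (analyticAt_coordChange he hf hw hw').differentiableAt.hasDerivAt
  have hz : f (e.symm w) ∈ f.target := f.map_source hw'
  have hz' : f.symm (f (e.symm w)) ∈ e.source := by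
    rw [f.left_inv hw']; exact e.map_target hw
  have h2 := (analyticAt_coordChange hf he hz hz').differentiableAt.hasDerivAt
  have h3 : HasDerivAt ((e ∘ f.symm) ∘ (f ∘ e.symm)) _ w := HasDerivAt.comp w h2 h1
  rw [h0, mul_zero] at h3
  have h4 : HasDerivAt ((e ∘ f.symm) ∘ (f ∘ e.symm)) 1 w := by
    refine (hasDerivAt_id w).congr_of_eventuallyEq ?_
    have hc : ContinuousAt e.symm w := e.continuousAt_symm hw
    filter_upwards [e.open_target.mem_nhds hw, hc.preimage_mem_nhds (f.open_source.mem_nhds hw')]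
      with y hy hy'
    simp only [Function.comp_apply, id]
    rw [f.left_inv hy', e.right_inv hy]
  exact one_ne_zero (h4.unique h3)

end Coordinates

/-! ### Global primitives of holomorphic forms -/

section Primitive

/-- The complex numbers with the discrete topology. -/
structure DiscreteComplex : Type where
  /-- The underlying complex number. -/
  val : ℂ

instance : TopologicalSpace DiscreteComplex := ⊥

instance : DiscreteTopology DiscreteComplex := ⟨rfl⟩

variable {Y : Type*} [TopologicalSpace Y]

/-- The bundle of germs of primitives: local primitives `P y` on `U y`, any two of which differ by
locally constant functions, define a bundle with discrete fibre `ℂ`, in which the constant `c` in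
the trivialization over `U y` stands for the primitive `P y + c`. -/
def primitiveBundle (P : Y → Y → ℂ) (U : Y → Set Y) (hU : ∀ y, IsOpen (U y)) (hy : ∀ y, y ∈ U y)
    (hP : ∀ y y', ∀ z ∈ U y ∩ U y', ∀ᶠ x in 𝓝 z, P y x - P y' x = P y z - P y' z) :
    FiberBundleCore Y Y DiscreteComplex where
  baseSet := U
  isOpen_baseSet := hU
  indexAt := id
  mem_baseSet_at := hy
  coordChange i j x c := ⟨c.val + (P i x - P j x)⟩
  coordChange_self i x _ c := by simp
  continuousOn_coordChange i j := by
    rintro ⟨x, c⟩ ⟨hx, -⟩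
    refine ContinuousAt.continuousWithinAt ?_
    have h1 : ∀ᶠ p : Y × DiscreteComplex in 𝓝 (x, c),
        p.2 = c ∧ P i p.1 - P j p.1 = P i x - P j x := by
      rw [nhds_prod_eq]
      have h2 : ∀ᶠ d in 𝓝 c, d = c := by simp [nhds_discrete]
      exact ((hP i j x hx).prod_mk h2).mono fun p hp => ⟨hp.2, hp.1⟩
    refine (continuousAt_const (y := DiscreteComplex.mk (c.val + (P i x - P j x)))).congr ?_
    filter_upwards [h1] with p hp
    rw [hp.1, hp.2]
  coordChange_comp i j k x _ c := by
    simp only [DiscreteComplex.mk.injEq]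
    ring

/-- On a simply connected space, local primitives that agree up to locally constant functions come
from a global one. -/
theorem exists_global_primitive [SimplyConnectedSpace Y] [LocallyPathConnectedSpace Y]
    (P : Y → Y → ℂ) (U : Y → Set Y) (hU : ∀ y, IsOpen (U y)) (hy : ∀ y, y ∈ U y)
    (hP : ∀ y y', ∀ z ∈ U y ∩ U y', ∀ᶠ x in 𝓝 z, P y x - P y' x = P y z - P y' z) :
    ∃ F : Y → ℂ, ∀ y, ∀ z ∈ U y, ∀ᶠ x in 𝓝 z, F x - P y x = F z - P y z := by
  obtain ⟨y₀⟩ : Nonempty Y := inferInstance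
  let Z := primitiveBundle P U hU hy hP
  have hcov : IsCoveringMap (Bundle.TotalSpace.proj : Bundle.TotalSpace DiscreteComplex Z.Fiber → Y) :=
    FiberBundle.isCoveringMap
  obtain ⟨σ, ⟨-, hσ⟩, -⟩ := hcov.existsUnique_continuousMap_lifts (ContinuousMap.id Y) y₀
    ⟨y₀, DiscreteComplex.mk 0⟩ rfl
  have hσ' : ∀ x, (σ x).proj = x := fun x => congrFun hσ x
  refine ⟨fun x => P x x + DiscreteComplex.val (σ x).2, fun y z hz => ?_⟩
  have key : ∀ x ∈ U y, P x x + DiscreteComplex.val (σ x).2 =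
      P y x + ((Z.localTriv y) (σ x)).2.val := by
    intro x hx
    rw [Z.localTriv_apply]
    change _ = P y x + (DiscreteComplex.val (σ x).2 + (P (σ x).proj (σ x).proj - P y (σ x).proj))
    rw [hσ' x]
    ring
  have hc : ContinuousAt (fun x => ((Z.localTriv y) (σ x)).2) z := by
    have h1 : ContinuousAt (Z.localTriv y) (σ z) := by
      refine (Z.localTriv y).continuousAt ?_
      rw [Bundle.Trivialization.mem_source]
      change (σ z).proj ∈ U y
      rwa [hσ']
    exact continuous_snd.continuousAt.comp
      (ContinuousAt.comp (f := σ) h1 σ.continuous.continuousAt)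
  have h2 : ∀ᶠ x in 𝓝 z, ((Z.localTriv y) (σ x)).2 = ((Z.localTriv y) (σ z)).2 := by
    have := hc.eventually (p := fun d => d = ((Z.localTriv y) (σ z)).2) (by simp [nhds_discrete])
    exact this
  filter_upwards [h2, (hU y).mem_nhds hz] with x hx hx'
  rw [key x hx', key z hz, hx]
  ring

end Primitive

section HolomorphicForms

variable {X : Type*} [TopologicalSpace X] [ChartedSpace ℂ X]

/-- A holomorphic 1-form, near the point `p`: its coefficient is holomorphic in some coordinate. -/
def OneForm.HolomorphicAt (η : OneForm X) (p : X) : Prop :=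
  ∃ e ∈ IsManifold.maximalAtlas 𝓘(ℂ, ℂ) ω X, p ∈ e.source ∧ AnalyticAt ℂ (η.coeff e) (e p)

theorem OneForm.HolomorphicAt.coeff {η : OneForm X} {p : X} (h : η.HolomorphicAt p)
    {f : OpenPartialHomeomorph X ℂ} (hf : f ∈ IsManifold.maximalAtlas 𝓘(ℂ, ℂ) ω X)
    (hp : p ∈ f.source) : AnalyticAt ℂ (η.coeff f) (f p) := by
  obtain ⟨e, he, hpe, h⟩ := h
  have hw : f p ∈ f.target := f.map_source hp
  have hw' : f.symm (f p) ∈ e.source := by rwa [f.left_inv hp]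
  have h1 := analyticAt_coordChange hf he hw hw'
  have h2 : AnalyticAt ℂ (fun w => deriv (e ∘ f.symm) w * η.coeff e ((e ∘ f.symm) w)) (f p) := by
    refine h1.deriv.mul (AnalyticAt.comp (g := η.coeff e) ?_ h1)
    simpa [f.left_inv hp] using h
  refine h2.congr ?_
  filter_upwards [f.open_target.mem_nhds hw,
    (f.continuousAt_symm hw).preimage_mem_nhds (e.open_source.mem_nhds hw')] with y hy hy'
  exact (η.coeff_eq_deriv_mul hf he hy hy').symm

/-- Local primitives of a holomorphic 1-form. -/
theorem OneForm.HolomorphicAt.exists_primitive {η : OneForm X}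
    (h : ∀ p, η.HolomorphicAt p) [IsManifold 𝓘(ℂ, ℂ) ω X] (p : X) :
    ∃ U : Set X, IsOpen U ∧ p ∈ U ∧ ∃ P : X → ℂ, ∀ q ∈ U,
      ContMDiffAt 𝓘(ℂ, ℂ) 𝓘(ℂ, ℂ) ω P q ∧ ∀ v, dirDeriv P q v = η q v := by
  set e := chartAt ℂ p with he_def
  have he : e ∈ IsManifold.maximalAtlas 𝓘(ℂ, ℂ) ω X := IsManifold.chart_mem_maximalAtlas p
  have hp : p ∈ e.source := mem_chart_source ℂ p
  have ht : e.target ∈ 𝓝 (e p) := e.open_target.mem_nhds (e.map_source hp)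
  obtain ⟨r, hr, hball⟩ := Metric.mem_nhds_iff.1 ht
  have han : ∀ w ∈ Metric.ball (e p) r, AnalyticAt ℂ (η.coeff e) w := by
    intro w hw
    have := (h (e.symm w)).coeff he (e.map_target (hball hw))
    rwa [e.right_inv (hball hw)] at this
  have hd : DifferentiableOn ℂ (η.coeff e) (Metric.ball (e p) r) := fun w hw =>
    (han w hw).differentiableAt.differentiableWithinAt
  obtain ⟨G, hG⟩ := hd.isExactOn_ball
  have hGan : ∀ w ∈ Metric.ball (e p) r, AnalyticAt ℂ G w := by
    have : DifferentiableOn ℂ G (Metric.ball (e p) r) := fun w hw =>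
      (hG w hw).differentiableAt.differentiableWithinAt
    exact fun w hw => this.analyticAt (Metric.isOpen_ball.mem_nhds hw)
  refine ⟨e.source ∩ e ⁻¹' Metric.ball (e p) r, e.isOpen_inter_preimage Metric.isOpen_ball,
    ⟨hp, Metric.mem_ball_self hr⟩, G ∘ e, fun q hq => ?_⟩
  have hsm : ContMDiffAt 𝓘(ℂ, ℂ) 𝓘(ℂ, ℂ) ω (G ∘ e) q :=
    (contMDiffAt_iff_contDiffAt.2 (hGan _ hq.2).contDiffAt).comp q
      ((contMDiffOn_of_mem_maximalAtlas he).contMDiffAt (e.open_source.mem_nhds hq.1))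
  refine ⟨hsm, fun v => ?_⟩
  rw [η.apply_eq he hq.1 v]
  have h1 : HasMFDerivAt 𝓘(ℂ, ℂ) 𝓘(ℂ, ℂ) G (e q)
      (ContinuousLinearMap.toSpanSingleton ℂ (η.coeff e (e q))) :=
    hasMFDerivAt_iff_hasFDerivAt.2 (hG _ hq.2).hasFDerivAt
  have h2 := (h1.comp q (mdifferentiableAt_coord he hq.1).hasMFDerivAt).mfderiv
  unfold dirDeriv
  rw [h2]
  rfl

end HolomorphicForms

/-! ### Green's formula on the polygon -/

section Green

open scoped ComplexConjugate

/-- Green's formula on the unit square for the form `conj G dG`. -/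
theorem green_unit_square {G : ℝ × ℝ → ℂ} (hG : ContDiff ℝ 2 G) :
    (∫ x in (0 : ℝ)..1, ∫ y in (0 : ℝ)..1,
      (conj (fderiv ℝ G (x, y) (1, 0)) * fderiv ℝ G (x, y) (0, 1) -
        conj (fderiv ℝ G (x, y) (0, 1)) * fderiv ℝ G (x, y) (1, 0))) =
      ((((∫ x in (0 : ℝ)..1, -(conj (G (x, 1)) * fderiv ℝ G (x, 1) (1, 0))) -
        ∫ x in (0 : ℝ)..1, -(conj (G (x, 0)) * fderiv ℝ G (x, 0) (1, 0))) +
        ∫ y in (0 : ℝ)..1, conj (G (1, y)) * fderiv ℝ G (1, y) (0, 1)) -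
        ∫ y in (0 : ℝ)..1, conj (G (0, y)) * fderiv ℝ G (0, y) (0, 1)) := by
  have hD : ContDiff ℝ 1 (fderiv ℝ G) := hG.fderiv_right (by norm_num)
  have hv : ∀ v p, HasFDerivAt (fun q => conj (G q) * fderiv ℝ G q v)
      (conj (G p) • (fderiv ℝ (fderiv ℝ G) p).flip v +
        (fderiv ℝ G p v) • ((Complex.conjCLE : ℂ →L[ℝ] ℂ).comp (fderiv ℝ G p))) p := by
    intro v p
    have h1 : HasFDerivAt (fun q => conj (G q))
        ((Complex.conjCLE : ℂ →L[ℝ] ℂ).comp (fderiv ℝ G p)) p :=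
      (Complex.conjCLE : ℂ →L[ℝ] ℂ).hasFDerivAt.comp p
        (hG.differentiable (by norm_num) p).hasFDerivAt
    have h2 : HasFDerivAt (fun q => fderiv ℝ G q v) ((fderiv ℝ (fderiv ℝ G) p).flip v) p := by
      have := (hD.differentiable (by norm_num) p).hasFDerivAt.clm_apply (hasFDerivAt_const v p)
      simpa using this
    exact h1.mul h2
  have hcont : ∀ v, Continuous (fun q => conj (G q) * fderiv ℝ G q v) := fun v =>
    continuous_iff_continuousAt.2 fun p => (hv v p).continuousAt
  have hval : ∀ p : ℝ × ℝ, (conj (G p) • (fderiv ℝ (fderiv ℝ G) p).flip (0, 1) +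
        (fderiv ℝ G p (0, 1)) • ((Complex.conjCLE : ℂ →L[ℝ] ℂ).comp (fderiv ℝ G p))) (1, 0) +
      (-(conj (G p) • (fderiv ℝ (fderiv ℝ G) p).flip (1, 0) +
        (fderiv ℝ G p (1, 0)) • ((Complex.conjCLE : ℂ →L[ℝ] ℂ).comp (fderiv ℝ G p)))) (0, 1) =
      conj (fderiv ℝ G p (1, 0)) * fderiv ℝ G p (0, 1) -
        conj (fderiv ℝ G p (0, 1)) * fderiv ℝ G p (1, 0) := by
    intro p
    have hs := (hG.contDiffAt (x := p)).isSymmSndFDerivAt (by simp) (1, 0) (0, 1)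
    simp only [add_apply, neg_apply,
      smul_apply, ContinuousLinearMap.flip_apply, hs, smul_eq_mul,
      ContinuousLinearMap.comp_apply, ContinuousLinearEquiv.coe_coe, Complex.conjCLE_apply]
    ring
  have hc0 : Continuous (fun p : ℝ × ℝ => conj (fderiv ℝ G p (1, 0)) * fderiv ℝ G p (0, 1) -
        conj (fderiv ℝ G p (0, 1)) * fderiv ℝ G p (1, 0)) := by
    have h1 : ∀ v, Continuous fun p => fderiv ℝ G p v := fun v => hD.continuous.clm_apply
      continuous_const
    exact ((Complex.continuous_conj.comp (h1 _)).mul (h1 _)).sub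
      ((Complex.continuous_conj.comp (h1 _)).mul (h1 _))
  have := integral2_divergence_prod_of_hasFDerivAt
    (fun q => conj (G q) * fderiv ℝ G q (0, 1)) (fun q => -(conj (G q) * fderiv ℝ G q (1, 0))) _ _
    0 0 1 1 (hcont _).continuousOn (hcont _).neg.continuousOn (fun p _ => hv _ p)
    (fun p _ => (hv _ p).neg) ?_
  · simp only [hval] at this
    exact this
  · simp only [hval]
    exact hc0.continuousOn.integrableOn_compact (isCompact_uIcc.prod isCompact_uIcc)

/-- The contributions to `∫ conj F dF` of two sides of a polygon that are traversed in opposite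
directions, when the values of `F` on them differ by a constant. -/
theorem integral_conj_mul_deriv_reverse {a c a' c' : ℝ → ℂ} (ha : ∀ t, HasDerivAt a (a' t) t)
    (hc : ∀ t, HasDerivAt c (c' t) t) (hac : Continuous a') {α : ℂ}
    (h : ∀ t ∈ Icc (0 : ℝ) 1, c (1 - t) - a t = α) :
    (∫ t in (0 : ℝ)..1, conj (a t) * a' t) + ∫ t in (0 : ℝ)..1, conj (c t) * c' t =
      -(conj α * (a 1 - a 0)) := by
  have hca : Continuous a := continuous_iff_continuousAt.2 fun t => (ha t).continuousAt
  have e1 : (∫ t in (0 : ℝ)..1, conj (c t) * c' t) =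
      ∫ t in (0 : ℝ)..1, conj (c (1 - t)) * c' (1 - t) := by
    rw [intervalIntegral.integral_comp_sub_left (fun t => conj (c t) * c' t)]
    simp
  have e2 : (∫ t in (0 : ℝ)..1, conj (c (1 - t)) * c' (1 - t)) =
      ∫ t in (0 : ℝ)..1, -(conj (a t) * a' t) - conj α * a' t := by
    rw [intervalIntegral.integral_of_le zero_le_one, intervalIntegral.integral_of_le zero_le_one,
      integral_Ioc_eq_integral_Ioo, integral_Ioc_eq_integral_Ioo]
    refine setIntegral_congr_fun measurableSet_Ioo fun t ht => ?_
    have h1 : HasDerivAt (fun t => c (1 - t)) (-c' (1 - t)) t := by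
      have := (hc (1 - t)).scomp t ((hasDerivAt_id t).const_sub 1)
      simpa [Function.comp_def] using this
    have h2 : HasDerivAt (fun t => c (1 - t)) (a' t) t := by
      refine ((ha t).add_const α).congr_of_eventuallyEq ?_
      filter_upwards [Ioo_mem_nhds ht.1 ht.2] with s hs
      rw [← h s (Ioo_subset_Icc_self hs)]; ring
    have h3 : c' (1 - t) = -a' t := by rw [← h1.unique h2]; ring
    have h4 : c (1 - t) = a t + α := by
      rw [← h t (Ioo_subset_Icc_self ht)]; ring
    simp only [h3, h4, map_add]
    ring
  have e3 : ∫ t in (0 : ℝ)..1, a' t = a 1 - a 0 :=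
    intervalIntegral.integral_eq_sub_of_hasDerivAt (fun t _ => ha t) (hac.intervalIntegrable _ _)
  have hi : IntervalIntegrable (fun t => conj (a t) * a' t) volume 0 1 :=
    ((Complex.continuous_conj.comp hca).mul hac).intervalIntegrable _ _
  have hj : IntervalIntegrable (fun t => conj α * a' t) volume 0 1 :=
    (continuous_const.mul hac).intervalIntegrable _ _
  have hi' : IntervalIntegrable (fun t => -(conj (a t) * a' t)) volume 0 1 := hi.neg
  rw [e1, e2, intervalIntegral.integral_sub hi' hj,
    intervalIntegral.integral_neg, intervalIntegral.integral_const_mul, e3]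
  ring

end Green

section Polygon

open scoped ComplexConjugate

theorem vertex_periodic {g : ℕ} (hg : 0 < g) (k : ℕ) : vertex g (k + 4 * g) = vertex g k := by
  have hg' : (g : ℂ) ≠ 0 := by exact_mod_cast hg.ne'
  unfold vertex
  have : 2 * (Real.pi : ℂ) * Complex.I * ((k + 4 * g : ℕ) : ℂ) / (4 * g) =
      2 * Real.pi * Complex.I * k / (4 * g) + 2 * Real.pi * Complex.I := by
    push_cast; field_simp
  rw [this, Complex.exp_periodic]

theorem side_apply (g k : ℕ) (t : ℝ) :
    side g k t = vertex g k + t * (vertex g (k + 1) - vertex g k) := by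
  simp [side, AffineMap.lineMap_apply, add_comm]

theorem conj_vertex_mul_succ (g k : ℕ) :
    conj (vertex g k) * vertex g (k + 1) = Complex.exp ((2 * Real.pi / (4 * g) : ℝ) * Complex.I) := by
  unfold vertex
  rw [← Complex.exp_conj, ← Complex.exp_add]
  congr 1
  simp only [map_div₀, map_mul, map_ofNat, Complex.conj_ofReal, Complex.conj_I, map_natCast]
  push_cast
  ring

theorem im_conj_vertex_mul_succ {g : ℕ} (hg : 0 < g) (k : ℕ) :
    0 < (conj (vertex g k) * vertex g (k + 1)).im := by
  rw [conj_vertex_mul_succ, Complex.exp_ofReal_mul_I_im]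
  have hg' : (1 : ℝ) ≤ g := by exact_mod_cast hg
  apply Real.sin_pos_of_pos_of_lt_pi
  · positivity
  · rw [div_lt_iff₀ (by positivity)]
    nlinarith [Real.pi_pos]

theorem zero_mem_polygon {g : ℕ} (hg : 0 < g) : (0 : ℂ) ∈ polygon g := by
  have h1 : vertex g (2 * g) = - vertex g 0 := by
    have hg' : (g : ℂ) ≠ 0 := by exact_mod_cast hg.ne'
    unfold vertex
    have : 2 * (Real.pi : ℂ) * Complex.I * ((2 * g : ℕ) : ℂ) / (4 * g) = Real.pi * Complex.I := by
      push_cast; field_simp; norm_num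
    rw [this, Complex.exp_pi_mul_I]
    simp
  have h2 : vertex g 0 ∈ polygon g := subset_convexHull ℝ _ ⟨0, rfl⟩
  have h3 : vertex g (2 * g) ∈ polygon g := subset_convexHull ℝ _ ⟨2 * g, rfl⟩
  have := (convex_convexHull ℝ (range (vertex g))) h2 h3 (a := 1 / 2) (b := 1 / 2) (by norm_num)
    (by norm_num) (by norm_num)
  rw [h1] at this
  simpa [polygon] using this

theorem side_mem_polygon (g k : ℕ) {t : ℝ} (ht : t ∈ Icc (0 : ℝ) 1) : side g k t ∈ polygon g := by
  have h2 : vertex g k ∈ polygon g := subset_convexHull ℝ _ ⟨k, rfl⟩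
  have h3 : vertex g (k + 1) ∈ polygon g := subset_convexHull ℝ _ ⟨k + 1, rfl⟩
  exact (convex_convexHull ℝ (range (vertex g))).segment_subset h2 h3
    (by rw [segment_eq_image_lineMap]; exact ⟨t, ht, rfl⟩)

/-- Points of the open triangles spanned by the centre and a side are interior. -/
theorem smul_side_mem_interior {g : ℕ} (hg : 0 < g) (k : ℕ) {x t : ℝ} (hx : x ∈ Ioo (0 : ℝ) 1)
    (ht : t ∈ Ioo (0 : ℝ) 1) : (x : ℂ) * side g k t ∈ interior (polygon g) := by
  set p := vertex g k
  set q := vertex g (k + 1)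
  set s := (conj p * q).im with hs
  have hs0 : 0 < s := im_conj_vertex_mul_succ hg k
  have hs' : p.re * q.im - p.im * q.re = s := by
    simp [hs, Complex.mul_im]; ring
  rw [mem_interior]
  refine ⟨{z | 0 < (conj z * q).im} ∩ {z | 0 < (conj p * z).im} ∩
    {z | (conj z * q).im + (conj p * z).im < s}, ?_, ?_, ?_⟩
  · rintro z ⟨⟨h1, h2⟩, h3⟩
    simp only [mem_ofPred_eq] at h1 h2 h3
    have hz : z = ((conj z * q).im / s : ℝ) • p + ((conj p * z).im / s : ℝ) • q +
        (1 - (conj z * q).im / s - (conj p * z).im / s : ℝ) • (0 : ℂ) := by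
      have : (s : ℝ) ≠ 0 := hs0.ne'
      apply Complex.ext
      · simp [Complex.mul_im]
        field_simp
        rw [← hs']; ring
      · simp [Complex.mul_im]
        field_simp
        rw [← hs']; ring
    rw [hz]
    have hp : p ∈ polygon g := subset_convexHull ℝ _ ⟨k, rfl⟩
    have hq : q ∈ polygon g := subset_convexHull ℝ _ ⟨k + 1, rfl⟩
    have h4 : (conj z * q).im / s + (conj p * z).im / s < 1 := by
      rw [← add_div, div_lt_one hs0]; exact h3
    have := (convex_convexHull ℝ (range (vertex g))).sum_mem (t := Finset.univ)
      (w := ![(conj z * q).im / s, (conj p * z).im / s,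
        1 - (conj z * q).im / s - (conj p * z).im / s]) (z := ![p, q, 0]) ?_ ?_ ?_
    · simpa [polygon, Fin.sum_univ_succ, add_assoc] using this
    · intro i _
      fin_cases i
      · exact (div_pos h1 hs0).le
      · exact (div_pos h2 hs0).le
      · simp only [Fin.reduceFinMk, Matrix.cons_val]; linarith
    · simp [Fin.sum_univ_succ]
    · intro i _
      fin_cases i
      · exact hp
      · exact hq
      · exact zero_mem_polygon hg
  · refine IsOpen.inter (IsOpen.inter ?_ ?_) ?_
    · exact isOpen_lt continuous_const (Complex.continuous_im.comp
        (Complex.continuous_conj.mul continuous_const))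
    · exact isOpen_lt continuous_const (Complex.continuous_im.comp
        (continuous_const.mul continuous_id))
    · exact isOpen_lt ((Complex.continuous_im.comp
        (Complex.continuous_conj.mul continuous_const)).add (Complex.continuous_im.comp
        (continuous_const.mul continuous_id))) continuous_const
  · have e1 : (conj ((x : ℂ) * side g k t) * q).im = x * (1 - t) * s := by
      rw [side_apply]
      change (conj ((x : ℂ) * (p + t * (q - p))) * q).im = _
      simp only [Complex.mul_im, Complex.mul_re, Complex.conj_re, Complex.conj_im, Complex.add_re,
        Complex.add_im, Complex.sub_re, Complex.sub_im, Complex.ofReal_re, Complex.ofReal_im]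
      rw [← hs']; ring
    have e2 : (conj p * ((x : ℂ) * side g k t)).im = x * t * s := by
      rw [side_apply]
      change (conj p * ((x : ℂ) * (p + t * (q - p)))).im = _
      simp only [Complex.mul_im, Complex.mul_re, Complex.conj_re, Complex.conj_im, Complex.add_re,
        Complex.add_im, Complex.sub_re, Complex.sub_im, Complex.ofReal_re, Complex.ofReal_im]
      rw [← hs']; ring
    have h1 : 0 < 1 - t := by linarith [ht.2]
    have h2 := hx.1
    have h3 := ht.1
    refine ⟨⟨?_, ?_⟩, ?_⟩ <;> simp only [mem_ofPred_eq, e1, e2]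
    · positivity
    · positivity
    · nlinarith [mul_pos (sub_pos.2 hx.2) hs0]

end Polygon

/-! ### The bilinear relation -/

section PolygonGreen

open scoped ComplexConjugate

theorem sum_range_four_mul {M : Type*} [AddCommMonoid M] (f : ℕ → M) (n : ℕ) :
    ∑ k ∈ Finset.range (4 * n), f k =
      ∑ j ∈ Finset.range n, (f (4 * j) + f (4 * j + 1) + f (4 * j + 2) + f (4 * j + 3)) := by
  induction n with
  | zero => simp
  | succ n ih =>
    rw [Finset.sum_range_succ, ← ih, show 4 * (n + 1) = 4 * n + 1 + 1 + 1 + 1 by ring,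
      Finset.sum_range_succ, Finset.sum_range_succ, Finset.sum_range_succ, Finset.sum_range_succ]
    simp only [add_assoc]

/-- A real linear map of the plane multiplies oriented areas by its determinant. -/
theorem im_conj_map_mul_map (L : ℂ →L[ℝ] ℂ) (u v : ℂ) :
    (conj (L u) * L v).im = (conj (L 1) * L Complex.I).im * (conj u * v).im := by
  have h : ∀ z : ℂ, L z = z.re * L 1 + z.im * L Complex.I := by
    intro z
    conv_lhs => rw [← Complex.re_add_im z]
    have h1 : ((z.re : ℂ) + z.im * Complex.I) = z.re • (1 : ℂ) + z.im • Complex.I := by simp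
    rw [h1, map_add, map_smul, map_smul]
    simp
  rw [h u, h v]
  simp only [Complex.mul_im, Complex.mul_re, Complex.conj_re, Complex.conj_im, Complex.add_re,
    Complex.add_im, Complex.ofReal_re, Complex.ofReal_im]
  ring

/-- The Jacobian determinant of a map of the plane. -/
def jacobian (F : ℂ → ℂ) (z : ℂ) : ℝ := (conj (fderiv ℝ F z 1) * fderiv ℝ F z Complex.I).im

theorem continuous_jacobian {F : ℂ → ℂ} (hF : ContDiff ℝ 2 F) : Continuous (jacobian F) := by
  have h1 : ∀ v, Continuous fun p => fderiv ℝ F p v := fun v =>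
    (hF.continuous_fderiv (by norm_num)).clm_apply continuous_const
  exact Complex.continuous_im.comp ((Complex.continuous_conj.comp (h1 _)).mul (h1 _))

/-- Riemann's bilinear argument: a map of the `4g`-gon with nonnegative Jacobian, whose values on
paired sides differ by constants, and whose increments along the `𝒜`-sides vanish, has Jacobian
zero, since the integral of its Jacobian over the polygon is a sum of products of increments
along the `𝒜`- and `ℬ`-sides. -/
theorem jacobian_eq_zero {g : ℕ} (hg : 0 < g) {F : ℂ → ℂ} (hF : ContDiff ℝ 2 F)
    (hJ : ∀ z ∈ interior (polygon g), 0 ≤ jacobian F z)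
    (hper : ∀ j < g, F (side g (4 * j) 1) = F (side g (4 * j) 0))
    (hα : ∀ j < g, ∃ α, ∀ t ∈ Icc (0 : ℝ) 1,
      F (side g (4 * j + 2) (1 - t)) - F (side g (4 * j) t) = α)
    (hβ : ∀ j < g, ∃ β, ∀ t ∈ Icc (0 : ℝ) 1,
      F (side g (4 * j + 3) (1 - t)) - F (side g (4 * j + 1) t) = β)
    {x t : ℝ} (hx : x ∈ Ioo (0 : ℝ) 1) (ht : t ∈ Ioo (0 : ℝ) 1) :
    jacobian F (x * side g 0 t) = 0 := by
  have hFd : ∀ z, HasFDerivAt F (fderiv ℝ F z) z := fun z =>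
    (hF.differentiable (by norm_num) z).hasFDerivAt
  have hDc : Continuous (fderiv ℝ F) := hF.continuous_fderiv (by norm_num)
  let d : ℕ → ℂ := fun k => vertex g (k + 1) - vertex g k
  let s : ℕ → ℝ := fun k => (conj (vertex g k) * vertex g (k + 1)).im
  have hs : ∀ k, 0 < s k := im_conj_vertex_mul_succ hg
  have hside : ∀ k t, HasDerivAt (side g k) (d k) t := by
    intro k t
    have : HasDerivAt (fun t : ℝ => vertex g k + t * (vertex g (k + 1) - vertex g k))
        (1 * (vertex g (k + 1) - vertex g k)) t :=
      ((Complex.ofRealCLM.hasDerivAt (x := t)).mul_const _).const_add _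
    rw [one_mul] at this
    exact this.congr_of_eventuallyEq (Eventually.of_forall fun y => side_apply g k y)
  have hsidec : ∀ k, Continuous (side g k) := fun k =>
    continuous_iff_continuousAt.2 fun t => (hside k t).continuousAt
  have hs1 : ∀ k, side g k 1 = vertex g (k + 1) := fun k => by rw [side_apply]; simp
  have hs0 : ∀ k, side g k 0 = vertex g k := fun k => by rw [side_apply]; simp
  -- the oriented area spanned by a point of a side and the direction of the side
  have hsd : ∀ k t, (conj (side g k t) * d k).im = s k := by
    intro k t
    rw [side_apply]
    simp only [s, d, Complex.mul_im, Complex.mul_re, Complex.conj_re, Complex.conj_im,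
      Complex.add_re, Complex.add_im, Complex.sub_re, Complex.sub_im, Complex.ofReal_re,
      Complex.ofReal_im]
    ring
  let H : ℕ → ℝ × ℝ → ℂ := fun k p => p.1 * side g k p.2
  have hH : ∀ k p, HasFDerivAt (H k) (((ContinuousLinearMap.fst ℝ ℝ ℝ).smulRight (side g k p.2)) +
      (ContinuousLinearMap.snd ℝ ℝ ℝ).smulRight (p.1 * d k)) p := by
    intro k p
    have h1 : HasFDerivAt (fun p : ℝ × ℝ => (p.1 : ℂ)) (Complex.ofRealCLM.comp
        (ContinuousLinearMap.fst ℝ ℝ ℝ)) p := Complex.ofRealCLM.hasFDerivAt.comp p hasFDerivAt_fst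
    have h2 : HasFDerivAt (fun p : ℝ × ℝ => side g k p.2) ((ContinuousLinearMap.toSpanSingleton ℝ (d k)).comp
        (ContinuousLinearMap.snd ℝ ℝ ℝ)) p := (hside k p.2).hasFDerivAt.comp p hasFDerivAt_snd
    refine (h1.mul h2).congr_fderiv ?_
    ext <;> simp [mul_comm]
  have hHs : ∀ k, ContDiff ℝ 2 (H k) := by
    intro k
    have h1 : ContDiff ℝ 2 (fun p : ℝ × ℝ => (p.1 : ℂ)) := Complex.ofRealCLM.contDiff.comp contDiff_fst
    have h2 : ContDiff ℝ 2 (fun p : ℝ × ℝ => (p.2 : ℂ)) := Complex.ofRealCLM.contDiff.comp contDiff_snd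
    have : H k = fun p => (p.1 : ℂ) * (vertex g k + p.2 * (vertex g (k + 1) - vertex g k)) := by
      funext p; simp only [H, side_apply]
    rw [this]
    exact h1.mul (contDiff_const.add (h2.mul contDiff_const))
  have hG : ∀ k, ContDiff ℝ 2 (F ∘ H k) := fun k => hF.comp (hHs k)
  have hGd : ∀ k p v, fderiv ℝ (F ∘ H k) p v =
      fderiv ℝ F (H k p) (v.1 * side g k p.2 + v.2 * (p.1 * d k)) := by
    intro k p v
    rw [((hFd (H k p)).comp p (hH k p)).fderiv]
    simp
  -- the densities of the area forms
  let Φ : ℕ → ℝ → ℝ → ℝ := fun k x y => x * s k * jacobian F (x * side g k y)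
  have hΦc : ∀ k, Continuous (fun p : ℝ × ℝ => Φ k p.1 p.2) := by
    intro k
    exact (continuous_fst.mul continuous_const).mul
      ((continuous_jacobian hF).comp (hHs k).continuous)
  have hΦ0 : ∀ k, ∀ x ∈ Icc (0 : ℝ) 1, ∀ y ∈ Icc (0 : ℝ) 1, 0 ≤ Φ k x y := by
    intro k x hx y hy
    have h1 : ∀ p ∈ Ioo (0 : ℝ) 1 ×ˢ Ioo (0 : ℝ) 1, (fun _ => (0 : ℝ)) p ≤ Φ k p.1 p.2 := by
      intro p hp
      exact mul_nonneg (mul_nonneg hp.1.1.le (hs k).le)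
        (hJ _ (smul_side_mem_interior hg k hp.1 hp.2))
    have h2 : (x, y) ∈ closure (Ioo (0 : ℝ) 1 ×ˢ Ioo (0 : ℝ) 1) := by
      rw [closure_prod_eq, closure_Ioo zero_ne_one]
      exact ⟨hx, hy⟩
    exact le_on_closure h1 continuousOn_const (hΦc k).continuousOn h2
  -- the boundary terms
  let E : ℕ → ℂ := fun k => ∫ x in (0 : ℝ)..1,
    conj (F (x * vertex g k)) * fderiv ℝ F (x * vertex g k) (vertex g k)
  let I : ℕ → ℂ := fun k => ∫ y in (0 : ℝ)..1,
    conj (F (side g k y)) * fderiv ℝ F (side g k y) (d k)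
  have hgreen : ∀ k, (2 * Complex.I) * ((∫ x in (0 : ℝ)..1, ∫ y in (0 : ℝ)..1, Φ k x y : ℝ) : ℂ) =
      (E k - E (k + 1)) + I k := by
    intro k
    have h := green_unit_square (hG k)
    have e0 : ∀ x y, (conj (fderiv ℝ (F ∘ H k) (x, y) (1, 0)) * fderiv ℝ (F ∘ H k) (x, y) (0, 1) -
        conj (fderiv ℝ (F ∘ H k) (x, y) (0, 1)) * fderiv ℝ (F ∘ H k) (x, y) (1, 0)) =
        (2 * Complex.I) * (Φ k x y : ℂ) := by
      intro x y
      rw [hGd, hGd]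
      simp only [Complex.ofReal_one, one_mul, Complex.ofReal_zero, zero_mul, add_zero, zero_add]
      have h1 := im_conj_map_mul_map (fderiv ℝ F (H k (x, y))) (side g k y) (x * d k)
      set u := fderiv ℝ F (H k (x, y)) (side g k y)
      set v := fderiv ℝ F (H k (x, y)) (x * d k)
      have h2 : (conj (side g k y) * (x * d k)).im = x * s k := by
        rw [← hsd k y, mul_left_comm, Complex.im_ofReal_mul]
      have h3 : Φ k x y = (conj u * v).im := by
        rw [h1, h2]
        simp only [Φ, jacobian, H]
        ring
      rw [h3]
      have h4 := Complex.sub_conj (conj u * v)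
      rw [map_mul, Complex.conj_conj] at h4
      rw [mul_comm (conj v), h4]
      push_cast; ring
    simp only [e0, intervalIntegral.integral_const_mul, intervalIntegral.integral_ofReal] at h
    rw [h]
    simp only [hGd, Function.comp_apply, H, hs1, hs0, Complex.ofReal_one, one_mul,
      Complex.ofReal_zero, zero_mul, add_zero, zero_add, map_zero, mul_zero,
      intervalIntegral.integral_zero, intervalIntegral.integral_neg, sub_zero, E, I]
    ring
  have hIsum : ∑ k ∈ Finset.range (4 * g), I k = 0 := by
    rw [sum_range_four_mul]
    refine Finset.sum_eq_zero fun j hj => ?_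
    have hj := Finset.mem_range.1 hj
    have hd : ∀ k t, HasDerivAt (fun t => F (side g k t)) (fderiv ℝ F (side g k t) (d k)) t :=
      fun k t => (hFd _).comp_hasDerivAt t (hside k t)
    have hdc : ∀ k, Continuous fun t => fderiv ℝ F (side g k t) (d k) := fun k =>
      (hDc.comp (hsidec k)).clm_apply continuous_const
    obtain ⟨α, hα⟩ := hα j hj
    obtain ⟨β, hβ⟩ := hβ j hj
    have h1 := integral_conj_mul_deriv_reverse (hd (4 * j)) (hd (4 * j + 2)) (hdc _) hα
    have h2 := integral_conj_mul_deriv_reverse (hd (4 * j + 1)) (hd (4 * j + 3)) (hdc _) hβ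
    rw [hper j hj, sub_self, mul_zero, neg_zero] at h1
    -- `β` is minus the increment along an `𝒜`-side
    have hβ0 : β = 0 := by
      have a1 := hβ 1 (by simp)
      have a2 := hα 1 (by simp)
      have a3 := hα 0 (by simp)
      have a4 := hper j hj
      simp only [sub_self, sub_zero, hs1, hs0] at a1 a2 a3 a4
      have e1 : 4 * j + 2 + 1 = 4 * j + 3 := rfl
      have e2 : 4 * j + 1 + 1 = 4 * j + 2 := rfl
      rw [e1] at a3
      rw [e2] at a1
      rw [← a1]
      have : F (vertex g (4 * j + 3)) = F (vertex g (4 * j + 2)) := by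
        linear_combination a3 - a2 - a4
      rw [this, sub_self]
    rw [hβ0, map_zero, zero_mul, neg_zero] at h2
    have : I (4 * j) + I (4 * j + 1) + I (4 * j + 2) + I (4 * j + 3) =
      (I (4 * j) + I (4 * j + 2)) + (I (4 * j + 1) + I (4 * j + 3)) := by ring
    rw [this]
    simp only [I]
    rw [h1, h2, add_zero]
  have hEper : E (4 * g) = E 0 := by
    simp only [E]
    have : vertex g (4 * g) = vertex g 0 := by simpa using vertex_periodic hg 0
    rw [this]
  have hsum : ∑ k ∈ Finset.range (4 * g), (∫ x in (0 : ℝ)..1, ∫ y in (0 : ℝ)..1, Φ k x y) = 0 := by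
    have h1 : (2 * Complex.I) * ((∑ k ∈ Finset.range (4 * g),
        (∫ x in (0 : ℝ)..1, ∫ y in (0 : ℝ)..1, Φ k x y) : ℝ) : ℂ) = 0 := by
      rw [Complex.ofReal_sum, Finset.mul_sum, Finset.sum_congr rfl fun k _ => hgreen k,
        Finset.sum_add_distrib, hIsum, Finset.sum_range_sub', hEper]
      simp
    have h2 : (2 * Complex.I) ≠ 0 := by simp
    exact_mod_cast (mul_eq_zero.1 h1).resolve_left h2
  have hinner : ∀ k, ∀ x ∈ Icc (0 : ℝ) 1, 0 ≤ ∫ y in (0 : ℝ)..1, Φ k x y := fun k x hx =>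
    intervalIntegral.integral_nonneg zero_le_one fun y hy => hΦ0 k x hx y hy
  have h0 : (∫ x in (0 : ℝ)..1, ∫ y in (0 : ℝ)..1, Φ 0 x y) = 0 :=
    (Finset.sum_eq_zero_iff_of_nonneg fun k _ =>
      intervalIntegral.integral_nonneg zero_le_one fun x hx => hinner k x hx).1 hsum 0
      (Finset.mem_range.2 (by omega))
  have hcont : Continuous fun x => ∫ y in (0 : ℝ)..1, Φ 0 x y :=
    intervalIntegral.continuous_parametric_intervalIntegral_of_continuous' (hΦc 0) _ _
  have hzero : Φ 0 x t = 0 := by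
    by_contra hne
    have hpos : 0 < Φ 0 x t :=
      lt_of_le_of_ne (hΦ0 0 x (Ioo_subset_Icc_self hx) t (Ioo_subset_Icc_self ht)) (Ne.symm hne)
    have h1 : 0 < ∫ y in (0 : ℝ)..1, Φ 0 x y :=
      intervalIntegral.integral_pos zero_lt_one
        ((hΦc 0).comp (Continuous.prodMk_right x)).continuousOn
        (fun y hy => hΦ0 0 x (Ioo_subset_Icc_self hx) y (Ioc_subset_Icc_self hy))
        ⟨t, Ioo_subset_Icc_self ht, hpos⟩
    have h2 := intervalIntegral.integral_pos zero_lt_one hcont.continuousOn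
        (fun y hy => hinner 0 y (Ioc_subset_Icc_self hy)) ⟨x, Ioo_subset_Icc_self hx, h1⟩
    exact h2.ne' h0
  have h3 : x * s 0 ≠ 0 := mul_ne_zero hx.1.ne' (hs 0).ne'
  exact (mul_eq_zero.1 hzero).resolve_left h3

end PolygonGreen

/-! ### Holomorphic forms with vanishing periods -/

section Vanishing

open scoped ComplexConjugate

variable {X : Type*} [TopologicalSpace X] [ChartedSpace ℂ X]

theorem ContMDiffAt.complexToReal {P : X → ℂ} {q : X} (h : ContMDiffAt 𝓘(ℂ, ℂ) 𝓘(ℂ, ℂ) ω P q) :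
    ContMDiffAt 𝓘(ℝ, ℂ) 𝓘(ℝ, ℂ) ω P q := by
  rw [contMDiffAt_iff] at h ⊢
  exact ⟨h.1, ContDiffWithinAt.restrict_scalars ℝ h.2⟩

theorem dirDeriv_congr {F G : X → ℂ} {p : X} (h : F =ᶠ[𝓝 p] G) (v : TangentSpace 𝓘(ℂ, ℂ) p) :
    dirDeriv F p v = dirDeriv G p v := by
  unfold dirDeriv
  rw [h.mfderiv_eq]
  rfl

theorem det_eq_im_conj_mul (L : ℂ →L[ℝ] ℂ) : L.det = (conj (L 1) * L Complex.I).im := by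
  change LinearMap.det (L : ℂ →ₗ[ℝ] ℂ) = _
  rw [← LinearMap.det_toMatrix Complex.basisOneI, Matrix.det_fin_two]
  simp [LinearMap.toMatrix_apply, Complex.mul_im]
  ring

theorem OneForm.coeff_eq_zero_iff (η : OneForm X) {e : OpenPartialHomeomorph X ℂ}
    (he : e ∈ IsManifold.maximalAtlas 𝓘(ℂ, ℂ) ω X) {p : X} (hp : p ∈ e.source) :
    η.coeff e (e p) = 0 ↔ η p = 0 := by
  constructor
  · intro h
    refine LinearMap.ext fun v => ?_
    rw [η.apply_eq he hp, h, mul_zero]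
    rfl
  · intro h
    unfold OneForm.coeff
    rw [e.left_inv hp, h]
    rfl

variable [IsManifold 𝓘(ℂ, ℂ) ω X]

/-- Two functions with the same differential differ by a locally constant function. -/
theorem eventually_sub_eq_of_dirDeriv_eq {P Q : X → ℂ} {z : X}
    (h : ∀ᶠ q in 𝓝 z, MDifferentiableAt 𝓘(ℂ, ℂ) 𝓘(ℂ, ℂ) P q ∧
      MDifferentiableAt 𝓘(ℂ, ℂ) 𝓘(ℂ, ℂ) Q q ∧ ∀ v, dirDeriv P q v = dirDeriv Q q v) :
    ∀ᶠ x in 𝓝 z, P x - Q x = P z - Q z := by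
  set e := chartAt ℂ z with he_def
  have he : e ∈ IsManifold.maximalAtlas 𝓘(ℂ, ℂ) ω X := IsManifold.chart_mem_maximalAtlas z
  have hz : z ∈ e.source := mem_chart_source ℂ z
  have hc : Tendsto e.symm (𝓝 (e z)) (𝓝 z) := e.tendsto_symm hz
  have h1 := (hc.eventually h).and (e.open_target.mem_nhds (e.map_source hz))
  obtain ⟨r, hr, hb⟩ := Metric.mem_nhds_iff.1 h1
  have hd : ∀ w ∈ Metric.ball (e z) r,
      HasDerivWithinAt (fun w => P (e.symm w) - Q (e.symm w)) 0 (Metric.ball (e z) r) w := by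
    intro w hw
    obtain ⟨⟨hP, hQ, hv⟩, ht⟩ := hb hw
    have := (hasDerivAt_comp_symm he ht hP).sub (hasDerivAt_comp_symm he ht hQ)
    rw [hv, sub_self] at this
    exact this.hasDerivWithinAt
  have hconst : ∀ w ∈ Metric.ball (e z) r, P (e.symm w) - Q (e.symm w) = P z - Q z := by
    intro w hw
    have := (convex_ball (e z) r).norm_image_sub_le_of_norm_hasDerivWithin_le (C := 0) hd
      (fun _ _ => by simp) (Metric.mem_ball_self hr) hw
    rw [zero_mul, norm_le_zero_iff, sub_eq_zero, e.left_inv hz] at this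
    exact this
  filter_upwards [e.open_source.mem_nhds hz,
    (e.continuousAt hz).preimage_mem_nhds (Metric.ball_mem_nhds _ hr)] with x hx hx'
  have := hconst (e x) hx'
  rwa [e.left_inv hx] at this

/-- The identity theorem for holomorphic 1-forms. -/
theorem OneForm.HolomorphicAt.eventually_eq_zero {η : OneForm X} {p : X} (h : η.HolomorphicAt p)
    (hf : ∃ᶠ q in 𝓝[≠] p, η q = 0) : ∀ᶠ q in 𝓝 p, η q = 0 := by
  set e := chartAt ℂ p with he_def
  have he : e ∈ IsManifold.maximalAtlas 𝓘(ℂ, ℂ) ω X := IsManifold.chart_mem_maximalAtlas p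
  have hp : p ∈ e.source := mem_chart_source ℂ p
  have han := h.coeff he hp
  have ht : Tendsto e (𝓝[≠] p) (𝓝[≠] (e p)) := by
    refine tendsto_nhdsWithin_iff.2 ⟨(e.continuousAt hp).mono_left nhdsWithin_le_nhds, ?_⟩
    filter_upwards [self_mem_nhdsWithin, mem_nhdsWithin_of_mem_nhds (e.open_source.mem_nhds hp)]
      with q hq hq' heq
    exact hq (e.injOn hq' hp heq)
  have h1 : ∃ᶠ w in 𝓝[≠] (e p), η.coeff e w = 0 := by
    refine ht.frequently ((hf.and_eventually
      (mem_nhdsWithin_of_mem_nhds (e.open_source.mem_nhds hp))).mono ?_)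
    rintro q ⟨hq, hq'⟩
    exact (η.coeff_eq_zero_iff he hq').2 hq
  have h2 := han.frequently_zero_iff_eventually_zero.1 h1
  filter_upwards [(e.continuousAt hp).eventually h2, e.open_source.mem_nhds hp] with q hq hq'
  exact (η.coeff_eq_zero_iff he hq').1 hq

theorem OneForm.eq_zero_of_eventually [ConnectedSpace X] {η : OneForm X}
    (h : ∀ p, η.HolomorphicAt p) {p₀ : X} (h0 : ∀ᶠ q in 𝓝 p₀, η q = 0) (p : X) : η p = 0 := by
  let S : Set X := {p | ∀ᶠ q in 𝓝 p, η q = 0}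
  have hopen : IsOpen S := isOpen_iff_eventually.2 fun p hp => eventually_eventually_nhds.2 hp
  have hclosed : IsClosed S := by
    refine isClosed_of_closure_subset fun p hp => ?_
    by_contra hpS
    refine hpS ((h p).eventually_eq_zero ?_)
    have h1 : ∃ᶠ q in 𝓝 p, q ∈ S := mem_closure_iff_frequently.1 hp
    rw [frequently_nhdsWithin_iff]
    refine h1.mono fun q hq => ⟨Eventually.self_of_nhds (p := fun q => η q = 0) hq, fun hqp => hpS (hqp ▸ hq)⟩
  have huniv : S = univ := IsClopen.eq_univ ⟨hclosed, hopen⟩ ⟨p₀, h0⟩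
  have : p ∈ S := huniv ▸ mem_univ p
  exact Eventually.self_of_nhds (p := fun q => η q = 0) this

/-- A holomorphic 1-form on a compact Riemann surface is determined by its `𝒜`-periods. -/
theorem OneForm.eq_zero_of_periods_eq_zero [T2Space X] [CompactSpace X] [ConnectedSpace X]
    {g : ℕ} {A C : Fin g → ℝ → X} (hAC : IsCanonicalHomologyBasis g A C) {η : OneForm X}
    (h : ∀ p, η.HolomorphicAt p)
    (hper : ∀ j, ∫ t in (0 : ℝ)..1, η (A j t) (velocity (A j) t) = 0) (p : X) : η p = 0 := by
  choose U hUo hUm P hP using OneForm.HolomorphicAt.exists_primitive h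
  have hPmd : ∀ y, ∀ q ∈ U y, MDifferentiableAt 𝓘(ℂ, ℂ) 𝓘(ℂ, ℂ) (P y) q := fun y q hq =>
    (hP y q hq).1.mdifferentiableAt (by simp)
  have hcompat : ∀ y y', ∀ z ∈ U y ∩ U y', ∀ᶠ x in 𝓝 z, P y x - P y' x = P y z - P y' z := by
    rintro y y' z ⟨hz, hz'⟩
    refine eventually_sub_eq_of_dirDeriv_eq ?_
    filter_upwards [(hUo y).mem_nhds hz, (hUo y').mem_nhds hz'] with q hq hq'
    exact ⟨hPmd y q hq, hPmd y' q hq', fun v => by rw [(hP y q hq).2, (hP y' q hq').2]⟩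
  rcases hAC with ⟨-, hsc⟩ | ⟨hg, φ, hφ, hφAC⟩
  · -- genus zero: the primitive is a holomorphic function on `X`, hence constant
    have : LocallyPathConnectedSpace X := ChartedSpace.locallyPathConnectedSpace ℂ X
    obtain ⟨F, hF⟩ := exists_global_primitive P U hUo hUm hcompat
    have hFP : ∀ q, F =ᶠ[𝓝 q] fun x => P q x + (F q - P q q) := fun q => by
      filter_upwards [hF q q (hUm q)] with x hx
      rw [← hx]; ring
    have hmd : MDifferentiable 𝓘(ℂ, ℂ) 𝓘(ℂ, ℂ) F := fun q =>
      ((hPmd q q (hUm q)).add mdifferentiableAt_const).congr_of_eventuallyEq (hFP q)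
    refine LinearMap.ext fun v => ?_
    have hconst : P p =ᶠ[𝓝 p] fun _ => P p p := by
      filter_upwards [hFP p] with x hx
      have := hmd.apply_eq_of_compactSpace x p
      rw [hx] at this
      linear_combination this
    rw [← (hP p p (hUm p)).2 v, dirDeriv_congr hconst]
    unfold dirDeriv
    rw [mfderiv_const]
    rfl
  · -- positive genus: the primitive lives on the plane of the polygon
    have hφc : Continuous φ := hφ.smooth.continuous
    obtain ⟨F, hF⟩ := exists_global_primitive (Y := ℂ) (fun z => P (φ z) ∘ φ)
      (fun z => φ ⁻¹' U (φ z)) (fun z => (hUo _).preimage hφc) (fun z => hUm _)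
      (fun y y' z hz => hφc.continuousAt.eventually (hcompat (φ y) (φ y') (φ z) hz))
    have hFP : ∀ z, F =ᶠ[𝓝 z] fun x => P (φ z) (φ x) + (F z - P (φ z) (φ z)) := fun z => by
      filter_upwards [hF z z (hUm _)] with x hx
      simp only [Function.comp_apply] at hx
      rw [← hx]; ring
    have hFs : ContDiff ℝ 2 F := by
      rw [contDiff_iff_contDiffAt]
      intro z
      have h1 : ContMDiffAt 𝓘(ℝ, ℂ) 𝓘(ℝ, ℂ) 2 (P (φ z) ∘ φ) z :=
        ((ContMDiffAt.complexToReal (hP (φ z) (φ z) (hUm _)).1).of_le le_top).comp z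
          ((hφ.smooth z).of_le (WithTop.coe_le_coe.2 (le_top : (2 : ℕ∞) ≤ ⊤)))
      exact ((contMDiffAt_iff_contDiffAt.1 h1).add contDiffAt_const).congr_of_eventuallyEq (hFP z)
    have hφmd : ∀ z, MDifferentiableAt 𝓘(ℝ, ℂ) 𝓘(ℝ, ℂ) φ z := fun z =>
      (hφ.smooth z).mdifferentiableAt (by simp)
    let c : ℂ → ℂ := fun z => η (φ z) (show TangentSpace 𝓘(ℂ, ℂ) (φ z) from (1 : ℂ))
    have hηc : ∀ z (v : ℂ), η (φ z) (show TangentSpace 𝓘(ℂ, ℂ) (φ z) from v) = v * c z := by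
      intro z v
      have := (η (φ z)).map_smul v (show TangentSpace 𝓘(ℂ, ℂ) (φ z) from (1 : ℂ))
      refine Eq.trans ?_ this
      congr 1
      exact (mul_one v).symm
    have hFd : ∀ z v, fderiv ℝ F z v = realDeriv φ z v * c z := by
      intro z v
      have h1 := (HasMFDerivAt.complexToReal
        (hPmd (φ z) (φ z) (hUm _)).hasMFDerivAt).comp z (hφmd z).hasMFDerivAt
      have h2 := (hasMFDerivAt_iff_hasFDerivAt.1 h1).add_const (F z - P (φ z) (φ z))
      have h3 := h2.congr_of_eventuallyEq (hFP z)
      rw [h3.fderiv]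
      refine Eq.trans ?_ (hηc z _)
      exact (hP (φ z) (φ z) (hUm _)).2 _
    have hjac : ∀ z, jacobian F z = Complex.normSq (c z) * (realDeriv φ z).det := by
      intro z
      rw [det_eq_im_conj_mul]
      unfold jacobian
      rw [hFd, hFd, map_mul]
      simp only [Complex.mul_im, Complex.mul_re, Complex.conj_re, Complex.conj_im,
        Complex.normSq_apply]
      ring
    have hsidec : ∀ k, Continuous (side g k) := fun k => AffineMap.lineMap_continuous
    have hsm : ∀ k, ContDiff ℝ 2 (side g k) := by
      intro k
      have : side g k = fun t : ℝ => vertex g k + t * (vertex g (k + 1) - vertex g k) := by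
        funext t; exact side_apply g k t
      rw [this]
      exact contDiff_const.add (Complex.ofRealCLM.contDiff.mul contDiff_const)
    -- values of `F` at points with the same image in `X`
    have hpair : ∀ k l : ℕ, (∀ t ∈ Icc (0 : ℝ) 1, φ (side g k t) = φ (side g l (1 - t))) →
        ∃ α, ∀ t ∈ Icc (0 : ℝ) 1, F (side g l (1 - t)) - F (side g k t) = α := by
      intro k l hkl
      refine ⟨_, constant_of_has_deriv_right_zero ?_ ?_⟩
      · exact ((hFs.continuous.comp ((hsidec l).comp (continuous_const.sub continuous_id))).sub
          (hFs.continuous.comp (hsidec k))).continuousOn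
      · intro t ht
        have ht' := Ico_subset_Icc_self ht
        have h1 : ∀ᶠ s in 𝓝 t, F (side g l (1 - s)) = P (φ (side g l (1 - t))) (φ (side g l (1 - s)))
            + (F (side g l (1 - t)) - P (φ (side g l (1 - t))) (φ (side g l (1 - t)))) :=
          ((hsidec l).comp (continuous_const.sub continuous_id)).continuousAt.eventually
            (hFP (side g l (1 - t)))
        have h2 : ∀ᶠ s in 𝓝 t, F (side g k s) = P (φ (side g k t)) (φ (side g k s))
            + (F (side g k t) - P (φ (side g k t)) (φ (side g k t))) :=
          (hsidec k).continuousAt.eventually (hFP (side g k t))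
        have h3 : ∀ᶠ s in 𝓝[≥] t, s ∈ Icc (0 : ℝ) 1 := by
          filter_upwards [Ico_mem_nhdsGE ht.2] with s hs
          exact ⟨ht.1.trans hs.1, hs.2.le⟩
        refine HasDerivWithinAt.congr_of_eventuallyEq (f := fun _ =>
          F (side g l (1 - t)) - F (side g k t)) (hasDerivWithinAt_const _ _ _) ?_ rfl
        filter_upwards [mem_nhdsWithin_of_mem_nhds h1, mem_nhdsWithin_of_mem_nhds h2, h3]
          with s hs1 hs2 hs3
        change F (side g l (1 - s)) = _ at hs1
        rw [hs1, hs2, ← hkl s hs3, ← hkl t ht']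
        ring
    have hsidePaired : ∀ k l : ℕ, (∀ t ∈ Icc (0 : ℝ) 1, SidePaired g (side g k t) (side g l (1 - t))) →
        ∀ t ∈ Icc (0 : ℝ) 1, φ (side g k t) = φ (side g l (1 - t)) := by
      intro k l hkl t ht
      exact (hφ.fiber _ (side_mem_polygon g k ht) _ (side_mem_polygon g l
        ⟨by linarith [ht.2], by linarith [ht.1]⟩)).2 (Relation.EqvGen.rel _ _ (hkl t ht))
    have hα : ∀ j < g, ∃ α, ∀ t ∈ Icc (0 : ℝ) 1,
        F (side g (4 * j + 2) (1 - t)) - F (side g (4 * j) t) = α := fun j hj =>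
      hpair _ _ (hsidePaired _ _ fun t ht => ⟨j, hj, t, ht, Or.inl ⟨rfl, rfl⟩⟩)
    have hβ : ∀ j < g, ∃ α, ∀ t ∈ Icc (0 : ℝ) 1,
        F (side g (4 * j + 3) (1 - t)) - F (side g (4 * j + 1) t) = α := fun j hj =>
      hpair _ _ (hsidePaired _ _ fun t ht => ⟨j, hj, t, ht, Or.inr ⟨rfl, rfl⟩⟩)
    have hperF : ∀ j < g, F (side g (4 * j) 1) = F (side g (4 * j) 0) := by
      intro j hj
      have h1 := hper ⟨j, hj⟩
      have hd : ∀ t, HasDerivAt (F ∘ side g (4 * j)) (η (φ (side g (4 * j) t))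
          (velocity (φ ∘ side g (4 * j)) t)) t := by
        intro t
        have hmd : MDifferentiableAt 𝓘(ℝ, ℝ) 𝓘(ℝ, ℂ) (φ ∘ side g (4 * j)) t :=
          (hφmd _).comp t (mdifferentiableAt_iff_differentiableAt.2
            ((hsm _).differentiable (by norm_num) t))
        have h2 := (hasDerivAt_comp_path hmd (hPmd _ _ (hUm (φ (side g (4 * j) t))))).add_const
          (F (side g (4 * j) t) - P (φ (side g (4 * j) t)) (φ (side g (4 * j) t)))
        rw [← (hP (φ (side g (4 * j) t)) (φ (side g (4 * j) t)) (hUm _)).2]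
        exact h2.congr_of_eventuallyEq ((hsidec _).continuousAt.eventually (hFP _))
      have hsmF : ContDiff ℝ 1 (F ∘ side g (4 * j)) := (hFs.comp (hsm _)).of_le (by norm_num)
      have h3 : (∫ t in (0 : ℝ)..1, η (φ (side g (4 * j) t)) (velocity (φ ∘ side g (4 * j)) t)) =
          (F ∘ side g (4 * j)) 1 - (F ∘ side g (4 * j)) 0 := by
        refine intervalIntegral.integral_eq_sub_of_hasDerivAt (fun t _ => hd t) ?_
        have : (fun t => η (φ (side g (4 * j) t)) (velocity (φ ∘ side g (4 * j)) t)) =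
            deriv (F ∘ side g (4 * j)) := funext fun t => (hd t).deriv.symm
        rw [this]
        exact (hsmF.continuous_deriv (by simp)).intervalIntegrable _ _
      have h4 : (∫ t in (0 : ℝ)..1, η (A ⟨j, hj⟩ t) (velocity (A ⟨j, hj⟩) t)) =
          ∫ t in (0 : ℝ)..1, η (φ (side g (4 * j) t)) (velocity (φ ∘ side g (4 * j)) t) := by
        rw [intervalIntegral.integral_of_le zero_le_one, intervalIntegral.integral_of_le zero_le_one,
          integral_Ioc_eq_integral_Ioo, integral_Ioc_eq_integral_Ioo]
        refine setIntegral_congr_fun measurableSet_Ioo fun t ht => ?_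
        have h5 : A ⟨j, hj⟩ =ᶠ[𝓝 t] φ ∘ side g (4 * j) := by
          filter_upwards [Ioo_mem_nhds ht.1 ht.2] with s hs
          exact (hφAC ⟨j, hj⟩ s (Ioo_subset_Icc_self hs)).1
        have h6 : (velocity (A ⟨j, hj⟩) t : ℂ) = (velocity (φ ∘ side g (4 * j)) t : ℂ) :=
          velocity_congr h5
        have h7 : ∀ (p q : X) (v w : ℂ), p = q → v = w →
            η p (show TangentSpace 𝓘(ℂ, ℂ) p from v) = η q (show TangentSpace 𝓘(ℂ, ℂ) q from w) := by
          rintro p q v w rfl rfl; rfl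
        exact h7 _ _ _ _ h5.eq_of_nhds h6
      rw [← h4, h1] at h3
      exact (sub_eq_zero.1 h3.symm)
    have hzero := fun (x t : ℝ) (hx : x ∈ Ioo (0 : ℝ) 1) (ht : t ∈ Ioo (0 : ℝ) 1) =>
      jacobian_eq_zero hg hFs (fun z hz => by
        rw [hjac]; exact mul_nonneg (Complex.normSq_nonneg _) (hφ.orient z hz).le) hperF hα hβ hx ht
    -- `η` vanishes on the image of a path in the interior of the polygon
    have hc0 : ∀ x ∈ Ioo (0 : ℝ) 1, ∀ t ∈ Ioo (0 : ℝ) 1, η (φ (x * side g 0 t)) = 0 := by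
      intro x hx t ht
      have h1 := hzero x t hx ht
      rw [hjac] at h1
      have h2 := (mul_eq_zero.1 h1).resolve_right
        (hφ.orient _ (smul_side_mem_interior hg 0 hx ht)).ne'
      have h3 : c (x * side g 0 t) = 0 := Complex.normSq_eq_zero.1 h2
      refine LinearMap.ext fun v => ?_
      refine (hηc _ v).trans ?_
      rw [h3]
      exact mul_zero (M₀ := ℂ) _
    have hhalf : (1 / 2 : ℝ) ∈ Ioo (0 : ℝ) 1 := ⟨by norm_num, by norm_num⟩
    set z₀ : ℂ := (1 / 2 : ℝ) * side g 0 (1 / 2 : ℝ) with hz₀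
    have hz₀i : z₀ ∈ interior (polygon g) := smul_side_mem_interior hg 0 hhalf hhalf
    refine OneForm.eq_zero_of_eventually h (p₀ := φ z₀) ((h _).eventually_eq_zero ?_) p
    let q : ℝ → ℂ := fun t => (1 / 2 : ℝ) * side g 0 t
    have hqc : Continuous q := continuous_const.mul (hsidec 0)
    have hev : ∀ᶠ t in 𝓝 (1 / 2 : ℝ), η (φ (q t)) = 0 := by
      filter_upwards [Ioo_mem_nhds hhalf.1 hhalf.2] with t ht using hc0 _ hhalf t ht
    by_contra hnot
    rw [not_frequently] at hnot
    have hcst : (φ ∘ q) =ᶠ[𝓝 (1 / 2 : ℝ)] fun _ => φ z₀ := by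
      have h1 := ((hφc.comp hqc).continuousAt (x := (1 / 2 : ℝ))).eventually
        (eventually_nhdsWithin_iff.1 hnot)
      filter_upwards [h1, hev] with t ht ht'
      by_contra hne
      exact ht hne ht'
    -- a constant path has zero velocity, but `φ` is a local diffeomorphism at `z₀`
    have hq' : HasDerivAt q ((1 / 2 : ℝ) * (vertex g 1 - vertex g 0)) (1 / 2 : ℝ) := by
      have h1 : HasDerivAt (fun t : ℝ => vertex g 0 + t * (vertex g (0 + 1) - vertex g 0))
          (1 * (vertex g (0 + 1) - vertex g 0)) (1 / 2 : ℝ) :=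
        ((Complex.ofRealCLM.hasDerivAt (x := (1 / 2 : ℝ))).mul_const _).const_add _
      rw [one_mul] at h1
      exact (h1.congr_of_eventuallyEq (Eventually.of_forall fun y => side_apply g 0 y)).const_mul _
    have h1 := ((hφmd z₀).hasMFDerivAt.comp (1 / 2 : ℝ)
      (hasMFDerivAt_iff_hasFDerivAt.2 hq'.hasFDerivAt)).mfderiv
    rw [hcst.mfderiv_eq, mfderiv_const] at h1
    have h2 : realDeriv φ z₀ ((1 / 2 : ℝ) * (vertex g 1 - vertex g 0)) = 0 := by
      have h3 := congrArg (fun L : ℝ →L[ℝ] ℂ => L 1) h1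
      have h4 : (0 : ℂ) = realDeriv φ z₀ ((1 : ℝ) • ((1 / 2 : ℝ) * (vertex g 1 - vertex g 0))) := h3
      rw [one_smul] at h4
      exact h4.symm
    have hdet := hφ.orient z₀ hz₀i
    have hinj : Function.Injective (realDeriv φ z₀) := by
      have h5 : LinearMap.ker ((realDeriv φ z₀ : ℂ →L[ℝ] ℂ) : ℂ →ₗ[ℝ] ℂ) = ⊥ := by
        by_contra hne
        exact hdet.ne' (LinearMap.det_eq_zero_iff_ker_ne_bot.2 hne)
      exact LinearMap.ker_eq_bot.1 h5
    have h3 : vertex g 1 = vertex g 0 := by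
      have := hinj (h2.trans (map_zero _).symm)
      have h4 := (mul_eq_zero.1 this).resolve_left (by norm_num)
      exact sub_eq_zero.1 h4
    have h4 := im_conj_vertex_mul_succ hg 0
    rw [zero_add, h3, mul_comm, Complex.mul_conj] at h4
    simp at h4

end Vanishing

/-! ### The key form -/

section Analytic

theorem AnalyticAt.deriv_snd {Φ : ℂ × ℂ → ℂ} {w z : ℂ} (h : AnalyticAt ℂ Φ (w, z)) :
    AnalyticAt ℂ (fun y : ℂ × ℂ => deriv (fun z' => Φ (y.1, z')) y.2) (w, z) := by
  have h1 : AnalyticAt ℂ (fun y => fderiv ℂ Φ y (0, 1)) (w, z) :=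
    ((ContinuousLinearMap.apply ℂ ℂ ((0, 1) : ℂ × ℂ)).analyticAt _).comp h.fderiv
  refine h1.congr ?_
  filter_upwards [h.eventually_analyticAt] with y hy
  have h2 : HasDerivAt (fun z' : ℂ => (y.1, z')) (0, 1) y.2 :=
    (hasDerivAt_const y.2 y.1).prodMk (hasDerivAt_id y.2)
  exact (hy.differentiableAt.hasFDerivAt.comp_hasDerivAt y.2 h2).deriv.symm

theorem AnalyticAt.deriv_fst {Φ : ℂ × ℂ → ℂ} {w z : ℂ} (h : AnalyticAt ℂ Φ (w, z)) :
    AnalyticAt ℂ (fun y : ℂ × ℂ => deriv (fun w' => Φ (w', y.2)) y.1) (w, z) := by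
  have h1 : AnalyticAt ℂ (fun y => fderiv ℂ Φ y (1, 0)) (w, z) :=
    ((ContinuousLinearMap.apply ℂ ℂ ((1, 0) : ℂ × ℂ)).analyticAt _).comp h.fderiv
  refine h1.congr ?_
  filter_upwards [h.eventually_analyticAt] with y hy
  have h2 : HasDerivAt (fun w' : ℂ => (w', y.2)) (1, 0) y.1 :=
    (hasDerivAt_id y.1).prodMk (hasDerivAt_const y.1 y.2)
  exact (hy.differentiableAt.hasFDerivAt.comp_hasDerivAt y.1 h2).deriv.symm

theorem AnalyticAt.comp_left {Φ : ℂ × ℂ → ℂ} {w z : ℂ} (h : AnalyticAt ℂ Φ (w, z)) :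
    AnalyticAt ℂ (fun w' => Φ (w', z)) w :=
  AnalyticAt.fun_comp (g := Φ) (f := fun w' => (w', z)) h (analyticAt_id.prod analyticAt_const)

theorem AnalyticAt.comp_right {Φ : ℂ × ℂ → ℂ} {w z : ℂ} (h : AnalyticAt ℂ Φ (w, z)) :
    AnalyticAt ℂ (fun z' => Φ (w, z')) z :=
  AnalyticAt.fun_comp (g := Φ) (f := fun z' => (w, z')) h (analyticAt_const.prod analyticAt_id)

/-- Second order Taylor expansion at the origin, with analytic remainder. -/
theorem AnalyticAt.exists_taylor_two {b : ℂ → ℂ} (h : AnalyticAt ℂ b 0) :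
    ∃ (c : ℂ) (G : ℂ → ℂ), AnalyticAt ℂ G 0 ∧ ∀ᶠ w in 𝓝 (0 : ℂ), b w = b 0 + c * w + w ^ 2 * G w := by
  have step : ∀ {u : ℂ → ℂ}, AnalyticAt ℂ u 0 →
      ∃ v : ℂ → ℂ, AnalyticAt ℂ v 0 ∧ ∀ᶠ w in 𝓝 (0 : ℂ), u w = u 0 + w * v w := by
    intro u hu
    refine ⟨dslope u 0, ?_, Eventually.of_forall fun w => ?_⟩
    · obtain ⟨p, hp⟩ := hu
      exact (hp.has_fpower_series_dslope_fslope).analyticAt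
    · have := sub_smul_dslope u 0 w
      rw [sub_zero, smul_eq_mul] at this
      rw [this]; ring
  obtain ⟨v, hv, h1⟩ := step h
  obtain ⟨G, hG, h2⟩ := step hv
  refine ⟨v 0, G, hG, ?_⟩
  filter_upwards [h1, h2] with w e1 e2
  rw [e1, e2]; ring

end Analytic

section KeyForm

variable {X : Type*} [TopologicalSpace X] [ChartedSpace ℂ X]

/-- A coordinate in which `dx = d(ζ²)`, not necessarily centred at a branchpoint. -/
structure IsRootCoordinate (dx : OneForm X) (e : OpenPartialHomeomorph X ℂ) : Prop where
  mem_maximalAtlas : e ∈ IsManifold.maximalAtlas 𝓘(ℂ, ℂ) ω X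
  coeff_eq : ∀ w ∈ e.target, dx.coeff e w = 2 * w

theorem IsBranchCoordinate.isRootCoordinate {dx : OneForm X} {a : X}
    {e : OpenPartialHomeomorph X ℂ} (h : IsBranchCoordinate dx a e) : IsRootCoordinate dx e :=
  ⟨h.mem_maximalAtlas, h.coeff_eq⟩

theorem IsBranchCoordinate.zero_mem {dx : OneForm X} {a : X}
    {e : OpenPartialHomeomorph X ℂ} (h : IsBranchCoordinate dx a e) : (0 : ℂ) ∈ e.target :=
  h.map_center ▸ e.map_source h.mem_source

theorem IsBranchCoordinate.symm_zero {dx : OneForm X} {a : X}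
    {e : OpenPartialHomeomorph X ℂ} (h : IsBranchCoordinate dx a e) : e.symm 0 = a := by
  rw [← h.map_center, e.left_inv h.mem_source]

theorem IsBranchCoordinate.apply_eq_zero {dx : OneForm X} {a : X}
    {e : OpenPartialHomeomorph X ℂ} (h : IsBranchCoordinate dx a e) : dx a = 0 := by
  rw [← dx.coeff_eq_zero_iff h.mem_maximalAtlas h.mem_source, h.map_center, h.coeff_eq 0 h.zero_mem,
    mul_zero]

/-- Away from the origin, a root coordinate misses the branchpoints. -/
theorem IsRootCoordinate.symm_ne {dx : OneForm X} {e : OpenPartialHomeomorph X ℂ}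
    (he : IsRootCoordinate dx e) {w : ℂ} (hw : w ∈ e.target) (hw0 : w ≠ 0) {a : X}
    (ha : dx a = 0) : e.symm w ≠ a := by
  intro h
  have h1 := (dx.coeff_eq_zero_iff he.mem_maximalAtlas (e.map_target hw)).2 (h ▸ ha)
  rw [e.right_inv hw, he.coeff_eq w hw] at h1
  exact hw0 (by simpa using h1)

theorem Bidifferential.IsBergmanKernel.coeff_comm {B : Bidifferential X} (hB : B.IsBergmanKernel)
    {e f : OpenPartialHomeomorph X ℂ} {w z : ℂ} (h : e.symm w ≠ f.symm z) :
    B.coeff e f w z = B.coeff f e z w :=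
  hB.symm _ _ _ _ h

/-- Gluing: local coefficients that transform like a 1-form away from a finite set, and that have
removable singularities there, come from a holomorphic 1-form. -/
theorem exists_oneForm_of_coeff [T1Space X]
    (c : OpenPartialHomeomorph X ℂ → ℂ → ℂ) (S : Set X) (hS : S.Finite)
    (hc : ∀ e ∈ IsManifold.maximalAtlas 𝓘(ℂ, ℂ) ω X, ∀ f ∈ IsManifold.maximalAtlas 𝓘(ℂ, ℂ) ω X,
      ∀ w ∈ e.target, e.symm w ∉ S → e.symm w ∈ f.source →
        c e w = deriv (f ∘ e.symm) w * c f (f (e.symm w)))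
    (hloc : ∀ p : X, ∃ e ∈ IsManifold.maximalAtlas 𝓘(ℂ, ℂ) ω X, p ∈ e.source ∧ ∃ G : ℂ → ℂ,
      AnalyticAt ℂ G (e p) ∧ (∀ᶠ w in 𝓝[≠] (e p), c e w = G w) ∧ (p ∉ S → c e (e p) = G (e p))) :
    ∃ η : OneForm X, (∀ p, η.HolomorphicAt p) ∧
      ∀ e ∈ IsManifold.maximalAtlas 𝓘(ℂ, ℂ) ω X, ∀ w ∈ e.target, e.symm w ∉ S →
        η.coeff e w = c e w := by
  choose e he hpe G hG hcG hcG' using hloc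
  let η : OneForm X := fun p => G p (e p p) •
    ((show TangentSpace 𝓘(ℂ, ℂ) p →L[ℂ] ℂ from mfderiv 𝓘(ℂ, ℂ) 𝓘(ℂ, ℂ) (e p) p) :
      TangentSpace 𝓘(ℂ, ℂ) p →ₗ[ℂ] ℂ)
  have hη : ∀ p v, η p v = G p (e p p) * dirDeriv (e p) p v := fun p v => rfl
  have hcoeff : ∀ f ∈ IsManifold.maximalAtlas 𝓘(ℂ, ℂ) ω X, ∀ w ∈ f.target, f.symm w ∉ S →
      η.coeff f w = c f w := by
    intro f hf w hw hwS
    have h1 := hpe (f.symm w)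
    rw [hc f hf (e (f.symm w)) (he _) w hw hwS h1, hcG' _ hwS,
      (hasDerivAt_comp_symm hf hw (mdifferentiableAt_coord (he _) h1)).deriv, mul_comm]
    rfl
  refine ⟨η, fun p => ⟨e p, he p, hpe p, (hG p).congr ?_⟩, hcoeff⟩
  have ht : e p p ∈ (e p).target := (e p).map_source (hpe p)
  have hcs : ContinuousAt (e p).symm (e p p) := (e p).continuousAt_symm ht
  have h1 : ∀ᶠ w in 𝓝 (e p p), (e p).symm w ∉ S \ {p} := by
    have : (S \ {p})ᶜ ∈ 𝓝 p := (hS.subset sdiff_subset).isClosed.isOpen_compl.mem_nhds (by simp)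
    rw [← (e p).left_inv (hpe p)] at this
    have h2 := hcs.preimage_mem_nhds this
    filter_upwards [h2] with w hw
    rw [(e p).left_inv (hpe p)] at hw
    exact hw
  filter_upwards [h1, eventually_nhdsWithin_iff.1 (hcG p), (e p).open_target.mem_nhds ht]
    with w hw hw' hwt
  by_cases hwp : w = e p p
  · rw [hwp]
    unfold OneForm.coeff
    rw [hη]
    have e1 : (e p).symm (e p p) = p := (e p).left_inv (hpe p)
    have e2 := dirDeriv_coordVec (he p) ht
    have key : ∀ q, q = p → ∀ v : ℂ, dirDeriv (e p) q (show TangentSpace 𝓘(ℂ, ℂ) q from v) = 1 →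
        G p (e p p) = G q (e q q) * dirDeriv (e q) q (show TangentSpace 𝓘(ℂ, ℂ) q from v) := by
      rintro q rfl v hv
      rw [hv, mul_one]
    exact key _ e1 _ e2
  · have hne : (e p).symm w ≠ p := by
      intro h
      apply hwp
      exact ((e p).right_inv hwt).symm.trans (congrArg (e p) h)
    rw [hcoeff (e p) (he p) w hwt (fun h => hw ⟨h, hne⟩), hw' hwp]

/-- In any coordinate the reciprocal of the coefficient of `dx` is holomorphic away from the zeros
of `dx`. -/
theorem analyticAt_inv_coeff [IsManifold 𝓘(ℂ, ℂ) ω X] {dx : OneForm X} (hdx : dx.IsMeromorphic)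
    {p : X} (hp : ¬ 0 < dx.order p) {e : OpenPartialHomeomorph X ℂ}
    (he : e ∈ IsManifold.maximalAtlas 𝓘(ℂ, ℂ) ω X) (hpe : p ∈ e.source) :
    AnalyticAt ℂ (fun w => (dx.coeff e w)⁻¹) (e p) := by
  set f := chartAt ℂ p with hf_def
  have hf : f ∈ IsManifold.maximalAtlas 𝓘(ℂ, ℂ) ω X := IsManifold.chart_mem_maximalAtlas p
  have hpf : p ∈ f.source := mem_chart_source ℂ p
  have h1 : MeromorphicNFAt (dx.coeff f)⁻¹ (f p) := (hdx f hf _ (f.map_source hpf)).inv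
  have h2 : 0 ≤ meromorphicOrderAt (dx.coeff f)⁻¹ (f p) := by
    rw [meromorphicOrderAt_inv]
    have : meromorphicOrderAt (dx.coeff f) (f p) ≤ 0 := not_lt.1 hp
    revert this
    generalize meromorphicOrderAt (dx.coeff f) (f p) = n
    intro hn
    lift n to ℤ using (fun h => by rw [h] at hn; exact absurd hn (by simp))
    have hn' : n ≤ 0 := by exact_mod_cast hn
    have : (0 : WithTop ℤ) ≤ ((-n : ℤ) : WithTop ℤ) := by exact_mod_cast neg_nonneg.2 hn'
    simpa using this
  have h3 : AnalyticAt ℂ (dx.coeff f)⁻¹ (f p) := h1.meromorphicOrderAt_nonneg_iff_analyticAt.1 h2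
  have hw : e p ∈ e.target := e.map_source hpe
  have hw' : e.symm (e p) ∈ f.source := by rwa [e.left_inv hpe]
  have h4 := analyticAt_coordChange he hf hw hw'
  have h5 : AnalyticAt ℂ (fun w => (deriv (f ∘ e.symm) w)⁻¹ * (dx.coeff f)⁻¹ ((f ∘ e.symm) w))
      (e p) := by
    refine (h4.deriv.inv (deriv_coordChange_ne_zero he hf hw hw')).mul
      (AnalyticAt.comp (g := (dx.coeff f)⁻¹) ?_ h4)
    simpa [e.left_inv hpe] using h3
  refine h5.congr ?_
  filter_upwards [e.open_target.mem_nhds hw,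
    (e.continuousAt_symm hw).preimage_mem_nhds (f.open_source.mem_nhds hw')] with y hy hy'
  rw [dx.coeff_eq_deriv_mul he hf hy hy', mul_inv]
  rfl

/-- For a fixed point with coordinate `z₀`, this is the coefficient, in the coordinate `e`, of the
1-form `d(B/dx) + ∂_{z₀}(B/dx) + ½ ∑ₖ B(·, aₖ) B(z₀, aₖ)`. -/
def keyCoeff {b : ℕ} (dx : OneForm X) (B : Bidifferential X) (ζ : Fin b → OpenPartialHomeomorph X ℂ)
    (f : OpenPartialHomeomorph X ℂ) (z₀ : ℂ) (e : OpenPartialHomeomorph X ℂ) (w : ℂ) : ℂ :=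
  deriv (fun w => B.coeff e f w z₀ * (dx.coeff e w)⁻¹) w +
    deriv (fun z => B.coeff e f w z / (2 * z)) z₀ +
    (1 / 2) * ∑ k, B.coeff e (ζ k) w 0 * B.coeff f (ζ k) z₀ 0

theorem analyticAt_coeff_left {B : Bidifferential X} (hB : B.IsBergmanKernel) {e f : OpenPartialHomeomorph X ℂ}
    (he : e ∈ IsManifold.maximalAtlas 𝓘(ℂ, ℂ) ω X) (hf : f ∈ IsManifold.maximalAtlas 𝓘(ℂ, ℂ) ω X)
    {w z : ℂ} (hw : w ∈ e.target) (hz : z ∈ f.target) (h : e.symm w ≠ f.symm z) :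
    AnalyticAt ℂ (fun w => B.coeff e f w z) w :=
  AnalyticAt.comp_left (hB.holo e he f hf w hw z hz h)

theorem analyticAt_deriv_coeff_div {B : Bidifferential X} (hB : B.IsBergmanKernel) {e f : OpenPartialHomeomorph X ℂ}
    (he : e ∈ IsManifold.maximalAtlas 𝓘(ℂ, ℂ) ω X) (hf : f ∈ IsManifold.maximalAtlas 𝓘(ℂ, ℂ) ω X)
    {w z : ℂ} (hw : w ∈ e.target) (hz : z ∈ f.target) (h : e.symm w ≠ f.symm z) (hz0 : z ≠ 0) :
    AnalyticAt ℂ (fun w => deriv (fun z => B.coeff e f w z / (2 * z)) z) w := by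
  have h1 : AnalyticAt ℂ (fun y : ℂ × ℂ => B.coeff e f y.1 y.2 / (2 * y.2)) (w, z) :=
    (hB.holo e he f hf w hw z hz h).div (analyticAt_const.mul analyticAt_snd) (by simpa using hz0)
  exact AnalyticAt.comp_left (AnalyticAt.deriv_snd h1)

variable [IsManifold 𝓘(ℂ, ℂ) ω X] {dx : OneForm X} {b : ℕ} {a : Fin b → X}
  {ζ : Fin b → OpenPartialHomeomorph X ℂ} {B : Bidifferential X}

/-- The coefficients `keyCoeff` transform like those of a 1-form. The reason is that `B(·, q) / dx` is
a function on the surface, so that its derivative is a form. -/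
theorem keyCoeff_transform (hdx : dx.IsMeromorphic) (ha_range : range a = {p | 0 < dx.order p})
    (hζ : ∀ i, IsBranchCoordinate dx (a i) (ζ i)) (hB : B.IsBergmanKernel)
    {f : OpenPartialHomeomorph X ℂ} (hf : IsRootCoordinate dx f) {z₀ : ℂ} (hz₀ : z₀ ∈ f.target)
    {e e' : OpenPartialHomeomorph X ℂ} (he : e ∈ IsManifold.maximalAtlas 𝓘(ℂ, ℂ) ω X)
    (he' : e' ∈ IsManifold.maximalAtlas 𝓘(ℂ, ℂ) ω X) {w : ℂ} (hw : w ∈ e.target)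
    (hwS : e.symm w ∉ insert (f.symm z₀) (range a)) (hw' : e.symm w ∈ e'.source) :
    keyCoeff dx B ζ f z₀ e w =
      deriv (e' ∘ e.symm) w * keyCoeff dx B ζ f z₀ e' (e' (e.symm w)) := by
  have hfa := hf.mem_maximalAtlas
  rw [mem_insert_iff, not_or] at hwS
  have htr : ∀ (f' : OpenPartialHomeomorph X ℂ), f' ∈ IsManifold.maximalAtlas 𝓘(ℂ, ℂ) ω X →
      ∀ y ∈ e.target, e.symm y ∈ e'.source → ∀ z ∈ f'.target,
      B.coeff e f' y z = deriv (e' ∘ e.symm) y * B.coeff e' f' (e' (e.symm y)) z := by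
    intro f' hf' y hy hy' z hz
    rw [B.coeff_eq_deriv_mul he hf' he' hf' hy hz hy' (f'.map_target hz),
      f'.right_inv hz]
    have : deriv (f' ∘ f'.symm) z = 1 := by
      have h : f' ∘ f'.symm =ᶠ[𝓝 z] id := by
        filter_upwards [f'.open_target.mem_nhds hz] with x hx using f'.right_inv hx
      rw [h.deriv_eq, deriv_id]
    rw [this, one_mul]
  have hτ := analyticAt_coordChange he he' hw hw'
  have hw1 : e' (e.symm w) ∈ e'.target := e'.map_source hw'
  have hw2 : e'.symm (e' (e.symm w)) = e.symm w := e'.left_inv hw'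
  have hnear : ∀ᶠ y in 𝓝 w, y ∈ e.target ∧ e.symm y ∈ e'.source :=
    (e.open_target.eventually_mem hw).and ((e.continuousAt_symm hw).preimage_mem_nhds
      (e'.open_source.mem_nhds hw'))
  unfold keyCoeff
  rw [mul_add, mul_add]
  congr 1
  · congr 1
    · have h1 : (fun w => B.coeff e f w z₀ * (dx.coeff e w)⁻¹) =ᶠ[𝓝 w]
          (fun w => B.coeff e' f w z₀ * (dx.coeff e' w)⁻¹) ∘ (e' ∘ e.symm) := by
        filter_upwards [hnear] with y hy
        rw [htr f hfa y hy.1 hy.2 z₀ hz₀, dx.coeff_eq_deriv_mul he he' hy.1 hy.2]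
        have := deriv_coordChange_ne_zero he he' hy.1 hy.2
        simp only [Function.comp_apply]
        rw [mul_inv]
        field_simp
      have h2 : DifferentiableAt ℂ (fun w => B.coeff e' f w z₀ * (dx.coeff e' w)⁻¹)
          (e' (e.symm w)) := by
        refine DifferentiableAt.mul ?_ ?_
        · exact (AnalyticAt.comp_left (hB.holo e' he' f hfa _ hw1 z₀ hz₀
            (by rw [hw2]; exact hwS.1))).differentiableAt
        · exact (analyticAt_inv_coeff hdx (fun h => hwS.2 (by rw [ha_range]; exact h)) he'
            hw').differentiableAt
      rw [h1.deriv_eq, ((h2.hasDerivAt (𝕜 := ℂ)).comp w hτ.differentiableAt.hasDerivAt).deriv,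
        mul_comm]
    · have h1 : (fun z => B.coeff e f w z / (2 * z)) =ᶠ[𝓝 z₀]
          fun z => deriv (e' ∘ e.symm) w * (B.coeff e' f (e' (e.symm w)) z / (2 * z)) := by
        filter_upwards [f.open_target.mem_nhds hz₀] with z hz
        rw [htr f hfa w hw hw' z hz, mul_div_assoc]
      rw [h1.deriv_eq, deriv_const_mul_field]
  · rw [mul_left_comm]
    congr 1
    rw [Finset.mul_sum]
    refine Finset.sum_congr rfl fun k _ => ?_
    rw [htr (ζ k) (hζ k).mem_maximalAtlas w hw hw' 0 (hζ k).zero_mem, mul_assoc]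

/-- The local coefficients of the key form have removable singularities. -/
theorem keyCoeff_removable (hdx : dx.IsMeromorphic) (ha : Function.Injective a)
    (ha_range : range a = {p | 0 < dx.order p})
    (hζ : ∀ i, IsBranchCoordinate dx (a i) (ζ i)) (hB : B.IsBergmanKernel)
    {f : OpenPartialHomeomorph X ℂ} (hf : IsRootCoordinate dx f) {z₀ : ℂ} (hz₀ : z₀ ∈ f.target)
    (hz0 : z₀ ≠ 0) (p : X) :
    ∃ e ∈ IsManifold.maximalAtlas 𝓘(ℂ, ℂ) ω X, p ∈ e.source ∧ ∃ G : ℂ → ℂ,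
      AnalyticAt ℂ G (e p) ∧ (∀ᶠ w in 𝓝[≠] (e p), keyCoeff dx B ζ f z₀ e w = G w) ∧
      (p ∉ insert (f.symm z₀) (range a) → keyCoeff dx B ζ f z₀ e (e p) = G (e p)) := by
  have hfa := hf.mem_maximalAtlas
  have hqa : ∀ k, f.symm z₀ ≠ a k := fun k => hf.symm_ne hz₀ hz0 (hζ k).apply_eq_zero
  by_cases hp : p ∈ insert (f.symm z₀) (range a)
  swap
  · -- a regular point
    rw [mem_insert_iff, not_or] at hp
    set e := chartAt ℂ p with he_def
    have he : e ∈ IsManifold.maximalAtlas 𝓘(ℂ, ℂ) ω X := IsManifold.chart_mem_maximalAtlas p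
    have hpe : p ∈ e.source := mem_chart_source ℂ p
    have hw : e p ∈ e.target := e.map_source hpe
    have hsw : e.symm (e p) = p := e.left_inv hpe
    refine ⟨e, he, hpe, keyCoeff dx B ζ f z₀ e, ?_, Eventually.of_forall fun _ => rfl, fun _ => rfl⟩
    refine ((AnalyticAt.deriv ?_).add ?_).add (analyticAt_const.mul ?_)
    · exact (analyticAt_coeff_left hB he hfa hw hz₀ (by rw [hsw]; exact hp.1)).mul
        (analyticAt_inv_coeff hdx (fun h => hp.2 (by rw [ha_range]; exact h)) he hpe)
    · exact analyticAt_deriv_coeff_div hB he hfa hw hz₀ (by rw [hsw]; exact hp.1) hz0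
    · refine Finset.analyticAt_fun_sum _ fun k _ => AnalyticAt.mul ?_ analyticAt_const
      refine analyticAt_coeff_left hB he (hζ k).mem_maximalAtlas hw (hζ k).zero_mem ?_
      rw [hsw, (hζ k).symm_zero]
      exact fun h => hp.2 ⟨k, h.symm⟩
  · rcases hp with rfl | ⟨k, rfl⟩
    · -- the point with coordinate `z₀`
      have hpe : f.symm z₀ ∈ f.source := f.map_target hz₀
      have hfw : f (f.symm z₀) = z₀ := f.right_inv hz₀
      obtain ⟨H, hH, hBH⟩ := hB.diag f hfa z₀ hz₀
      have hnz : ∀ᶠ w in 𝓝 z₀, w ≠ 0 := continuousAt_id.eventually_ne hz0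
      have hHw : AnalyticAt ℂ (fun w => H (w, z₀) / (2 * w)) z₀ :=
        (AnalyticAt.comp_left hH).div (analyticAt_const.mul analyticAt_id) (by simpa using hz0)
      have hHz : AnalyticAt ℂ (fun y : ℂ × ℂ => H y / (2 * y.2)) (z₀, z₀) :=
        hH.div (analyticAt_const.mul analyticAt_snd) (by simpa using hz0)
      refine ⟨f, hfa, hpe, fun w => (deriv (fun w => H (w, z₀) / (2 * w)) w +
        deriv (fun z => H (w, z) / (2 * z)) z₀ - 1 / (2 * w ^ 2 * z₀ ^ 2)) +
        (1 / 2) * ∑ k, B.coeff f (ζ k) w 0 * B.coeff f (ζ k) z₀ 0, ?_, ?_,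
        fun h => absurd (mem_insert _ _) h⟩
      · rw [hfw]
        refine ((hHw.deriv.add (AnalyticAt.comp_left (AnalyticAt.deriv_snd hHz))).sub ?_).add
          (analyticAt_const.mul ?_)
        · exact analyticAt_const.div ((analyticAt_const.mul (analyticAt_id.pow 2)).mul
            analyticAt_const) (by simp [hz0])
        · refine Finset.analyticAt_fun_sum _ fun k _ => AnalyticAt.mul ?_ analyticAt_const
          refine analyticAt_coeff_left hB hfa (hζ k).mem_maximalAtlas hz₀ (hζ k).zero_mem ?_
          rw [(hζ k).symm_zero]; exact hqa k
      · rw [hfw]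
        have hBH1 : ∀ᶠ w in 𝓝 z₀, ∀ᶠ y in 𝓝 (w, z₀),
            y.1 ≠ y.2 → B.coeff f f y.1 y.2 = 1 / (y.1 - y.2) ^ 2 + H y :=
          (continuous_id.prodMk continuous_const).continuousAt.eventually
            (eventually_eventually_nhds.2 hBH)
        have hHan : ∀ᶠ w in 𝓝 z₀, AnalyticAt ℂ H (w, z₀) :=
          (continuous_id.prodMk continuous_const).continuousAt.eventually hH.eventually_analyticAt
        rw [eventually_nhdsWithin_iff]
        filter_upwards [hBH1, hHan, hnz, f.open_target.mem_nhds hz₀] with w hw hHa hw0 hwt hwz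
        have hwz' : w - z₀ ≠ 0 := sub_ne_zero.2 hwz
        have hd1 : ∀ᶠ w' in 𝓝 w, B.coeff f f w' z₀ * (dx.coeff f w')⁻¹ =
            1 / ((w' - z₀) ^ 2 * (2 * w')) + H (w', z₀) / (2 * w') := by
          have h1 := (continuous_id.prodMk (continuous_const (y := z₀))).continuousAt.eventually hw
          filter_upwards [h1, f.open_target.mem_nhds hwt, continuousAt_id.eventually_ne hwz]
            with w' e1 e2 e3
          have := e1 e3
          simp only [id] at this
          rw [this, hf.coeff_eq w' e2]
          rw [← div_eq_mul_inv, add_div, div_div]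
        have hd2 : ∀ᶠ z in 𝓝 z₀, B.coeff f f w z / (2 * z) =
            1 / ((w - z) ^ 2 * (2 * z)) + H (w, z) / (2 * z) := by
          have h1 := ((continuous_const (y := w)).prodMk continuous_id).continuousAt.eventually hw
          filter_upwards [h1, continuousAt_id.eventually_ne (Ne.symm hwz)] with z e1 e3
          have := e1 (Ne.symm e3)
          simp only [id] at this
          rw [this, add_div, div_div]
        unfold keyCoeff
        rw [EventuallyEq.deriv_eq hd1, EventuallyEq.deriv_eq hd2]
        have a1 : HasDerivAt (fun w' => 1 / ((w' - z₀) ^ 2 * (2 * w')))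
            (-(2 * (w - z₀) * (2 * w) + (w - z₀) ^ 2 * 2) / ((w - z₀) ^ 2 * (2 * w)) ^ 2) w := by
          have h1 : HasDerivAt (fun w' => (w' - z₀) ^ 2 * (2 * w'))
              (2 * (w - z₀) * (2 * w) + (w - z₀) ^ 2 * 2) w := by
            have := (((hasDerivAt_id w).sub_const z₀).fun_pow 2).fun_mul ((hasDerivAt_id w).const_mul 2)
            simpa using this
          have := h1.fun_inv (mul_ne_zero (pow_ne_zero 2 hwz') (mul_ne_zero two_ne_zero hw0))
          simpa only [one_div] using this
        have a2 : HasDerivAt (fun z => 1 / ((w - z) ^ 2 * (2 * z)))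
            (-(-(2 * (w - z₀)) * (2 * z₀) + (w - z₀) ^ 2 * 2) / ((w - z₀) ^ 2 * (2 * z₀)) ^ 2)
            z₀ := by
          have h1 : HasDerivAt (fun z => (w - z) ^ 2 * (2 * z))
              (-(2 * (w - z₀)) * (2 * z₀) + (w - z₀) ^ 2 * 2) z₀ := by
            have := (((hasDerivAt_id z₀).const_sub w).fun_pow 2).fun_mul ((hasDerivAt_id z₀).const_mul 2)
            simpa using this
          have := h1.fun_inv (mul_ne_zero (pow_ne_zero 2 hwz') (mul_ne_zero two_ne_zero hz0))
          simpa only [one_div] using this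
        have b1 : DifferentiableAt ℂ (fun w => H (w, z₀) / (2 * w)) w :=
          (AnalyticAt.comp_left hHa).differentiableAt.div (by fun_prop) (by simpa using hw0)
        have b2 : DifferentiableAt ℂ (fun z => H (w, z) / (2 * z)) z₀ :=
          (AnalyticAt.comp_right hHa).differentiableAt.div (by fun_prop) (by simpa using hz0)
        rw [deriv_fun_add a1.differentiableAt b1, deriv_fun_add a2.differentiableAt b2, a1.deriv,
          a2.deriv]
        field_simp
        ring
    · -- a branchpoint
      have hk := hζ k
      have hek := hk.mem_maximalAtlas
      have h0t := hk.zero_mem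
      have hs0 := hk.symm_zero
      have hne : (ζ k).symm 0 ≠ f.symm z₀ := by rw [hs0]; exact (hqa k).symm
      obtain ⟨c₁, G, hG, hbG⟩ := AnalyticAt.exists_taylor_two
        (analyticAt_coeff_left hB hek hfa h0t hz₀ hne)
      obtain ⟨H, hH, hBH⟩ := hB.diag (ζ k) hek 0 h0t
      set β := fun m => B.coeff f (ζ m) z₀ 0 with hβ
      refine ⟨ζ k, hek, hk.mem_source, fun w => (1 / 2) * deriv (fun w => w * G w) w +
        deriv (fun z => B.coeff (ζ k) f w z / (2 * z)) z₀ + (1 / 2) * (H (w, 0) * β k +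
          ∑ m ∈ Finset.univ.erase k, B.coeff (ζ k) (ζ m) w 0 * β m), ?_, ?_,
        fun h => absurd (mem_insert_of_mem _ (mem_range_self k)) h⟩
      · rw [hk.map_center]
        refine ((analyticAt_const.mul (analyticAt_id.mul hG).deriv).add
          (analyticAt_deriv_coeff_div hB hek hfa h0t hz₀ hne hz0)).add (analyticAt_const.mul
          (((AnalyticAt.comp_left hH).mul analyticAt_const).add
          (Finset.analyticAt_fun_sum _ fun m hm => AnalyticAt.mul ?_ analyticAt_const)))
        refine analyticAt_coeff_left hB hek (hζ m).mem_maximalAtlas h0t (hζ m).zero_mem ?_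
        rw [hs0, (hζ m).symm_zero]
        exact fun h => (Finset.mem_erase.1 hm).1 (ha h).symm
      · rw [hk.map_center, eventually_nhdsWithin_iff]
        have hBH1 : ∀ᶠ w in 𝓝 (0 : ℂ), w ≠ 0 →
            B.coeff (ζ k) (ζ k) w 0 = 1 / w ^ 2 + H (w, 0) := by
          have := (continuous_id.prodMk (continuous_const (y := (0 : ℂ)))).continuousAt.eventually
            hBH
          simpa using this
        filter_upwards [hBH1, eventually_eventually_nhds.2 hbG, (ζ k).open_target.mem_nhds h0t,
          hG.eventually_analyticAt] with w e1 e2 e3 e4 hw0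
        have hw0 : w ≠ 0 := hw0
        have hd : ∀ᶠ w' in 𝓝 w, B.coeff (ζ k) f w' z₀ * (dx.coeff (ζ k) w')⁻¹ =
            (β k / 2) * w'⁻¹ + c₁ / 2 + (1 / 2) * (w' * G w') := by
          filter_upwards [e2, (ζ k).open_target.mem_nhds e3, continuousAt_id.eventually_ne hw0]
            with w' d1 d2 d3
          have d3 : w' ≠ 0 := d3
          rw [d1, hk.coeff_eq w' d2, hβ]
          simp only
          rw [hB.coeff_comm hne]
          field_simp
        have hd1 : HasDerivAt (fun w' => (β k / 2) * w'⁻¹ + c₁ / 2 + (1 / 2) * (w' * G w'))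
            ((β k / 2) * (-(w ^ 2)⁻¹) + (1 / 2) * deriv (fun w => w * G w) w) w := by
          have h1 : DifferentiableAt ℂ (fun w => w * G w) w :=
            differentiableAt_id.mul e4.differentiableAt
          exact (((hasDerivAt_inv hw0).const_mul _).add_const _).add (h1.hasDerivAt.const_mul _)
        unfold keyCoeff
        rw [EventuallyEq.deriv_eq hd, hd1.deriv,
          ← Finset.add_sum_erase Finset.univ _ (Finset.mem_univ k), e1 hw0]
        simp only [hβ]
        field_simp
        ring

end KeyForm

/-! ### Regularized normalized differentials -/

section Paths

variable {X : Type*} [TopologicalSpace X] [ChartedSpace ℂ X]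

/-- The contraction of `B` with the velocity of a path in the first variable, as a function of the
time and of the coordinate of the second point. -/
def pathCoeff (B : Bidifferential X) (γ : ℝ → X) (e : OpenPartialHomeomorph X ℂ) (t : ℝ) (z : ℂ) :
    ℂ :=
  B (γ t) (e.symm z) (velocity γ t) (coordVec e z)

variable {γ : ℝ → X} {e f : OpenPartialHomeomorph X ℂ} {B : Bidifferential X}

theorem contDiffAt_coord_comp (hγ : ContMDiff 𝓘(ℝ, ℝ) 𝓘(ℝ, ℂ) 1 γ)
    (he : e ∈ IsManifold.maximalAtlas 𝓘(ℂ, ℂ) ω X) {t : ℝ} (ht : γ t ∈ e.source) :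
    ContDiffAt ℝ 1 (e ∘ γ) t := by
  have h1 : ContMDiffAt 𝓘(ℂ, ℂ) 𝓘(ℂ, ℂ) ω e (γ t) :=
    (contMDiffOn_of_mem_maximalAtlas he).contMDiffAt (e.open_source.mem_nhds ht)
  exact contMDiffAt_iff_contDiffAt.1
    (((ContMDiffAt.complexToReal h1).of_le le_top).comp t hγ.contMDiffAt)

theorem continuousAt_deriv_coord_comp (hγ : ContMDiff 𝓘(ℝ, ℝ) 𝓘(ℝ, ℂ) 1 γ)
    (he : e ∈ IsManifold.maximalAtlas 𝓘(ℂ, ℂ) ω X) {t : ℝ} (ht : γ t ∈ e.source) :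
    ContinuousAt (deriv (e ∘ γ)) t := by
  have h := ((contDiffAt_coord_comp hγ he ht).fderiv_right (m := 0) (by norm_num)).continuousAt
  exact h.clm_apply continuousAt_const

theorem hasDerivAt_coord_comp (hγ : ContMDiff 𝓘(ℝ, ℝ) 𝓘(ℝ, ℂ) 1 γ)
    (he : e ∈ IsManifold.maximalAtlas 𝓘(ℂ, ℂ) ω X) {t : ℝ} (ht : γ t ∈ e.source) :
    HasDerivAt (e ∘ γ) (deriv (e ∘ γ) t) t :=
  ((contDiffAt_coord_comp hγ he ht).differentiableAt (by norm_num)).hasDerivAt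

theorem dirDeriv_velocity {t : ℝ} (hγ : MDifferentiableAt 𝓘(ℝ, ℝ) 𝓘(ℝ, ℂ) γ t)
    (he : e ∈ IsManifold.maximalAtlas 𝓘(ℂ, ℂ) ω X) (ht : γ t ∈ e.source) :
    dirDeriv e (γ t) (velocity γ t) = deriv (e ∘ γ) t :=
  (hasDerivAt_comp_path hγ (mdifferentiableAt_coord he ht)).deriv.symm

theorem pathCoeff_eq {t : ℝ} (hγ : MDifferentiableAt 𝓘(ℝ, ℝ) 𝓘(ℝ, ℂ) γ t)
    (he : e ∈ IsManifold.maximalAtlas 𝓘(ℂ, ℂ) ω X) (hf : f ∈ IsManifold.maximalAtlas 𝓘(ℂ, ℂ) ω X)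
    (ht : γ t ∈ f.source) {z : ℂ} (hz : z ∈ e.target) :
    pathCoeff B γ e t z = deriv (f ∘ γ) t * B.coeff f e (f (γ t)) z := by
  unfold pathCoeff
  rw [B.apply_eq hf he ht (e.map_target hz), dirDeriv_coordVec he hz, e.right_inv hz,
    dirDeriv_velocity hγ hf ht, one_mul]

/-- The function `χ / (e - κ)`, where `χ` is a bump function at the centre of the chart `e`,
extended by zero to the whole surface. -/
def cutoffPole (e : OpenPartialHomeomorph X ℂ) (χ : ContDiffBump (0 : ℂ)) (κ : ℂ) (p : X) : ℂ :=
  open Classical in if p ∈ e.source then (χ (e p) : ℂ) / (e p - κ) else 0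

variable {χ : ContDiffBump (0 : ℂ)}

theorem cutoffPole_of_mem {κ : ℂ} {p : X} (hp : p ∈ e.source) :
    cutoffPole e χ κ p = (χ (e p) : ℂ) / (e p - κ) := if_pos hp

theorem cutoffPole_symm {w : ℂ} (hw : w ∈ e.target) (hχ : ‖w‖ ≤ χ.rIn) :
    cutoffPole e χ 0 (e.symm w) = 1 / w := by
  rw [cutoffPole_of_mem (e.map_target hw), e.right_inv hw,
    χ.one_of_mem_closedBall (by simpa using hχ)]
  simp

/-- The cut-off pole vanishes near the complement of the chart domain. -/
theorem cutoffPole_eventually_eq_zero [T2Space X] (hχ : Metric.closedBall 0 χ.rOut ⊆ e.target)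
    {p : X} (hp : p ∉ e.source) : ∀ᶠ q in 𝓝 p, ∀ κ, cutoffPole e χ κ q = 0 := by
  have hK : IsCompact (e.symm '' Metric.closedBall 0 χ.rOut) :=
    (isCompact_closedBall _ _).image_of_continuousOn (e.continuousOn_symm.mono hχ)
  have hpK : p ∉ e.symm '' Metric.closedBall 0 χ.rOut := by
    rintro ⟨w, hw, rfl⟩
    exact hp (e.map_target (hχ hw))
  filter_upwards [hK.isClosed.isOpen_compl.mem_nhds hpK] with q hq κ
  unfold cutoffPole
  split_ifs with h
  · have : χ (e q) = 0 := by
      by_contra h0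
      refine hq ⟨e q, ?_, e.left_inv h⟩
      have : e q ∈ Function.support χ := h0
      rw [χ.support_eq] at this
      exact Metric.ball_subset_closedBall this
    simp [this]
  · rfl

/-- The derivative of the cut-off pole along a path. -/
def cutoffDeriv (γ : ℝ → X) (e : OpenPartialHomeomorph X ℂ) (χ : ContDiffBump (0 : ℂ)) (t : ℝ)
    (κ : ℂ) : ℂ :=
  open Classical in if γ t ∈ e.source then
    deriv (fun s => (χ (e (γ s)) : ℂ)) t / (e (γ t) - κ) -
      χ (e (γ t)) * deriv (e ∘ γ) t / (e (γ t) - κ) ^ 2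
  else 0

theorem contDiffAt_bump_comp (hγ : ContMDiff 𝓘(ℝ, ℝ) 𝓘(ℝ, ℂ) 1 γ)
    (he : e ∈ IsManifold.maximalAtlas 𝓘(ℂ, ℂ) ω X) {t : ℝ} (ht : γ t ∈ e.source) :
    ContDiffAt ℝ 1 (fun s => (χ (e (γ s)) : ℂ)) t := by
  have h1 : ContDiffAt ℝ 1 (fun w : ℂ => (χ w : ℂ)) (e (γ t)) :=
    Complex.ofRealCLM.contDiff.contDiffAt.comp _ χ.contDiffAt
  exact h1.comp t (contDiffAt_coord_comp hγ he ht)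

theorem hasDerivAt_cutoffPole [T2Space X] (hγ : ContMDiff 𝓘(ℝ, ℝ) 𝓘(ℝ, ℂ) 1 γ)
    (he : e ∈ IsManifold.maximalAtlas 𝓘(ℂ, ℂ) ω X) (hχ : Metric.closedBall 0 χ.rOut ⊆ e.target)
    {κ : ℂ} {t : ℝ} (ht : γ t ≠ e.symm κ) :
    HasDerivAt (cutoffPole e χ κ ∘ γ) (cutoffDeriv γ e χ t κ) t := by
  by_cases hs : γ t ∈ e.source
  · have hev : cutoffPole e χ κ ∘ γ =ᶠ[𝓝 t] fun s => (χ (e (γ s)) : ℂ) / (e (γ s) - κ) := by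
      filter_upwards [hγ.continuous.continuousAt.eventually (e.open_source.eventually_mem hs)]
        with s h
      exact cutoffPole_of_mem h
    have hne : e (γ t) - κ ≠ 0 := by
      intro h
      apply ht
      rw [← sub_eq_zero.1 h, e.left_inv hs]
    have h1 : HasDerivAt (fun s => (χ (e (γ s)) : ℂ)) (deriv (fun s => (χ (e (γ s)) : ℂ)) t) t :=
      ((contDiffAt_bump_comp hγ he hs).differentiableAt (by norm_num)).hasDerivAt
    have h2 : HasDerivAt (fun s => e (γ s) - κ) (deriv (e ∘ γ) t) t :=
      (hasDerivAt_coord_comp hγ he hs).sub_const κ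
    refine ((h1.fun_div h2 hne).congr_of_eventuallyEq hev).congr_deriv ?_
    rw [cutoffDeriv, if_pos hs]
    field_simp
  · rw [cutoffDeriv, if_neg hs]
    refine (hasDerivAt_const t (0 : ℂ)).congr_of_eventuallyEq ?_
    filter_upwards [hγ.continuous.continuousAt.eventually (cutoffPole_eventually_eq_zero hχ hs)]
      with s h using h κ

theorem continuousAt_cutoffDeriv [T2Space X] (hγ : ContMDiff 𝓘(ℝ, ℝ) 𝓘(ℝ, ℂ) 1 γ)
    (he : e ∈ IsManifold.maximalAtlas 𝓘(ℂ, ℂ) ω X) (hχ : Metric.closedBall 0 χ.rOut ⊆ e.target)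
    {κ : ℂ} {t : ℝ} (ht : γ t ≠ e.symm κ) :
    ContinuousAt (fun y : ℝ × ℂ => cutoffDeriv γ e χ y.1 y.2) (t, κ) := by
  have hfst : Tendsto (Prod.fst : ℝ × ℂ → ℝ) (𝓝 (t, κ)) (𝓝 t) := continuousAt_fst
  have hγc := hγ.continuous.continuousAt (x := t)
  by_cases hs : γ t ∈ e.source
  · have hne : e (γ t) - κ ≠ 0 := by
      intro h
      apply ht
      rw [← sub_eq_zero.1 h, e.left_inv hs]
    have hev : (fun y : ℝ × ℂ => cutoffDeriv γ e χ y.1 y.2) =ᶠ[𝓝 (t, κ)] fun y =>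
        deriv (fun s => (χ (e (γ s)) : ℂ)) y.1 / (e (γ y.1) - y.2) -
          χ (e (γ y.1)) * deriv (e ∘ γ) y.1 / (e (γ y.1) - y.2) ^ 2 := by
      filter_upwards [hfst.eventually (hγc.eventually (e.open_source.eventually_mem hs))] with y hy
      exact if_pos hy
    refine ContinuousAt.congr ?_ hev.symm
    have h0 := contDiffAt_bump_comp (χ := χ) hγ he hs
    have h1 : ContinuousAt (deriv fun s => (χ (e (γ s)) : ℂ)) t :=
      (h0.fderiv_right (m := 0) (by norm_num)).continuousAt.clm_apply continuousAt_const
    have c1 := ContinuousAt.comp (f := Prod.fst) (x := (t, κ)) h1 hfst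
    have c2 := ContinuousAt.comp (f := Prod.fst) (x := (t, κ)) h0.continuousAt hfst
    have c3 := ContinuousAt.comp (f := Prod.fst) (x := (t, κ))
      (continuousAt_deriv_coord_comp hγ he hs) hfst
    have c4 := ContinuousAt.comp (f := Prod.fst) (x := (t, κ))
      (contDiffAt_coord_comp hγ he hs).continuousAt hfst
    have c5 : ContinuousAt (fun y : ℝ × ℂ => e (γ y.1) - y.2) (t, κ) := c4.sub continuousAt_snd
    exact (c1.div c5 hne).sub ((c2.mul c3).div (c5.pow 2) (pow_ne_zero 2 hne))
  · refine (continuousAt_const (y := (0 : ℂ))).congr ?_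
    have hK := cutoffPole_eventually_eq_zero hχ hs
    filter_upwards [hfst.eventually (hγc.eventually hK).eventually_nhds] with y hy
    unfold cutoffDeriv
    split_ifs with h
    · have h1 : ∀ᶠ s in 𝓝 y.1, (χ (e (γ s)) : ℂ) = 0 := by
        filter_upwards [hy, hγ.continuous.continuousAt.eventually (e.open_source.eventually_mem h)]
          with s hs1 hs2
        have := hs1 (e (γ s) - 1)
        rw [cutoffPole_of_mem hs2] at this
        simpa using this
      have h2 : deriv (fun s => (χ (e (γ s)) : ℂ)) y.1 = 0 := by
        rw [Filter.EventuallyEq.deriv_eq (f := fun _ => (0 : ℂ)) h1, deriv_const]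
      rw [h2, h1.self_of_nhds]
      simp
    · rfl

theorem continuousAt_pathCoeff (hB : B.IsBergmanKernel) [IsManifold 𝓘(ℂ, ℂ) ω X]
    (hγ : ContMDiff 𝓘(ℝ, ℝ) 𝓘(ℝ, ℂ) 1 γ)
    (he : e ∈ IsManifold.maximalAtlas 𝓘(ℂ, ℂ) ω X) {κ : ℂ} (hκ : κ ∈ e.target) {t : ℝ}
    (ht : γ t ≠ e.symm κ) :
    ContinuousAt (fun y : ℝ × ℂ => pathCoeff B γ e y.1 y.2) (t, κ) := by
  have hf := IsManifold.chart_mem_maximalAtlas (I := 𝓘(ℂ, ℂ)) (n := ω) (γ t)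
  have hs := mem_chart_source ℂ (γ t)
  generalize chartAt ℂ (γ t) = f at hf hs
  have hfst : Tendsto (Prod.fst : ℝ × ℂ → ℝ) (𝓝 (t, κ)) (𝓝 t) := continuousAt_fst
  have hsnd : Tendsto (Prod.snd : ℝ × ℂ → ℂ) (𝓝 (t, κ)) (𝓝 κ) := continuousAt_snd
  have hγc := hγ.continuous.continuousAt (x := t)
  have hev : (fun y : ℝ × ℂ => pathCoeff B γ e y.1 y.2) =ᶠ[𝓝 (t, κ)] fun y =>
      deriv (f ∘ γ) y.1 * B.coeff f e (f (γ y.1)) y.2 := by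
    filter_upwards [hfst.eventually (hγc.eventually (f.open_source.eventually_mem hs)),
      hsnd.eventually (e.open_target.eventually_mem hκ)] with y h1 h2
    exact pathCoeff_eq (hγ.mdifferentiable one_ne_zero _) he hf h1 h2
  refine ContinuousAt.congr ?_ hev.symm
  have c1 := ContinuousAt.comp (f := Prod.fst) (x := (t, κ))
    (continuousAt_deriv_coord_comp hγ hf hs) hfst
  have c2 : ContinuousAt (fun y : ℝ × ℂ => (f (γ y.1), y.2)) (t, κ) :=
    (ContinuousAt.comp (f := Prod.fst) (x := (t, κ))
      (contDiffAt_coord_comp hγ hf hs).continuousAt hfst).prodMk continuousAt_snd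
  have c3 := (hB.holo f hf e he (f (γ t)) (f.map_source hs) κ hκ
    (by rwa [f.left_inv hs])).continuousAt
  have c4 : ContinuousAt (fun y : ℝ × ℂ => B.coeff f e (f (γ y.1)) y.2) (t, κ) :=
    ContinuousAt.comp (f := fun y : ℝ × ℂ => (f (γ y.1), y.2)) (x := (t, κ)) c3 c2
  exact c1.mul c4

/-- Regularization of the period of a second kind differential along a closed path `γ` that may pass
through its pole, the centre of the coordinate `e`. Subtracting the differential of a cut-off pole
`s` from `B(·, e⁻¹(0))` leaves a continuous integrand `Θ` along `γ`. Its integral is a limit of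
normalized periods of `B(·, e⁻¹(κ))` with `e⁻¹(κ)` off the path, so it vanishes. -/
theorem exists_regularization [T2Space X] [IsManifold 𝓘(ℂ, ℂ) ω X] (hB : B.IsBergmanKernel)
    (hγ : ContMDiff 𝓘(ℝ, ℝ) 𝓘(ℝ, ℂ) 1 γ) (hclosed : γ 0 = γ 1)
    (hper : ∀ p, p ∉ γ '' Icc 0 1 → ∀ v : TangentSpace 𝓘(ℂ, ℂ) p,
      ∫ t in (0 : ℝ)..1, B p (γ t) v (velocity γ t) = 0)
    (he : e ∈ IsManifold.maximalAtlas 𝓘(ℂ, ℂ) ω X) (h0 : (0 : ℂ) ∈ e.target)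
    (hdense : ∃ᶠ κ in 𝓝 (0 : ℂ), e.symm κ ∉ γ '' Icc 0 1) :
    ∃ (s : X → ℂ) (Θ : ℝ → ℂ) (ε : ℝ) (H : ℂ → ℂ), 0 < ε ∧ AnalyticAt ℂ H 0 ∧ Continuous Θ ∧
      ∫ t in (0 : ℝ)..1, Θ t = 0 ∧
      (∀ w : ℂ, ‖w‖ < ε → w ∈ e.target ∧
        (w ≠ 0 → s (e.symm w) = 1 / w ∧ B.coeff e e w 0 = 1 / w ^ 2 + H w)) ∧
      (∀ t, γ t ≠ e.symm 0 → HasDerivAt (s ∘ γ) (Θ t - pathCoeff B γ e t 0) t) ∧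
      ∀ t, γ t ∈ e.source → ‖e (γ t)‖ < ε → Θ t = deriv (e ∘ γ) t * H (e (γ t)) := by
  obtain ⟨h, hh, hev⟩ := hB.diag e he 0 h0
  have htar : ∀ᶠ y in 𝓝 ((0 : ℂ), (0 : ℂ)), y.1 ∈ e.target :=
    continuousAt_fst.eventually (e.open_target.eventually_mem h0)
  obtain ⟨ρ, hρ, hball⟩ := Metric.eventually_nhds_iff_ball.1
    ((hev.and hh.eventually_analyticAt).and htar)
  have hmem : ∀ {w z : ℂ}, ‖w‖ < ρ → ‖z‖ < ρ → (w, z) ∈ Metric.ball ((0 : ℂ), (0 : ℂ)) ρ := by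
    intro w z hw hz
    rw [← ball_prod_same]
    exact ⟨by simpa using hw, by simpa using hz⟩
  let χ : ContDiffBump (0 : ℂ) := ⟨ρ / 3, ρ / 2, by positivity, by linarith⟩
  have hχin : χ.rIn = ρ / 3 := rfl
  have hχ : Metric.closedBall 0 χ.rOut ⊆ e.target := by
    intro w hw
    have hw' : ‖w‖ ≤ ρ / 2 := by simpa using hw
    exact (hball _ (hmem (w := w) (z := w) (by linarith) (by linarith))).2
  have htarget : ∀ {w : ℂ}, ‖w‖ < ρ → w ∈ e.target := fun hw =>
    (hball _ (hmem hw hw)).2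
  let Θ : ℝ → ℂ → ℂ := fun t κ => open Classical in
    if γ t = e.symm κ then deriv (e ∘ γ) t * h (e (γ t), κ)
    else pathCoeff B γ e t κ + cutoffDeriv γ e χ t κ
  have hmd : ∀ t, MDifferentiableAt 𝓘(ℝ, ℝ) 𝓘(ℝ, ℂ) γ t := fun t => hγ.mdifferentiable one_ne_zero t
  -- near the pole the singular parts of the two summands cancel
  have hnear : ∀ t κ, γ t ∈ e.source → ‖e (γ t)‖ < ρ / 3 → ‖κ‖ < ρ / 3 →
      Θ t κ = deriv (e ∘ γ) t * h (e (γ t), κ) := by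
    intro t κ hs hu hκ
    by_cases heq : γ t = e.symm κ
    · exact if_pos heq
    have hne : e (γ t) ≠ κ := fun h' => heq (by rw [← h', e.left_inv hs])
    have hκt : κ ∈ e.target := htarget (by linarith)
    have hχ1 : (fun s => (χ (e (γ s)) : ℂ)) =ᶠ[𝓝 t] fun _ => 1 := by
      have hc := (contDiffAt_coord_comp hγ he hs).continuousAt
      have : ∀ᶠ w in 𝓝 (e (γ t)), ‖w‖ < ρ / 3 := (continuous_norm.tendsto _).eventually_lt_const hu
      filter_upwards [hc.eventually this] with s hs'
      rw [χ.one_of_mem_closedBall (by simpa [hχin] using hs'.le)]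
      simp
    refine (if_neg heq).trans ?_
    rw [cutoffDeriv, if_pos hs, hχ1.deriv_eq, deriv_const,
      show (χ (e (γ t)) : ℂ) = 1 from hχ1.self_of_nhds,
      pathCoeff_eq (hmd t) he he hs hκt,
      (hball (e (γ t), κ) (hmem (by linarith) (by linarith))).1.1 hne]
    ring
  have hcont : ∀ t κ, ‖κ‖ < ρ / 3 → ContinuousAt (fun y : ℝ × ℂ => Θ y.1 y.2) (t, κ) := by
    intro t κ hκ
    have hκt : κ ∈ e.target := htarget (by linarith)
    have hfst : Tendsto (Prod.fst : ℝ × ℂ → ℝ) (𝓝 (t, κ)) (𝓝 t) := continuousAt_fst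
    have hsnd : Tendsto (Prod.snd : ℝ × ℂ → ℂ) (𝓝 (t, κ)) (𝓝 κ) := continuousAt_snd
    have hγc := hγ.continuous.continuousAt (x := t)
    by_cases heq : γ t = e.symm κ
    · have hs : γ t ∈ e.source := heq ▸ e.map_target hκt
      have hu : e (γ t) = κ := by rw [heq, e.right_inv hκt]
      have hc := (contDiffAt_coord_comp hγ he hs).continuousAt
      have hlt : ∀ {w : ℂ}, ‖w‖ < ρ / 3 → ∀ᶠ w' in 𝓝 w, ‖w'‖ < ρ / 3 := fun hw =>
        (continuous_norm.tendsto _).eventually_lt_const hw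
      have hev : (fun y : ℝ × ℂ => Θ y.1 y.2) =ᶠ[𝓝 (t, κ)] fun y =>
          deriv (e ∘ γ) y.1 * h (e (γ y.1), y.2) := by
        filter_upwards [hfst.eventually (hγc.eventually (e.open_source.eventually_mem hs)),
          hfst.eventually (hc.eventually (hlt (show ‖(e ∘ γ) t‖ < ρ / 3 by rw [Function.comp_apply, hu]; exact hκ))),
          hsnd.eventually (hlt hκ)] with y h1 h2 h3
        exact hnear _ _ h1 h2 h3
      refine ContinuousAt.congr ?_ hev.symm
      have c1 := ContinuousAt.comp (f := Prod.fst) (x := (t, κ))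
        (continuousAt_deriv_coord_comp hγ he hs) hfst
      have c2 : ContinuousAt (fun y : ℝ × ℂ => (e (γ y.1), y.2)) (t, κ) :=
        (ContinuousAt.comp (f := Prod.fst) (x := (t, κ)) hc hfst).prodMk continuousAt_snd
      have c3 := (hball (e (γ t), κ) (hmem (by rw [hu]; linarith) (by linarith))).1.2.continuousAt
      exact c1.mul (ContinuousAt.comp (f := fun y : ℝ × ℂ => (e (γ y.1), y.2)) (x := (t, κ)) c3 c2)
    · have hne : ∀ᶠ y : ℝ × ℂ in 𝓝 (t, κ), γ y.1 ≠ e.symm y.2 :=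
        ((hγc.tendsto.comp hfst).prodMk_nhds
          ((e.continuousAt_symm hκt).tendsto.comp hsnd)).eventually
          (isClosed_diagonal.isOpen_compl.mem_nhds heq)
      refine ContinuousAt.congr ?_ (f := fun y : ℝ × ℂ => pathCoeff B γ e y.1 y.2 +
        cutoffDeriv γ e χ y.1 y.2) ?_
      · exact (continuousAt_pathCoeff hB hγ he hκt heq).add (continuousAt_cutoffDeriv hγ he hχ heq)
      · filter_upwards [hne] with y hy using (if_neg hy).symm
  have hcontκ : ∀ κ, ‖κ‖ < ρ / 3 → Continuous fun t => Θ t κ := fun κ hκ =>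
    continuous_iff_continuousAt.2 fun t =>
      ContinuousAt.comp (f := fun t => (t, κ)) (g := fun y : ℝ × ℂ => Θ y.1 y.2) (hcont t κ hκ)
        (by fun_prop)
  -- the integral vanishes when the pole is off the path
  have hoff : ∀ κ, ‖κ‖ < ρ / 3 → e.symm κ ∉ γ '' Icc 0 1 → ∫ t in (0 : ℝ)..1, Θ t κ = 0 := by
    intro κ hκ hoff
    have hκt : κ ∈ e.target := htarget (by linarith)
    have hne : ∀ t ∈ uIcc (0 : ℝ) 1, γ t ≠ e.symm κ := by
      intro t ht h'
      exact hoff ⟨t, by simpa using ht, h'⟩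
    have hΘ : ∀ t ∈ uIcc (0 : ℝ) 1, Θ t κ = pathCoeff B γ e t κ + cutoffDeriv γ e χ t κ :=
      fun t ht => if_neg (hne t ht)
    have i1 : ContinuousOn (fun t => pathCoeff B γ e t κ) (uIcc 0 1) := fun t ht =>
      (ContinuousAt.comp (f := fun t => (t, κ)) (continuousAt_pathCoeff hB hγ he hκt (hne t ht))
        (by fun_prop)).continuousWithinAt
    have i2 : ContinuousOn (fun t => cutoffDeriv γ e χ t κ) (uIcc 0 1) := fun t ht =>
      (ContinuousAt.comp (f := fun t => (t, κ)) (continuousAt_cutoffDeriv hγ he hχ (hne t ht))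
        (by fun_prop)).continuousWithinAt
    rw [intervalIntegral.integral_congr hΘ, intervalIntegral.integral_add i1.intervalIntegrable
      i2.intervalIntegrable, intervalIntegral.integral_eq_sub_of_hasDerivAt
        (fun t ht => hasDerivAt_cutoffPole hγ he hχ (hne t ht)) i2.intervalIntegrable,
      Function.comp_apply, Function.comp_apply, hclosed, sub_self, add_zero,
      ← hper _ hoff (coordVec e κ)]
    refine intervalIntegral.integral_congr fun t ht => ?_
    exact hB.symm _ _ _ _ (hne t ht)
  have hint : ∫ t in (0 : ℝ)..1, Θ t 0 = 0 := by
    have hF : Continuous fun κ : Metric.ball (0 : ℂ) (ρ / 3) => ∫ t in (0 : ℝ)..1, Θ t κ := by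
      refine intervalIntegral.continuous_parametric_intervalIntegral_of_continuous'
        (f := fun κ : Metric.ball (0 : ℂ) (ρ / 3) => fun t => Θ t κ) ?_ 0 1
      refine continuous_iff_continuousAt.2 fun y => ?_
      exact ContinuousAt.comp (f := fun y : Metric.ball (0 : ℂ) (ρ / 3) × ℝ => (y.2, (y.1 : ℂ)))
        (g := fun y : ℝ × ℂ => Θ y.1 y.2) (hcont y.2 y.1 (mem_ball_zero_iff.1 y.1.2)) (by fun_prop)
    have hF' : ContinuousOn (fun κ : ℂ => ∫ t in (0 : ℝ)..1, Θ t κ) (Metric.ball 0 (ρ / 3)) :=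
      continuousOn_iff_continuous_domRestrict.2 hF
    have hF0 := (hF'.continuousAt (Metric.ball_mem_nhds 0 (by positivity))).tendsto
    by_contra hne
    have h1 := hF0.eventually_ne hne
    obtain ⟨κ, hκ, h2, h3⟩ := (hdense.and_eventually
      (h1.and (Metric.ball_mem_nhds 0 (show 0 < ρ / 3 by positivity)))).exists
    exact h2 (hoff κ (by simpa using h3) hκ)
  refine ⟨cutoffPole e χ 0, fun t => Θ t 0, ρ / 3, fun w => h (w, 0), by positivity,
    AnalyticAt.comp_left hh, hcontκ 0 (by simpa using hρ), hint, ?_, ?_, ?_⟩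
  · intro w hw
    refine ⟨htarget (by linarith), fun hw0 => ⟨?_, ?_⟩⟩
    · exact cutoffPole_symm (htarget (by linarith)) hw.le
    · have := (hball (w, 0) (hmem (by linarith) (by simpa using hρ))).1.1 hw0
      simpa using this
  · intro t ht
    refine (hasDerivAt_cutoffPole hγ he hχ ht).congr_deriv ?_
    simp only [Θ, if_neg ht]
    ring
  · intro t hs hu
    exact hnear t 0 hs hu (by simpa using hρ)

end Paths

/-! ### Periods of the key form -/

section Periods

variable {X : Type*} [TopologicalSpace X] [ChartedSpace ℂ X]

theorem dirDeriv_one_ne_zero {e : OpenPartialHomeomorph X ℂ}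
    (he : e ∈ IsManifold.maximalAtlas 𝓘(ℂ, ℂ) ω X) {p : X} (hp : p ∈ e.source) :
    dirDeriv e p (show TangentSpace 𝓘(ℂ, ℂ) p from (1 : ℂ)) ≠ 0 := by
  intro h
  obtain ⟨w, hw, rfl⟩ : ∃ w ∈ e.target, e.symm w = p := ⟨e p, e.map_source hp, e.left_inv hp⟩
  have h1 := eq_smul_coordVec he hw (show TangentSpace 𝓘(ℂ, ℂ) (e.symm w) from (1 : ℂ))
  rw [h, zero_smul] at h1
  exact one_ne_zero (α := ℂ) h1

/-- The function `B(·, q) / dx`, where `q` has the coordinate `z` and `B` is contracted with the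
coordinate vector there. -/
def bergmanRatio (dx : OneForm X) (B : Bidifferential X) (f : OpenPartialHomeomorph X ℂ) (z : ℂ)
    (p : X) : ℂ :=
  B p (f.symm z) (show TangentSpace 𝓘(ℂ, ℂ) p from (1 : ℂ)) (coordVec f z) *
    (dx p (show TangentSpace 𝓘(ℂ, ℂ) p from (1 : ℂ)))⁻¹

theorem bergmanRatio_eq {dx : OneForm X} {B : Bidifferential X} {e f : OpenPartialHomeomorph X ℂ}
    (he : e ∈ IsManifold.maximalAtlas 𝓘(ℂ, ℂ) ω X) (hf : f ∈ IsManifold.maximalAtlas 𝓘(ℂ, ℂ) ω X)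
    {z : ℂ} (hz : z ∈ f.target) {p : X} (hp : p ∈ e.source) :
    bergmanRatio dx B f z p = B.coeff e f (e p) z * (dx.coeff e (e p))⁻¹ := by
  have h := dirDeriv_one_ne_zero he hp
  rw [bergmanRatio, B.apply_eq he hf hp (f.map_target hz), dx.apply_eq he hp,
    dirDeriv_coordVec hf hz, f.right_inv hz, one_mul, mul_inv]
  field_simp

variable [IsManifold 𝓘(ℂ, ℂ) ω X] {dx : OneForm X} {b : ℕ} {a : Fin b → X}
  {ζ : Fin b → OpenPartialHomeomorph X ℂ} {B : Bidifferential X} {γ : ℝ → X}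
  {e f : OpenPartialHomeomorph X ℂ}

theorem continuous_form_velocity {η : OneForm X} (hη : ∀ p, η.HolomorphicAt p)
    (hγ : ContMDiff 𝓘(ℝ, ℝ) 𝓘(ℝ, ℂ) 1 γ) : Continuous fun t => η (γ t) (velocity γ t) := by
  refine continuous_iff_continuousAt.2 fun t => ?_
  have hf := IsManifold.chart_mem_maximalAtlas (I := 𝓘(ℂ, ℂ)) (n := ω) (γ t)
  have hs := mem_chart_source ℂ (γ t)
  generalize chartAt ℂ (γ t) = f at hf hs
  have hev : (fun t => η (γ t) (velocity γ t)) =ᶠ[𝓝 t] fun s =>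
      deriv (f ∘ γ) s * η.coeff f ((f ∘ γ) s) := by
    filter_upwards [hγ.continuous.continuousAt.eventually (f.open_source.eventually_mem hs)]
      with s h
    rw [η.apply_eq hf h, dirDeriv_velocity (hγ.mdifferentiable one_ne_zero _) hf h]
    rfl
  refine ContinuousAt.congr ?_ hev.symm
  exact (continuousAt_deriv_coord_comp hγ hf hs).mul (ContinuousAt.comp (f := f ∘ γ)
    ((hη _).coeff hf hs).continuousAt (contDiffAt_coord_comp hγ hf hs).continuousAt)

/-- Near a point of the path, `B / (2 z)` contracted with the velocity is analytic in `z`, with a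
derivative that is jointly continuous. -/
theorem pathCoeff_div_regular (hB : B.IsBergmanKernel) (hγ : ContMDiff 𝓘(ℝ, ℝ) 𝓘(ℝ, ℂ) 1 γ)
    (hf : f ∈ IsManifold.maximalAtlas 𝓘(ℂ, ℂ) ω X) {z : ℂ} (hz : z ∈ f.target) (hz0 : z ≠ 0)
    {t : ℝ} (ht : γ t ≠ f.symm z) :
    DifferentiableAt ℂ (fun z => pathCoeff B γ f t z / (2 * z)) z ∧
      ContinuousAt (fun y : ℝ × ℂ => deriv (fun z => pathCoeff B γ f y.1 z / (2 * z)) y.2)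
        (t, z) ∧
      ∀ e ∈ IsManifold.maximalAtlas 𝓘(ℂ, ℂ) ω X, γ t ∈ e.source →
        deriv (fun z => pathCoeff B γ f t z / (2 * z)) z =
          deriv (e ∘ γ) t * deriv (fun z => B.coeff e f (e (γ t)) z / (2 * z)) z := by
  have hfst : Tendsto (Prod.fst : ℝ × ℂ → ℝ) (𝓝 (t, z)) (𝓝 t) := continuousAt_fst
  have hsnd : Tendsto (Prod.snd : ℝ × ℂ → ℂ) (𝓝 (t, z)) (𝓝 z) := continuousAt_snd
  have hγc := hγ.continuous.continuousAt (x := t)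
  have key : ∀ e ∈ IsManifold.maximalAtlas 𝓘(ℂ, ℂ) ω X, ∀ s, γ s ∈ e.source → ∀ y ∈ f.target,
      (fun z => pathCoeff B γ f s z / (2 * z)) =ᶠ[𝓝 y] fun z =>
        deriv (e ∘ γ) s * (B.coeff e f (e (γ s)) z / (2 * z)) := by
    intro e he s hs y hy
    filter_upwards [f.open_target.eventually_mem hy] with z' hz'
    rw [pathCoeff_eq (hγ.mdifferentiable one_ne_zero _) hf he hs hz', mul_div_assoc]
  have han : ∀ e ∈ IsManifold.maximalAtlas 𝓘(ℂ, ℂ) ω X, γ t ∈ e.source →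
      AnalyticAt ℂ (fun y : ℂ × ℂ => B.coeff e f y.1 y.2 / (2 * y.2)) (e (γ t), z) := by
    intro e he hs
    exact (hB.holo e he f hf _ (e.map_source hs) z hz (by rwa [e.left_inv hs])).div
      (analyticAt_const.mul analyticAt_snd) (by simpa using hz0)
  have he := IsManifold.chart_mem_maximalAtlas (I := 𝓘(ℂ, ℂ)) (n := ω) (γ t)
  have hs := mem_chart_source ℂ (γ t)
  generalize chartAt ℂ (γ t) = e at he hs
  have hd := fun (e : OpenPartialHomeomorph X ℂ) (he : e ∈ IsManifold.maximalAtlas 𝓘(ℂ, ℂ) ω X)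
    (hs : γ t ∈ e.source) => (AnalyticAt.comp_right (han e he hs)).differentiableAt
  refine ⟨?_, ?_, ?_⟩
  · exact ((hd e he hs).const_mul _).congr_of_eventuallyEq (key e he t hs z hz)
  · have hev : (fun y : ℝ × ℂ => deriv (fun z => pathCoeff B γ f y.1 z / (2 * z)) y.2)
        =ᶠ[𝓝 (t, z)] fun y =>
        deriv (e ∘ γ) y.1 * deriv (fun z => B.coeff e f (e (γ y.1)) z / (2 * z)) y.2 := by
      filter_upwards [hfst.eventually (hγc.eventually (e.open_source.eventually_mem hs)),
        hsnd.eventually (f.open_target.eventually_mem hz)] with y h1 h2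
      rw [(key e he y.1 h1 y.2 h2).deriv_eq, deriv_const_mul_field]
    refine ContinuousAt.congr ?_ hev.symm
    have c1 := ContinuousAt.comp (f := Prod.fst) (x := (t, z))
      (continuousAt_deriv_coord_comp hγ he hs) hfst
    have c2 : ContinuousAt (fun y : ℝ × ℂ => (e (γ y.1), y.2)) (t, z) :=
      (ContinuousAt.comp (f := Prod.fst) (x := (t, z))
        (contDiffAt_coord_comp hγ he hs).continuousAt hfst).prodMk continuousAt_snd
    have c3 := (AnalyticAt.deriv_snd (han e he hs)).continuousAt
    exact c1.mul (ContinuousAt.comp (f := fun y : ℝ × ℂ => (e (γ y.1), y.2)) (x := (t, z)) c3 c2)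
  · intro e he hs
    rw [(key e he t hs z hz).deriv_eq, deriv_const_mul_field]

/-- The periods of `∂_z (B / (2 z))` vanish, by differentiation under the integral sign. -/
theorem integral_deriv_pathCoeff_div (hB : B.IsBergmanKernel) (hγ : ContMDiff 𝓘(ℝ, ℝ) 𝓘(ℝ, ℂ) 1 γ)
    [T2Space X]
    (hper : ∀ p, p ∉ γ '' Icc 0 1 → ∀ v : TangentSpace 𝓘(ℂ, ℂ) p,
      ∫ t in (0 : ℝ)..1, B p (γ t) v (velocity γ t) = 0)
    (hf : f ∈ IsManifold.maximalAtlas 𝓘(ℂ, ℂ) ω X) {z : ℂ} (hz : z ∈ f.target) (hz0 : z ≠ 0)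
    (hoff : f.symm z ∉ γ '' Icc 0 1) :
    ContinuousOn (fun t => deriv (fun z => pathCoeff B γ f t z / (2 * z)) z) (Icc 0 1) ∧
    ∫ t in (0 : ℝ)..1, deriv (fun z => pathCoeff B γ f t z / (2 * z)) z = 0 := by
  have hK : IsClosed (γ '' Icc 0 1) := (isCompact_Icc.image hγ.continuous).isClosed
  have hev : ∀ᶠ y in 𝓝 z, y ∈ f.target ∧ y ≠ 0 ∧ f.symm y ∉ γ '' Icc 0 1 :=
    (f.open_target.eventually_mem hz).and ((isOpen_ne.eventually_mem hz0).and
      ((f.continuousAt_symm hz).eventually (hK.isOpen_compl.eventually_mem hoff)))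
  obtain ⟨δ, hδ, hball⟩ := Metric.eventually_nhds_iff_ball.1 hev
  have hne : ∀ y ∈ Metric.ball z δ, ∀ t ∈ Icc (0 : ℝ) 1, γ t ≠ f.symm y := fun y hy t ht h =>
    (hball y hy).2.2 ⟨t, ht, h⟩
  have hcont : ∀ t ∈ Icc (0 : ℝ) 1, ∀ y ∈ Metric.ball z δ, ContinuousAt
      (fun y : ℝ × ℂ => deriv (fun z => pathCoeff B γ f y.1 z / (2 * z)) y.2) (t, y) :=
    fun t ht y hy => (pathCoeff_div_regular hB hγ hf (hball y hy).1 (hball y hy).2.1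
      (hne y hy t ht)).2.1
  have hz' : z ∈ Metric.ball z δ := Metric.mem_ball_self hδ
  have hc1 : ContinuousOn (fun t => deriv (fun z => pathCoeff B γ f t z / (2 * z)) z) (Icc 0 1) :=
    fun t ht => (ContinuousAt.comp (f := fun t : ℝ => (t, z)) (hcont t ht z hz')
      (by fun_prop)).continuousWithinAt
  refine ⟨hc1, ?_⟩
  have hsub : Metric.closedBall z (δ / 2) ⊆ Metric.ball z δ :=
    Metric.closedBall_subset_ball (by linarith)
  obtain ⟨M, hM⟩ := (isCompact_Icc.prod (isCompact_closedBall z (δ / 2))).exists_bound_of_continuousOn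
    (f := fun y : ℝ × ℂ => deriv (fun z => pathCoeff B γ f y.1 z / (2 * z)) y.2)
    (s := Icc (0 : ℝ) 1 ×ˢ Metric.closedBall z (δ / 2))
    fun y hy => (hcont y.1 hy.1 y.2 (hsub hy.2)).continuousWithinAt
  have hpc : ∀ y ∈ Metric.ball z δ, ContinuousOn (fun t => pathCoeff B γ f t y / (2 * y))
      (Icc 0 1) := fun y hy t ht => (ContinuousAt.div_const (ContinuousAt.comp
        (f := fun t : ℝ => (t, y)) (continuousAt_pathCoeff hB hγ hf (hball y hy).1 (hne y hy t ht))
        (by fun_prop)) _).continuousWithinAt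
  have huIoc : uIoc (0 : ℝ) 1 = Ioc 0 1 := uIoc_of_le zero_le_one
  have huIcc : uIcc (0 : ℝ) 1 = Icc 0 1 := uIcc_of_le zero_le_one
  have hmeas : ∀ g : ℝ → ℂ, ContinuousOn g (Icc 0 1) →
      AEStronglyMeasurable g (volume.restrict (uIoc 0 1)) := fun g hg => by
    rw [huIoc]
    exact (hg.mono Ioc_subset_Icc_self).aestronglyMeasurable measurableSet_Ioc
  have hD := intervalIntegral.hasDerivAt_integral_of_dominated_loc_of_deriv_le (μ := volume)
    (F := fun y t => pathCoeff B γ f t y / (2 * y)) (x₀ := z) (a := 0) (b := 1)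
    (F' := fun y t => deriv (fun z => pathCoeff B γ f t z / (2 * z)) y) (bound := fun _ => M)
    (s := Metric.ball z (δ / 2)) (Metric.ball_mem_nhds z (by positivity))
    (by
      filter_upwards [Metric.ball_mem_nhds z hδ] with y hy using hmeas _ (hpc y hy))
    (ContinuousOn.intervalIntegrable (by rw [huIcc]; exact hpc z hz'))
    (hmeas _ hc1)
    (Eventually.of_forall fun t ht y hy => by
      rw [huIoc] at ht
      exact hM (t, y) ⟨Ioc_subset_Icc_self ht, Metric.ball_subset_closedBall hy⟩)
    (by simp)
    (Eventually.of_forall fun t ht y hy => by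
      rw [huIoc] at ht
      have hy' := hsub (Metric.ball_subset_closedBall hy)
      exact (pathCoeff_div_regular hB hγ hf (hball y hy').1 (hball y hy').2.1
        (hne y hy' t (Ioc_subset_Icc_self ht))).1.hasDerivAt)
  have hzero : (fun y => ∫ t in (0 : ℝ)..1, pathCoeff B γ f t y / (2 * y)) =ᶠ[𝓝 z] fun _ => 0 := by
    filter_upwards [Metric.ball_mem_nhds z hδ] with y hy
    rw [intervalIntegral.integral_div]
    have h1 := hper _ (hball y hy).2.2 (coordVec f y)
    have h2 : (∫ t in (0 : ℝ)..1, pathCoeff B γ f t y) = 0 := by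
      rw [← h1]
      refine intervalIntegral.integral_congr fun t ht => ?_
      rw [huIcc] at ht
      exact hB.symm _ _ _ _ (hne y hy t ht)
    rw [h2, zero_div]
  have h1 := hD.2.unique ((hasDerivAt_const z (0 : ℂ)).congr_of_eventuallyEq hzero)
  exact h1

/-- A holomorphic form with the coefficients `keyCoeff` has vanishing integral along a normalized
closed path: it differs from exact and normalized terms by regularized second kind differentials. -/
theorem integral_keyForm_eq_zero [T2Space X] (ha : Function.Injective a)
    (hdx : dx.IsMeromorphic) (ha_range : range a = {p | 0 < dx.order p})
    (hζ : ∀ i, IsBranchCoordinate dx (a i) (ζ i)) (hB : B.IsBergmanKernel)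
    (hγ : ContMDiff 𝓘(ℝ, ℝ) 𝓘(ℝ, ℂ) 1 γ) (hclosed : γ 0 = γ 1)
    (hper : ∀ p, p ∉ γ '' Icc 0 1 → ∀ v : TangentSpace 𝓘(ℂ, ℂ) p,
      ∫ t in (0 : ℝ)..1, B p (γ t) v (velocity γ t) = 0)
    (hdense : ∀ k, ∃ᶠ κ in 𝓝 (0 : ℂ), (ζ k).symm κ ∉ γ '' Icc 0 1)
    (hf : IsRootCoordinate dx f) {z₀ : ℂ} (hz₀ : z₀ ∈ f.target) (hz0 : z₀ ≠ 0)
    (hoff : f.symm z₀ ∉ γ '' Icc 0 1) {η : OneForm X} (hη : ∀ p, η.HolomorphicAt p)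
    (hηc : ∀ e ∈ IsManifold.maximalAtlas 𝓘(ℂ, ℂ) ω X, ∀ w ∈ e.target,
      e.symm w ∉ insert (f.symm z₀) (range a) → η.coeff e w = keyCoeff dx B ζ f z₀ e w) :
    ∫ t in (0 : ℝ)..1, η (γ t) (velocity γ t) = 0 := by
  have hfa := hf.mem_maximalAtlas
  have hζa := fun k => (hζ k).mem_maximalAtlas
  have hmd : ∀ t, MDifferentiableAt 𝓘(ℝ, ℝ) 𝓘(ℝ, ℂ) γ t := fun t => hγ.mdifferentiable one_ne_zero t
  choose s Θ ε H hε hH hΘc hΘi hsH hsd hΘn using fun k =>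
    exists_regularization hB hγ hclosed hper (hζa k) (hζ k).zero_mem (hdense k)
  simp only [fun k => (hζ k).symm_zero] at hsd
  have hqa : ∀ k, f.symm z₀ ≠ a k := fun k => hf.symm_ne hz₀ hz0 (hζ k).apply_eq_zero
  let β : Fin b → ℂ := fun k => B.coeff f (ζ k) z₀ 0
  let bk : Fin b → ℂ → ℂ := fun k w => B.coeff (ζ k) f w z₀
  have hbk : ∀ k, AnalyticAt ℂ (bk k) 0 := fun k => analyticAt_coeff_left hB (hζa k) hfa
    (hζ k).zero_mem hz₀ (by rw [(hζ k).symm_zero]; exact (hqa k).symm)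
  have hbk0 : ∀ k, bk k 0 = β k := fun k => hB.coeff_comm (by
    rw [(hζ k).symm_zero]; exact (hqa k).symm)
  -- `Y` is a primitive along `γ` of what is left of `η` after the normalized terms are removed: away
  -- from the branchpoints it is `B / dx - ½ ∑ β s`, and at a branchpoint, where `B / dx` has the pole
  -- `β / (2 w)`, it is continued by the value of the difference quotient `Φ`.
  let Φ : Fin b → ℂ → ℂ := fun k w => dslope (bk k) 0 w / 2
  let Y : X → ℂ := Function.extend a
    (fun k => Φ k 0 - (1 / 2) * ∑ m ∈ Finset.univ.erase k, β m * s m (a k))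
    fun p => bergmanRatio dx B f z₀ p - (1 / 2) * ∑ m, β m * s m p
  have hYa : ∀ k, Y (a k) = Φ k 0 - (1 / 2) * ∑ m ∈ Finset.univ.erase k, β m * s m (a k) :=
    fun k => ha.extend_apply _ _ k
  have hY : ∀ p, p ∉ range a → Y p = bergmanRatio dx B f z₀ p - (1 / 2) * ∑ m, β m * s m p :=
    fun p hp => Function.extend_apply' _ _ _ hp
  obtain ⟨hE, hEi⟩ := integral_deriv_pathCoeff_div hB hγ hper hfa hz₀ hz0 hoff
  set E : ℝ → ℂ := fun t => deriv (fun z => pathCoeff B γ f t z / (2 * z)) z₀ with hEdef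
  have hder : ∀ t ∈ Icc (0 : ℝ) 1, HasDerivAt (Y ∘ γ)
      (η (γ t) (velocity γ t) - E t - (1 / 2) * ∑ m, β m * Θ m t) t := by
    intro t ht
    have hγc := hγ.continuous.continuousAt (x := t)
    have htq : γ t ≠ f.symm z₀ := fun h => hoff ⟨t, ht, h⟩
    have hEt := (pathCoeff_div_regular hB hγ hfa hz₀ hz0 htq).2.2
    by_cases hta : γ t ∈ range a
    · obtain ⟨k, hk⟩ := hta
      -- near a branchpoint the poles of `B / dx` and of the cut-off pole cancel
      have hs : γ t ∈ (ζ k).source := hk ▸ (hζ k).mem_source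
      have hu0 : (ζ k) (γ t) = 0 := by rw [← hk, (hζ k).map_center]
      have hu := hasDerivAt_coord_comp hγ (hζa k) hs
      have huc : Tendsto (ζ k ∘ γ) (𝓝 t) (𝓝 0) := hu0 ▸ hu.continuousAt.tendsto
      have hne : ∀ m, m ≠ k → γ t ≠ a m := fun m hm h => hm (ha (h.symm.trans hk.symm))
      have hΦan : AnalyticAt ℂ (Φ k) 0 := by
        have : AnalyticAt ℂ (dslope (bk k) 0) 0 := by
          obtain ⟨p, hp⟩ := hbk k
          exact ⟨_, hp.has_fpower_series_dslope_fslope⟩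
        exact this.div_const
      have hBm : ∀ m, m ≠ k → AnalyticAt ℂ (fun w => B.coeff (ζ k) (ζ m) w 0) 0 := fun m hm =>
        analyticAt_coeff_left hB (hζa k) (hζa m) (hζ k).zero_mem (hζ m).zero_mem (by
          rw [(hζ k).symm_zero, (hζ m).symm_zero]; exact fun h => hm (ha h).symm)
      have hDz := analyticAt_deriv_coeff_div hB (hζa k) hfa (hζ k).zero_mem hz₀
        (by rw [(hζ k).symm_zero]; exact (hqa k).symm) hz0
      let R : ℂ → ℂ := fun w => η.coeff (ζ k) w -
        deriv (fun z => B.coeff (ζ k) f w z / (2 * z)) z₀ - (1 / 2) * (β k * H k w) -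
        (1 / 2) * ∑ m ∈ Finset.univ.erase k, β m * B.coeff (ζ k) (ζ m) w 0
      have hRc : ContinuousAt R 0 := by
        have h1 : AnalyticAt ℂ (η.coeff (ζ k)) 0 := by
          have := (hη (a k)).coeff (hζa k) (hζ k).mem_source
          rwa [(hζ k).map_center] at this
        have h2 : AnalyticAt ℂ (fun w => ∑ m ∈ Finset.univ.erase k,
            β m * B.coeff (ζ k) (ζ m) w 0) 0 :=
          Finset.analyticAt_fun_sum _ fun m hm =>
            analyticAt_const.mul (hBm m (Finset.ne_of_mem_erase hm))
        exact (((h1.sub hDz).sub (analyticAt_const.mul (analyticAt_const.mul (hH k)))).sub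
          (analyticAt_const.mul h2)).continuousAt
      have hF : ∀ w, ‖w‖ < ε k → w ≠ 0 → (ζ k).symm w ≠ f.symm z₀ → Φ k w =
          B.coeff (ζ k) f w z₀ * (dx.coeff (ζ k) w)⁻¹ - (1 / 2) * (β k * s k ((ζ k).symm w)) := by
        intro w hw hw0 _
        obtain ⟨h1, h2⟩ := hsH k w hw
        rw [(h2 hw0).1, (hζ k).coeff_eq w h1]
        simp only [Φ]
        rw [dslope_of_ne _ hw0, slope_def_field, hbk0]
        simp only [bk]
        field_simp
        ring
      have hnear : ∀ᶠ w in 𝓝 (0 : ℂ), ‖w‖ < ε k ∧ (ζ k).symm w ≠ f.symm z₀ := by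
        refine ((continuous_norm.tendsto' (0 : ℂ) 0 norm_zero).eventually_lt_const (hε k)).and ?_
        exact ((ζ k).continuousAt_symm (hζ k).zero_mem).eventually_ne
          (by rw [(hζ k).symm_zero]; exact (hqa k).symm)
      have hΦR : deriv (Φ k) 0 = R 0 := by
        have h1 : deriv (Φ k) =ᶠ[𝓝[≠] 0] R := by
          have hn : ∀ᶠ w in 𝓝[≠] (0 : ℂ), w ≠ 0 ∧ ∀ᶠ w' in 𝓝 w, w' ≠ 0 ∧ ‖w'‖ < ε k ∧
              (ζ k).symm w' ≠ f.symm z₀ := by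
            filter_upwards [self_mem_nhdsWithin,
              (hnear.eventually_nhds).filter_mono nhdsWithin_le_nhds] with w hw hw'
            exact ⟨hw, (isOpen_ne.eventually_mem hw).and hw'⟩
          filter_upwards [hn] with w hw
          obtain ⟨hw0, hwn⟩ := hw
          obtain ⟨-, hwε, hwq⟩ := hwn.self_of_nhds
          obtain ⟨hwt, hws⟩ := hsH k w hwε
          have hwa : (ζ k).symm w ∉ insert (f.symm z₀) (range a) := by
            rintro (h | ⟨m, hm⟩)
            · exact hwq h
            · exact (hζ k).isRootCoordinate.symm_ne hwt hw0 (hζ m).apply_eq_zero hm.symm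
          have hev : Φ k =ᶠ[𝓝 w] fun w => B.coeff (ζ k) f w z₀ * (dx.coeff (ζ k) w)⁻¹ -
              (1 / 2) * (β k * w⁻¹) := by
            filter_upwards [hwn] with w' h'
            rw [hF w' h'.2.1 h'.1 h'.2.2, ((hsH k w' h'.2.1).2 h'.1).1, one_div w']
          have hdF : DifferentiableAt ℂ
              (fun w => B.coeff (ζ k) f w z₀ * (dx.coeff (ζ k) w)⁻¹) w := by
            have h1 := (analyticAt_coeff_left hB (hζa k) hfa hwt hz₀ hwq).differentiableAt
            have h2 : DifferentiableAt ℂ (fun w => (dx.coeff (ζ k) w)⁻¹) w := by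
              have h3 : DifferentiableAt ℂ (fun w : ℂ => (2 * w)⁻¹) w :=
                (differentiableAt_id.const_mul 2).inv (by simpa using hw0)
              refine h3.congr_of_eventuallyEq ?_
              filter_upwards [(ζ k).open_target.eventually_mem hwt] with y hy
              rw [(hζ k).coeff_eq y hy]
            exact h1.mul h2
          have hd2 : HasDerivAt (fun w : ℂ => (1 / 2 : ℂ) * (β k * w⁻¹))
              ((1 / 2) * (β k * (-(w ^ 2)⁻¹))) w :=
            ((hasDerivAt_inv hw0).const_mul _).const_mul _
          rw [hev.deriv_eq, (hdF.hasDerivAt.fun_sub hd2).deriv]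
          simp only [R]
          rw [hηc _ (hζa k) w hwt hwa, keyCoeff, ← Finset.add_sum_erase _ _ (Finset.mem_univ k),
            (hws hw0).2]
          simp only [β, mul_comm (B.coeff f _ z₀ 0)]
          field_simp
          ring
        exact tendsto_nhds_unique
          ((hΦan.deriv.continuousAt.tendsto.mono_left nhdsWithin_le_nhds).congr' h1)
          (hRc.tendsto.mono_left nhdsWithin_le_nhds)
      have hYev : Y ∘ γ =ᶠ[𝓝 t] fun r => Φ k ((ζ k ∘ γ) r) -
          (1 / 2) * ∑ m ∈ Finset.univ.erase k, β m * (s m ∘ γ) r := by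
        filter_upwards [hγc.eventually ((ζ k).open_source.eventually_mem hs),
          huc.eventually hnear] with r hr1 hr2
        have hre : (ζ k).symm ((ζ k) (γ r)) = γ r := (ζ k).left_inv hr1
        by_cases hr0 : (ζ k) (γ r) = 0
        · have : γ r = a k := by rw [← hre, hr0, (hζ k).symm_zero]
          simp only [Function.comp_apply, this, hYa, (hζ k).map_center]
        · have hra : γ r ∉ range a := by
            rintro ⟨m, hm⟩
            refine (hζ k).isRootCoordinate.symm_ne ((ζ k).map_source hr1) hr0
              (hζ m).apply_eq_zero ?_
            rw [hre, hm]
          simp only [Function.comp_apply, hY _ hra]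
          rw [hF (ζ k (γ r)) hr2.1 hr0 hr2.2, hre, bergmanRatio_eq (hζa k) hfa hz₀ hr1,
            ← Finset.add_sum_erase _ _ (Finset.mem_univ k)]
          ring
      have hd : HasDerivAt (fun r => Φ k ((ζ k ∘ γ) r) -
          (1 / 2) * ∑ m ∈ Finset.univ.erase k, β m * (s m ∘ γ) r)
          (deriv (ζ k ∘ γ) t * deriv (Φ k) 0 -
            (1 / 2) * ∑ m ∈ Finset.univ.erase k, β m * (Θ m t - pathCoeff B γ (ζ m) t 0)) t := by
        have h1 : HasDerivAt (Φ k) (deriv (Φ k) 0) ((ζ k ∘ γ) t) := by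
          rw [Function.comp_apply, hu0]
          exact hΦan.differentiableAt.hasDerivAt
        have h2 := h1.scomp t hu
        exact h2.sub (HasDerivAt.const_mul _ (HasDerivAt.fun_sum fun m hm =>
          (hsd m t (hne m (Finset.ne_of_mem_erase hm))).const_mul _))
      refine (hd.congr_of_eventuallyEq hYev).congr_deriv ?_
      have hpc : ∀ m, pathCoeff B γ (ζ m) t 0 =
          deriv (ζ k ∘ γ) t * B.coeff (ζ k) (ζ m) 0 0 := fun m => by
        rw [pathCoeff_eq (hmd t) (hζa m) (hζa k) hs (hζ m).zero_mem, hu0]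
      have hΘk : Θ k t = deriv (ζ k ∘ γ) t * H k 0 := by
        rw [hΘn k t hs (by rw [hu0, norm_zero]; exact hε k), hu0]
      have hηt : η (γ t) (velocity γ t) = deriv (ζ k ∘ γ) t * η.coeff (ζ k) 0 := by
        rw [η.apply_eq (hζa k) hs, dirDeriv_velocity (hmd t) (hζa k) hs, hu0]
      rw [hΦR, hηt, hEdef]
      simp only
      rw [hEt _ (hζa k) hs, hu0, ← Finset.add_sum_erase _ _ (Finset.mem_univ k), hΘk]
      have hsum : ∑ m ∈ Finset.univ.erase k, β m * (Θ m t - pathCoeff B γ (ζ m) t 0) =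
          ∑ m ∈ Finset.univ.erase k, β m * Θ m t - deriv (ζ k ∘ γ) t *
            ∑ m ∈ Finset.univ.erase k, β m * B.coeff (ζ k) (ζ m) 0 0 := by
        rw [Finset.mul_sum, ← Finset.sum_sub_distrib]
        exact Finset.sum_congr rfl fun m _ => by rw [hpc]; ring
      rw [hsum]
      simp only [R]
      ring
    · -- a regular point
      have he := IsManifold.chart_mem_maximalAtlas (I := 𝓘(ℂ, ℂ)) (n := ω) (γ t)
      have hs := mem_chart_source ℂ (γ t)
      generalize chartAt ℂ (γ t) = e at he hs
      have hne : ∀ m, γ t ≠ a m := fun m h => hta ⟨m, h.symm⟩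
      have hut : e (γ t) ∈ e.target := e.map_source hs
      have hord : ¬ 0 < dx.order (γ t) := fun h => hta (by rw [ha_range]; exact h)
      have hF : AnalyticAt ℂ (fun w => B.coeff e f w z₀ * (dx.coeff e w)⁻¹) (e (γ t)) :=
        (analyticAt_coeff_left hB he hfa hut hz₀ (by rwa [e.left_inv hs])).mul
          (analyticAt_inv_coeff hdx hord he hs)
      have hYev : Y ∘ γ =ᶠ[𝓝 t] fun r =>
          (fun w => B.coeff e f w z₀ * (dx.coeff e w)⁻¹) ((e ∘ γ) r) -
            (1 / 2) * ∑ m, β m * (s m ∘ γ) r := by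
        have hcl : IsClosed (range a) := (finite_range a).isClosed
        filter_upwards [hγc.eventually (e.open_source.eventually_mem hs),
          hγc.eventually (hcl.isOpen_compl.eventually_mem hta)] with r hr1 hr2
        simp only [Function.comp_apply, hY _ hr2, bergmanRatio_eq he hfa hz₀ hr1]
      have hd := (hF.differentiableAt.hasDerivAt.scomp t (hasDerivAt_coord_comp hγ he hs)).sub
        (HasDerivAt.const_mul (1 / 2 : ℂ) (HasDerivAt.fun_sum (u := Finset.univ) fun m _ =>
          (hsd m t (hne m)).const_mul (β m)))
      refine (hd.congr_of_eventuallyEq hYev).congr_deriv ?_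
      have hpc : ∀ m, pathCoeff B γ (ζ m) t 0 =
          deriv (e ∘ γ) t * B.coeff e (ζ m) (e (γ t)) 0 := fun m =>
        pathCoeff_eq (hmd t) (hζa m) he hs (hζ m).zero_mem
      have hwS : e.symm (e (γ t)) ∉ insert (f.symm z₀) (range a) := by
        rw [e.left_inv hs]
        rintro (h | h)
        · exact htq h
        · exact hta h
      have hηt : η (γ t) (velocity γ t) = deriv (e ∘ γ) t * keyCoeff dx B ζ f z₀ e (e (γ t)) := by
        rw [η.apply_eq he hs, dirDeriv_velocity (hmd t) he hs, hηc e he _ hut hwS]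
      rw [hηt, hEdef]
      simp only
      rw [hEt e he hs, keyCoeff]
      have hsum : ∑ m, β m * (Θ m t - pathCoeff B γ (ζ m) t 0) =
          ∑ m, β m * Θ m t - deriv (e ∘ γ) t *
            ∑ m, B.coeff e (ζ m) (e (γ t)) 0 * B.coeff f (ζ m) z₀ 0 := by
        rw [Finset.mul_sum, ← Finset.sum_sub_distrib]
        exact Finset.sum_congr rfl fun m _ => by rw [hpc]; ring
      rw [hsum, smul_eq_mul]
      ring
  have huIcc : uIcc (0 : ℝ) 1 = Icc 0 1 := uIcc_of_le zero_le_one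
  have hi1 : IntervalIntegrable (fun t => η (γ t) (velocity γ t)) volume 0 1 :=
    (continuous_form_velocity hη hγ).intervalIntegrable _ _
  have hi2 : IntervalIntegrable E volume 0 1 :=
    ContinuousOn.intervalIntegrable (by rwa [huIcc])
  have hi3 : ∀ m, IntervalIntegrable (fun t => β m * Θ m t) volume 0 1 := fun m =>
    (continuous_const.mul (hΘc m)).intervalIntegrable _ _
  have hi4 : IntervalIntegrable (fun t => ∑ m, β m * Θ m t) volume 0 1 :=
    (continuous_finsetSum _ fun m _ => continuous_const.mul (hΘc m)).intervalIntegrable _ _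
  have hfund := intervalIntegral.integral_eq_sub_of_hasDerivAt
    (fun t ht => hder t (huIcc ▸ ht)) ((hi1.sub hi2).sub (hi4.const_mul _))
  rw [intervalIntegral.integral_sub (hi1.sub hi2) (hi4.const_mul _),
    intervalIntegral.integral_sub hi1 hi2, hEi, intervalIntegral.integral_const_mul,
    intervalIntegral.integral_finsetSum fun m _ => hi3 m] at hfund
  simp only [intervalIntegral.integral_const_mul, hΘi, mul_zero, Finset.sum_const_zero, sub_zero,
    Function.comp_apply, hclosed, sub_self] at hfund
  exact hfund

end Periods

/-! ### The infinitesimal factorization -/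

section Cycles

variable {X : Type*} [TopologicalSpace X] [ChartedSpace ℂ X]

/-- The `𝒜`-cycles of a canonical homology basis are the restrictions to `[0, 1]` of smooth paths
on the whole real line, and they are closed. -/
theorem IsCanonicalHomologyBasis.exists_smooth {g : ℕ} {A C : Fin g → ℝ → X}
    (hAC : IsCanonicalHomologyBasis g A C) (j : Fin g) :
    ∃ γ : ℝ → X, ContMDiff 𝓘(ℝ, ℝ) 𝓘(ℝ, ℂ) 1 γ ∧ γ 0 = γ 1 ∧ EqOn (A j) γ (Icc 0 1) := by
  rcases hAC with ⟨rfl, -⟩ | ⟨hg, φ, hφ, hφAC⟩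
  · exact j.elim0
  have hs : ∀ k t, side g k t = vertex g k + t * (vertex g (k + 1) - vertex g k) := side_apply g
  have hs0 : ∀ k, side g k 0 = vertex g k := fun k => by rw [hs]; simp
  have hs1 : ∀ k, side g k 1 = vertex g (k + 1) := fun k => by rw [hs]; simp
  refine ⟨φ ∘ side g (4 * j), ?_, ?_, fun t ht => (hφAC j t ht).1⟩
  · refine (hφ.smooth.of_le (by norm_num)).comp (contMDiff_iff_contDiff.2 ?_)
    rw [funext (hs (4 * j))]
    exact contDiff_const.add ((Complex.ofRealCLM.contDiff).mul contDiff_const)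
  · have h0 : (0 : ℝ) ∈ Icc (0 : ℝ) 1 := ⟨le_rfl, zero_le_one⟩
    have h1 : (1 : ℝ) ∈ Icc (0 : ℝ) 1 := ⟨zero_le_one, le_rfl⟩
    refine (hφ.fiber _ (side_mem_polygon g _ h0) _ (side_mem_polygon g _ h1)).2 ?_
    have p1 : SidePaired g (vertex g (4 * j)) (vertex g (4 * j + 3)) :=
      ⟨j, j.2, 0, h0, Or.inl ⟨(hs0 _).symm, by rw [sub_zero, hs1]⟩⟩
    have p2 : SidePaired g (vertex g (4 * j + 2)) (vertex g (4 * j + 3)) :=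
      ⟨j, j.2, 1, h1, Or.inr ⟨(hs1 _).symm, by rw [sub_self, hs0]⟩⟩
    have p3 : SidePaired g (vertex g (4 * j + 1)) (vertex g (4 * j + 2)) :=
      ⟨j, j.2, 1, h1, Or.inl ⟨(hs1 _).symm, by rw [sub_self, hs0]⟩⟩
    rw [hs0, hs1]
    exact ((Relation.EqvGen.rel _ _ p1).trans _ _ _ ((Relation.EqvGen.rel _ _ p2).symm _ _)).trans
      _ _ _ ((Relation.EqvGen.rel _ _ p3).symm _ _)

/-- The integral of a form along a path on `[0, 1]` only depends on the path on `[0, 1]`. -/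
theorem integral_velocity_congr {γ₁ γ₂ : ℝ → X} (h : EqOn γ₁ γ₂ (Icc 0 1))
    (L : ∀ p : X, TangentSpace 𝓘(ℂ, ℂ) p → ℂ) :
    ∫ t in (0 : ℝ)..1, L (γ₁ t) (velocity γ₁ t) = ∫ t in (0 : ℝ)..1, L (γ₂ t) (velocity γ₂ t) := by
  rw [intervalIntegral.integral_of_le zero_le_one, intervalIntegral.integral_of_le zero_le_one,
    integral_Ioc_eq_integral_Ioo, integral_Ioc_eq_integral_Ioo]
  refine setIntegral_congr_fun measurableSet_Ioo fun t ht => ?_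
  have h5 : γ₁ =ᶠ[𝓝 t] γ₂ := by
    filter_upwards [Ioo_mem_nhds ht.1 ht.2] with s hs using h (Ioo_subset_Icc_self hs)
  have h6 : (velocity γ₁ t : ℂ) = (velocity γ₂ t : ℂ) := velocity_congr h5
  have h7 : ∀ (p q : X) (v w : ℂ), p = q → v = w →
      L p (show TangentSpace 𝓘(ℂ, ℂ) p from v) = L q (show TangentSpace 𝓘(ℂ, ℂ) q from w) := by
    rintro p q v w rfl rfl; rfl
  exact h7 _ _ _ _ h5.eq_of_nhds h6

/-- In a coordinate, the complement of finitely many smooth paths is dense. -/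
theorem frequently_notMem_paths {ι : Type*} [Countable ι] {γ : ι → ℝ → X}
    (hγ : ∀ j, ContMDiff 𝓘(ℝ, ℝ) 𝓘(ℝ, ℂ) 1 (γ j)) {e : OpenPartialHomeomorph X ℂ}
    (he : e ∈ IsManifold.maximalAtlas 𝓘(ℂ, ℂ) ω X) {w : ℂ} (hw : w ∈ e.target) :
    ∃ᶠ κ in 𝓝 w, ∀ j, e.symm κ ∉ γ j '' Icc 0 1 := by
  set T : ι → Set ℝ := fun j => {t | γ j t ∈ e.source} with hT
  have hdim : dimH (⋃ j, (e ∘ γ j) '' T j) ≤ 1 := by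
    rw [dimH_iUnion]
    refine iSup_le fun j => ?_
    refine (dimH_image_le_of_locally_lipschitzOn fun t ht => ?_).trans
      ((dimH_mono (subset_univ _)).trans_eq Real.dimH_univ)
    obtain ⟨K, U, hU, hK⟩ := (contDiffAt_coord_comp (hγ j) he ht).exists_lipschitzOnWith
    exact ⟨K, U, nhdsWithin_le_nhds hU, hK⟩
  have hd : Dense (⋃ j, (e ∘ γ j) '' T j)ᶜ := by
    refine dense_compl_of_dimH_lt_finrank (hdim.trans_lt ?_)
    rw [Complex.finrank_real_complex]
    norm_num
  rw [frequently_iff]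
  intro U hU
  obtain ⟨κ, hκ1, hκ2⟩ := mem_closure_iff_nhds.1 (hd w) (U ∩ e.target)
    (inter_mem hU (e.open_target.mem_nhds hw))
  refine ⟨κ, hκ1.1, fun j => ?_⟩
  rintro ⟨t, -, ht⟩
  refine hκ2 (mem_iUnion.2 ⟨j, t, ?_, ?_⟩)
  · change γ j t ∈ e.source
    rw [ht]; exact e.map_target hκ1.2
  · rw [Function.comp_apply, ht, e.right_inv hκ1.2]

end Cycles

section Factorization

variable {X : Type*} [TopologicalSpace X] [ChartedSpace ℂ X] [IsManifold 𝓘(ℂ, ℂ) ω X] [T2Space X]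
  [CompactSpace X] [ConnectedSpace X] {dx : OneForm X} {b : ℕ} {a : Fin b → X}
  {ζ : Fin b → OpenPartialHomeomorph X ℂ} {B : Bidifferential X}
  {e f : OpenPartialHomeomorph X ℂ} {g : ℕ} {A C : Fin g → ℝ → X}

/-- The infinitesimal form of the factorization: in coordinates in which `dx = 2 w dw` and
`dx = 2 z dz`, the derivative of `B` along the flow of `∂/∂x + ∂/∂x'` is a sum of products of
one-variable forms. -/
theorem Bidifferential.IsBergmanKernel.deriv_div_add_deriv_div (hB : B.IsBergmanKernel)
    (hAC : IsCanonicalHomologyBasis g A C) (hBA : B.IsNormalizedOn A) (hdx : dx.IsMeromorphic)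
    (ha : Function.Injective a) (ha_range : range a = {p | 0 < dx.order p})
    (hζ : ∀ i, IsBranchCoordinate dx (a i) (ζ i)) (he : IsRootCoordinate dx e)
    (hf : IsRootCoordinate dx f) {w₀ z₀ : ℂ} (hw : w₀ ∈ e.target) (hz : z₀ ∈ f.target)
    (hw0 : w₀ ≠ 0) (hz0 : z₀ ≠ 0) (hne : e.symm w₀ ≠ f.symm z₀) :
    deriv (fun w => B.coeff e f w z₀ / w) w₀ + deriv (fun z => B.coeff e f w₀ z / z) z₀ =
      -∑ k, B.coeff e (ζ k) w₀ 0 * B.coeff f (ζ k) z₀ 0 := by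
  have hea := he.mem_maximalAtlas
  have hfa := hf.mem_maximalAtlas
  choose γ hγ hclosed hAγ using fun j => hAC.exists_smooth j
  have hper : ∀ j p, p ∉ γ j '' Icc 0 1 → ∀ v : TangentSpace 𝓘(ℂ, ℂ) p,
      ∫ t in (0 : ℝ)..1, B p (γ j t) v (velocity (γ j) t) = 0 := by
    intro j p hp v
    rw [← integral_velocity_congr (hAγ j) fun q => B p q v]
    exact hBA j p (by rwa [(hAγ j).image_eq]) v
  -- the identity for a generic second point
  have hgen : ∀ z ∈ f.target, z ≠ 0 → e.symm w₀ ≠ f.symm z → (∀ j, f.symm z ∉ γ j '' Icc 0 1) →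
      keyCoeff dx B ζ f z e w₀ = 0 := by
    intro z hz hz0 hne hoff
    have hS : (insert (f.symm z) (range a)).Finite := (finite_range a).insert _
    obtain ⟨η, hη, hηc⟩ := exists_oneForm_of_coeff (fun e w => keyCoeff dx B ζ f z e w)
      (insert (f.symm z) (range a)) hS
      (fun e he e' he' w hw hwS hw' => keyCoeff_transform hdx ha_range hζ hB hf hz he he' hw hwS hw')
      (keyCoeff_removable hdx ha ha_range hζ hB hf hz hz0)
    have hzero := OneForm.eq_zero_of_periods_eq_zero hAC hη (fun j => by
      rw [integral_velocity_congr (hAγ j) fun q => η q]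
      refine integral_keyForm_eq_zero ha hdx ha_range hζ hB (hγ j) (hclosed j) (hper j)
        (fun k => ?_) hf hz hz0 (hoff j) hη hηc
      exact (frequently_notMem_paths hγ (hζ k).mem_maximalAtlas (hζ k).zero_mem).mono
        fun κ hκ => hκ j)
    rw [← hηc e hea w₀ hw]
    · rw [OneForm.coeff, hzero]; rfl
    · rintro (h | ⟨k, hk⟩)
      · exact hne h
      · exact he.symm_ne hw hw0 (hζ k).apply_eq_zero hk.symm
  have hkey : ∀ z, keyCoeff dx B ζ f z e w₀ = (1 / 2) *
      (deriv (fun w => B.coeff e f w z / w) w₀ + deriv (fun y => B.coeff e f w₀ y / y) z +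
        ∑ k, B.coeff e (ζ k) w₀ 0 * B.coeff f (ζ k) z 0) := by
    intro z
    have h1 : (fun w => B.coeff e f w z * (dx.coeff e w)⁻¹) =ᶠ[𝓝 w₀]
        fun w => (1 / 2) * (B.coeff e f w z / w) := by
      filter_upwards [e.open_target.eventually_mem hw] with w hw
      rw [he.coeff_eq w hw, mul_inv]
      ring
    have h2 : (fun y => B.coeff e f w₀ y / (2 * y)) = fun y => (1 / 2) * (B.coeff e f w₀ y / y) := by
      funext y
      rw [div_mul_eq_div_div_swap]
      ring
    rw [keyCoeff, h1.deriv_eq, h2, deriv_const_mul_field, deriv_const_mul_field]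
    ring
  have hcont : ContinuousAt (fun z => keyCoeff dx B ζ f z e w₀) z₀ := by
    rw [funext hkey]
    have h1 : AnalyticAt ℂ (fun y : ℂ × ℂ => B.coeff e f y.1 y.2 / y.1) (w₀, z₀) :=
      (hB.holo e hea f hfa w₀ hw z₀ hz hne).div analyticAt_fst hw0
    have h2 : AnalyticAt ℂ (fun y : ℂ × ℂ => B.coeff e f y.1 y.2 / y.2) (w₀, z₀) :=
      (hB.holo e hea f hfa w₀ hw z₀ hz hne).div analyticAt_snd hz0
    have h3 := AnalyticAt.comp_right (AnalyticAt.deriv_fst h1)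
    have h4 := AnalyticAt.comp_right (AnalyticAt.deriv_snd h2)
    have h5 : AnalyticAt ℂ (fun z => ∑ k, B.coeff e (ζ k) w₀ 0 * B.coeff f (ζ k) z 0) z₀ :=
      Finset.analyticAt_fun_sum _ fun k _ => analyticAt_const.mul
        (analyticAt_coeff_left hB hfa (hζ k).mem_maximalAtlas hz (hζ k).zero_mem
          (by rw [(hζ k).symm_zero]; exact hf.symm_ne hz hz0 (hζ k).apply_eq_zero))
    exact (analyticAt_const.mul ((h3.add h4).add h5)).continuousAt
  have hzero : keyCoeff dx B ζ f z₀ e w₀ = 0 := by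
    by_contra h
    have hev : ∀ᶠ z in 𝓝 z₀, z ∈ f.target ∧ z ≠ 0 ∧ e.symm w₀ ≠ f.symm z ∧
        keyCoeff dx B ζ f z e w₀ ≠ 0 :=
      (f.open_target.eventually_mem hz).and ((isOpen_ne.eventually_mem hz0).and
        ((((f.continuousAt_symm hz).eventually_ne hne.symm).mono fun _ h => h.symm).and
          (hcont.eventually_ne h)))
    obtain ⟨z, hz1, hz2, hz3, hz4, hz5⟩ :=
      ((frequently_notMem_paths hγ hfa hz).and_eventually hev).exists
    exact hz5 (hgen z hz2 hz3 hz4 hz1)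
  rw [hkey] at hzero
  linear_combination 2 * hzero

end Factorization

/-! ### Double power series -/

section DoubleSeries

/-- An analytic function of two variables is the sum of a double power series. -/
theorem exists_hasSum_of_analyticAt {h : ℂ × ℂ → ℂ} (hh : AnalyticAt ℂ h (0, 0)) :
    ∃ (c : ℕ → ℕ → ℂ) (ρ : ℝ), 0 < ρ ∧ ∀ w z : ℂ, ‖w‖ < ρ → ‖z‖ < ρ →
      HasSum (fun n : ℕ × ℕ => c n.1 n.2 * w ^ n.1 * z ^ n.2) (h (w, z)) := by
  obtain ⟨p, r, hp⟩ := hh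
  let m : ∀ n : ℕ, Finset (Fin n) → Fin n → ℂ × ℂ := fun n s =>
    s.piecewise (fun _ => ((1 : ℂ), (0 : ℂ))) fun _ => ((0 : ℂ), (1 : ℂ))
  let c : ℕ → ℕ → ℂ := fun d l =>
    ∑ s ∈ Finset.univ.filter fun s : Finset (Fin (d + l)) => s.card = d, p (d + l) (m (d + l) s)
  obtain ⟨R, hR0, hRr⟩ : ∃ R : NNReal, 0 < R ∧ (R : ENNReal) < r := by
    obtain ⟨R, h1, h2⟩ := ENNReal.lt_iff_exists_nnreal_btwn.1 hp.r_pos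
    exact ⟨R, by exact_mod_cast h1, h2⟩
  have hsum : Summable fun n => ‖p n‖ * (R : ℝ) ^ n :=
    p.summable_norm_mul_pow (hRr.trans_le hp.r_le)
  have hm : ∀ n s, ‖p n (m n s)‖ ≤ ‖p n‖ := by
    intro n s
    refine ((p n).le_opNorm (m n s)).trans (mul_le_of_le_one_right (norm_nonneg _) ?_)
    refine Finset.prod_le_one (fun _ _ => norm_nonneg _) fun i _ => ?_
    by_cases hi : i ∈ s <;> simp [m, hi, Prod.norm_def]
  have hcard : ∀ n (s : Finset (Fin n)) (x y : ℂ),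
      (∏ i, if i ∈ s then x else y) = x ^ s.card * y ^ (n - s.card) := by
    intro n s x y
    rw [Finset.prod_ite, Finset.prod_const, Finset.prod_const, Finset.filter_mem_eq_inter,
      Finset.univ_inter]
    congr 2
    rw [Finset.filter_not, Finset.filter_mem_eq_inter, Finset.univ_inter,
      Finset.card_univ_sdiff, Fintype.card_fin]
  have hterm : ∀ n (w z : ℂ), p n (fun _ => (w, z)) =
      ∑ s : Finset (Fin n), w ^ s.card * z ^ (n - s.card) * p n (m n s) := by
    intro n w z
    have h1 : (fun _ : Fin n => (w, z)) = (fun _ => w • ((1 : ℂ), (0 : ℂ))) +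
        fun _ => z • ((0 : ℂ), (1 : ℂ)) := by
      funext i; simp
    rw [h1, (p n).map_add_univ]
    refine Finset.sum_congr rfl fun s _ => ?_
    have h2 : (s.piecewise (fun _ => w • ((1 : ℂ), (0 : ℂ))) fun _ => z • ((0 : ℂ), (1 : ℂ))) =
        fun i => (if i ∈ s then w else z) • m n s i := by
      funext i
      by_cases hi : i ∈ s <;> simp [m, hi]
    rw [h2, (p n).map_smul_univ, hcard, smul_eq_mul]
  -- grouping subsets by their cardinality
  have hgroup : ∀ n (x y : ℂ) (F : Finset (Fin n) → ℂ),
      ∑ s : Finset (Fin n), x ^ s.card * y ^ (n - s.card) * F s =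
        ∑ q ∈ Finset.HasAntidiagonal.antidiagonal n, x ^ q.1 * y ^ q.2 *
          ∑ s ∈ Finset.univ.filter fun s : Finset (Fin n) => s.card = q.1, F s := by
    intro n x y F
    rw [← Finset.sum_fiberwise_of_maps_to (s := Finset.univ) (t := Finset.HasAntidiagonal.antidiagonal n)
      (g := fun s : Finset (Fin n) => (s.card, n - s.card))]
    · refine Finset.sum_congr rfl fun q hq => ?_
      rw [Finset.HasAntidiagonal.mem_antidiagonal] at hq
      rw [Finset.mul_sum]
      have hfil : (Finset.univ.filter fun s : Finset (Fin n) => (s.card, n - s.card) = q) =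
          Finset.univ.filter fun s : Finset (Fin n) => s.card = q.1 := by
        refine Finset.filter_congr fun s _ => ?_
        rw [Prod.ext_iff]
        simp only
        omega
      rw [hfil]
      refine Finset.sum_congr rfl fun s hs => ?_
      rw [Finset.mem_filter] at hs
      rw [hs.2, show n - q.1 = q.2 by omega]
    · intro s _
      have := s.card_le_univ
      rw [Fintype.card_fin] at this
      rw [Finset.HasAntidiagonal.mem_antidiagonal]
      simp only
      omega
  have hc : ∀ n, ∀ q ∈ Finset.HasAntidiagonal.antidiagonal n, c q.1 q.2 =
      ∑ s ∈ Finset.univ.filter fun s : Finset (Fin n) => s.card = q.1, p n (m n s) := by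
    intro n q hq
    rw [Finset.HasAntidiagonal.mem_antidiagonal] at hq
    subst hq
    rfl
  refine ⟨c, R / 2, by positivity, fun w z hw hz => ?_⟩
  have hwz : ‖w‖ + ‖z‖ ≤ R := by linarith
  rw [← Finset.HasAntidiagonal.sigmaAntidiagonalEquivProd.hasSum_iff]
  have hcn : ∀ n, ∀ q ∈ Finset.HasAntidiagonal.antidiagonal n, ‖c q.1 q.2 * w ^ q.1 * z ^ q.2‖ ≤
      ‖w‖ ^ q.1 * ‖z‖ ^ q.2 *
        ∑ s ∈ Finset.univ.filter fun s : Finset (Fin n) => s.card = q.1, ‖p n (m n s)‖ := by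
    intro n q hq
    rw [norm_mul, norm_mul, norm_pow, norm_pow, mul_assoc, mul_comm, hc n q hq]
    exact mul_le_mul_of_nonneg_left (norm_sum_le _ _) (by positivity)
  refine HasSum.sigma_of_hasSum (g := fun n => p n (fun _ => (w, z))) ?_ ?_ ?_
  · have hy : ((w, z) : ℂ × ℂ) ∈ Metric.eball (0 : ℂ × ℂ) r := by
      rw [Metric.mem_eball, edist_zero_right]
      refine lt_of_le_of_lt ?_ hRr
      rw [← ofReal_norm, ENNReal.ofReal_le_coe, Prod.norm_def]
      have := norm_nonneg w; have := norm_nonneg z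
      exact max_le (by linarith) (by linarith)
    have h1 := hp.hasSum hy
    simpa using h1
  · intro n
    have h1 := hasSum_fintype (fun q : Finset.HasAntidiagonal.antidiagonal n =>
      ((fun n : ℕ × ℕ => c n.1 n.2 * w ^ n.1 * z ^ n.2) ∘ Finset.HasAntidiagonal.sigmaAntidiagonalEquivProd)
        ⟨n, q⟩)
    convert h1 using 1
    rw [hterm, hgroup, ← Finset.sum_coe_sort]
    refine Finset.sum_congr rfl fun q _ => ?_
    simp only [Function.comp_apply, Finset.HasAntidiagonal.sigmaAntidiagonalEquivProd_apply]
    rw [hc n q.1 q.2]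
    ring
  · refine Summable.of_norm ((summable_sigma_of_nonneg fun _ => norm_nonneg _).2
      ⟨fun n => Summable.of_finite, ?_⟩)
    refine Summable.of_nonneg_of_le (fun n => tsum_nonneg fun _ => norm_nonneg _) (fun n => ?_) hsum
    rw [tsum_fintype]
    calc _ = ∑ q ∈ Finset.HasAntidiagonal.antidiagonal n, ‖c q.1 q.2 * w ^ q.1 * z ^ q.2‖ := by
          exact Finset.sum_coe_sort (Finset.HasAntidiagonal.antidiagonal n)
            fun q => ‖c q.1 q.2 * w ^ q.1 * z ^ q.2‖
      _ ≤ ∑ q ∈ Finset.HasAntidiagonal.antidiagonal n, ‖w‖ ^ q.1 * ‖z‖ ^ q.2 *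
          ∑ s ∈ Finset.univ.filter fun s : Finset (Fin n) => s.card = q.1, ‖p n (m n s)‖ :=
        Finset.sum_le_sum (hcn n)
      _ = ∑ s : Finset (Fin n), ‖w‖ ^ s.card * ‖z‖ ^ (n - s.card) * ‖p n (m n s)‖ := by
        have := hgroup n (‖w‖ : ℂ) (‖z‖ : ℂ) fun s => (‖p n (m n s)‖ : ℂ)
        exact_mod_cast this.symm
      _ ≤ ∑ s : Finset (Fin n), ‖w‖ ^ s.card * ‖z‖ ^ (n - s.card) * ‖p n‖ := by
        gcongr with s _
        exact hm n s
      _ = ‖p n‖ * (‖w‖ + ‖z‖) ^ n := by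
        rw [← Finset.sum_mul, mul_comm]
        congr 1
        simpa using Fintype.sum_pow_mul_eq_add_pow (Fin n) ‖w‖ ‖z‖
      _ ≤ ‖p n‖ * (R : ℝ) ^ n := by gcongr

theorem eq_zero_of_hasSum_pow {c : ℕ → ℂ}
    (h : ∀ᶠ z : ℂ in 𝓝[≠] 0, HasSum (fun n => c n * z ^ n) 0) (n : ℕ) : c n = 0 := by
  classical
  let p : FormalMultilinearSeries ℂ ℂ ℂ := FormalMultilinearSeries.ofScalars ℂ c
  let F : ℂ → ℂ := fun z => if z = 0 then c 0 else 0
  have hF : HasFPowerSeriesAt F p 0 := by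
    rw [hasFPowerSeriesAt_iff]
    filter_upwards [eventually_nhdsWithin_iff.1 h] with z hz
    simp only [p, FormalMultilinearSeries.coeff_ofScalars, zero_add, smul_eq_mul, F]
    split_ifs with h0
    · subst h0
      convert hasSum_single 0 ?_ using 1
      · simp
      · intro n hn; simp [hn]
    · simpa only [mul_comm] using hz h0
  have h0 : F =ᶠ[𝓝[≠] 0] fun _ => 0 := by
    filter_upwards [self_mem_nhdsWithin] with z hz using if_neg hz
  have h1 : F 0 = 0 := tendsto_nhds_unique
    ((hF.continuousAt.tendsto.mono_left nhdsWithin_le_nhds).congr' h0) tendsto_const_nhds |>.symm ▸ rfl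
  have h2 : F = fun _ => 0 := by
    funext z
    by_cases hz : z = 0
    · rw [hz, h1]
    · exact if_neg hz
  have h3 : p = 0 := by
    rw [h2] at hF
    exact hF.eq_zero
  have : p.coeff n = 0 := by rw [h3]; rfl
  simpa [p, FormalMultilinearSeries.coeff_ofScalars] using this

/-- A double power series is determined by its sum off the diagonal. -/
theorem eq_zero_of_hasSum_two {c : ℕ → ℕ → ℂ} {ρ : ℝ} (hρ : 0 < ρ)
    (h : ∀ w z : ℂ, ‖w‖ < ρ → ‖z‖ < ρ → w ≠ 0 → z ≠ 0 → w ≠ z →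
      HasSum (fun n : ℕ × ℕ => c n.1 n.2 * w ^ n.1 * z ^ n.2) 0) (d l : ℕ) : c d l = 0 := by
  have hball : ∀ᶠ z : ℂ in 𝓝[≠] 0, z ≠ 0 ∧ ‖z‖ < ρ :=
    eventually_nhdsWithin_of_eventually_nhds
      ((continuous_norm.tendsto' (0 : ℂ) 0 norm_zero).eventually_lt_const hρ) |>.and
      self_mem_nhdsWithin |>.mono fun z hz => ⟨hz.2, hz.1⟩
  have hsl : ∀ d, ∀ᶠ z : ℂ in 𝓝[≠] 0, HasSum (fun l => c d l * z ^ l) 0 := by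
    intro d
    filter_upwards [hball] with z hz
    have hne : ∀ᶠ w : ℂ in 𝓝[≠] 0, w ≠ z :=
      eventually_nhdsWithin_of_eventually_nhds (isOpen_ne.eventually_mem hz.1.symm)
    have hw : ∀ᶠ w : ℂ in 𝓝[≠] 0, HasSum (fun d => (∑' l, c d l * z ^ l) * w ^ d) 0 ∧
        Summable fun l => c d l * z ^ l := by
      filter_upwards [hball, hne] with w hw hwz
      have h1 := h w z hw.2 hz.2 hw.1 hz.1 hwz
      have h2 : (fun d => ∑' l, c d l * w ^ d * z ^ l) =
          fun d => (∑' l, c d l * z ^ l) * w ^ d := by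
        funext d
        rw [← tsum_mul_right]
        exact tsum_congr fun l => by ring
      refine ⟨h2 ▸ h1.prod_fiberwise fun d => (h1.summable.prod_factor d).hasSum, ?_⟩
      have h3 := (h1.summable.prod_factor d).mul_left (w ^ d)⁻¹
      refine h3.congr fun l => ?_
      have := pow_ne_zero d hw.1
      simp only
      field_simp
    have h0 := eq_zero_of_hasSum_pow (hw.mono fun w h => h.1) d
    obtain ⟨w, hw⟩ := hw.exists
    exact h0 ▸ hw.2.hasSum
  exact eq_zero_of_hasSum_pow (hsl d) l

/-- Termwise differentiation of a double power series in its first variable. -/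
theorem hasSum_mul_deriv_fst {c : ℕ → ℕ → ℂ} {ρ : ℝ} {h : ℂ → ℂ → ℂ}
    (hs : ∀ w z : ℂ, ‖w‖ < ρ → ‖z‖ < ρ →
      HasSum (fun n : ℕ × ℕ => c n.1 n.2 * w ^ n.1 * z ^ n.2) (h w z)) {w z : ℂ} (hw : ‖w‖ < ρ)
    (hz : ‖z‖ < ρ) :
    HasSum (fun n : ℕ × ℕ => n.1 * c n.1 n.2 * w ^ n.1 * z ^ n.2)
      (w * deriv (fun w => h w z) w) := by
  obtain ⟨r, hr1, hr2⟩ := exists_between hw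
  obtain ⟨r', hr'1, hr'2⟩ := exists_between hr2
  have hr0 : 0 < r := (norm_nonneg w).trans_lt hr1
  have hr'0 : 0 < r' := hr0.trans hr'1
  obtain ⟨K, hK⟩ := (tendsto_self_mul_const_pow_of_lt_one (r := r / r') (by positivity)
    ((div_lt_one hr'0).2 hr'1)).bddAbove_range
  have hK' : ∀ n : ℕ, (n : ℝ) * r ^ n ≤ K * r' ^ n := by
    intro n
    have h1 := hK ⟨n, rfl⟩
    have h2 := pow_pos hr'0 n
    simp only at h1
    rwa [div_pow, ← mul_div_assoc, div_le_iff₀ h2] at h1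
  have hsum : Summable fun n : ℕ × ℕ => K / r * (‖c n.1 n.2‖ * r' ^ n.1 * ‖z‖ ^ n.2) := by
    refine Summable.mul_left _ ?_
    have h1 := (hs (r' : ℂ) z (by simpa [abs_of_pos hr'0] using hr'2) hz).summable.norm
    simpa [abs_of_pos hr'0] using h1
  have hd : ∀ (n : ℕ × ℕ) (y : ℂ), y ∈ Metric.ball (0 : ℂ) r →
      HasDerivAt (fun y => c n.1 n.2 * y ^ n.1 * z ^ n.2)
        (c n.1 n.2 * (n.1 * y ^ (n.1 - 1)) * z ^ n.2) y := fun n y _ =>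
    ((hasDerivAt_pow n.1 y).const_mul _).mul_const _
  have hbd : ∀ (n : ℕ × ℕ) (y : ℂ), y ∈ Metric.ball (0 : ℂ) r →
      ‖c n.1 n.2 * (n.1 * y ^ (n.1 - 1)) * z ^ n.2‖ ≤
        K / r * (‖c n.1 n.2‖ * r' ^ n.1 * ‖z‖ ^ n.2) := by
    intro n y hy
    have hy' : ‖y‖ ≤ r := (mem_ball_zero_iff.1 hy).le
    have h1 : (n.1 : ℝ) * ‖y‖ ^ (n.1 - 1) ≤ K / r * r' ^ n.1 := by
      rcases Nat.eq_zero_or_pos n.1 with h0 | h0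
      · have := hK' 0
        rw [h0]; simp at this ⊢
        positivity
      · calc (n.1 : ℝ) * ‖y‖ ^ (n.1 - 1) ≤ n.1 * r ^ (n.1 - 1) := by gcongr
          _ = n.1 * r ^ n.1 / r := by
            rw [← pow_sub_one_mul h0.ne' r]; field_simp
          _ ≤ K * r' ^ n.1 / r := div_le_div_of_nonneg_right (hK' _) hr0.le
          _ = _ := by ring
    calc _ = ‖c n.1 n.2‖ * (n.1 * ‖y‖ ^ (n.1 - 1)) * ‖z‖ ^ n.2 := by simp
      _ ≤ ‖c n.1 n.2‖ * (K / r * r' ^ n.1) * ‖z‖ ^ n.2 := by gcongr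
      _ = _ := by ring
  have h0 : (0 : ℂ) ∈ Metric.ball (0 : ℂ) r := Metric.mem_ball_self hr0
  have hder := hasDerivAt_tsum_of_isPreconnected hsum Metric.isOpen_ball
    (convex_ball (0 : ℂ) r).isPreconnected hd hbd h0
    (hs 0 z (by simpa using hr0.trans hr2) hz).summable (mem_ball_zero_iff.2 hr1)
  have hev : (fun w => h w z) =ᶠ[𝓝 w] fun y => ∑' n : ℕ × ℕ, c n.1 n.2 * y ^ n.1 * z ^ n.2 := by
    filter_upwards [(continuous_norm.tendsto w).eventually_lt_const hw] with y hy
    exact (hs y z hy hz).tsum_eq.symm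
  rw [hev.deriv_eq, hder.deriv]
  have h2 : Summable fun n : ℕ × ℕ => c n.1 n.2 * (n.1 * w ^ (n.1 - 1)) * z ^ n.2 :=
    Summable.of_norm_bounded hsum fun n => hbd n w (mem_ball_zero_iff.2 hr1)
  refine (h2.hasSum.mul_left w).congr_fun fun n => ?_
  rcases Nat.eq_zero_or_pos n.1 with h0 | h0
  · simp [h0]
  · rw [← pow_sub_one_mul h0.ne' w]; ring

/-- Termwise differentiation of a double power series in its second variable. -/
theorem hasSum_mul_deriv_snd {c : ℕ → ℕ → ℂ} {ρ : ℝ} {h : ℂ → ℂ → ℂ}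
    (hs : ∀ w z : ℂ, ‖w‖ < ρ → ‖z‖ < ρ →
      HasSum (fun n : ℕ × ℕ => c n.1 n.2 * w ^ n.1 * z ^ n.2) (h w z)) {w z : ℂ} (hw : ‖w‖ < ρ)
    (hz : ‖z‖ < ρ) :
    HasSum (fun n : ℕ × ℕ => n.2 * c n.1 n.2 * w ^ n.1 * z ^ n.2)
      (z * deriv (fun z => h w z) z) := by
  have h1 := hasSum_mul_deriv_fst (c := fun d l => c l d) (h := fun w z => h z w) (ρ := ρ)
    (fun w z hw hz => by
      refine ((Equiv.prodComm ℕ ℕ).hasSum_iff.2 (hs z w hz hw)).congr_fun fun n => ?_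
      simp only [Function.comp_apply, Equiv.prodComm_apply, Prod.fst_swap, Prod.snd_swap]
      ring) hz hw
  refine ((Equiv.prodComm ℕ ℕ).hasSum_iff.2 h1).congr_fun fun n => ?_
  simp only [Function.comp_apply, Equiv.prodComm_apply, Prod.fst_swap, Prod.snd_swap]
  ring

/-- The remainder of a double power series after the terms with both exponents below `N`. -/
theorem norm_sub_sum_le {c : ℕ → ℕ → ℂ} {ρ : ℝ} (hρ : 0 < ρ) {h : ℂ → ℂ → ℂ}
    (hs : ∀ w z : ℂ, ‖w‖ < ρ → ‖z‖ < ρ →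
      HasSum (fun n : ℕ × ℕ => c n.1 n.2 * w ^ n.1 * z ^ n.2) (h w z)) (N : ℕ) :
    ∃ K, ∀ w z : ℂ, ‖w‖ ≤ ρ / 2 → ‖z‖ ≤ ρ / 2 →
      ‖h w z - ∑ d ∈ Finset.range N, ∑ l ∈ Finset.range N, c d l * w ^ d * z ^ l‖ ≤
        K * (‖w‖ ^ N + ‖z‖ ^ N) := by
  have hr : 0 < ρ / 2 := by positivity
  have habs : |ρ| / 2 = ρ / 2 := by rw [abs_of_pos hρ]
  have hS : Summable fun n : ℕ × ℕ => ‖c n.1 n.2‖ * (ρ / 2) ^ n.1 * (ρ / 2) ^ n.2 := by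
    have h1 := (hs (ρ / 2 : ℝ) (ρ / 2 : ℝ) (by simp [habs, hρ]) (by simp [habs, hρ])).summable.norm
    simpa [habs] using h1
  refine ⟨(∑' n : ℕ × ℕ, ‖c n.1 n.2‖ * (ρ / 2) ^ n.1 * (ρ / 2) ^ n.2) * ((ρ / 2) ^ N)⁻¹,
    fun w z hw hz => ?_⟩
  have h1 := hs w z (by linarith) (by linarith)
  rw [← Finset.sum_product', ← h1.tsum_eq,
    ← h1.summable.sum_add_tsum_subtype_compl (Finset.range N ×ˢ Finset.range N)]
  rw [add_sub_cancel_left]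
  have hb : ∀ n : ℕ × ℕ, n ∉ Finset.range N ×ˢ Finset.range N →
      ‖c n.1 n.2 * w ^ n.1 * z ^ n.2‖ ≤
      ‖c n.1 n.2‖ * (ρ / 2) ^ n.1 * (ρ / 2) ^ n.2 * (((ρ / 2) ^ N)⁻¹ * (‖w‖ ^ N + ‖z‖ ^ N)) := by
    intro n hn
    have key : ∀ (m : ℕ) (x : ℝ), N ≤ m → 0 ≤ x → x ≤ ρ / 2 →
        x ^ m ≤ (ρ / 2) ^ m * (((ρ / 2) ^ N)⁻¹ * x ^ N) := by
      intro m x hm hx hx'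
      obtain ⟨k, rfl⟩ := Nat.exists_eq_add_of_le hm
      rw [pow_add, pow_add]
      have : x ^ k ≤ (ρ / 2) ^ k := by gcongr
      have h2 : 0 ≤ x ^ N := by positivity
      calc x ^ N * x ^ k ≤ x ^ N * (ρ / 2) ^ k := by gcongr
        _ = _ := by field_simp
    rw [norm_mul, norm_mul, norm_pow, norm_pow]
    have hw0 := norm_nonneg w
    have hz0 := norm_nonneg z
    have e1 : ‖w‖ ^ n.1 ≤ (ρ / 2) ^ n.1 := by gcongr
    have e2 : ‖z‖ ^ n.2 ≤ (ρ / 2) ^ n.2 := by gcongr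
    have e3 : ‖w‖ ^ n.1 * ‖z‖ ^ n.2 ≤
        (ρ / 2) ^ n.1 * (ρ / 2) ^ n.2 * (((ρ / 2) ^ N)⁻¹ * (‖w‖ ^ N + ‖z‖ ^ N)) := by
      by_cases h1 : N ≤ n.1
      · calc ‖w‖ ^ n.1 * ‖z‖ ^ n.2 ≤ ((ρ / 2) ^ n.1 * (((ρ / 2) ^ N)⁻¹ * ‖w‖ ^ N)) *
              (ρ / 2) ^ n.2 := by gcongr; exact key _ _ h1 hw0 hw
          _ = (ρ / 2) ^ n.1 * (ρ / 2) ^ n.2 * (((ρ / 2) ^ N)⁻¹ * (‖w‖ ^ N + 0)) := by ring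
          _ ≤ _ := by gcongr; positivity
      · have h2 : N ≤ n.2 := by
          simp only [Finset.mem_product, Finset.mem_range, not_and_or, not_lt] at hn
          exact hn.resolve_left h1
        calc ‖w‖ ^ n.1 * ‖z‖ ^ n.2 ≤ (ρ / 2) ^ n.1 *
              ((ρ / 2) ^ n.2 * (((ρ / 2) ^ N)⁻¹ * ‖z‖ ^ N)) := by gcongr; exact key _ _ h2 hz0 hz
          _ = (ρ / 2) ^ n.1 * (ρ / 2) ^ n.2 * (((ρ / 2) ^ N)⁻¹ * (0 + ‖z‖ ^ N)) := by ring
          _ ≤ _ := by gcongr; positivity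
    calc _ = ‖c n.1 n.2‖ * (‖w‖ ^ n.1 * ‖z‖ ^ n.2) := by ring
      _ ≤ ‖c n.1 n.2‖ * _ := mul_le_mul_of_nonneg_left e3 (norm_nonneg _)
      _ = _ := by ring
  have hS2 := hS.mul_right (((ρ / 2) ^ N)⁻¹ * (‖w‖ ^ N + ‖z‖ ^ N))
  have hnn : ∀ n : ℕ × ℕ, 0 ≤ ‖c n.1 n.2‖ * (ρ / 2) ^ n.1 * (ρ / 2) ^ n.2 *
      (((ρ / 2) ^ N)⁻¹ * (‖w‖ ^ N + ‖z‖ ^ N)) := fun n => by positivity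
  refine (tsum_of_norm_bounded (hS2.subtype _).hasSum fun n => hb n.1 n.2).trans ?_
  refine (Summable.tsum_subtype_le _ _ hnn hS2).trans_eq ?_
  rw [tsum_mul_right]
  ring

end DoubleSeries

/-! ### Expansion of the kernel at the branchpoints -/

section Expansion

variable {X : Type*} [TopologicalSpace X] [ChartedSpace ℂ X] {dx : OneForm X} {b : ℕ}
  {a : Fin b → X} {ζ : Fin b → OpenPartialHomeomorph X ℂ} {B : Bidifferential X}

theorem kron_self (i : Fin b) : (kron i i : ℂ) = 1 := if_pos rfl

theorem kron_of_ne {i j : Fin b} (h : i ≠ j) : (kron i j : ℂ) = 0 := if_neg h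

theorem kron_comm (i j : Fin b) : (kron i j : ℂ) = kron j i := by
  simp only [kron, eq_comm]

/-- Near a pair of branchpoints, `B` is the double pole plus the sum of a double power series. -/
theorem exists_coeff_eq_add [T2Space X] (ha : Function.Injective a)
    (hζ : ∀ i, IsBranchCoordinate dx (a i) (ζ i)) (hB : B.IsBergmanKernel) (i j : Fin b) :
    ∃ (c : ℕ → ℕ → ℂ) (h : ℂ × ℂ → ℂ) (ρ : ℝ), 0 < ρ ∧ ∀ w z : ℂ, ‖w‖ < ρ → ‖z‖ < ρ →
      w ∈ (ζ i).target ∧ z ∈ (ζ j).target ∧ AnalyticAt ℂ h (w, z) ∧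
      HasSum (fun n : ℕ × ℕ => c n.1 n.2 * w ^ n.1 * z ^ n.2) (h (w, z)) ∧
      ((ζ i).symm w = (ζ j).symm z → i = j ∧ w = z) ∧
      ((ζ i).symm w ≠ (ζ j).symm z →
        B.coeff (ζ i) (ζ j) w z = kron i j / (w - z) ^ 2 + h (w, z)) := by
  have hi := (hζ i).mem_maximalAtlas
  have hj := (hζ j).mem_maximalAtlas
  have ht : ∀ᶠ y : ℂ × ℂ in 𝓝 (0, 0), y.1 ∈ (ζ i).target ∧ y.2 ∈ (ζ j).target :=
    (continuousAt_fst.eventually ((ζ i).open_target.eventually_mem (hζ i).zero_mem)).and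
      (continuousAt_snd.eventually ((ζ j).open_target.eventually_mem (hζ j).zero_mem))
  obtain ⟨h, hh, hev⟩ : ∃ h : ℂ × ℂ → ℂ, AnalyticAt ℂ h (0, 0) ∧ ∀ᶠ y : ℂ × ℂ in 𝓝 (0, 0),
      ((ζ i).symm y.1 = (ζ j).symm y.2 → i = j ∧ y.1 = y.2) ∧
      ((ζ i).symm y.1 ≠ (ζ j).symm y.2 →
        B.coeff (ζ i) (ζ j) y.1 y.2 = kron i j / (y.1 - y.2) ^ 2 + h y) := by
    by_cases hij : i = j
    · subst hij
      obtain ⟨h, hh, hev⟩ := hB.diag _ hi 0 (hζ i).zero_mem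
      refine ⟨h, hh, ?_⟩
      filter_upwards [hev, ht] with y hy hty
      refine ⟨fun h1 => ⟨rfl, (ζ i).symm.injOn hty.1 hty.2 h1⟩, fun h1 => ?_⟩
      rw [hy fun h2 => h1 (by rw [h2]), kron_self]
    · have hne : (ζ i).symm 0 ≠ (ζ j).symm 0 := by
        rw [(hζ i).symm_zero, (hζ j).symm_zero]; exact fun h => hij (ha h)
      refine ⟨_, hB.holo _ hi _ hj 0 (hζ i).zero_mem 0 (hζ j).zero_mem hne, ?_⟩
      have hc : ContinuousAt (fun y : ℂ × ℂ => ((ζ i).symm y.1, (ζ j).symm y.2)) (0, 0) :=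
        (ContinuousAt.comp (f := Prod.fst) (x := ((0 : ℂ), (0 : ℂ)))
          ((ζ i).continuousAt_symm (hζ i).zero_mem) continuousAt_fst).prodMk
        (ContinuousAt.comp (f := Prod.snd) (x := ((0 : ℂ), (0 : ℂ)))
          ((ζ j).continuousAt_symm (hζ j).zero_mem) continuousAt_snd)
      filter_upwards [hc.eventually (isClosed_diagonal.isOpen_compl.eventually_mem hne)] with y hy
      exact ⟨fun h => absurd h hy, fun _ => by rw [kron_of_ne hij]; simp⟩
  obtain ⟨c, ρ, hρ, hs⟩ := exists_hasSum_of_analyticAt hh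
  obtain ⟨ρ', hρ', hball⟩ := Metric.eventually_nhds_iff_ball.1
    ((hev.and ht).and hh.eventually_analyticAt)
  refine ⟨c, h, min ρ ρ', lt_min hρ hρ', fun w z hw hz => ?_⟩
  obtain ⟨⟨h1, h2⟩, h3⟩ := hball (w, z) (by
    rw [← ball_prod_same]
    exact ⟨by simpa using hw.trans_le (min_le_right _ _),
      by simpa using hz.trans_le (min_le_right _ _)⟩)
  exact ⟨h2.1, h2.2, h3, hs w z (hw.trans_le (min_le_left _ _)) (hz.trans_le (min_le_left _ _)),
    h1.1, h1.2⟩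

/-- The regular part of `B` near a pair of branchpoints is the sum of the power series with
coefficients `bergmanCoeff`. -/
theorem exists_regularPart [T2Space X] (ha : Function.Injective a)
    (hζ : ∀ i, IsBranchCoordinate dx (a i) (ζ i)) (hB : B.IsBergmanKernel) (i j : Fin b) :
    ∃ (h : ℂ × ℂ → ℂ) (ρ : ℝ), 0 < ρ ∧ ∀ w z : ℂ, ‖w‖ < ρ → ‖z‖ < ρ →
      w ∈ (ζ i).target ∧ z ∈ (ζ j).target ∧ AnalyticAt ℂ h (w, z) ∧
      HasSum (fun n : ℕ × ℕ => bergmanCoeff B ζ i n.1 j n.2 * w ^ n.1 * z ^ n.2) (h (w, z)) ∧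
      ((ζ i).symm w = (ζ j).symm z → i = j ∧ w = z) ∧
      ((ζ i).symm w ≠ (ζ j).symm z →
        B.coeff (ζ i) (ζ j) w z = kron i j / (w - z) ^ 2 + h (w, z)) := by
  obtain ⟨c, h, ρ, hρ, hc⟩ := exists_coeff_eq_add ha hζ hB i j
  have hex : ∃ c, B.HasExpansion (ζ i) (ζ j) (kron i j) c := by
    refine ⟨c, ρ, hρ, fun w z hw hz => ?_⟩
    obtain ⟨h1, h2, -, h3, -, h4⟩ := hc w z hw hz
    refine ⟨h1, h2, fun hne => ?_⟩
    rw [h4 hne, add_sub_cancel_left]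
    exact h3
  have hcoef : ∀ d l, bergmanCoeff B ζ i d j l = c d l := by
    intro d l
    unfold bergmanCoeff
    rw [dif_pos hex]
    obtain ⟨ρ', hρ', hc'⟩ := hex.choose_spec
    refine sub_eq_zero.1 (eq_zero_of_hasSum_two (c := fun d l => hex.choose d l - c d l)
      (lt_min hρ hρ') (fun w z hw hz _ _ hwz => ?_) d l)
    obtain ⟨-, -, -, h3, h5, h4⟩ := hc w z (hw.trans_le (min_le_left _ _))
      (hz.trans_le (min_le_left _ _))
    have hne : (ζ i).symm w ≠ (ζ j).symm z := fun h => hwz (h5 h).2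
    have h6 := (hc' w z (hw.trans_le (min_le_right _ _)) (hz.trans_le (min_le_right _ _))).2.2 hne
    rw [h4 hne, add_sub_cancel_left] at h6
    simpa [sub_mul] using h6.sub h3
  refine ⟨h, ρ, hρ, fun w z hw hz => ?_⟩
  simpa only [hcoef] using hc w z hw hz

theorem hasExpansion_bergmanCoeff [T2Space X] (ha : Function.Injective a)
    (hζ : ∀ i, IsBranchCoordinate dx (a i) (ζ i)) (hB : B.IsBergmanKernel) (i j : Fin b) :
    B.HasExpansion (ζ i) (ζ j) (kron i j) fun d l => bergmanCoeff B ζ i d j l := by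
  obtain ⟨h, ρ, hρ, hc⟩ := exists_regularPart ha hζ hB i j
  refine ⟨ρ, hρ, fun w z hw hz => ?_⟩
  obtain ⟨h1, h2, -, h3, -, h4⟩ := hc w z hw hz
  refine ⟨h1, h2, fun hne => ?_⟩
  rw [h4 hne, add_sub_cancel_left]
  exact h3

theorem bergmanCoeff_comm [T2Space X] (ha : Function.Injective a)
    (hζ : ∀ i, IsBranchCoordinate dx (a i) (ζ i)) (hB : B.IsBergmanKernel) (i j : Fin b)
    (d l : ℕ) : bergmanCoeff B ζ i d j l = bergmanCoeff B ζ j l i d := by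
  obtain ⟨h, ρ, hρ, hc⟩ := exists_regularPart ha hζ hB i j
  obtain ⟨h', ρ', hρ', hc'⟩ := exists_regularPart ha hζ hB j i
  refine sub_eq_zero.1 (eq_zero_of_hasSum_two
    (c := fun d l => bergmanCoeff B ζ i d j l - bergmanCoeff B ζ j l i d)
    (lt_min hρ hρ') (fun w z hw hz _ _ hwz => ?_) d l)
  obtain ⟨-, -, -, h3, h5, h4⟩ := hc w z (hw.trans_le (min_le_left _ _))
    (hz.trans_le (min_le_left _ _))
  obtain ⟨-, -, -, h3', -, h4'⟩ := hc' z w (hz.trans_le (min_le_right _ _))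
    (hw.trans_le (min_le_right _ _))
  have hne : (ζ i).symm w ≠ (ζ j).symm z := fun h => hwz (h5 h).2
  have heq : h (w, z) = h' (z, w) := by
    have e1 := h4 hne
    have e2 := h4' hne.symm
    rw [hB.coeff_comm hne, e2, kron_comm j i, show (z - w) ^ 2 = (w - z) ^ 2 by ring] at e1
    exact (add_left_cancel e1).symm
  have h6 : HasSum (fun n : ℕ × ℕ => bergmanCoeff B ζ j n.2 i n.1 * w ^ n.1 * z ^ n.2)
      (h' (z, w)) := by
    refine ((Equiv.prodComm ℕ ℕ).hasSum_iff.2 h3').congr_fun fun n => ?_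
    simp only [Function.comp_apply, Equiv.prodComm_apply, Prod.fst_swap, Prod.snd_swap]
    ring
  have h7 := h3.sub h6
  rw [heq, sub_self] at h7
  simpa only [sub_mul] using h7

/-- The coefficients of `x + z ^ 2 * ∑ c l * z ^ l`. -/
def consTwo (x : ℂ) (c : ℕ → ℂ) : ℕ → ℂ
  | 0 => x
  | 1 => 0
  | l + 2 => c l

theorem hasSum_consTwo {x z s : ℂ} {c : ℕ → ℂ} (h : HasSum (fun l => c l * z ^ l) s) :
    HasSum (fun l => consTwo x c l * z ^ l) (x + z ^ 2 * s) := by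
  rw [← hasSum_nat_add_iff' 2]
  have e : x + z ^ 2 * s - ∑ l ∈ Finset.range 2, consTwo x c l * z ^ l = z ^ 2 * s := by
    simp [Finset.sum_range_succ, consTwo]
  rw [e]
  refine (h.mul_left (z ^ 2)).congr_fun fun l => ?_
  simp only [consTwo]
  ring

theorem hasSum_consTwo_snd {w z s : ℂ} {c : ℕ → ℕ → ℂ}
    (h : HasSum (fun n : ℕ × ℕ => c n.1 n.2 * w ^ n.1 * z ^ n.2) s) :
    HasSum (fun n : ℕ × ℕ => consTwo 0 (c n.1) n.2 * w ^ n.1 * z ^ n.2) (z ^ 2 * s) := by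
  have hinj : Function.Injective fun n : ℕ × ℕ => (n.1, n.2 + 2) := by
    rintro ⟨d, l⟩ ⟨d', l'⟩ h
    simpa using h
  rw [← hinj.hasSum_iff]
  · refine (h.mul_left (z ^ 2)).congr_fun fun n => ?_
    simp only [Function.comp_apply, consTwo]
    ring
  · rintro ⟨d, l⟩ hn
    match l with
    | 0 => simp [consTwo]
    | 1 => simp [consTwo]
    | l + 2 => exact absurd ⟨(d, l), rfl⟩ hn

theorem hasSum_consTwo_fst {w z s : ℂ} {c : ℕ → ℕ → ℂ}
    (h : HasSum (fun n : ℕ × ℕ => c n.1 n.2 * w ^ n.1 * z ^ n.2) s) :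
    HasSum (fun n : ℕ × ℕ => consTwo 0 (fun d => c d n.2) n.1 * w ^ n.1 * z ^ n.2)
      (w ^ 2 * s) := by
  have h1 := hasSum_consTwo_snd (c := fun l d => c d l) (w := z) (z := w) (s := s) (by
    refine ((Equiv.prodComm ℕ ℕ).hasSum_iff.2 h).congr_fun fun n => ?_
    simp only [Function.comp_apply, Equiv.prodComm_apply, Prod.fst_swap, Prod.snd_swap]
    ring)
  refine ((Equiv.prodComm ℕ ℕ).hasSum_iff.2 h1).congr_fun fun n => ?_
  simp only [Function.comp_apply, Equiv.prodComm_apply, Prod.fst_swap, Prod.snd_swap]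
  ring

theorem hasSum_slice {w s : ℂ} {c : ℕ → ℕ → ℂ}
    (h : HasSum (fun n : ℕ × ℕ => c n.1 n.2 * w ^ n.1 * (0 : ℂ) ^ n.2) s) :
    HasSum (fun d => c d 0 * w ^ d) s := by
  refine h.prod_fiberwise fun d => ?_
  convert hasSum_single 0 ?_ using 1
  · simp
  · intro l hl; simp [hl]

end Expansion

/-! ### The formal factorization -/

section Coefficients

/-- Comparison of coefficients in the infinitesimal factorization. Here `h` is the regular part of
the kernel near a pair of branchpoints, `x k + w ^ 2 * P k w` is `w ^ 2` times the kernel with second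
argument at the `k`-th branchpoint, and the identity has been multiplied by `w ^ 2 * z ^ 2`, so that
the double poles leave only the constant `δ`. -/
theorem coeff_relation {ι : Type*} [Fintype ι] {c : ℕ → ℕ → ℂ} {r : ℝ} (hr : 0 < r)
    {h : ℂ → ℂ → ℂ} {p q : ι → ℕ → ℂ} {P Q : ι → ℂ → ℂ} {x y : ι → ℂ} {δ : ℂ}
    (hs : ∀ w z : ℂ, ‖w‖ < r → ‖z‖ < r →
      HasSum (fun n : ℕ × ℕ => c n.1 n.2 * w ^ n.1 * z ^ n.2) (h w z))
    (hP : ∀ k (w : ℂ), ‖w‖ < r → HasSum (fun d => p k d * w ^ d) (P k w))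
    (hQ : ∀ k (z : ℂ), ‖z‖ < r → HasSum (fun l => q k l * z ^ l) (Q k z))
    (hid : ∀ w z : ℂ, ‖w‖ < r → ‖z‖ < r → w ≠ 0 → z ≠ 0 → w ≠ z →
      z ^ 2 * (w * deriv (fun w => h w z) w - h w z) +
        w ^ 2 * (z * deriv (fun z => h w z) z - h w z) - δ +
        ∑ k, (x k + w ^ 2 * P k w) * (y k + z ^ 2 * Q k z) = 0) (d l : ℕ) :
    (d + 1) * c (d + 2) l + (l + 1) * c d (l + 2) = -∑ k, p k d * q k l := by
  have hT := eq_zero_of_hasSum_two hr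
    (c := fun d l => consTwo 0 (fun l => ((d : ℂ) - 1) * c d l) l +
      consTwo 0 (fun d => ((l : ℂ) - 1) * c d l) d - (if (d, l) = (0, 0) then δ else 0) +
      ∑ k, consTwo (x k) (p k) d * consTwo (y k) (q k) l)
    (fun w z hw hz hw0 hz0 hwz => by
      have h0 := hs w z hw hz
      have h1 := hasSum_mul_deriv_fst hs hw hz
      have h2 := hasSum_mul_deriv_snd hs hw hz
      have h3 : HasSum (fun n : ℕ × ℕ => ((n.1 : ℂ) - 1) * c n.1 n.2 * w ^ n.1 * z ^ n.2)
          (w * deriv (fun w => h w z) w - h w z) :=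
        (h1.sub h0).congr_fun fun n => by ring
      have h4 : HasSum (fun n : ℕ × ℕ => ((n.2 : ℂ) - 1) * c n.1 n.2 * w ^ n.1 * z ^ n.2)
          (z * deriv (fun z => h w z) z - h w z) :=
        (h2.sub h0).congr_fun fun n => by ring
      have h5 := hasSum_consTwo_snd (c := fun d l => ((d : ℂ) - 1) * c d l) h3
      have h6 := hasSum_consTwo_fst (c := fun d l => ((l : ℂ) - 1) * c d l) h4
      have h7 : HasSum (fun n : ℕ × ℕ => (if (n.1, n.2) = (0, 0) then δ else 0 : ℂ) *
          w ^ n.1 * z ^ n.2) δ := by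
        convert hasSum_single ((0, 0) : ℕ × ℕ) ?_ using 1
        · simp
        · intro n hn; simp [hn]
      have h8 : ∀ k ∈ Finset.univ, HasSum (fun n : ℕ × ℕ =>
          (consTwo (x k) (p k) n.1 * consTwo (y k) (q k) n.2) * w ^ n.1 * z ^ n.2)
          ((x k + w ^ 2 * P k w) * (y k + z ^ 2 * Q k z)) := by
        intro k _
        have e1 := hasSum_consTwo (x := x k) (hP k w hw)
        have e2 := hasSum_consTwo (x := y k) (hQ k z hz)
        have e3 : Summable fun n : ℕ × ℕ => consTwo (x k) (p k) n.1 * w ^ n.1 *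
            (consTwo (y k) (q k) n.2 * z ^ n.2) :=
          summable_mul_of_summable_norm (f := fun d => consTwo (x k) (p k) d * w ^ d)
            (g := fun l => consTwo (y k) (q k) l * z ^ l) e1.summable.norm e2.summable.norm
        have e4 : HasSum (fun n : ℕ × ℕ => consTwo (x k) (p k) n.1 * w ^ n.1 *
            (consTwo (y k) (q k) n.2 * z ^ n.2))
            ((x k + w ^ 2 * P k w) * (y k + z ^ 2 * Q k z)) :=
          HasSum.mul (f := fun d => consTwo (x k) (p k) d * w ^ d)
            (g := fun l => consTwo (y k) (q k) l * z ^ l) e1 e2 e3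
        refine e4.congr_fun fun n => ?_
        ring
      have h10 := ((h5.add h6).sub h7).add (hasSum_sum h8)
      rw [hid w z hw hz hw0 hz0 hwz] at h10
      refine h10.congr_fun fun n => ?_
      simp only [add_mul, sub_mul, Finset.sum_mul]) (d + 2) (l + 2)
  have h0 : ((d + 2, l + 2) : ℕ × ℕ) ≠ (0, 0) := by simp
  simp only [if_neg h0, consTwo] at hT
  push_cast at hT
  linear_combination hT

end Coefficients

section Recurrence

variable {X : Type*} [TopologicalSpace X] [ChartedSpace ℂ X] [IsManifold 𝓘(ℂ, ℂ) ω X] [T2Space X]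
  [CompactSpace X] [ConnectedSpace X] {dx : OneForm X} {b : ℕ} {a : Fin b → X}
  {ζ : Fin b → OpenPartialHomeomorph X ℂ} {B : Bidifferential X}
  {g : ℕ} {A C : Fin g → ℝ → X}

/-- The infinitesimal factorization in terms of the regular parts: the double pole contributes
`-1 / (w ^ 2 * z ^ 2)`, which cancels against the poles on the right. -/
theorem regularPart_identity (hB : B.IsBergmanKernel)
    (hAC : IsCanonicalHomologyBasis g A C) (hBA : B.IsNormalizedOn A) (hdx : dx.IsMeromorphic)
    (ha : Function.Injective a) (ha_range : range a = {p | 0 < dx.order p})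
    (hζ : ∀ i, IsBranchCoordinate dx (a i) (ζ i)) {i j : Fin b} {w z : ℂ}
    (hw : w ∈ (ζ i).target) (hz : z ∈ (ζ j).target) (hw0 : w ≠ 0) (hz0 : z ≠ 0) (hwz : w ≠ z)
    (hne : (ζ i).symm w ≠ (ζ j).symm z) {h : ℂ × ℂ → ℂ} (hh : AnalyticAt ℂ h (w, z))
    (hev : ∀ᶠ y in 𝓝 (w, z), B.coeff (ζ i) (ζ j) y.1 y.2 = kron i j / (y.1 - y.2) ^ 2 + h y)
    {P Q : Fin b → ℂ} (hP : ∀ k, B.coeff (ζ i) (ζ k) w 0 = kron i k / w ^ 2 + P k)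
    (hQ : ∀ k, B.coeff (ζ j) (ζ k) z 0 = kron j k / z ^ 2 + Q k) :
    z ^ 2 * (w * deriv (fun w => h (w, z)) w - h (w, z)) +
        w ^ 2 * (z * deriv (fun z => h (w, z)) z - h (w, z)) - kron i j +
        ∑ k, (kron i k + w ^ 2 * P k) * (kron j k + z ^ 2 * Q k) = 0 := by
  have key := hB.deriv_div_add_deriv_div hAC hBA hdx ha ha_range hζ (hζ i).isRootCoordinate
    (hζ j).isRootCoordinate hw hz hw0 hz0 hne
  have hsub : w - z ≠ 0 := sub_ne_zero.2 hwz
  have hd1 : deriv (fun w => B.coeff (ζ i) (ζ j) w z / w) w =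
      (-2 * kron i j / (w - z) ^ 3 + deriv (fun w => h (w, z)) w) / w -
        (kron i j / (w - z) ^ 2 + h (w, z)) / w ^ 2 := by
    have hev : (fun w => B.coeff (ζ i) (ζ j) w z / w) =ᶠ[𝓝 w]
        fun w => (kron i j * ((w - z) ^ 2)⁻¹ + h (w, z)) / w := by
      have hc : Tendsto (fun w' : ℂ => (w', z)) (𝓝 w) (𝓝 (w, z)) :=
        (continuous_id.prodMk continuous_const).tendsto w
      filter_upwards [hc.eventually hev] with y hy
      rw [hy, div_eq_mul_inv (kron i j)]
    have e1 : HasDerivAt (fun w => ((w - z) ^ 2)⁻¹) (-(2 * (w - z)) / ((w - z) ^ 2) ^ 2) w := by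
      have := (((hasDerivAt_id w).sub_const z).fun_pow 2).fun_inv (pow_ne_zero 2 hsub)
      simpa using this
    have e2 : HasDerivAt (fun w => h (w, z)) (deriv (fun w => h (w, z)) w) w :=
      (AnalyticAt.comp_left hh).differentiableAt.hasDerivAt
    have e3 := ((e1.const_mul (kron i j)).fun_add e2).fun_div (hasDerivAt_id w) hw0
    rw [hev.deriv_eq]
    refine e3.deriv.trans ?_
    simp only [id]
    field_simp
  have hd2 : deriv (fun z => B.coeff (ζ i) (ζ j) w z / z) z =
      (2 * kron i j / (w - z) ^ 3 + deriv (fun z => h (w, z)) z) / z -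
        (kron i j / (w - z) ^ 2 + h (w, z)) / z ^ 2 := by
    have hev : (fun z => B.coeff (ζ i) (ζ j) w z / z) =ᶠ[𝓝 z]
        fun z => (kron i j * ((w - z) ^ 2)⁻¹ + h (w, z)) / z := by
      have hc : Tendsto (fun z' : ℂ => (w, z')) (𝓝 z) (𝓝 (w, z)) :=
        (continuous_const.prodMk continuous_id).tendsto z
      filter_upwards [hc.eventually hev] with y hy
      rw [hy, div_eq_mul_inv (kron i j)]
    have e1 : HasDerivAt (fun z => ((w - z) ^ 2)⁻¹) (2 * (w - z) / ((w - z) ^ 2) ^ 2) z := by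
      have := (((hasDerivAt_id z).const_sub w).fun_pow 2).fun_inv (pow_ne_zero 2 hsub)
      simpa using this
    have e2 : HasDerivAt (fun z => h (w, z)) (deriv (fun z => h (w, z)) z) z :=
      (AnalyticAt.comp_right hh).differentiableAt.hasDerivAt
    have e3 := ((e1.const_mul (kron i j)).fun_add e2).fun_div (hasDerivAt_id z) hz0
    rw [hev.deriv_eq]
    refine e3.deriv.trans ?_
    simp only [id]
    field_simp
  have hsum : ∑ k, B.coeff (ζ i) (ζ k) w 0 * B.coeff (ζ j) (ζ k) z 0 = (w ^ 2)⁻¹ * (z ^ 2)⁻¹ *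
      ∑ k, (kron i k + w ^ 2 * P k) * (kron j k + z ^ 2 * Q k) := by
    rw [Finset.mul_sum]
    refine Finset.sum_congr rfl fun k _ => ?_
    rw [hP, hQ]
    field_simp
  rw [hd1, hd2, hsum] at key
  generalize (∑ k, (kron i k + w ^ 2 * P k) * (kron j k + z ^ 2 * Q k)) = S at key ⊢
  generalize deriv (fun w => h (w, z)) w = h₁ at key ⊢
  generalize deriv (fun z => h (w, z)) z = h₂ at key ⊢
  generalize h (w, z) = h₀ at key ⊢
  generalize (kron i j : ℂ) = δ at key ⊢
  have hδ : (-2 * δ / (w - z) ^ 3) / w - δ / (w - z) ^ 2 / w ^ 2 +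
      ((2 * δ / (w - z) ^ 3) / z - δ / (w - z) ^ 2 / z ^ 2) = -δ / (w ^ 2 * z ^ 2) := by
    field_simp
    ring
  have key2 : -δ / (w ^ 2 * z ^ 2) + (h₁ / w - h₀ / w ^ 2) + (h₂ / z - h₀ / z ^ 2) =
      -((w ^ 2)⁻¹ * (z ^ 2)⁻¹ * S) := by
    rw [← hδ, ← key]; ring
  field_simp at key2
  linear_combination key2

/-- Comparison of coefficients in the infinitesimal factorization near a pair of branchpoints. -/
theorem bergmanCoeff_recurrence (hB : B.IsBergmanKernel)
    (hAC : IsCanonicalHomologyBasis g A C) (hBA : B.IsNormalizedOn A) (hdx : dx.IsMeromorphic)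
    (ha : Function.Injective a) (ha_range : range a = {p | 0 < dx.order p})
    (hζ : ∀ i, IsBranchCoordinate dx (a i) (ζ i)) (i j : Fin b) (d l : ℕ) :
    (d + 1) * bergmanCoeff B ζ i (d + 2) j l + (l + 1) * bergmanCoeff B ζ i d j (l + 2) =
      -∑ k, bergmanCoeff B ζ i d k 0 * bergmanCoeff B ζ j l k 0 := by
  choose h ρ hρ hh using exists_regularPart ha hζ hB
  obtain ⟨r, hr0, hr⟩ : ∃ r > 0, ∀ i j, r ≤ ρ i j := by
    have h1 : ∀ᶠ r in 𝓝[>] (0 : ℝ), 0 < r ∧ ∀ i j, r ≤ ρ i j := by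
      refine (eventually_mem_nhdsWithin).and (eventually_nhdsWithin_of_eventually_nhds ?_)
      exact eventually_all.2 fun i => eventually_all.2 fun j => eventually_le_nhds (hρ i j)
    obtain ⟨r, h1, h2⟩ := h1.exists
    exact ⟨r, h1, h2⟩
  have hh' : ∀ (i j : Fin b) (w z : ℂ), ‖w‖ < r → ‖z‖ < r → _ := fun i j w z hw hz =>
    hh i j w z (hw.trans_le (hr i j)) (hz.trans_le (hr i j))
  have hsl : ∀ (i k : Fin b) (w : ℂ), ‖w‖ < r →
      HasSum (fun d => bergmanCoeff B ζ i d k 0 * w ^ d) (h i k (w, 0)) := fun i k w hw =>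
    hasSum_slice (c := fun d l => bergmanCoeff B ζ i d k l)
      (hh' i k w 0 hw (by simpa using hr0)).2.2.2.1
  refine coeff_relation hr0 (c := fun d l => bergmanCoeff B ζ i d j l)
    (p := fun k d => bergmanCoeff B ζ i d k 0) (q := fun k l => bergmanCoeff B ζ j l k 0)
    (P := fun k w => h i k (w, 0)) (Q := fun k z => h j k (z, 0)) (h := fun w z => h i j (w, z))
    (x := fun k => kron i k) (y := fun k => kron j k) (δ := kron i j)
    (fun w z hw hz => (hh' i j w z hw hz).2.2.2.1) (fun k w hw => hsl i k w hw)
    (fun k z hz => hsl j k z hz) (fun w z hw hz hw0 hz0 hwz => ?_) d l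
  have hi := hh' i j w z hw hz
  have hP : ∀ (i k : Fin b) (w : ℂ), ‖w‖ < r → w ≠ 0 →
      B.coeff (ζ i) (ζ k) w 0 = kron i k / w ^ 2 + h i k (w, 0) := by
    intro i k w hw hw0
    have e := hh' i k w 0 hw (by simpa using hr0)
    rw [e.2.2.2.2.2 fun h => hw0 (e.2.2.2.2.1 h).2, sub_zero]
  refine regularPart_identity hB hAC hBA hdx ha ha_range hζ hi.1 hi.2.1 hw0 hz0 hwz
    (fun h => hwz (hi.2.2.2.2.1 h).2) hi.2.2.1 ?_ (fun k => hP i k w hw hw0)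
    fun k => hP j k z hz hz0
  have c1 : Tendsto (fun y : ℂ × ℂ => ‖y.1‖) (𝓝 (w, z)) (𝓝 ‖w‖) :=
    (continuous_norm.comp continuous_fst).tendsto _
  have c2 : Tendsto (fun y : ℂ × ℂ => ‖y.2‖) (𝓝 (w, z)) (𝓝 ‖z‖) :=
    (continuous_norm.comp continuous_snd).tendsto _
  filter_upwards [c1.eventually_lt_const hw, c2.eventually_lt_const hz,
    isClosed_diagonal.isOpen_compl.eventually_mem (show (w, z) ∈ (diagonal ℂ)ᶜ from hwz)]
    with y h1 h2 h3
  have e := hh' i j y.1 y.2 h1 h2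
  exact e.2.2.2.2.2 fun h => h3 (e.2.2.2.2.1 h).2

/-- The recurrence for the normalized coefficients, which are the coefficients of the two Laplace
transforms. -/
theorem hatCoeff_recurrence (hB : B.IsBergmanKernel)
    (hAC : IsCanonicalHomologyBasis g A C) (hBA : B.IsNormalizedOn A) (hdx : dx.IsMeromorphic)
    (ha : Function.Injective a) (ha_range : range a = {p | 0 < dx.order p})
    (hζ : ∀ i, IsBranchCoordinate dx (a i) (ζ i)) (i j : Fin b) (d l : ℕ) :
    hatCoeff B ζ i (d + 1) j l + hatCoeff B ζ i d j (l + 1) =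
      -∑ k, hatCoeff B ζ k 0 i d * hatCoeff B ζ k 0 j l := by
  have hdf : ∀ n : ℕ, ((2 * (n + 1) - 1).doubleFactorial : ℂ) =
      (2 * n + 1) * ((2 * n - 1).doubleFactorial : ℂ) := by
    intro n
    rcases Nat.eq_zero_or_pos n with rfl | hn
    · simp
    · obtain ⟨m, rfl⟩ := Nat.exists_eq_add_of_lt hn
      rw [show 2 * (0 + m + 1 + 1) - 1 = (2 * (0 + m + 1) - 1) + 2 by omega,
        Nat.doubleFactorial_add_two, Nat.cast_mul,
        show 2 * (0 + m + 1) - 1 + 2 = 2 * (0 + m + 1) + 1 by omega]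
      push_cast
      ring
  have key := bergmanCoeff_recurrence hB hAC hBA hdx ha ha_range hζ i j (2 * d) (2 * l)
  simp only [bergmanCoeff_comm ha hζ hB _ _ _ 0] at key
  simp only [hatCoeff, Nat.cast_mul, hdf, mul_zero]
  simp only [show 2 * (d + 1) = 2 * d + 2 by ring, show 2 * (l + 1) = 2 * l + 2 by ring]
  set D : ℂ := ((2 * d - 1).doubleFactorial : ℂ)
  set L : ℂ := ((2 * l - 1).doubleFactorial : ℂ)
  have hsum : ∑ k, ((0 - 1 : ℕ).doubleFactorial : ℂ) * D / 2 ^ (0 + d + 1) *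
      bergmanCoeff B ζ k 0 i (2 * d) * (((0 - 1 : ℕ).doubleFactorial : ℂ) * L / 2 ^ (0 + l + 1) *
        bergmanCoeff B ζ k 0 j (2 * l)) = D * L / 2 ^ (d + l + 2) *
      ∑ k, bergmanCoeff B ζ k 0 i (2 * d) * bergmanCoeff B ζ k 0 j (2 * l) := by
    rw [Finset.mul_sum]
    refine Finset.sum_congr rfl fun k _ => ?_
    simp only [zero_tsub, Nat.doubleFactorial, Nat.cast_one, zero_add, pow_add]
    field_simp
  rw [hsum]
  push_cast at key
  have h2 : ∀ x y : ℂ, (2 * (d : ℂ) + 1) * D * L / 2 ^ (d + 1 + l + 1) * x +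
      D * ((2 * (l : ℂ) + 1) * L) / 2 ^ (d + (l + 1) + 1) * y =
      D * L / 2 ^ (d + l + 2) * ((2 * (d : ℂ) + 1) * x + (2 * (l : ℂ) + 1) * y) := by
    intro x y
    rw [show d + 1 + l + 1 = d + l + 2 by ring, show d + (l + 1) + 1 = d + l + 2 by ring]
    ring
  rw [h2, key]
  ring

theorem hatCoeff_comm (hB : B.IsBergmanKernel) (ha : Function.Injective a)
    (hζ : ∀ i, IsBranchCoordinate dx (a i) (ζ i)) (i j : Fin b) (d l : ℕ) :
    hatCoeff B ζ i d j l = hatCoeff B ζ j l i d := by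
  rw [hatCoeff, hatCoeff, bergmanCoeff_comm ha hζ hB, mul_comm (Nat.doubleFactorial _),
    add_comm d l]

theorem coeff_subst_X_zero_mul_subst_X_one (p q : PowerSeries ℂ) (m : Fin 2 →₀ ℕ) :
    MvPowerSeries.coeff m (p.subst (MvPowerSeries.X 0 : MvPowerSeries (Fin 2) ℂ) *
      q.subst (MvPowerSeries.X 1 : MvPowerSeries (Fin 2) ℂ)) = p.coeff (m 0) * q.coeff (m 1) := by
  classical
  have hm : m = Finsupp.single 0 (m 0) + Finsupp.single 1 (m 1) := by
    ext i; fin_cases i <;> simp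
  rw [MvPowerSeries.coeff_mul, Finset.sum_eq_single
    (Finsupp.single 0 (m 0), Finsupp.single 1 (m 1))]
  · simp [PowerSeries.coeff_subst_single]
  · rintro ⟨m₁, m₂⟩ h1 h2
    rw [Finset.HasAntidiagonal.mem_antidiagonal] at h1
    simp only at h1
    rw [PowerSeries.coeff_subst_single, PowerSeries.coeff_subst_single]
    by_contra hne
    have e1 : m₁ = Finsupp.single 0 (m₁ 0) := by
      by_contra h; simp [if_neg h] at hne
    have e2 : m₂ = Finsupp.single 1 (m₂ 1) := by
      by_contra h; simp [if_neg h] at hne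
    have e3 : m₂ 0 = 0 := by rw [e2]; simp
    have e4 : m₁ 1 = 0 := by rw [e1]; simp
    apply h2
    rw [← h1, Finsupp.add_apply, Finsupp.add_apply, e3, e4, add_zero, zero_add, ← e1, ← e2]
  · intro h
    exact absurd (Finset.HasAntidiagonal.mem_antidiagonal.2 hm.symm) h

/-- The factorization as an identity of formal power series. -/
theorem formal_factorization (hB : B.IsBergmanKernel)
    (hAC : IsCanonicalHomologyBasis g A C) (hBA : B.IsNormalizedOn A) (hdx : dx.IsMeromorphic)
    (ha : Function.Injective a) (ha_range : range a = {p | 0 < dx.order p})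
    (hζ : ∀ i, IsBranchCoordinate dx (a i) (ζ i)) (i j : Fin b) :
    (MvPowerSeries.X 0 + MvPowerSeries.X 1) * checkSeries B ζ i j =
      MvPowerSeries.C (kron i j) -
        ∑ k, (fSeries B ζ i k).subst (MvPowerSeries.X 0 : MvPowerSeries (Fin 2) ℂ) *
          (fSeries B ζ j k).subst (MvPowerSeries.X 1 : MvPowerSeries (Fin 2) ℂ) := by
  classical
  ext m
  have hcheck : ∀ m, MvPowerSeries.coeff m (checkSeries B ζ i j) =
    hatCoeff B ζ i (m 0) j (m 1) := fun m => rfl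
  have hle : ∀ s : Fin 2, Finsupp.single s 1 ≤ m ↔ m s ≠ 0 := fun s => by
    rw [Finsupp.single_le_iff, Nat.one_le_iff_ne_zero]
  have hm0 : m = 0 ↔ m 0 = 0 ∧ m 1 = 0 := by
    constructor
    · rintro rfl; simp
    · rintro ⟨h1, h2⟩; ext s; fin_cases s <;> simp [h1, h2]
  rw [add_mul, map_add, map_sub, map_sum]
  simp only [coeff_subst_X_zero_mul_subst_X_one]
  rw [MvPowerSeries.X_def, MvPowerSeries.X_def,
    MvPowerSeries.coeff_monomial_mul, MvPowerSeries.coeff_monomial_mul, MvPowerSeries.coeff_C,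
    hcheck, hcheck]
  simp only [hle, hm0, fSeries, PowerSeries.coeff_mk,
    Finsupp.tsub_apply, Finsupp.single_apply]
  norm_num
  have hk : ∀ (i : Fin b) (F : Fin b → ℂ), ∑ k, kron i k * F k = F i := by
    intro i F
    simp [kron]
  rcases h0 : m 0 with _ | d <;> rcases h1 : m 1 with _ | l
  · simp [hk, kron_comm]
  · simp [hk]
  · simp only [mul_comm _ (kron j _), hk]
    simp [hatCoeff_comm hB ha hζ i j]
  · simp only [neg_mul_neg]
    have := hatCoeff_recurrence hB hAC hBA hdx ha ha_range hζ i j d l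
    simp [← this, add_comm]

end Recurrence

/-! ### Root coordinates -/

section RootCharts

variable {X : Type*} [TopologicalSpace X] [ChartedSpace ℂ X]

theorem trans_mem_maximalAtlas {M H : Type*} [TopologicalSpace H] [TopologicalSpace M]
    [ChartedSpace H M] {G : StructureGroupoid H} {e : OpenPartialHomeomorph M H}
    (he : e ∈ G.maximalAtlas M) {k : OpenPartialHomeomorph H H} (hk : k ∈ G) :
    e.trans k ∈ G.maximalAtlas M := by
  refine mem_maximalAtlas_iff.2 fun e' he' => ?_
  have h := mem_maximalAtlas_iff.1 he e' he'
  constructor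
  · rw [OpenPartialHomeomorph.trans_symm_eq_symm_trans_symm, OpenPartialHomeomorph.trans_assoc]
    exact G.trans (G.symm hk) h.1
  · rw [← OpenPartialHomeomorph.trans_assoc]
    exact G.trans h.2 hk

theorem mem_contDiffGroupoid_of_analytic {k : OpenPartialHomeomorph ℂ ℂ}
    (h : ∀ w ∈ k.source, AnalyticAt ℂ k w ∧ deriv k w ≠ 0) :
    k ∈ contDiffGroupoid ω 𝓘(ℂ, ℂ) := by
  have h1 : ContDiffOn ℂ ω k k.source := fun w hw => (h w hw).1.contDiffAt.contDiffWithinAt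
  have h2 : ContDiffOn ℂ ω k.symm k.target := by
    intro z hz
    have hs := k.map_target hz
    obtain ⟨h3, h4⟩ := h _ hs
    have := k.analyticAt_symm (i := ContinuousLinearEquiv.unitsEquivAut ℂ (Units.mk0 _ h4)) hz h3
      (by
        refine ContinuousLinearMap.ext_ring ?_
        simp)
    exact this.contDiffAt.contDiffWithinAt
  rw [contDiffGroupoid, mem_groupoid_of_pregroupoid, contDiffPregroupoid]
  simpa using ⟨h1, h2⟩

/-- Away from the zeros and poles of `dx` there are root coordinates, with any nonzero value at the
point: they are the branches of `√(x + const)`. -/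
theorem exists_rootCoordinate [IsManifold 𝓘(ℂ, ℂ) ω X] {dx : OneForm X} (hdx : dx.IsMeromorphic)
    {p : X} (hp : dx p ≠ 0) {s : ℂ} (hs : s ≠ 0) :
    ∃ e, IsRootCoordinate dx e ∧ p ∈ e.source ∧ e p = s := by
  have hf := IsManifold.chart_mem_maximalAtlas (I := 𝓘(ℂ, ℂ)) (n := ω) p
  have hpf := mem_chart_source ℂ p
  generalize chartAt ℂ p = f at hf hpf
  have h0 : dx.coeff f (f p) ≠ 0 := fun h => hp ((dx.coeff_eq_zero_iff hf hpf).1 h)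
  have hNF := hdx f hf _ (f.map_source hpf)
  have han : AnalyticAt ℂ (dx.coeff f) (f p) := by
    rw [← hNF.meromorphicOrderAt_nonneg_iff_analyticAt, hNF.meromorphicOrderAt_eq_zero_iff.2 h0]
  obtain ⟨r, hr, hball⟩ := Metric.eventually_nhds_iff_ball.1 han.eventually_analyticAt
  have hd : DifferentiableOn ℂ (dx.coeff f) (Metric.ball (f p) r) := fun w hw =>
    (hball w hw).differentiableAt.differentiableWithinAt
  obtain ⟨G, hG⟩ := hd.isExactOn_ball
  have hpr : f p ∈ Metric.ball (f p) r := Metric.mem_ball_self hr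
  have hs2 : s ^ 2 ≠ 0 := pow_ne_zero 2 hs
  let Q : ℂ → ℂ := fun w => 1 + (G w - G (f p)) / s ^ 2
  let σ : ℂ → ℂ := fun w => s * Complex.exp (Complex.log (Q w) / 2)
  have hQ : ∀ w ∈ Metric.ball (f p) r, HasDerivAt Q (dx.coeff f w / s ^ 2) w := fun w hw =>
    (((hG w hw).sub_const _).div_const _).const_add _
  have hQp : Q (f p) = 1 := by simp [Q]
  have hσp : σ (f p) = s := by simp [σ, hQp]
  -- an open set on which everything is defined
  let U : Set ℂ := {w | w ∈ Metric.ball (f p) r ∧ w ∈ f.target ∧ Q w ∈ Complex.slitPlane ∧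
    dx.coeff f w ≠ 0}
  have hUev : ∀ᶠ w in 𝓝 (f p), w ∈ U := by
    refine (Metric.isOpen_ball.eventually_mem hpr).and ((f.open_target.eventually_mem
      (f.map_source hpf)).and (((hQ _ hpr).continuousAt.eventually
        (Complex.isOpen_slitPlane.eventually_mem ?_)).and (han.continuousAt.eventually_ne h0)))
    rw [hQp]; exact Complex.one_mem_slitPlane
  have hσsq : ∀ w ∈ U, σ w ^ 2 = s ^ 2 * Q w := by
    intro w hw
    have hQ0 : Q w ≠ 0 := Complex.slitPlane_ne_zero hw.2.2.1
    simp only [σ]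
    rw [mul_pow, ← Complex.exp_nat_mul]
    congr 1
    rw [show ((2 : ℕ) : ℂ) * (Complex.log (Q w) / 2) = Complex.log (Q w) by push_cast; ring,
      Complex.exp_log hQ0]
  have hσ0 : ∀ w, σ w ≠ 0 := fun w => mul_ne_zero hs (Complex.exp_ne_zero _)
  have hσan : ∀ w ∈ U, AnalyticAt ℂ σ w := by
    intro w hw
    have hGan : AnalyticAt ℂ G w := by
      have : DifferentiableOn ℂ G (Metric.ball (f p) r) := fun w hw =>
        (hG w hw).differentiableAt.differentiableWithinAt
      exact this.analyticAt (Metric.isOpen_ball.mem_nhds hw.1)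
    have hQan : AnalyticAt ℂ Q w :=
      analyticAt_const.add ((hGan.sub analyticAt_const).div_const)
    exact analyticAt_const.mul (((hQan.clog hw.2.2.1).div_const).cexp)
  obtain ⟨V, hVU, hVo, hpV⟩ := eventually_nhds_iff.1 hUev
  have hσd : ∀ w ∈ V, deriv σ w * (2 * σ w) = dx.coeff f w := by
    intro w hw
    have h1 := ((hσan w (hVU w hw)).differentiableAt.hasDerivAt.fun_pow 2)
    have h2 : (fun w => σ w ^ 2) =ᶠ[𝓝 w] fun w => s ^ 2 * Q w := by
      filter_upwards [hVo.mem_nhds hw] with y hy using hσsq y (hVU y hy)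
    have h3 := ((hQ w (hVU w hw).1).const_mul (s ^ 2)).congr_of_eventuallyEq h2
    have h4 := h1.unique h3
    rw [mul_div_cancel₀ _ hs2] at h4
    rw [← h4]
    norm_num
    ring
  have hσ' : ∀ w ∈ V, deriv σ w ≠ 0 := fun w hw h => (hVU w hw).2.2.2 (by
    rw [← hσd w hw, h, zero_mul])
  have hstrict : HasStrictDerivAt σ (deriv σ (f p)) (f p) :=
    (hσan _ (hVU _ hpV)).hasStrictDerivAt
  let k₀ : OpenPartialHomeomorph ℂ ℂ :=
    hstrict.hasStrictFDerivAt_equiv (hσ' _ hpV) |>.toOpenPartialHomeomorph σ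
  have hk₀ : ⇑k₀ = σ := HasStrictFDerivAt.toOpenPartialHomeomorph_coe _
  have hk₀p : f p ∈ k₀.source := HasStrictFDerivAt.mem_toOpenPartialHomeomorph_source _
  let k := k₀.restrOpen V hVo
  have hk : ⇑k = σ := hk₀
  have hks : k.source = k₀.source ∩ V := k₀.restrOpen_source V hVo
  have hkV : ∀ w ∈ k.source, w ∈ V := fun w hw => (hks ▸ hw).2
  have hkG : k ∈ contDiffGroupoid ω 𝓘(ℂ, ℂ) := mem_contDiffGroupoid_of_analytic fun w hw => by
    rw [hk]; exact ⟨hσan w (hVU w (hkV w hw)), hσ' w (hkV w hw)⟩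
  have heM := trans_mem_maximalAtlas hf hkG
  have hpe : p ∈ (f.trans k).source := by
    rw [OpenPartialHomeomorph.trans_source]
    exact ⟨hpf, by rw [mem_preimage, hks]; exact ⟨hk₀p, hpV⟩⟩
  refine ⟨f.trans k, ⟨heM, fun y hy => ?_⟩, hpe, ?_⟩
  · obtain ⟨q, hq, rfl⟩ : ∃ q ∈ (f.trans k).source, (f.trans k) q = y :=
      ⟨_, (f.trans k).map_target hy, (f.trans k).right_inv hy⟩
    have hq' := hq
    rw [OpenPartialHomeomorph.trans_source] at hq'
    have hqf : f.symm (f q) = q := f.left_inv hq'.1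
    have hwV : f q ∈ V := hkV _ hq'.2
    have h1 := dx.coeff_eq_deriv_mul hf heM (f.map_source hq'.1) (by rw [hqf]; exact hq)
    have h2 : (f.trans k) ∘ f.symm =ᶠ[𝓝 (f q)] σ := by
      filter_upwards [f.open_target.mem_nhds (f.map_source hq'.1)] with w hw
      simp [hk, f.right_inv hw]
    have h3 : (f.trans k) q = σ (f q) := by simp [hk]
    rw [h2.deriv_eq, hqf] at h1
    have h4 := hσd _ hwV
    rw [h1] at h4
    rw [← mul_left_cancel₀ (hσ' _ hwV) h4, h3]
  · rw [OpenPartialHomeomorph.coe_trans, Function.comp_apply, hk, hσp]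

end RootCharts

/-! ### Steepest descent paths -/

section SteepestDescent

variable {X : Type*} [TopologicalSpace X] [ChartedSpace ℂ X]

/-- At time `s` the path `γ` runs along the real axis of the coordinate `e`, with unit speed and at
the point `s` of the axis. -/
structure Follows (γ : ℝ → X) (e : OpenPartialHomeomorph X ℂ) (s : ℝ) : Prop where
  mem_source : γ s ∈ e.source
  apply_eq : e (γ s) = s
  dirDeriv_eq : dirDeriv e (γ s) (velocity γ s) = 1

variable {dx : OneForm X} {e f : OpenPartialHomeomorph X ℂ} {γ γ' : ℝ → X} {I : Set ℝ}

theorem Follows.mem_target {s : ℝ} (h : Follows γ e s) : (s : ℂ) ∈ e.target :=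
  h.apply_eq ▸ e.map_source h.mem_source

theorem Follows.symm_eq {s : ℝ} (h : Follows γ e s) : e.symm s = γ s := by
  rw [← h.apply_eq, e.left_inv h.mem_source]

theorem Follows.oneForm {s : ℝ} (h : Follows γ e s)
    (he : e ∈ IsManifold.maximalAtlas 𝓘(ℂ, ℂ) ω X) (η : OneForm X) :
    η (γ s) (velocity γ s) = η.coeff e s := by
  rw [η.apply_eq he h.mem_source, h.dirDeriv_eq, h.apply_eq, one_mul]

theorem Follows.bidifferential {s s' : ℝ} (h : Follows γ e s) (h' : Follows γ' f s')
    (he : e ∈ IsManifold.maximalAtlas 𝓘(ℂ, ℂ) ω X) (hf : f ∈ IsManifold.maximalAtlas 𝓘(ℂ, ℂ) ω X)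
    (B : Bidifferential X) :
    B (γ s) (γ' s') (velocity γ s) (velocity γ' s') = B.coeff e f s s' := by
  rw [B.apply_eq he hf h.mem_source h'.mem_source, h.dirDeriv_eq, h'.dirDeriv_eq, h.apply_eq,
    h'.apply_eq, one_mul, one_mul]

/-- If a path agrees with the real axis of a coordinate, then so does its velocity. -/
theorem eventually_follows_of_eq (he : e ∈ IsManifold.maximalAtlas 𝓘(ℂ, ℂ) ω X)
    (hI : UniqueDiffOn ℝ I) (hγ : ∀ s ∈ I, MDifferentiableAt 𝓘(ℝ, ℝ) 𝓘(ℝ, ℂ) γ s) {s₀ : ℝ}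
    (h : ∀ᶠ s in 𝓝[I] s₀, γ s ∈ e.source ∧ e (γ s) = s) : ∀ᶠ s in 𝓝[I] s₀, Follows γ e s := by
  filter_upwards [eventually_eventually_nhdsWithin.2 h, self_mem_nhdsWithin] with s hs hsI
  obtain ⟨h1, h2⟩ := hs.self_of_nhdsWithin hsI
  refine ⟨h1, h2, ?_⟩
  have h3 := (hasDerivAt_comp_path (hγ s hsI) (mdifferentiableAt_coord he h1)).hasDerivWithinAt
    (s := I)
  have h4 : HasDerivWithinAt (fun s : ℝ => (s : ℂ)) 1 I s :=
    Complex.ofRealCLM.hasDerivAt.hasDerivWithinAt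
  refine (hI s hsI).eq_deriv _ h3 (h4.congr_of_eventuallyEq_of_mem ?_ hsI)
  filter_upwards [hs] with t ht using ht.2

theorem IsSteepestDescent.eventually_follows_zero (hγ : IsSteepestDescent dx e I γ)
    (he : e ∈ IsManifold.maximalAtlas 𝓘(ℂ, ℂ) ω X) (h0 : (0 : ℂ) ∈ e.target)
    (hI : UniqueDiffOn ℝ I) (hI0 : I ∈ 𝓝 0) : ∀ᶠ s in 𝓝 0, Follows γ e s := by
  rw [← nhdsWithin_eq_nhds.2 hI0]
  refine eventually_follows_of_eq he hI hγ.diff (eventually_nhdsWithin_of_eventually_nhds ?_)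
  have hc : Tendsto (fun s : ℝ => (s : ℂ)) (𝓝 0) (𝓝 0) :=
    Complex.continuous_ofReal.tendsto' 0 0 Complex.ofReal_zero
  filter_upwards [hγ.near, hc.eventually (e.open_target.eventually_mem h0)] with s h1 h2
  rw [h1]
  exact ⟨e.map_target h2, e.right_inv h2⟩

/-- A steepest descent path runs along the real axis of every root coordinate that has the right
value at one of its points. -/
theorem IsSteepestDescent.eventually_follows (hγ : IsSteepestDescent dx e I γ)
    (hI : UniqueDiffOn ℝ I) (hI' : I.OrdConnected) (hf : IsRootCoordinate dx f) {s₀ : ℝ}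
    (hs₀ : s₀ ∈ I) (hs0 : s₀ ≠ 0) (h1 : γ s₀ ∈ f.source) (h2 : f (γ s₀) = s₀) :
    ∀ᶠ s in 𝓝[I] s₀, Follows γ f s := by
  have hfa := hf.mem_maximalAtlas
  refine eventually_follows_of_eq hfa hI hγ.diff ?_
  have hc : ContinuousAt γ s₀ := (hγ.diff s₀ hs₀).continuousAt
  have hc2 : ContinuousAt (f ∘ γ) s₀ := (f.continuousAt h1).comp hc
  have hne : ∀ᶠ s in 𝓝 s₀, (f (γ s) : ℂ) + s ≠ 0 := by
    refine ContinuousAt.eventually_ne (g := fun s : ℝ => (f (γ s) : ℂ) + s)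
      (hc2.add Complex.continuous_ofReal.continuousAt) ?_
    rw [h2, ← two_mul]
    exact_mod_cast mul_ne_zero two_ne_zero hs0
  obtain ⟨δ, hδ, hball⟩ := Metric.eventually_nhds_iff_ball.1
    ((hc.eventually (f.open_source.eventually_mem h1)).and hne)
  have hconv : Convex ℝ (I ∩ Metric.ball s₀ δ) := hI'.convex.inter (convex_ball _ _)
  have hder : ∀ s ∈ I ∩ Metric.ball s₀ δ,
      HasDerivWithinAt (fun s : ℝ => f (γ s) ^ 2 - (s : ℂ) ^ 2) 0 (I ∩ Metric.ball s₀ δ) s := by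
    rintro s ⟨hsI, hsb⟩
    have hs1 := (hball s hsb).1
    have h3 : HasDerivAt (fun s => f (γ s)) (dirDeriv f (γ s) (velocity γ s)) s :=
      hasDerivAt_comp_path (hγ.diff s hsI) (mdifferentiableAt_coord hfa hs1)
    have h4 : HasDerivAt (fun s : ℝ => (s : ℂ)) 1 s := Complex.ofRealCLM.hasDerivAt
    have h5 := (h3.fun_pow 2).fun_sub (h4.fun_pow 2)
    refine (h5.congr_deriv ?_).hasDerivWithinAt
    have h6 := hγ.deriv_x s hsI
    rw [dx.apply_eq hfa hs1, hf.coeff_eq _ (f.map_source hs1)] at h6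
    norm_num
    linear_combination h6
  have hs₀b : s₀ ∈ I ∩ Metric.ball s₀ δ := ⟨hs₀, Metric.mem_ball_self hδ⟩
  filter_upwards [self_mem_nhdsWithin, nhdsWithin_le_nhds (Metric.ball_mem_nhds s₀ hδ)]
    with s hsI hsb
  have h3 := hconv.norm_image_sub_le_of_norm_hasDerivWithin_le hder (C := 0) (by simp) hs₀b
    ⟨hsI, hsb⟩
  rw [zero_mul, h2, sub_self, sub_zero, norm_le_zero_iff, sq_sub_sq] at h3
  exact ⟨(hball s hsb).1, sub_eq_zero.1 ((mul_eq_zero.1 h3).resolve_left (hball s hsb).2)⟩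

theorem IsSteepestDescent.apply_ne_zero (hγ : IsSteepestDescent dx e I γ) {s : ℝ} (hs : s ∈ I)
    (hs0 : s ≠ 0) : dx (γ s) ≠ 0 := by
  intro h
  have h1 := hγ.deriv_x s hs
  rw [h] at h1
  have h2 : (2 * s : ℂ) = 0 := h1.symm
  exact hs0 (by simpa using h2)

variable [IsManifold 𝓘(ℂ, ℂ) ω X]

/-- Everywhere along a steepest descent path there is a root coordinate whose real axis the path
follows. -/
theorem IsSteepestDescent.exists_follows (hγ : IsSteepestDescent dx e I γ) {a : X}
    (he : IsBranchCoordinate dx a e) (hdx : dx.IsMeromorphic) (hI : UniqueDiffOn ℝ I)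
    (hI' : I.OrdConnected) (hI0 : I ∈ 𝓝 0) {s₀ : ℝ} (hs₀ : s₀ ∈ I) :
    ∃ f, IsRootCoordinate dx f ∧ ∀ᶠ s in 𝓝[I] s₀, Follows γ f s := by
  by_cases hs0 : s₀ = 0
  · subst hs0
    exact ⟨e, he.isRootCoordinate, eventually_nhdsWithin_of_eventually_nhds
      (hγ.eventually_follows_zero he.mem_maximalAtlas he.zero_mem hI hI0)⟩
  · obtain ⟨f, hf, h1, h2⟩ := exists_rootCoordinate hdx (hγ.apply_ne_zero hs₀ hs0)
      (s := s₀) (by exact_mod_cast hs0)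
    exact ⟨f, hf, hγ.eventually_follows hI hI' hf hs₀ hs0 h1 h2⟩

/-- Two steepest descent paths that meet coincide backwards in time. This is the uniqueness of the
flow of `∂/∂x`, with `x` decreasing; the signs `c`, `c'` select the halves of the paths. -/
theorem IsSteepestDescent.eq_of_apply_eq [T2Space X] {e' : OpenPartialHomeomorph X ℂ}
    (hγ : IsSteepestDescent dx e I γ) (hγ' : IsSteepestDescent dx e' I γ') (hdx : dx.IsMeromorphic)
    (hI : UniqueDiffOn ℝ I) (hI' : I.OrdConnected) (hI0 : (0 : ℝ) ∈ I) {c c' m d : ℝ}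
    (hc : c ^ 2 = 1) (hc' : c' ^ 2 = 1) (hd : 0 ≤ d) (hs : c * √m ∈ I)
    (hs' : c' * √(m + d) ∈ I) (heq : γ (c * √m) = γ' (c' * √(m + d))) {t : ℝ} (ht : t ∈ Icc 0 m) :
    γ (c * √t) = γ' (c' * √(t + d)) := by
  have hmemI : ∀ {c x y : ℝ}, c ^ 2 = 1 → x ≤ y → c * √y ∈ I → c * √x ∈ I := by
    intro c x y hc hxy h
    refine hI'.uIcc_subset hI0 h ?_
    have h1 := Real.sqrt_le_sqrt hxy
    have h2 := Real.sqrt_nonneg x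
    rcases mul_self_eq_one_iff.1 ((sq c).symm.trans hc) with rfl | rfl
    · rw [one_mul, one_mul, uIcc_of_le (h2.trans h1)]; exact ⟨h2, h1⟩
    · rw [uIcc_of_ge (by linarith)]; constructor <;> linarith
  have hcγ : ContinuousOn (fun t => γ (c * √t)) (Icc 0 m) := fun t ht =>
    (ContinuousAt.comp (f := fun t => c * √t) (hγ.diff _ (hmemI hc ht.2 hs)).continuousAt
      (by fun_prop)).continuousWithinAt
  have hcγ' : ContinuousOn (fun t => γ' (c' * √(t + d))) (Icc 0 m) := fun t ht =>
    (ContinuousAt.comp (f := fun t => c' * √(t + d))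
      (hγ'.diff _ (hmemI hc' (by linarith [ht.2]) hs')).continuousAt
      (by fun_prop)).continuousWithinAt
  have hcne : c ≠ 0 := by rintro rfl; norm_num at hc
  have hcne' : c' ≠ 0 := by rintro rfl; norm_num at hc'
  -- the set of times in `(0, m]` at which the paths agree is open
  have hopen : ∀ t₀ ∈ Ioc 0 m, γ (c * √t₀) = γ' (c' * √(t₀ + d)) →
      ∀ᶠ t in 𝓝[Ioc 0 m] t₀, γ (c * √t) = γ' (c' * √(t + d)) := by
    intro t₀ ht₀ h
    have hs1 : c * √t₀ ≠ 0 := mul_ne_zero hcne (Real.sqrt_ne_zero'.2 ht₀.1)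
    have hs1' : c' * √(t₀ + d) ≠ 0 :=
      mul_ne_zero hcne' (Real.sqrt_ne_zero'.2 (by linarith [ht₀.1]))
    have hI1 := hmemI hc ht₀.2 hs
    have hI1' := hmemI hc' (by linarith [ht₀.2] : t₀ + d ≤ m + d) hs'
    obtain ⟨f, hf, hf1, hf2⟩ := exists_rootCoordinate hdx (hγ.apply_ne_zero hI1 hs1)
      (s := (c * √t₀ : ℝ)) (by exact_mod_cast hs1)
    obtain ⟨f', hf', hf1', hf2'⟩ := exists_rootCoordinate hdx (hγ'.apply_ne_zero hI1' hs1')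
      (s := (c' * √(t₀ + d) : ℝ)) (by exact_mod_cast hs1')
    have hF := hγ.eventually_follows hI hI' hf hI1 hs1 hf1 hf2
    have hF' := hγ'.eventually_follows hI hI' hf' hI1' hs1' hf1' hf2'
    have hfa := hf.mem_maximalAtlas
    have hfa' := hf'.mem_maximalAtlas
    have htend : Tendsto (fun t => c * √t) (𝓝[Ioc 0 m] t₀) (𝓝[I] (c * √t₀)) :=
      tendsto_nhdsWithin_iff.2 ⟨(Continuous.tendsto (by fun_prop) t₀).mono_left nhdsWithin_le_nhds,
        eventually_nhdsWithin_of_forall fun t ht => hmemI hc ht.2 hs⟩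
    have htend' : Tendsto (fun t => c' * √(t + d)) (𝓝[Ioc 0 m] t₀) (𝓝[I] (c' * √(t₀ + d))) :=
      tendsto_nhdsWithin_iff.2 ⟨(Continuous.tendsto (by fun_prop) t₀).mono_left nhdsWithin_le_nhds,
        eventually_nhdsWithin_of_forall fun t ht => hmemI hc' (by linarith [ht.2]) hs'⟩
    have hs1t : ((c * √t₀ : ℝ) : ℂ) ∈ f.target := hf2 ▸ f.map_source hf1
    have hsym : f.symm (c * √t₀ : ℝ) = γ (c * √t₀) := by rw [← hf2, f.left_inv hf1]
    have hs1f' : f.symm (c * √t₀ : ℝ) ∈ f'.source := by rw [hsym, h]; exact hf1'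
    -- the transition function `φ` satisfies `φ w ^ 2 = w ^ 2 + d`
    have hev : ∀ᶠ w in 𝓝 ((c * √t₀ : ℝ) : ℂ), w ∈ f.target ∧ f.symm w ∈ f'.source :=
      (f.open_target.eventually_mem hs1t).and
        ((f.continuousAt_symm hs1t).eventually (f'.open_source.eventually_mem hs1f'))
    obtain ⟨δ, hδ, hball⟩ := Metric.eventually_nhds_iff_ball.1 hev
    have hder : ∀ w ∈ Metric.ball ((c * √t₀ : ℝ) : ℂ) δ,
        HasDerivWithinAt (fun w => (f' (f.symm w)) ^ 2 - w ^ 2) 0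
          (Metric.ball ((c * √t₀ : ℝ) : ℂ) δ) w := by
      intro w hw
      obtain ⟨hw1, hw2⟩ := hball w hw
      have h3 : HasDerivAt (fun w => f' (f.symm w)) (deriv (f' ∘ f.symm) w) w :=
        (analyticAt_coordChange hfa hfa' hw1 hw2).differentiableAt.hasDerivAt
      refine (((h3.fun_pow 2).fun_sub ((hasDerivAt_id w).fun_pow 2)).congr_deriv
        ?_).hasDerivWithinAt
      have h4 := dx.coeff_eq_deriv_mul hfa hfa' hw1 hw2
      rw [hf.coeff_eq w hw1, hf'.coeff_eq _ (f'.map_source hw2)] at h4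
      norm_num
      linear_combination -h4
    have hφ : ∀ w ∈ Metric.ball ((c * √t₀ : ℝ) : ℂ) δ, (f' (f.symm w)) ^ 2 = w ^ 2 + d := by
      intro w hw
      have h3 := (convex_ball _ _).norm_image_sub_le_of_norm_hasDerivWithin_le hder (C := 0)
        (by simp) (Metric.mem_ball_self hδ) hw
      rw [zero_mul, norm_le_zero_iff, hsym, h, hf2', sub_eq_zero] at h3
      have e1 : ((c' * √(t₀ + d) : ℝ) : ℂ) ^ 2 = (t₀ + d : ℝ) := by
        norm_cast
        rw [mul_pow, hc', one_mul, Real.sq_sqrt (by linarith [ht₀.1])]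
      have e2 : ((c * √t₀ : ℝ) : ℂ) ^ 2 = (t₀ : ℝ) := by
        norm_cast
        rw [mul_pow, hc, one_mul, Real.sq_sqrt ht₀.1.le]
      rw [e1, e2] at h3
      push_cast at h3
      linear_combination h3
    have hct : Tendsto (fun t : ℝ => ((c * √t : ℝ) : ℂ)) (𝓝[Ioc 0 m] t₀)
        (𝓝 ((c * √t₀ : ℝ) : ℂ)) :=
      (Complex.continuous_ofReal.tendsto _).comp (htend.mono_right nhdsWithin_le_nhds)
    have hct' : Tendsto (fun t : ℝ => ((c' * √(t + d) : ℝ) : ℂ)) (𝓝[Ioc 0 m] t₀)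
        (𝓝 ((c' * √(t₀ + d) : ℝ) : ℂ)) :=
      (Complex.continuous_ofReal.tendsto _).comp (htend'.mono_right nhdsWithin_le_nhds)
    have hφc : Tendsto (fun w => f' (f.symm w)) (𝓝 ((c * √t₀ : ℝ) : ℂ))
        (𝓝 ((c' * √(t₀ + d) : ℝ) : ℂ)) := by
      have h3 := (analyticAt_coordChange hfa hfa' hs1t hs1f').continuousAt.tendsto
      rw [Function.comp_apply, hsym, h, hf2'] at h3
      exact h3
    have hne : ∀ᶠ t in 𝓝[Ioc 0 m] t₀,
        f' (f.symm (c * √t : ℝ)) + ((c' * √(t + d) : ℝ) : ℂ) ≠ 0 := by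
      refine ((hφc.comp hct).add hct').eventually_ne ?_
      rw [← two_mul]
      exact_mod_cast mul_ne_zero two_ne_zero hs1'
    filter_upwards [htend.eventually hF, htend'.eventually hF',
      hct.eventually (Metric.ball_mem_nhds _ hδ), hne, self_mem_nhdsWithin]
      with t g1 g2 g3 g4 ht
    have h5 := hφ _ g3
    have e1 : ((c' * √(t + d) : ℝ) : ℂ) ^ 2 = (t + d : ℝ) := by
      norm_cast
      rw [mul_pow, hc', one_mul, Real.sq_sqrt (by linarith [ht.1])]
    have e2 : ((c * √t : ℝ) : ℂ) ^ 2 = (t : ℝ) := by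
      norm_cast
      rw [mul_pow, hc, one_mul, Real.sq_sqrt ht.1.le]
    rw [e2, ← Complex.ofReal_add, ← e1, ← sub_eq_zero, sq_sub_sq] at h5
    have h6 := sub_eq_zero.1 ((mul_eq_zero.1 h5).resolve_left g4)
    rw [g1.symm_eq, ← g2.apply_eq] at h6
    refine f'.injOn ?_ g2.mem_source h6
    rw [← g1.symm_eq]
    exact (hball _ g3).2
  rcases eq_or_lt_of_le (ht.1.trans ht.2) with hm | hm
  · obtain rfl : t = m := le_antisymm ht.2 (hm ▸ ht.1)
    exact heq
  have hIoc : ∀ t ∈ Ioc 0 m, γ (c * √t) = γ' (c' * √(t + d)) := by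
    let S : Set (Ioc 0 m) := {t | γ (c * √t) = γ' (c' * √(t + d))}
    have hSc : IsClosed S := isClosed_eq
      (continuousOn_iff_continuous_domRestrict.1 (hcγ.mono Ioc_subset_Icc_self))
      (continuousOn_iff_continuous_domRestrict.1 (hcγ'.mono Ioc_subset_Icc_self))
    have hSo : IsOpen S := isOpen_iff_eventually.2 fun t ht =>
      (eventually_nhds_subtype_iff _ t (fun t => γ (c * √t) = γ' (c' * √(t + d)))).2
        (hopen t t.2 ht)
    have : PreconnectedSpace (Ioc 0 m) := Subtype.preconnectedSpace isPreconnected_Ioc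
    have hS := IsClopen.eq_univ ⟨hSc, hSo⟩ ⟨⟨m, hm, le_rfl⟩, heq⟩
    intro t ht
    have : (⟨t, ht⟩ : Ioc 0 m) ∈ S := hS ▸ mem_univ _
    exact this
  rcases eq_or_lt_of_le ht.1 with h0 | h0
  · subst h0
    have hle : 𝓝[Ioc 0 m] (0 : ℝ) ≤ 𝓝[Icc 0 m] 0 := nhdsWithin_mono _ Ioc_subset_Icc_self
    have : (𝓝[Ioc 0 m] (0 : ℝ)).NeBot := by
      rw [nhdsWithin_Ioc_eq_nhdsGT hm]; infer_instance
    exact tendsto_nhds_unique_of_eventuallyEq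
      ((hcγ 0 ⟨le_rfl, hm.le⟩).tendsto.mono_left hle)
      ((hcγ' 0 ⟨le_rfl, hm.le⟩).tendsto.mono_left hle)
      (eventually_nhdsWithin_of_forall hIoc)
  · exact hIoc t ⟨h0, ht.2⟩

theorem exists_sign_mul_sqrt (s : ℝ) : ∃ c : ℝ, c ^ 2 = 1 ∧ s = c * √(s ^ 2) := by
  rcases le_total 0 s with h | h
  · exact ⟨1, by norm_num, by rw [Real.sqrt_sq h, one_mul]⟩
  · exact ⟨-1, by norm_num, by rw [Real.sqrt_sq_eq_abs, abs_of_nonpos h]; ring⟩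

/-- Steepest descent paths through the branchpoints do not cross each other or themselves. -/
theorem IsSteepestDescent.injective [T2Space X] {b : ℕ} {a : Fin b → X}
    (ha : Function.Injective a) {ζ : Fin b → OpenPartialHomeomorph X ℂ}
    (hζ : ∀ i, IsBranchCoordinate dx (a i) (ζ i)) {γ : Fin b → ℝ → X} (hdx : dx.IsMeromorphic)
    (hI : UniqueDiffOn ℝ I) (hI' : I.OrdConnected) (hI0 : I ∈ 𝓝 0) {i j : Fin b}
    (hi : IsSteepestDescent dx (ζ i) I (γ i)) (hj : IsSteepestDescent dx (ζ j) I (γ j)) {s s' : ℝ}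
    (hs : s ∈ I) (hs' : s' ∈ I) (heq : γ i s = γ j s') : i = j ∧ s = s' := by
  wlog hle : s ^ 2 ≤ s' ^ 2 generalizing i j s s'
  · have h3 : s' ^ 2 ≤ s ^ 2 := le_of_not_ge hle
    obtain ⟨h1, h2⟩ := this hj hi hs' hs heq.symm h3
    exact ⟨h1.symm, h2.symm⟩
  have h00 : (0 : ℝ) ∈ I := mem_of_mem_nhds hI0
  obtain ⟨c, hc, hcs⟩ := exists_sign_mul_sqrt s
  obtain ⟨c', hc', hcs'⟩ := exists_sign_mul_sqrt s'
  obtain ⟨d, hd⟩ : ∃ d, s' ^ 2 = s ^ 2 + d := ⟨s' ^ 2 - s ^ 2, by ring⟩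
  have hd0 : 0 ≤ d := by linarith
  have key := fun t (ht : t ∈ Icc 0 (s ^ 2)) => hi.eq_of_apply_eq hj hdx hI hI' h00 hc hc' hd0
    (hcs ▸ hs) (by rw [← hd, ← hcs']; exact hs') (by rw [← hd, ← hcs', ← hcs]; exact heq) ht
  have h0 := key 0 ⟨le_rfl, sq_nonneg s⟩
  rw [Real.sqrt_zero, mul_zero, zero_add, hi.near.self_of_nhds, Complex.ofReal_zero,
    (hζ i).symm_zero] at h0
  have hdI : c' * √d ∈ I := by
    refine hI'.uIcc_subset h00 hs' ?_
    have h1 : √d ≤ √(s' ^ 2) := Real.sqrt_le_sqrt (by rw [hd]; nlinarith [sq_nonneg s])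
    have h2 := Real.sqrt_nonneg d
    rw [hcs']
    rcases mul_self_eq_one_iff.1 ((sq c').symm.trans hc') with rfl | rfl
    · rw [one_mul, one_mul, uIcc_of_le (h2.trans h1)]; exact ⟨h2, h1⟩
    · rw [uIcc_of_ge (by linarith)]; constructor <;> linarith
  have hd1 : c' * √d = 0 := by
    by_contra h
    exact hj.apply_ne_zero hdI h (h0 ▸ (hζ i).apply_eq_zero)
  have hd2 : d = 0 := by
    rcases mul_eq_zero.1 hd1 with h | h
    · rw [h] at hc'; norm_num at hc'
    · exact (Real.sqrt_eq_zero hd0).1 h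
  rw [hd1, hj.near.self_of_nhds, Complex.ofReal_zero, (hζ j).symm_zero] at h0
  obtain rfl : i = j := ha h0
  refine ⟨rfl, ?_⟩
  subst hd2
  rw [add_zero] at hd
  by_contra hne
  have hss : s ≠ 0 := fun h => hne (by rw [h] at hd ⊢; exact (pow_eq_zero_iff two_ne_zero).1 (by simpa using hd) |>.symm)
  have hneg : c' = -c := by
    have : (c' - c) * (c' + c) = 0 := by linear_combination hc' - hc
    rcases mul_eq_zero.1 this with h | h
    · exact absurd (by rw [hcs, hcs', hd, sub_eq_zero.1 h]) hne
    · linarith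
  have hF := hi.eventually_follows_zero (hζ i).mem_maximalAtlas (hζ i).zero_mem hI hI0
  have ht1 : Tendsto (fun t => c * √t) (𝓝[>] 0) (𝓝 0) :=
    (Continuous.tendsto' (by fun_prop) 0 0 (by simp)).mono_left nhdsWithin_le_nhds
  have ht2 : Tendsto (fun t => -c * √t) (𝓝[>] 0) (𝓝 0) :=
    (Continuous.tendsto' (by fun_prop) 0 0 (by simp)).mono_left nhdsWithin_le_nhds
  obtain ⟨t, g1, g2, g3⟩ := ((ht1.eventually hF).and ((ht2.eventually hF).and
    (Ioc_mem_nhdsGT (show (0 : ℝ) < s ^ 2 by positivity)))).exists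
  have h3 := key t ⟨g3.1.le, g3.2⟩
  rw [hneg, add_zero] at h3
  have h4 := g1.apply_eq
  rw [h3, g2.apply_eq] at h4
  have h5 : -c * √t = c * √t := by exact_mod_cast h4
  have h6 : c * √t = 0 := by linarith
  rcases mul_eq_zero.1 h6 with h | h
  · rw [h] at hc; norm_num at hc
  · exact (Real.sqrt_ne_zero'.2 g3.1) h

end SteepestDescent

/-! ### The kernel along steepest descent paths -/

/-- Along a steepest descent path, `dξ` is minus the kernel at a branchpoint. -/
theorem dxi_follows {X : Type*} [TopologicalSpace X] [ChartedSpace ℂ X] {B : Bidifferential X}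
    {e f : OpenPartialHomeomorph X ℂ} {γ : ℝ → X} {s : ℝ} (h : Follows γ e s)
    (he : e ∈ IsManifold.maximalAtlas 𝓘(ℂ, ℂ) ω X) :
    dxi B f (γ s) (velocity γ s) = -B.coeff e f s 0 :=
  h.oneForm he (dxi B f)

section Kernel

variable {X : Type*} [TopologicalSpace X] [ChartedSpace ℂ X] [IsManifold 𝓘(ℂ, ℂ) ω X] [T2Space X]
  {dx : OneForm X} {b : ℕ} {a : Fin b → X} {ζ : Fin b → OpenPartialHomeomorph X ℂ}
  {B : Bidifferential X} {I : Set ℝ} {γ : Fin b → ℝ → X}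

/-- The function `B(γ i s, γ j s')` of two times, contracted with the velocities. -/
def pathKernel (B : Bidifferential X) (γ η : ℝ → X) (s s' : ℝ) : ℂ :=
  B (γ s) (η s') (velocity γ s) (velocity η s')

/-- A function that off the diagonal agrees locally with analytic functions can be extended to the
diagonal with the same property. -/
theorem exists_extension_of_locally_analytic (hI : UniqueDiffOn ℝ I) {P : Prop} {k : ℝ × ℝ → ℂ}
    (hk : ∀ y ∈ I ×ˢ I, ∃ H : ℂ × ℂ → ℂ, AnalyticAt ℂ H ((y.1 : ℂ), (y.2 : ℂ)) ∧
      ∀ᶠ y' in 𝓝[I ×ˢ I] y, (P → y'.1 ≠ y'.2) → k y' = H ((y'.1 : ℂ), (y'.2 : ℂ))) :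
    ∃ K : ℝ × ℝ → ℂ, (∀ y ∈ I ×ˢ I, (P → y.1 ≠ y.2) → k y = K y) ∧
      ∀ y ∈ I ×ˢ I, ∃ H : ℂ × ℂ → ℂ, AnalyticAt ℂ H ((y.1 : ℂ), (y.2 : ℂ)) ∧
        ∀ᶠ y' in 𝓝[I ×ˢ I] y, K y' = H ((y'.1 : ℂ), (y'.2 : ℂ)) := by
  classical
  choose! H hH hkH using hk
  have hcast : Continuous fun y : ℝ × ℝ => ((y.1 : ℂ), (y.2 : ℂ)) := by fun_prop
  have hself : ∀ y ∈ I ×ˢ I, (P → y.1 ≠ y.2) → k y = H y ((y.1 : ℂ), (y.2 : ℂ)) :=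
    fun y hy h => (hkH y hy).self_of_nhdsWithin hy h
  refine ⟨fun y => H y ((y.1 : ℂ), (y.2 : ℂ)), hself, fun y hy => ⟨H y, hH y hy, ?_⟩⟩
  filter_upwards [eventually_eventually_nhdsWithin.2 (hkH y hy), self_mem_nhdsWithin,
    nhdsWithin_le_nhds (hcast.continuousAt.eventually (hH y hy).eventually_analyticAt)]
    with y' h1 h2 h3
  by_cases hP : P → y'.1 ≠ y'.2
  · rw [← hself y' h2 hP]
    exact h1.self_of_nhdsWithin h2 hP
  · -- both values are limits of `k` along the first axis
    simp only [not_forall, not_not] at hP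
    obtain ⟨-, hP2⟩ := hP
    have hne : (𝓝[I \ {y'.1}] y'.1).NeBot := accPt_principal_iff_nhdsWithin.1
      (uniqueDiffWithinAt_iff_accPt.1 (hI y'.1 h2.1))
    have hle : 𝓝[I \ {y'.1}] y'.1 ≤ 𝓝[I] y'.1 := nhdsWithin_mono _ sdiff_subset
    have htend : Tendsto (fun t => (t, y'.2)) (𝓝[I \ {y'.1}] y'.1) (𝓝[I ×ˢ I] y') := by
      rw [← Prod.mk.eta (p := y'), nhdsWithin_prod_eq]
      exact (tendsto_id.mono_right hle).prodMk
        (tendsto_const_nhds.mono_right (le_refl _) |>.congr' .rfl |> fun h =>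
          tendsto_nhdsWithin_iff.2 ⟨h, .of_forall fun _ => h2.2⟩)
    have hval : ∀ {G : ℂ × ℂ → ℂ}, AnalyticAt ℂ G ((y'.1 : ℂ), (y'.2 : ℂ)) →
        Tendsto (fun t : ℝ => G ((t : ℂ), (y'.2 : ℂ))) (𝓝[I \ {y'.1}] y'.1)
          (𝓝 (G ((y'.1 : ℂ), (y'.2 : ℂ)))) := fun {G} hG =>
      ((ContinuousAt.comp (f := fun y : ℝ × ℝ => ((y.1 : ℂ), (y.2 : ℂ))) (x := y')
        hG.continuousAt hcast.continuousAt).tendsto.mono_left nhdsWithin_le_nhds).comp htend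
    refine tendsto_nhds_unique_of_eventuallyEq (hval (hH y' h2)) (hval h3) ?_
    filter_upwards [htend.eventually h1, htend.eventually (hkH y' h2), self_mem_nhdsWithin]
      with t g1 g2 ht
    have hd : P → t ≠ y'.2 := fun _ => hP2 ▸ ht.2
    rw [← g1 hd, ← g2 hd]

/-- The kernel along two steepest descent paths, with the double pole removed, extends to the
diagonal and is locally the restriction of an analytic function. -/
theorem exists_kernel (ha : Function.Injective a) (hζ : ∀ i, IsBranchCoordinate dx (a i) (ζ i))
    (hdx : dx.IsMeromorphic) (hB : B.IsBergmanKernel) (hI : UniqueDiffOn ℝ I)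
    (hI' : I.OrdConnected) (hI0 : I ∈ 𝓝 0) {i j : Fin b}
    (hi : IsSteepestDescent dx (ζ i) I (γ i)) (hj : IsSteepestDescent dx (ζ j) I (γ j)) :
    ∃ K : ℝ × ℝ → ℂ,
      (∀ y ∈ I ×ˢ I, (i = j → y.1 ≠ y.2) → pathKernel B (γ i) (γ j) y.1 y.2 -
        kron i j / ((y.1 : ℂ) - y.2) ^ 2 = K y) ∧
      ∀ y ∈ I ×ˢ I, ∃ H : ℂ × ℂ → ℂ, AnalyticAt ℂ H ((y.1 : ℂ), (y.2 : ℂ)) ∧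
        ∀ᶠ y' in 𝓝[I ×ˢ I] y, K y' = H ((y'.1 : ℂ), (y'.2 : ℂ)) := by
  refine exists_extension_of_locally_analytic hI ?_
  rintro ⟨s, s'⟩ ⟨hs, hs'⟩
  obtain ⟨e, he, hes⟩ := hi.exists_follows (hζ i) hdx hI hI' hI0 hs
  obtain ⟨f, hf, hfs⟩ := hj.exists_follows (hζ j) hdx hI hI' hI0 hs'
  have hea := he.mem_maximalAtlas
  have hfa := hf.mem_maximalAtlas
  have hes0 := hes.self_of_nhdsWithin hs
  have hfs0 := hfs.self_of_nhdsWithin hs'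
  by_cases heq : γ i s = γ j s'
  · obtain ⟨rfl, hss⟩ := IsSteepestDescent.injective ha hζ hdx hI hI' hI0 hi hj hs hs' heq
    obtain rfl : s = s' := hss
    obtain ⟨h, hh, hev⟩ := hB.diag e hea s hes0.mem_target
    refine ⟨h, hh, ?_⟩
    have hcast : Tendsto (fun y : ℝ × ℝ => ((y.1 : ℂ), (y.2 : ℂ))) (𝓝[I ×ˢ I] (s, s))
        (𝓝 ((s : ℂ), (s : ℂ))) :=
      (Continuous.tendsto (by fun_prop) (s, s)).mono_left nhdsWithin_le_nhds
    have hev2 := hcast.eventually hev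
    rw [nhdsWithin_prod_eq] at hev2 ⊢
    filter_upwards [hev2, hes.prod_mk hes] with y h1 h2 hy
    have h3 := h1 (by exact_mod_cast hy rfl)
    rw [pathKernel, h2.1.bidifferential h2.2 hea hea, h3, kron_self]
    ring
  · refine ⟨fun y => B.coeff e f y.1 y.2 - kron i j / (y.1 - y.2) ^ 2, ?_, ?_⟩
    · refine (hB.holo e hea f hfa _ hes0.mem_target _ hfs0.mem_target
        (by rwa [hes0.symm_eq, hfs0.symm_eq])).sub ?_
      by_cases hij : i = j
      · subst hij
        have hne : (s : ℂ) - s' ≠ 0 := by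
          rw [sub_ne_zero]
          rintro h
          exact heq (by rw [Complex.ofReal_inj.1 h])
        exact analyticAt_const.div ((analyticAt_fst.sub analyticAt_snd).pow 2) (pow_ne_zero 2 hne)
      · simp only [kron_of_ne hij, zero_div]
        exact analyticAt_const
    · rw [nhdsWithin_prod_eq]
      filter_upwards [hes.prod_mk hfs] with y h2 _
      rw [pathKernel, h2.1.bidifferential h2.2 hea hfa]

/-- The regular part of `-dξ` along a steepest descent path is continuous. -/
theorem exists_dxi_regularPart (ha : Function.Injective a)
    (hζ : ∀ i, IsBranchCoordinate dx (a i) (ζ i)) (hdx : dx.IsMeromorphic)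
    (hB : B.IsBergmanKernel) (hI : UniqueDiffOn ℝ I) (hI' : I.OrdConnected) (hI0 : I ∈ 𝓝 0)
    {i : Fin b} (hi : IsSteepestDescent dx (ζ i) I (γ i)) (m : Fin b) :
    ∃ r : ℝ → ℂ, ContinuousOn r I ∧ (∀ s ∈ I, s ≠ 0 →
      dxi B (ζ m) (γ i s) (velocity (γ i) s) = -(kron i m / (s : ℂ) ^ 2 + r s)) ∧
      ∃ h : ℂ × ℂ → ℂ, ∃ ρ > 0, (∀ w z : ℂ, ‖w‖ < ρ → ‖z‖ < ρ →
        HasSum (fun n : ℕ × ℕ => bergmanCoeff B ζ i n.1 m n.2 * w ^ n.1 * z ^ n.2) (h (w, z))) ∧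
        ∀ᶠ s : ℝ in 𝓝 0, r s = h (s, 0) := by
  classical
  obtain ⟨h, ρ, hρ, hh⟩ := exists_regularPart ha hζ hB i m
  have h0 : ‖(0 : ℂ)‖ < ρ := by rwa [norm_zero]
  have hF := hi.eventually_follows_zero (hζ i).mem_maximalAtlas (hζ i).zero_mem hI hI0
  let r : ℝ → ℂ := fun s => if s = 0 then h (0, 0) else
    -dxi B (ζ m) (γ i s) (velocity (γ i) s) - kron i m / (s : ℂ) ^ 2
  have hr : ∀ᶠ s : ℝ in 𝓝 0, r s = h (s, 0) := by
    have hsm : ∀ᶠ s : ℝ in 𝓝 0, ‖(s : ℂ)‖ < ρ :=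
      (Continuous.tendsto' (by fun_prop) (0 : ℝ) 0 (by simp) : Tendsto (fun s : ℝ => ‖(s : ℂ)‖)
        (𝓝 0) (𝓝 0)).eventually (gt_mem_nhds hρ)
    filter_upwards [hF, hsm] with s h1 h2
    by_cases hs : s = 0
    · simp [r, hs]
    · obtain ⟨-, -, -, -, g1, g2⟩ := hh s 0 h2 h0
      have hs' : (s : ℂ) ≠ 0 := by exact_mod_cast hs
      have h3 := g2 fun h => hs' (g1 h).2
      simp only [r, if_neg hs]
      rw [dxi_follows h1 (hζ i).mem_maximalAtlas, h3]
      ring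
  refine ⟨r, fun s hs => ?_, fun s _ hs => ?_, h, ρ, hρ, fun w z hw hz => (hh w z hw hz).2.2.2.1, hr⟩
  · by_cases hs0 : s = 0
    · subst hs0
      refine (ContinuousAt.congr ?_ (hr.mono fun _ h => h.symm)).continuousWithinAt
      have := (hh 0 0 h0 h0).2.2.1.continuousAt
      exact ContinuousAt.comp (g := h) (f := fun s : ℝ => ((s : ℂ), (0 : ℂ))) (x := 0)
        (by simpa using this) (by fun_prop)
    · obtain ⟨e, he, hes⟩ := hi.exists_follows (hζ i) hdx hI hI' hI0 hs
      have hea := he.mem_maximalAtlas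
      have hes0 := hes.self_of_nhdsWithin hs
      have hsc : (s : ℂ) ≠ 0 := by exact_mod_cast hs0
      have hne : e.symm s ≠ (ζ m).symm 0 := by
        rw [(hζ m).symm_zero]
        exact he.symm_ne hes0.mem_target hsc (hζ m).apply_eq_zero
      have hev : r =ᶠ[𝓝[I] s] fun t : ℝ => B.coeff e (ζ m) t 0 - kron i m / (t : ℂ) ^ 2 := by
        filter_upwards [hes, nhdsWithin_le_nhds (eventually_ne_nhds hs0)] with t h1 h2
        simp only [r, if_neg h2]
        rw [dxi_follows h1 hea, neg_neg]
      refine ContinuousWithinAt.congr_of_eventuallyEq ?_ hev (hev.self_of_nhdsWithin hs)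
      refine ContinuousAt.continuousWithinAt (ContinuousAt.sub ?_ ?_)
      · exact ContinuousAt.comp (g := fun y : ℂ × ℂ => B.coeff e (ζ m) y.1 y.2)
          (f := fun s : ℝ => ((s : ℂ), (0 : ℂ))) (x := s)
          (hB.holo e hea _ (hζ m).mem_maximalAtlas _ hes0.mem_target _ (hζ m).zero_mem
            hne).continuousAt (by fun_prop)
      · exact ContinuousAt.div (by fun_prop) (by fun_prop) (pow_ne_zero 2 hsc)
  · simp only [r, if_neg hs]
    ring

end Kernel

/-! ### The differential equation of the kernel along paths -/

theorem sum_kron_add_mul_kron_add {b : ℕ} (i j : Fin b) (x y : ℂ) (p q : Fin b → ℂ) :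
    ∑ m, (kron i m * x + p m) * (kron j m * y + q m) =
      kron i j * (x * y) + x * q i + y * p j + ∑ m, p m * q m := by
  have h1 : ∀ m, (kron i m * x + p m) * (kron j m * y + q m) =
      kron i m * (kron j m * (x * y)) + kron i m * (x * q m) + kron j m * (y * p m) +
        p m * q m := fun m => by ring
  have h2 : ∀ (k : Fin b) (c : Fin b → ℂ), ∑ m, kron k m * c m = c k := fun k c => by
    simp [kron]
  simp only [h1, Finset.sum_add_distrib, h2]
  rw [kron_comm j i]

/-- The complement of three lines in the plane is dense. -/
theorem dense_ne_zero_ne_zero_ne : Dense {y : ℝ × ℝ | y.1 ≠ 0 ∧ y.2 ≠ 0 ∧ y.1 ≠ y.2} := by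
  intro y
  have h : Tendsto (fun t : ℝ => (y.1 + t, y.2 + 2 * t)) (𝓝[≠] 0) (𝓝 y) :=
    (Continuous.tendsto' (by fun_prop) 0 y (by simp)).mono_left nhdsWithin_le_nhds
  refine mem_closure_of_tendsto h ?_
  have key : ∀ c : ℝ, ∀ᶠ t : ℝ in 𝓝[≠] 0, t ≠ c := fun c => by
    by_cases hc : c = 0
    · subst hc; exact self_mem_nhdsWithin
    · exact nhdsWithin_le_nhds (eventually_ne_nhds (Ne.symm hc))
  filter_upwards [key (-y.1), key (-y.2 / 2), key (y.1 - y.2)] with t h1 h2 h3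
  refine ⟨fun h => h1 ?_, fun h => h2 ?_, fun h => h3 ?_⟩ <;> linarith

section Kernel

variable {X : Type*} [TopologicalSpace X] [ChartedSpace ℂ X] [IsManifold 𝓘(ℂ, ℂ) ω X] [T2Space X]
  [CompactSpace X] [ConnectedSpace X]
  {g : ℕ} {A C : Fin g → ℝ → X}
  {dx : OneForm X} {b : ℕ} {a : Fin b → X} {ζ : Fin b → OpenPartialHomeomorph X ℂ}
  {B : Bidifferential X} {γ : Fin b → ℝ → X}

/-- The kernel along two complete steepest descent paths, with its double pole removed, is a smooth
function `K` on the plane; the key identity for `B` becomes a differential equation for `K`, from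
which the double poles have disappeared. -/
theorem exists_smooth_kernel (hB : B.IsBergmanKernel) (hAC : IsCanonicalHomologyBasis g A C)
    (hBA : B.IsNormalizedOn A) (hdx : dx.IsMeromorphic) (ha : Function.Injective a)
    (ha_range : range a = {p | 0 < dx.order p}) (hζ : ∀ i, IsBranchCoordinate dx (a i) (ζ i))
    {i j : Fin b} (hi : IsSteepestDescent dx (ζ i) univ (γ i))
    (hj : IsSteepestDescent dx (ζ j) univ (γ j)) {p q : Fin b → ℝ → ℂ}
    (hpc : ∀ m, Continuous (p m)) (hqc : ∀ m, Continuous (q m))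
    (hp : ∀ m s, s ≠ 0 → dxi B (ζ m) (γ i s) (velocity (γ i) s) =
      -(kron i m / (s : ℂ) ^ 2 + p m s))
    (hq : ∀ m s, s ≠ 0 → dxi B (ζ m) (γ j s) (velocity (γ j) s) =
      -(kron j m / (s : ℂ) ^ 2 + q m s)) :
    ∃ K : ℝ × ℝ → ℂ, ContDiff ℝ 1 K ∧
      (∀ y, y.1 ≠ y.2 → pathKernel B (γ i) (γ j) y.1 y.2 -
        kron i j / ((y.1 : ℂ) - y.2) ^ 2 = K y) ∧
      (∀ s, K (s, 0) = p j s) ∧ (∀ s, K (0, s) = q i s) ∧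
      ∀ y : ℝ × ℝ, (y.2 : ℂ) ^ 2 * (y.1 * fderiv ℝ K y (1, 0) - K y + q i y.2) +
        (y.1 : ℂ) ^ 2 * (y.2 * fderiv ℝ K y (0, 1) - K y + p j y.1) =
        -((y.1 : ℂ) ^ 2 * y.2 ^ 2 * ∑ m, p m y.1 * q m y.2) := by
  have hI : UniqueDiffOn ℝ (univ : Set ℝ) := uniqueDiffOn_univ
  have hI' : (univ : Set ℝ).OrdConnected := ordConnected_univ
  have hI0 : (univ : Set ℝ) ∈ 𝓝 0 := univ_mem
  obtain ⟨K, hK, hKH⟩ := exists_kernel (γ := γ) ha hζ hdx hB hI hI' hI0 hi hj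
  simp only [univ_prod_univ, mem_univ, forall_const, nhdsWithin_univ] at hK hKH
  have hdiff : ContDiff ℝ 1 K := by
    refine contDiff_iff_contDiffAt.2 fun y => ?_
    obtain ⟨H, hH, hev⟩ := hKH y
    refine ContDiffAt.congr_of_eventuallyEq ?_ hev
    exact ContDiffAt.comp (g := H) (f := fun y : ℝ × ℝ => ((y.1 : ℂ), (y.2 : ℂ))) y
      (hH.contDiffAt.restrict_scalars ℝ)
      ((Complex.ofRealCLM.contDiff.comp contDiff_fst).prodMk
        (Complex.ofRealCLM.contDiff.comp contDiff_snd)).contDiffAt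
  have hKne : ∀ s s' : ℝ, s ≠ s' → K (s, s') = pathKernel B (γ i) (γ j) s s' -
      kron i j / ((s : ℂ) - s') ^ 2 := fun s s' h => (hK (s, s') fun _ => h).symm
  have hfol := fun s => hi.exists_follows (hζ i) hdx hI hI' hI0 (mem_univ s)
  have hfol' := fun s => hj.exists_follows (hζ j) hdx hI hI' hI0 (mem_univ s)
  simp only [nhdsWithin_univ] at hfol hfol'
  have hFi := (hi.eventually_follows_zero (hζ i).mem_maximalAtlas (hζ i).zero_mem hI
    hI0).self_of_nhds
  have hFj := (hj.eventually_follows_zero (hζ j).mem_maximalAtlas (hζ j).zero_mem hI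
    hI0).self_of_nhds
  -- the kernel at the branchpoints
  have hKp : ∀ s, K (s, 0) = p j s := by
    refine fun s => congrFun (Continuous.ext_on (dense_compl_singleton (0 : ℝ))
      (f := fun s => K (s, 0)) (hdiff.continuous.comp (by fun_prop)) (hpc j) fun s (hs : s ≠ 0) => ?_) s
    obtain ⟨e, he, hes⟩ := hfol s
    have h1 := hp j s hs
    rw [dxi_follows hes.self_of_nhds he.mem_maximalAtlas] at h1
    dsimp only
    rw [hKne s 0 hs, pathKernel,
      hes.self_of_nhds.bidifferential hFj he.mem_maximalAtlas (hζ j).mem_maximalAtlas]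
    rw [Complex.ofReal_zero, sub_zero]
    linear_combination -h1
  have hKq : ∀ s, K (0, s) = q i s := by
    refine fun s => congrFun (Continuous.ext_on (dense_compl_singleton (0 : ℝ))
      (f := fun s => K (0, s)) (hdiff.continuous.comp (by fun_prop)) (hqc i) fun s (hs : s ≠ 0) => ?_) s
    obtain ⟨e, he, hes⟩ := hfol' s
    have hsc : (s : ℂ) ≠ 0 := by exact_mod_cast hs
    have h1 := hq i s hs
    rw [dxi_follows hes.self_of_nhds he.mem_maximalAtlas] at h1
    have hne : (ζ i).symm 0 ≠ e.symm s := by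
      rw [(hζ i).symm_zero]
      exact (he.symm_ne hes.self_of_nhds.mem_target hsc (hζ i).apply_eq_zero).symm
    dsimp only
    rw [hKne 0 s hs.symm, pathKernel,
      hFi.bidifferential hes.self_of_nhds (hζ i).mem_maximalAtlas he.mem_maximalAtlas]
    rw [Complex.ofReal_zero, zero_sub, neg_sq, hB.coeff_comm hne, kron_comm i j]
    linear_combination -h1
  refine ⟨K, hdiff, fun y hy => hK y fun _ => hy, hKp, hKq, ?_⟩
  have hd := hdiff.continuous_fderiv one_ne_zero
  have hKc := hdiff.continuous
  have hpj := hpc j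
  have hqi := hqc i
  refine fun y => congrFun (Continuous.ext_on dense_ne_zero_ne_zero_ne
    (f := fun y : ℝ × ℝ => (y.2 : ℂ) ^ 2 * (y.1 * fderiv ℝ K y (1, 0) - K y + q i y.2) +
        (y.1 : ℂ) ^ 2 * (y.2 * fderiv ℝ K y (0, 1) - K y + p j y.1))
    (g := fun y : ℝ × ℝ => -((y.1 : ℂ) ^ 2 * y.2 ^ 2 * ∑ m, p m y.1 * q m y.2))
    (by fun_prop) (by fun_prop) ?_) y
  rintro ⟨s, s'⟩ ⟨hs, hs', hss⟩
  dsimp only at hs hs' hss ⊢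
  obtain ⟨e, he, hes⟩ := hfol s
  obtain ⟨f, hf, hfs⟩ := hfol' s'
  have hea := he.mem_maximalAtlas
  have hfa := hf.mem_maximalAtlas
  have hes0 := hes.self_of_nhds
  have hfs0 := hfs.self_of_nhds
  have hsc : (s : ℂ) ≠ 0 := by exact_mod_cast hs
  have hsc' : (s' : ℂ) ≠ 0 := by exact_mod_cast hs'
  have hssc : (s : ℂ) - s' ≠ 0 := sub_ne_zero.2 (by exact_mod_cast hss)
  have hne : e.symm s ≠ f.symm s' := by
    rw [hes0.symm_eq, hfs0.symm_eq]
    exact fun h => hss (IsSteepestDescent.injective ha hζ hdx hI hI' hI0 hi hj (mem_univ _)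
      (mem_univ _) h).2
  have key := hB.deriv_div_add_deriv_div hAC hBA hdx ha ha_range hζ he hf hes0.mem_target
    hfs0.mem_target hsc hsc' hne
  have han := hB.holo e hea f hfa _ hes0.mem_target _ hfs0.mem_target hne
  have hG := (AnalyticAt.comp_left han).differentiableAt.hasDerivAt
  have hG' := (AnalyticAt.comp_right han).differentiableAt.hasDerivAt
  rw [(hG.fun_div (hasDerivAt_id' _) hsc).deriv, (hG'.fun_div (hasDerivAt_id' _) hsc').deriv] at key
  have hsum : ∀ m, B.coeff e (ζ m) s 0 * B.coeff f (ζ m) s' 0 =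
      (kron i m * (1 / (s : ℂ) ^ 2) + p m s) * (kron j m * (1 / (s' : ℂ) ^ 2) + q m s') := by
    intro m
    have h1 := hp m s hs
    have h2 := hq m s' hs'
    rw [dxi_follows hes0 hea, neg_inj] at h1
    rw [dxi_follows hfs0 hfa, neg_inj] at h2
    rw [h1, h2]
    ring
  rw [Finset.sum_congr rfl fun m _ => hsum m, sum_kron_add_mul_kron_add] at key
  have hKd := (hdiff.differentiable one_ne_zero (s, s')).hasFDerivAt
  have hK1 : fderiv ℝ K (s, s') (1, 0) = deriv (fun w => B.coeff e f w s') s +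
      2 * kron i j / ((s : ℂ) - s') ^ 3 := by
    have h1 : HasDerivAt (fun t => K (t, s')) (fderiv ℝ K (s, s') (1, 0)) s :=
      hKd.comp_hasDerivAt s ((hasDerivAt_id' s).prodMk (hasDerivAt_const s s'))
    have h2 : HasDerivAt (fun t : ℂ => B.coeff e f t s' - kron i j / (t - s') ^ 2) _ (s : ℂ) :=
      hG.fun_sub ((hasDerivAt_const _ (kron i j)).fun_div
        (((hasDerivAt_id' (s : ℂ)).sub_const (s' : ℂ)).fun_pow 2) (pow_ne_zero 2 hssc))
    have h3 := h1.unique (h2.comp_ofReal.congr_of_eventuallyEq ?_)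
    · rw [h3]
      field_simp
      norm_num
      ring
    · filter_upwards [hes, eventually_ne_nhds hss] with t g1 g2
      rw [hKne t s' g2, pathKernel, g1.bidifferential hfs0 hea hfa]
  have hK2 : fderiv ℝ K (s, s') (0, 1) = deriv (fun z => B.coeff e f s z) s' -
      2 * kron i j / ((s : ℂ) - s') ^ 3 := by
    have h1 : HasDerivAt (fun t => K (s, t)) (fderiv ℝ K (s, s') (0, 1)) s' :=
      hKd.comp_hasDerivAt s' ((hasDerivAt_const s' s).prodMk (hasDerivAt_id' s'))
    have h2 : HasDerivAt (fun t : ℂ => B.coeff e f s t - kron i j / (s - t) ^ 2) _ (s' : ℂ) :=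
      hG'.fun_sub ((hasDerivAt_const _ (kron i j)).fun_div
        (((hasDerivAt_id' (s' : ℂ)).const_sub (s : ℂ)).fun_pow 2) (pow_ne_zero 2 hssc))
    have h3 := h1.unique (h2.comp_ofReal.congr_of_eventuallyEq ?_)
    · rw [h3]
      field_simp
      norm_num
      ring
    · filter_upwards [hfs, eventually_ne_nhds hss.symm] with t g1 g2
      rw [hKne s t g2.symm, pathKernel, hes0.bidifferential g1 hea hfa]
  rw [hK1, hK2, hKne s s' hss, pathKernel, hes0.bidifferential hfs0 hea hfa]
  generalize ∑ m, p m s * q m s' = T at key ⊢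
  field_simp at key ⊢
  linear_combination key * ((s : ℂ) - s') ^ 3

end Kernel

/-! ### Gaussian integrals over boxes -/

/-- The divergence theorem on a box centred at the origin, for vector fields that are merely
continuous on the coordinate axes. -/
theorem integral_box_divergence {F G D : ℝ × ℝ → ℂ} (hF : Continuous F) (hG : Continuous G)
    (hD : Continuous D) (hFd : ∀ y : ℝ × ℝ, y.1 ≠ 0 → y.2 ≠ 0 → DifferentiableAt ℝ F y)
    (hGd : ∀ y : ℝ × ℝ, y.1 ≠ 0 → y.2 ≠ 0 → DifferentiableAt ℝ G y)
    (hdiv : ∀ y : ℝ × ℝ, y.1 ≠ 0 → y.2 ≠ 0 → fderiv ℝ F y (1, 0) + fderiv ℝ G y (0, 1) = D y)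
    (S S' : ℝ) :
    ∫ x in (-S)..S, ∫ y in (-S')..S', D (x, y) =
      ((∫ x in (-S)..S, G (x, S')) - ∫ x in (-S)..S, G (x, -S')) +
        ((∫ y in (-S')..S', F (S, y)) - ∫ y in (-S')..S', F (-S, y)) := by
  have hquad : ∀ c d : ℝ, ∫ x in (0)..c, ∫ y in (0)..d, D (x, y) =
      (((∫ x in (0)..c, G (x, d)) - ∫ x in (0)..c, G (x, 0)) + ∫ y in (0)..d, F (c, y)) -
        ∫ y in (0)..d, F (0, y) := by
    intro c d
    have hne : ∀ {c s : ℝ}, s ∈ Ioo (min 0 c) (max 0 c) → s ≠ 0 := by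
      rintro c s hs rfl
      rcases le_total 0 c with h | h
      · rw [min_eq_left h] at hs; exact lt_irrefl _ hs.1
      · rw [max_eq_left h] at hs; exact lt_irrefl _ hs.2
    have hint : IntegrableOn D (uIcc 0 c ×ˢ uIcc 0 d) :=
      hD.continuousOn.integrableOn_compact (isCompact_uIcc.prod isCompact_uIcc)
    have hae : ∀ᵐ y : ℝ × ℝ, D y = fderiv ℝ F y (1, 0) + fderiv ℝ G y (0, 1) := by
      have h1 : ∀ᵐ s : ℝ, s ≠ 0 := Measure.ae_ne volume 0
      have h2 : ∀ᵐ y : ℝ × ℝ, y.1 ≠ 0 := Measure.quasiMeasurePreserving_fst.ae h1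
      have h3 : ∀ᵐ y : ℝ × ℝ, y.2 ≠ 0 := Measure.quasiMeasurePreserving_snd.ae h1
      filter_upwards [h2, h3] with y g1 g2 using (hdiv y g1 g2).symm
    rw [← integral2_divergence_prod_of_hasFDerivAt_off_countable F G (fderiv ℝ F) (fderiv ℝ G)
      0 0 c d ∅ countable_empty hF.continuousOn hG.continuousOn
      (fun y hy => (hFd y (hne hy.1.1) (hne hy.1.2)).hasFDerivAt)
      (fun y hy => (hGd y (hne hy.1.1) (hne hy.1.2)).hasFDerivAt)
      (hint.congr_fun_ae (ae_restrict_of_ae hae))]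
    have h1 : ∀ᵐ s : ℝ, s ≠ 0 := Measure.ae_ne volume 0
    refine intervalIntegral.integral_congr_ae ?_
    filter_upwards [h1] with x hx _
    refine intervalIntegral.integral_congr_ae ?_
    filter_upwards [h1] with y hy _ using (hdiv (x, y) hx hy).symm
  have hDi : Continuous fun p : ℝ × ℝ => ∫ y in (0)..p.2, D (p.1, y) :=
    intervalIntegral.continuous_parametric_intervalIntegral_of_continuous
      (f := fun (p : ℝ × ℝ) y => D (p.1, y)) (by fun_prop) continuous_snd
  have hDi' : ∀ d, Continuous fun x : ℝ => ∫ y in (0)..d, D (x, y) := fun d =>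
    hDi.comp (f := fun x : ℝ => (x, d)) (by fun_prop)
  have split : ∀ {f : ℝ → ℂ} (_ : Continuous f) (c : ℝ),
      ∫ x in (-c)..c, f x = (∫ x in (0)..c, f x) - ∫ x in (0)..(-c), f x := fun {f} hf c =>
    (intervalIntegral.integral_interval_sub_left (hf.intervalIntegrable _ _)
      (hf.intervalIntegrable _ _)).symm
  have e1 : ∀ x, ∫ y in (-S')..S', D (x, y) = (∫ y in (0)..S', D (x, y)) -
      ∫ y in (0)..(-S'), D (x, y) := fun x => split (by fun_prop) S'
  simp only [e1]
  rw [split (f := fun x => (∫ y in (0)..S', D (x, y)) - ∫ y in (0)..(-S'), D (x, y))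
    ((hDi' _).sub (hDi' _)), intervalIntegral.integral_sub
    ((hDi' _).intervalIntegrable _ _) ((hDi' _).intervalIntegrable _ _),
    intervalIntegral.integral_sub ((hDi' _).intervalIntegrable _ _)
      ((hDi' _).intervalIntegrable _ _), hquad, hquad, hquad, hquad,
    split (f := fun x => G (x, S')) (by fun_prop), split (f := fun x => G (x, -S')) (by fun_prop),
    split (f := fun x => F (S, x)) (by fun_prop), split (f := fun x => F (-S, x)) (by fun_prop)]
  ring

/-- An integrable function on the line tends to zero along a sequence of pairs `±S`, which may be
chosen in a given set of full measure. -/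
theorem exists_seq_tendsto_zero_of_integrable {φ : ℝ → ℝ} (hφ : Integrable φ) {P : ℝ → Prop}
    (hP : ∀ᵐ s, P s) :
    ∃ S : ℕ → ℝ, Tendsto S atTop atTop ∧ Tendsto (fun n => φ (S n)) atTop (𝓝 0) ∧
      Tendsto (fun n => φ (-S n)) atTop (𝓝 0) ∧ ∀ n, 0 < S n ∧ P (S n) ∧ P (-S n) := by
  have hP' : ∀ᵐ s : ℝ, P (-s) := (quasiMeasurePreserving_neg volume).ae hP
  have key : ∀ n : ℕ, ∃ s : ℝ, (n + 1 : ℝ) ≤ s ∧ (P s ∧ P (-s)) ∧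
      ‖φ s‖ + ‖φ (-s)‖ < 1 / (n + 1) := by
    intro n
    by_contra! h
    have hint : Integrable fun s => ‖φ s‖ + ‖φ (-s)‖ := hφ.norm.add hφ.comp_neg.norm
    have hlt := hint.measure_ge_lt_top (ε := 1 / (n + 1)) (by positivity)
    have hle : volume (Ici (n + 1 : ℝ)) ≤
        volume {s : ℝ | 1 / (n + 1) ≤ ‖φ s‖ + ‖φ (-s)‖} := by
      refine measure_mono_ae ?_
      filter_upwards [hP, hP'] with s h1 h2 hs using h s hs ⟨h1, h2⟩
    rw [Real.volume_Ici] at hle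
    exact absurd hlt (not_lt.2 hle)
  choose S h1 h2 h3 using key
  have hlim : Tendsto (fun n : ℕ => (1 : ℝ) / (n + 1)) atTop (𝓝 0) :=
    tendsto_one_div_add_atTop_nhds_zero_nat
  refine ⟨S, ?_, ?_, ?_, fun n => ⟨?_, h2 n⟩⟩
  · refine tendsto_atTop_mono (fun n => ?_) (tendsto_natCast_atTop_atTop (R := ℝ))
    linarith [h1 n]
  · refine squeeze_zero_norm (fun n => ?_) hlim
    linarith [h3 n, norm_nonneg (φ (-S n))]
  · refine squeeze_zero_norm (fun n => ?_) hlim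
    linarith [h3 n, norm_nonneg (φ (S n))]
  · exact lt_of_lt_of_le (by positivity) (h1 n)

/-- The Gaussian weight `exp (-u s ^ 2)`. -/
def gauss (u s : ℝ) : ℂ := Real.exp (-u * s ^ 2)

theorem continuous_gauss (u : ℝ) : Continuous (gauss u) := by
  unfold gauss; fun_prop

theorem hasDerivAt_gauss (u s : ℝ) : HasDerivAt (gauss u) (-2 * u * s * gauss u s) s := by
  have h := (((hasDerivAt_id' s).fun_pow 2).const_mul (-u)).exp.ofReal_comp
  refine h.congr_deriv ?_
  simp only [gauss]
  push_cast
  ring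

/-- Division of a `C¹` function by a coordinate on whose zero set it vanishes. -/
theorem exists_continuous_mul_eq_sub {K : ℝ × ℝ → ℂ} (hK : ContDiff ℝ 1 K) :
    ∃ M : ℝ × ℝ → ℂ, Continuous M ∧ ∀ y, (y.1 : ℂ) * M y = K y - K (0, y.2) := by
  have hc := hK.continuous_fderiv one_ne_zero
  refine ⟨fun y => ∫ t in (0 : ℝ)..1, fderiv ℝ K (t * y.1, y.2) (1, 0),
    intervalIntegral.continuous_parametric_intervalIntegral_of_continuous' (by fun_prop) _ _,
    fun y => ?_⟩
  have h : ∀ t ∈ uIcc (0 : ℝ) 1, HasDerivAt (fun t : ℝ => K (t * y.1, y.2))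
      ((y.1 : ℂ) * fderiv ℝ K (t * y.1, y.2) (1, 0)) t := by
    intro t _
    have h1 := (hK.differentiable one_ne_zero (t * y.1, y.2)).hasFDerivAt.comp_hasDerivAt t
      (((hasDerivAt_id' t).mul_const y.1).prodMk (hasDerivAt_const t y.2))
    refine h1.congr_deriv ?_
    have h2 : ((1 * y.1, 0) : ℝ × ℝ) = y.1 • ((1, 0) : ℝ × ℝ) := by simp
    rw [h2, map_smul, Complex.real_smul]
  have h2 := intervalIntegral.integral_eq_sub_of_hasDerivAt h
    (Continuous.intervalIntegrable (by fun_prop) _ _)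
  rw [intervalIntegral.integral_const_mul] at h2
  rw [h2]
  simp

/-- The differential equation for the regularized kernel, integrated against Gaussian weights over
a box. -/
theorem integral_box_gauss {K : ℝ × ℝ → ℂ} (hK : ContDiff ℝ 1 K) {ι : Type*} [Fintype ι]
    {p q : ι → ℝ → ℂ} (hp : ∀ m, Continuous (p m)) (hq : ∀ m, Continuous (q m))
    (hid : ∀ y : ℝ × ℝ, (y.2 : ℂ) ^ 2 * (y.1 * fderiv ℝ K y (1, 0) - K y + K (0, y.2)) +
        (y.1 : ℂ) ^ 2 * (y.2 * fderiv ℝ K y (0, 1) - K y + K (y.1, 0)) =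
        -((y.1 : ℂ) ^ 2 * y.2 ^ 2 * ∑ m, p m y.1 * q m y.2)) (u v : ℝ) {S S' : ℝ} (hS : 0 < S)
    (hS' : 0 < S') :
    ∫ x in (-S)..S, ∫ y in (-S')..S', gauss u x * gauss v y * (∑ m, p m x * q m y +
        2 * u * (K (x, y) - K (0, y)) + 2 * v * (K (x, y) - K (x, 0))) =
      -(gauss v S' / S' * ∫ x in (-S)..S, gauss u x * (K (x, S') + K (x, -S') - 2 * K (x, 0))) -
        gauss u S / S * ∫ y in (-S')..S', gauss v y * (K (S, y) + K (-S, y) - 2 * K (0, y)) := by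
  have hKc := hK.continuous
  have hKd := hK.differentiable one_ne_zero
  have hgu := continuous_gauss u
  have hgv := continuous_gauss v
  have hgud : Differentiable ℝ (gauss u) := fun s => (hasDerivAt_gauss u s).differentiableAt
  have hgvd : Differentiable ℝ (gauss v) := fun s => (hasDerivAt_gauss v s).differentiableAt
  obtain ⟨M, hM, hM1⟩ := exists_continuous_mul_eq_sub hK
  obtain ⟨N, hN, hN1⟩ := exists_continuous_mul_eq_sub (K := fun y => K (y.2, y.1))
    (hK.comp (contDiff_snd.prodMk contDiff_fst))
  have hMq : ∀ y : ℝ × ℝ, y.1 ≠ 0 → M y = (K y - K (0, y.2)) / y.1 := fun y hy => by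
    rw [← hM1, mul_div_cancel_left₀ _ (by exact_mod_cast hy)]
  have hNq : ∀ y : ℝ × ℝ, y.2 ≠ 0 → N (y.2, y.1) = (K y - K (y.1, 0)) / y.2 := fun y hy => by
    rw [← hN1 (y.2, y.1), mul_div_cancel_left₀ _ (by exact_mod_cast hy)]
  have hof : ∀ {f : ℝ × ℝ → ℝ} (_ : Differentiable ℝ f),
      Differentiable ℝ fun y => (f y : ℂ) := fun {f} hf => Complex.ofRealCLM.differentiable.comp hf
  have hF : ∀ y : ℝ × ℝ, y.1 ≠ 0 →
      HasFDerivAt (fun y => gauss u y.1 * gauss v y.2 * M y)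
        (fderiv ℝ (fun y : ℝ × ℝ => gauss u y.1 * gauss v y.2 * ((K y - K (0, y.2)) / y.1)) y) y := by
    intro y hy
    have hyc : (y.1 : ℂ) ≠ 0 := by exact_mod_cast hy
    refine HasFDerivAt.congr_of_eventuallyEq (DifferentiableAt.hasFDerivAt ?_) ?_
    · simp only [div_eq_mul_inv]
      exact DifferentiableAt.fun_mul (by fun_prop) (DifferentiableAt.fun_mul (by fun_prop)
        ((hof differentiable_fst y).fun_inv hyc))
    · filter_upwards [continuous_fst.continuousAt.eventually_ne hy] with z hz
      rw [hMq z hz]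
  have hG : ∀ y : ℝ × ℝ, y.2 ≠ 0 →
      HasFDerivAt (fun y : ℝ × ℝ => gauss u y.1 * gauss v y.2 * N (y.2, y.1))
        (fderiv ℝ (fun y : ℝ × ℝ => gauss u y.1 * gauss v y.2 * ((K y - K (y.1, 0)) / y.2)) y) y := by
    intro y hy
    have hyc : (y.2 : ℂ) ≠ 0 := by exact_mod_cast hy
    refine HasFDerivAt.congr_of_eventuallyEq (DifferentiableAt.hasFDerivAt ?_) ?_
    · simp only [div_eq_mul_inv]
      exact DifferentiableAt.fun_mul (by fun_prop) (DifferentiableAt.fun_mul (by fun_prop)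
        ((hof differentiable_snd y).fun_inv hyc))
    · filter_upwards [continuous_snd.continuousAt.eventually_ne hy] with z hz
      rw [hNq z hz]
  have hdiv := integral_box_divergence (F := fun y => gauss u y.1 * gauss v y.2 * M y)
    (G := fun y => gauss u y.1 * gauss v y.2 * N (y.2, y.1))
    (D := fun y => -(gauss u y.1 * gauss v y.2 * (∑ m, p m y.1 * q m y.2 +
        2 * u * (K y - K (0, y.2)) + 2 * v * (K y - K (y.1, 0)))))
    (by fun_prop) (by fun_prop) (by fun_prop) (fun y h _ => (hF y h).differentiableAt)
    (fun y _ h => (hG y h).differentiableAt) ?_ S S'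
  · have hSc : (S : ℂ) ≠ 0 := by exact_mod_cast hS.ne'
    have hSc' : (S' : ℂ) ≠ 0 := by exact_mod_cast hS'.ne'
    rw [← intervalIntegral.integral_sub (Continuous.intervalIntegrable (by fun_prop) _ _)
        (Continuous.intervalIntegrable (by fun_prop) _ _),
      ← intervalIntegral.integral_sub (Continuous.intervalIntegrable (by fun_prop) _ _)
        (Continuous.intervalIntegrable (by fun_prop) _ _)] at hdiv
    simp only [intervalIntegral.integral_neg] at hdiv
    rw [neg_eq_iff_eq_neg] at hdiv
    have hneg : ∀ u s, gauss u (-s) = gauss u s := fun u s => by simp [gauss]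
    rw [hdiv, ← intervalIntegral.integral_const_mul, ← intervalIntegral.integral_const_mul, neg_add,
      ← sub_eq_add_neg]
    refine congrArg₂ (· - ·) (congrArg Neg.neg ?_) ?_
    · refine intervalIntegral.integral_congr fun x _ => ?_
      have h1 := hNq (x, S') hS'.ne'
      have h2 := hNq (x, -S') (neg_ne_zero.2 hS'.ne')
      dsimp only at h1 h2 ⊢
      rw [h1, h2, hneg]
      push_cast
      field_simp
      ring
    · refine intervalIntegral.integral_congr fun y _ => ?_
      have h1 := hMq (S, y) hS.ne'
      have h2 := hMq (-S, y) (neg_ne_zero.2 hS.ne')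
      dsimp only at h1 h2 ⊢
      rw [h1, h2, hneg]
      push_cast
      field_simp
      ring
  · rintro ⟨s, s'⟩ hs hs'
    dsimp only at hs hs'
    have hsc : (s : ℂ) ≠ 0 := by exact_mod_cast hs
    have hsc' : (s' : ℂ) ≠ 0 := by exact_mod_cast hs'
    have hKf := (hKd (s, s')).hasFDerivAt
    have e1 := (hF (s, s') hs).differentiableAt.hasFDerivAt.comp_hasDerivAt s
      ((hasDerivAt_id' s).prodMk (hasDerivAt_const s s'))
    have e2 := (hG (s, s') hs').differentiableAt.hasFDerivAt.comp_hasDerivAt s'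
      ((hasDerivAt_const s' s).prodMk (hasDerivAt_id' s'))
    have k1 : HasDerivAt (fun t => K (t, s')) (fderiv ℝ K (s, s') (1, 0)) s :=
      hKf.comp_hasDerivAt s ((hasDerivAt_id' s).prodMk (hasDerivAt_const s s'))
    have k2 : HasDerivAt (fun t => K (s, t)) (fderiv ℝ K (s, s') (0, 1)) s' :=
      hKf.comp_hasDerivAt s' ((hasDerivAt_const s' s).prodMk (hasDerivAt_id' s'))
    have hcast : ∀ s : ℝ, HasDerivAt (fun t : ℝ => (t : ℂ)) 1 s := fun s =>
      Complex.ofRealCLM.hasDerivAt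
    have f1 := ((hasDerivAt_gauss u s).mul_const (gauss v s')).fun_mul
      ((k1.sub_const (K (0, s'))).fun_div (hcast s) hsc)
    have f2 := ((hasDerivAt_gauss v s').const_mul (gauss u s)).fun_mul
      ((k2.sub_const (K (s, 0))).fun_div (hcast s') hsc')
    have g1 := e1.unique (f1.congr_of_eventuallyEq ?_)
    · have g2 := e2.unique (f2.congr_of_eventuallyEq ?_)
      · rw [g1, g2]
        have h := hid (s, s')
        dsimp only at h ⊢
        generalize ∑ m, p m s * q m s' = T at h ⊢
        field_simp
        linear_combination gauss u s * gauss v s' * h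
      · filter_upwards [eventually_ne_nhds hs'] with t ht
        simp only [Function.comp_apply]
        rw [hNq (s, t) ht]
    · filter_upwards [eventually_ne_nhds hs] with t ht
      simp only [Function.comp_apply]
      rw [hMq (t, s') ht]

/-! ### Limits of the box integrals -/

theorem norm_gauss_le_one {u : ℝ} (hu : 0 ≤ u) (s : ℝ) : ‖gauss u s‖ ≤ 1 := by
  rw [gauss, Complex.norm_real, Real.norm_of_nonneg (Real.exp_pos _).le, Real.exp_le_one_iff]
  nlinarith [sq_nonneg s, mul_nonneg hu (sq_nonneg s)]

theorem gauss_neg (u s : ℝ) : gauss u (-s) = gauss u s := by simp [gauss]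

theorem integrable_gauss {u : ℝ} (hu : 0 < u) : Integrable (gauss u) :=
  (integrable_exp_neg_mul_sq hu).ofReal

/-- A primitive `ξ` with at most a simple pole at the origin has, after subtraction of the polar
part, a continuous extension to the origin. -/
theorem exists_continuous_primitive {I : Set ℝ} {ξ r : ℝ → ℂ} {δ : ℂ}
    (hξ : ∀ s ∈ I, s ≠ 0 → HasDerivWithinAt ξ (-(δ / (s : ℂ) ^ 2 + r s)) I s)
    (hpol : ∃ c : ℂ, Tendsto (fun s : ℝ => ξ s - δ / s) (𝓝[≠] 0) (𝓝 c)) :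
    ∃ R : ℝ → ℂ, ContinuousOn R I ∧ (∀ s ≠ 0, R s = ξ s - δ / s) ∧
      ∀ s ∈ I, s ≠ 0 → HasDerivWithinAt R (-r s) I s := by
  classical
  obtain ⟨c, hc⟩ := hpol
  let R : ℝ → ℂ := Function.update (fun s : ℝ => ξ s - δ / s) 0 c
  have hR : ∀ s ≠ 0, R s = ξ s - δ / s := fun s hs => Function.update_of_ne hs _ _
  have hd : ∀ s ∈ I, s ≠ 0 → HasDerivWithinAt R (-r s) I s := by
    intro s hsI hs
    have hsc : (s : ℂ) ≠ 0 := by exact_mod_cast hs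
    have h1 : HasDerivAt (fun s : ℝ => (s : ℂ)) 1 s := Complex.ofRealCLM.hasDerivAt
    have h2 := (hξ s hsI hs).fun_sub ((hasDerivAt_const s δ).fun_div h1 hsc).hasDerivWithinAt
    refine (h2.congr_deriv ?_).congr_of_eventuallyEq ?_ (hR s hs)
    · field_simp
      ring
    · filter_upwards [nhdsWithin_le_nhds (eventually_ne_nhds hs)] with t ht using hR t ht
  refine ⟨R, fun s hs => ?_, hR, hd⟩
  by_cases h0 : s = 0
  · subst h0
    exact (continuousAt_update_same.2 hc).continuousWithinAt
  · exact (hd s hs h0).continuousWithinAt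

/-- Integration by parts in the Laplace transform of `ξ`. -/
theorem integral_gauss_mul_regularPart {S : ℝ} (hS : 0 < S) {ξ r : ℝ → ℂ} {δ : ℂ}
    (hr : ContinuousOn r (Icc (-S) S))
    (hξ : ∀ s ∈ Icc (-S) S, s ≠ 0 →
      HasDerivWithinAt ξ (-(δ / (s : ℂ) ^ 2 + r s)) (Icc (-S) S) s)
    (hpol : ∃ c : ℂ, Tendsto (fun s : ℝ => ξ s - δ / s) (𝓝[≠] 0) (𝓝 c)) {u : ℝ}
    (hint : IntervalIntegrable (fun s => gauss u s * ξ s * (2 * s)) volume (-S) S) :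
    ∫ s in (-S)..S, gauss u s * r s = 2 * u * δ * (∫ s in (-S)..S, gauss u s) -
      u * (∫ s in (-S)..S, gauss u s * ξ s * (2 * s)) -
      gauss u S * (ξ S - ξ (-S) - 2 * δ / S) := by
  obtain ⟨R, hR, hRξ, hRd⟩ := exists_continuous_primitive hξ hpol
  have hle : -S ≤ S := by linarith
  have hg := continuous_gauss u
  have i1 : IntervalIntegrable (gauss u) volume (-S) S := hg.intervalIntegrable _ _
  have i2 : IntervalIntegrable (fun s => gauss u s * r s) volume (-S) S :=
    ContinuousOn.intervalIntegrable (by rw [uIcc_of_le hle]; exact hg.continuousOn.mul hr)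
  have hI : IntervalIntegrable (fun s => 2 * u * δ * gauss u s -
      u * (gauss u s * ξ s * (2 * s)) - gauss u s * r s) volume (-S) S :=
    ((i1.const_mul _).sub (hint.const_mul _)).sub i2
  have h := integral_eq_of_hasDerivAt_off_countable_of_le (fun s => gauss u s * R s)
    (fun s => 2 * u * δ * gauss u s - u * (gauss u s * ξ s * (2 * s)) - gauss u s * r s)
    hle (countable_singleton 0) (hg.continuousOn.mul hR) (fun s hs => ?_) hI
  · rw [intervalIntegral.integral_sub ((i1.const_mul _).sub (hint.const_mul _)) i2,
      intervalIntegral.integral_sub (i1.const_mul _) (hint.const_mul _),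
      intervalIntegral.integral_const_mul, intervalIntegral.integral_const_mul,
      hRξ S hS.ne', hRξ (-S) (neg_ne_zero.2 hS.ne'), gauss_neg] at h
    push_cast at h
    linear_combination -h
  · have hs0 : s ≠ 0 := hs.2
    have hsc : (s : ℂ) ≠ 0 := by exact_mod_cast hs0
    have h1 := (hRd s (Ioo_subset_Icc_self hs.1) hs0).hasDerivAt (Icc_mem_nhds hs.1.1 hs.1.2)
    refine ((hasDerivAt_gauss u s).fun_mul h1).congr_deriv ?_
    rw [hRξ s hs0]
    field_simp
    ring

/-- The limit of `integral_gauss_mul_regularPart` along a sequence of intervals at whose ends the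
integrand of the Laplace transform of `ξ` tends to zero. -/
theorem tendsto_integral_gauss_mul_regularPart {S : ℕ → ℝ} (hS : ∀ n, 0 < S n)
    (hS' : Tendsto S atTop atTop) {ξ r : ℝ → ℂ} {δ : ℂ} (hr : Continuous r)
    (hξ : ∀ s : ℝ, s ≠ 0 → HasDerivAt ξ (-(δ / (s : ℂ) ^ 2 + r s)) s)
    (hpol : ∃ c : ℂ, Tendsto (fun s : ℝ => ξ s - δ / s) (𝓝[≠] 0) (𝓝 c)) {u : ℝ} (hu : 0 < u)
    (hint : Integrable fun s : ℝ => gauss u s * ξ s * (2 * s))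
    (h1 : Tendsto (fun n => gauss u (S n) * ξ (S n) * (2 * S n)) atTop (𝓝 0))
    (h2 : Tendsto (fun n => gauss u (-S n) * ξ (-S n) * (2 * (-S n : ℝ))) atTop (𝓝 0)) :
    Tendsto (fun n => ∫ s in (-S n)..S n, gauss u s * r s) atTop
      (𝓝 (2 * u * δ * (∫ s, gauss u s) - u * ∫ s, gauss u s * ξ s * (2 * s))) := by
  have e : ∀ n, ∫ s in (-S n)..S n, gauss u s * r s = 2 * u * δ * (∫ s in (-S n)..S n, gauss u s) -
      u * (∫ s in (-S n)..S n, gauss u s * ξ s * (2 * s)) -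
      ((gauss u (S n) * ξ (S n) * (2 * S n)) * (2 * S n : ℂ)⁻¹ +
        (gauss u (-S n) * ξ (-S n) * (2 * (-S n : ℝ))) * (2 * S n : ℂ)⁻¹ -
          gauss u (S n) * (2 * δ) * (S n : ℂ)⁻¹) := by
    intro n
    rw [integral_gauss_mul_regularPart (hS n) hr.continuousOn
      (fun s _ hs => (hξ s hs).hasDerivWithinAt) hpol (hint.intervalIntegrable), gauss_neg]
    have : (S n : ℂ) ≠ 0 := by exact_mod_cast (hS n).ne'
    push_cast
    field_simp
    ring
  have hinv : Tendsto (fun n => ((S n : ℂ))⁻¹) atTop (𝓝 0) := by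
    have h3 := (Complex.continuous_ofReal.tendsto 0).comp (tendsto_inv_atTop_zero.comp hS')
    simpa [Function.comp_def] using h3
  have hinv2 : Tendsto (fun n => (2 * (S n : ℂ))⁻¹) atTop (𝓝 0) := by
    have := hinv.const_mul (2⁻¹ : ℂ)
    simpa [mul_inv, mul_comm] using this
  have hbot : Tendsto (fun n => -S n) atTop atBot := tendsto_neg_atTop_atBot.comp hS'
  have hlast : Tendsto (fun n => gauss u (S n) * (2 * δ) * (S n : ℂ)⁻¹) atTop (𝓝 0) := by
    refine squeeze_zero_norm (a := fun n => ‖2 * δ‖ * ‖(S n : ℂ)⁻¹‖) (fun n => ?_) ?_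
    · rw [norm_mul, norm_mul]
      gcongr
      exact mul_le_of_le_one_left (norm_nonneg _) (norm_gauss_le_one hu.le _)
    · simpa using (hinv.norm.const_mul ‖2 * δ‖)
  simp only [e]
  have := (((intervalIntegral_tendsto_integral (integrable_gauss hu) hbot hS').const_mul
    (2 * u * δ)).sub ((intervalIntegral_tendsto_integral hint hbot hS').const_mul (u : ℂ))).sub
    (((h1.mul hinv2).add (h2.mul hinv2)).sub hlast)
  simpa using this

theorem intervalIntegral_integral_eq_setIntegral {D : ℝ × ℝ → ℂ} (hD : Continuous D) {S S' : ℝ}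
    (hS : 0 < S) (hS' : 0 < S') :
    ∫ x in (-S)..S, ∫ y in (-S')..S', D (x, y) = ∫ y in Ioc (-S) S ×ˢ Ioc (-S') S', D y := by
  have hint : IntegrableOn D (Ioc (-S) S ×ˢ Ioc (-S') S') :=
    (hD.continuousOn.integrableOn_compact (isCompact_Icc.prod isCompact_Icc)).mono_set
      (prod_mono Ioc_subset_Icc_self Ioc_subset_Icc_self)
  rw [Measure.volume_eq_prod, setIntegral_prod _ hint, intervalIntegral.integral_of_le (by linarith)]
  simp only [intervalIntegral.integral_of_le (show -S' ≤ S' by linarith)]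

/-- A boundary term of the integrated differential equation tends to zero. -/
theorem tendsto_boundary_term {u v : ℝ} (hu : 0 < u) {L : ℝ → ℝ → ℂ} {q₀ : ℝ → ℂ} {S S' : ℕ → ℝ}
    (hL : ∀ s, Continuous (L s)) (hq₀ : Continuous q₀) (hS' : ∀ n, 0 < S' n)
    (hSt : Tendsto S atTop atTop)
    (hi : ∀ n, Integrable (fun y => gauss u (S n) * gauss v y * L (S n) y))
    (hi' : ∀ n, Integrable (fun y => gauss u (-S n) * gauss v y * L (-S n) y))
    (h1 : Tendsto (fun n => ∫ y, ‖gauss u (S n) * gauss v y * L (S n) y‖) atTop (𝓝 0))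
    (h2 : Tendsto (fun n => ∫ y, ‖gauss u (-S n) * gauss v y * L (-S n) y‖) atTop (𝓝 0))
    {c : ℂ} (h3 : Tendsto (fun n => ∫ y in (-S' n)..S' n, gauss v y * q₀ y) atTop (𝓝 c)) :
    Tendsto (fun n => gauss u (S n) / S n * ∫ y in (-S' n)..S' n,
      gauss v y * (L (S n) y + L (-S n) y - 2 * q₀ y)) atTop (𝓝 0) := by
  have hgv := continuous_gauss v
  have hinv : Tendsto (fun n => ((S n : ℂ))⁻¹) atTop (𝓝 0) := by
    have h3 := (Complex.continuous_ofReal.tendsto 0).comp (tendsto_inv_atTop_zero.comp hSt)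
    simpa [Function.comp_def] using h3
  have e : ∀ n, gauss u (S n) / S n * ∫ y in (-S' n)..S' n,
      gauss v y * (L (S n) y + L (-S n) y - 2 * q₀ y) = (S n : ℂ)⁻¹ *
      ((∫ y in (-S' n)..S' n, gauss u (S n) * gauss v y * L (S n) y) +
        (∫ y in (-S' n)..S' n, gauss u (-S n) * gauss v y * L (-S n) y)) -
      gauss u (S n) * ((S n : ℂ)⁻¹ * (2 * ∫ y in (-S' n)..S' n, gauss v y * q₀ y)) := by
    intro n
    have hL1 := hL (S n)
    have hL2 := hL (-S n)
    have : ∀ y, gauss v y * (L (S n) y + L (-S n) y - 2 * q₀ y) = gauss v y * L (S n) y +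
      gauss v y * L (-S n) y - 2 * (gauss v y * q₀ y) := fun y => by ring
    simp only [this, gauss_neg, mul_assoc, intervalIntegral.integral_const_mul]
    rw [intervalIntegral.integral_sub (Continuous.intervalIntegrable (by fun_prop) _ _)
      (Continuous.intervalIntegrable (by fun_prop) _ _),
      intervalIntegral.integral_add (Continuous.intervalIntegrable (by fun_prop) _ _)
      (Continuous.intervalIntegrable (by fun_prop) _ _), intervalIntegral.integral_const_mul]
    ring
  have hbd : ∀ {f : ℕ → ℝ → ℂ} (_ : ∀ n, Integrable (f n))
      (_ : Tendsto (fun n => ∫ y, ‖f n y‖) atTop (𝓝 0)),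
      Tendsto (fun n => ∫ y in (-S' n)..S' n, f n y) atTop (𝓝 0) := by
    intro f hf h
    refine squeeze_zero_norm (fun n => ?_) h
    have hle : -S' n ≤ S' n := by linarith [hS' n]
    rw [intervalIntegral.integral_of_le hle]
    exact (norm_integral_le_integral_norm _).trans
      (setIntegral_le_integral (hf n).norm (.of_forall fun _ => norm_nonneg _))
  have hlast : Tendsto (fun n => gauss u (S n) *
      ((S n : ℂ)⁻¹ * (2 * ∫ y in (-S' n)..S' n, gauss v y * q₀ y))) atTop (𝓝 0) := by
    refine squeeze_zero_norm
      (a := fun n => ‖(S n : ℂ)⁻¹ * (2 * ∫ y in (-S' n)..S' n, gauss v y * q₀ y)‖) (fun n => ?_)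
      (by simpa using (hinv.mul (h3.const_mul (2 : ℂ))).norm)
    rw [norm_mul]
    exact mul_le_of_le_one_left (norm_nonneg _) (norm_gauss_le_one hu.le _)
  simp only [e]
  simpa using (hinv.mul ((hbd hi h1).add (hbd hi' h2))).sub hlast

/-- The factorization of the double Laplace transform, for a kernel that satisfies the regularized
differential equation. The equation is integrated against Gaussian weights over boxes whose sides
escape to infinity along sequences on which the boundary terms vanish; such sequences exist because
the Laplace integrals converge absolutely. -/
theorem laplace_factorization {K : ℝ × ℝ → ℂ} (hK : ContDiff ℝ 1 K) {b : ℕ} {i j : Fin b}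
    {p q ξ η : Fin b → ℝ → ℂ} (hp : ∀ m, Continuous (p m)) (hq : ∀ m, Continuous (q m))
    (hKp : ∀ s, K (s, 0) = p j s) (hKq : ∀ s, K (0, s) = q i s)
    (hid : ∀ y : ℝ × ℝ, (y.2 : ℂ) ^ 2 * (y.1 * fderiv ℝ K y (1, 0) - K y + q i y.2) +
        (y.1 : ℂ) ^ 2 * (y.2 * fderiv ℝ K y (0, 1) - K y + p j y.1) =
        -((y.1 : ℂ) ^ 2 * y.2 ^ 2 * ∑ m, p m y.1 * q m y.2))
    (hξ : ∀ m (s : ℝ), s ≠ 0 → HasDerivAt (ξ m) (-(kron i m / (s : ℂ) ^ 2 + p m s)) s)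
    (hη : ∀ m (s : ℝ), s ≠ 0 → HasDerivAt (η m) (-(kron j m / (s : ℂ) ^ 2 + q m s)) s)
    (hξp : ∀ m, ∃ c : ℂ, Tendsto (fun s : ℝ => ξ m s - kron i m / s) (𝓝[≠] 0) (𝓝 c))
    (hηp : ∀ m, ∃ c : ℂ, Tendsto (fun s : ℝ => η m s - kron j m / s) (𝓝[≠] 0) (𝓝 c))
    {u v : ℝ} (hu : 0 < u) (hv : 0 < v)
    (hF : ∀ m, Integrable fun s : ℝ => gauss u s * ξ m s * (2 * s))
    (hG : ∀ m, Integrable fun s : ℝ => gauss v s * η m s * (2 * s))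
    (hJ : Integrable fun y : ℝ × ℝ => gauss u y.1 * gauss v y.2 * K y) {cu cv : ℂ} {P Q : Fin b → ℂ}
    (hcu : ∫ s, gauss u s = cu) (hcv : ∫ s, gauss v s = cv)
    (hP : ∀ m, 2 * u * kron i m * cu - u * ∫ s : ℝ, gauss u s * ξ m s * (2 * s) = P m)
    (hQ : ∀ m, 2 * v * kron j m * cv - v * ∫ s : ℝ, gauss v s * η m s * (2 * s) = Q m) :
    ∑ m, P m * Q m + 2 * u * ((∫ y : ℝ × ℝ, gauss u y.1 * gauss v y.2 * K y) - cu * Q i) +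
      2 * v * ((∫ y : ℝ × ℝ, gauss u y.1 * gauss v y.2 * K y) - P j * cv) = 0 := by
  have hKc := hK.continuous
  have hgu := continuous_gauss u
  have hgv := continuous_gauss v
  rw [Measure.volume_eq_prod] at hJ
  -- sequences along which the boundary terms vanish
  obtain ⟨S, hS, hS1, hS2, hS3⟩ := exists_seq_tendsto_zero_of_integrable
    ((integrable_finsetSum Finset.univ fun m _ => (hF m).norm).add hJ.integral_norm_prod_left)
    hJ.prod_right_ae
  obtain ⟨S', hS', hS1', hS2', hS3'⟩ := exists_seq_tendsto_zero_of_integrable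
    ((integrable_finsetSum Finset.univ fun m _ => (hG m).norm).add hJ.integral_norm_prod_right)
    hJ.prod_left_ae
  have hn0 : ∀ f : ℝ → ℂ, 0 ≤ ∫ y, ‖f y‖ := fun f => integral_nonneg fun _ => norm_nonneg _
  have hs0 : ∀ f : Fin b → ℂ, 0 ≤ ∑ m, ‖f m‖ := fun f => Finset.sum_nonneg fun _ _ => norm_nonneg _
  have hs1 : ∀ (f : Fin b → ℂ) (m : Fin b), ‖f m‖ ≤ ∑ m, ‖f m‖ := fun f m =>
    Finset.single_le_sum (f := fun m => ‖f m‖) (fun _ _ => norm_nonneg _) (Finset.mem_univ m)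
  have hPm : ∀ m, Tendsto (fun n => ∫ s in (-S n)..S n, gauss u s * p m s) atTop
      (𝓝 (P m)) := by
    intro m
    rw [← hP, ← hcu]
    exact tendsto_integral_gauss_mul_regularPart (fun n => (hS3 n).1) hS (hp m) (hξ m)
      (hξp m) hu (hF m)
      (squeeze_zero_norm (fun n => (hs1 (fun m => gauss u (S n) * ξ m (S n) * (2 * S n))
        m).trans (le_add_of_nonneg_right (hn0 _))) hS1)
      (squeeze_zero_norm (fun n => (hs1 (fun m => gauss u (-S n) * ξ m (-S n) *
        (2 * (-S n : ℝ))) m).trans (le_add_of_nonneg_right (hn0 _))) hS2)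
  have hQm : ∀ m, Tendsto (fun n => ∫ s in (-S' n)..S' n, gauss v s * q m s) atTop
      (𝓝 (Q m)) := by
    intro m
    rw [← hQ, ← hcv]
    exact tendsto_integral_gauss_mul_regularPart (fun n => (hS3' n).1) hS' (hq m) (hη m)
      (hηp m) hv (hG m)
      (squeeze_zero_norm (fun n => (hs1 (fun m => gauss v (S' n) * η m (S' n) * (2 * S' n))
        m).trans (le_add_of_nonneg_right (hn0 _))) hS1')
      (squeeze_zero_norm (fun n => (hs1 (fun m => gauss v (-S' n) * η m (-S' n) *
        (2 * (-S' n : ℝ))) m).trans (le_add_of_nonneg_right (hn0 _))) hS2')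
  have t1 : Tendsto (fun n => ∫ x, ‖gauss v (S' n) * gauss u x * K (x, S' n)‖) atTop (𝓝 0) := by
    simp only [mul_comm (gauss v _)]
    exact squeeze_zero (fun n => hn0 _) (fun n => le_add_of_nonneg_left (hs0 _)) hS1'
  have t2 : Tendsto (fun n => ∫ x, ‖gauss v (-S' n) * gauss u x * K (x, -S' n)‖) atTop (𝓝 0) := by
    simp only [mul_comm (gauss v _)]
    exact squeeze_zero (fun n => hn0 _) (fun n => le_add_of_nonneg_left (hs0 _)) hS2'
  have t3 : Tendsto (fun n => ∫ y, ‖gauss u (S n) * gauss v y * K (S n, y)‖) atTop (𝓝 0) :=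
    squeeze_zero (fun n => hn0 _) (fun n => le_add_of_nonneg_left (hs0 _)) hS1
  have t4 : Tendsto (fun n => ∫ y, ‖gauss u (-S n) * gauss v y * K (-S n, y)‖) atTop (𝓝 0) :=
    squeeze_zero (fun n => hn0 _) (fun n => le_add_of_nonneg_left (hs0 _)) hS2
  have t5 : Tendsto (fun n => ∫ s in (-S n)..S n, gauss u s * K (s, 0)) atTop (𝓝 (P j)) := by
    simpa only [hKp] using hPm j
  have t6 : Tendsto (fun n => ∫ s in (-S' n)..S' n, gauss v s * K (0, s)) atTop (𝓝 (Q i)) := by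
    simpa only [hKq] using hQm i
  have i1 : ∀ n, Integrable fun x => gauss v (S' n) * gauss u x * K (x, S' n) := fun n => by
    simpa only [mul_comm (gauss v _)] using (hS3' n).2.1
  have i2 : ∀ n, Integrable fun x => gauss v (-S' n) * gauss u x * K (x, -S' n) := fun n => by
    simpa only [mul_comm (gauss v _)] using (hS3' n).2.2
  have hb1 := tendsto_boundary_term (u := v) (v := u) hv (L := fun s x => K (x, s))
    (q₀ := fun x => K (x, 0)) (fun s => by fun_prop) (by fun_prop) (fun n => (hS3 n).1) hS' i1 i2
    t1 t2 t5
  have hb2 := tendsto_boundary_term (u := u) (v := v) hu (L := fun s x => K (s, x))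
    (q₀ := fun x => K (0, x)) (fun s => by fun_prop) (by fun_prop) (fun n => (hS3' n).1) hS
    (fun n => (hS3 n).2.1) (fun n => (hS3 n).2.2) t3 t4 t6
  have hcut : Tendsto (fun n => ∫ s in (-S n)..S n, gauss u s) atTop (𝓝 cu) :=
    hcu ▸ intervalIntegral_tendsto_integral (integrable_gauss hu)
      (tendsto_neg_atTop_atBot.comp hS) hS
  have hcvt : Tendsto (fun n => ∫ s in (-S' n)..S' n, gauss v s) atTop (𝓝 cv) :=
    hcv ▸ intervalIntegral_tendsto_integral (integrable_gauss hv)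
      (tendsto_neg_atTop_atBot.comp hS') hS'
  have hcov : AECover (volume : Measure (ℝ × ℝ)) atTop
      (fun n => Ioc (-S n) (S n) ×ˢ Ioc (-S' n) (S' n)) := by
    refine ⟨.of_forall fun y => ?_, fun n => measurableSet_Ioc.prod measurableSet_Ioc⟩
    filter_upwards [hS.eventually_gt_atTop |y.1|, hS'.eventually_gt_atTop |y.2|] with n h1 h2
    obtain ⟨h3, h4⟩ := abs_lt.1 h1
    obtain ⟨h5, h6⟩ := abs_lt.1 h2
    exact ⟨⟨h3, h4.le⟩, ⟨h5, h6.le⟩⟩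
  have hJt := hcov.integral_tendsto_of_countably_generated hJ
  -- the integrated differential equation over the boxes
  have hbox : ∀ n, (∑ m, (∫ s in (-S n)..S n, gauss u s * p m s) *
        ∫ s in (-S' n)..S' n, gauss v s * q m s) +
      2 * u * ((∫ y in Ioc (-S n) (S n) ×ˢ Ioc (-S' n) (S' n), gauss u y.1 * gauss v y.2 * K y) -
        (∫ s in (-S n)..S n, gauss u s) * ∫ s in (-S' n)..S' n, gauss v s * q i s) +
      2 * v * ((∫ y in Ioc (-S n) (S n) ×ˢ Ioc (-S' n) (S' n), gauss u y.1 * gauss v y.2 * K y) -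
        (∫ s in (-S n)..S n, gauss u s * p j s) * ∫ s in (-S' n)..S' n, gauss v s) =
      -(gauss v (S' n) / S' n * ∫ x in (-S n)..S n,
        gauss u x * (K (x, S' n) + K (x, -S' n) - 2 * K (x, 0))) -
      gauss u (S n) / S n * ∫ y in (-S' n)..S' n,
        gauss v y * (K (S n, y) + K (-S n, y) - 2 * K (0, y)) := by
    intro n
    have h1 := integral_box_gauss hK hp hq (by simpa only [hKp, hKq] using hid) u v (hS3 n).1
      (hS3' n).1
    rw [← h1, intervalIntegral_integral_eq_setIntegral
      (D := fun y => gauss u y.1 * gauss v y.2 * (∑ m, p m y.1 * q m y.2 +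
        2 * u * (K y - K (0, y.2)) + 2 * v * (K y - K (y.1, 0)))) (by fun_prop) (hS3 n).1
      (hS3' n).1]
    simp only [intervalIntegral.integral_of_le (show -S n ≤ S n by linarith [(hS3 n).1]),
      intervalIntegral.integral_of_le (show -S' n ≤ S' n by linarith [(hS3' n).1]),
      ← setIntegral_prod_mul, ← Measure.volume_eq_prod, hKp, hKq]
    have hint : ∀ {f : ℝ × ℝ → ℂ} (_ : Continuous f),
        IntegrableOn f (Ioc (-S n) (S n) ×ˢ Ioc (-S' n) (S' n)) := fun {f} hf =>
      (hf.continuousOn.integrableOn_compact (isCompact_Icc.prod isCompact_Icc)).mono_set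
        (prod_mono Ioc_subset_Icc_self Ioc_subset_Icc_self)
    have hpj := hp j
    have hqi := hq i
    have e : ∀ y : ℝ × ℝ, gauss u y.1 * gauss v y.2 * (∑ m, p m y.1 * q m y.2 +
        2 * u * (K y - q i y.2) + 2 * v * (K y - p j y.1)) =
        ∑ m, (gauss u y.1 * p m y.1) * (gauss v y.2 * q m y.2) +
        2 * u * (gauss u y.1 * gauss v y.2 * K y - gauss u y.1 * (gauss v y.2 * q i y.2)) +
        2 * v * (gauss u y.1 * gauss v y.2 * K y - (gauss u y.1 * p j y.1) * gauss v y.2) := by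
      intro y
      have h2 : ∑ m, (gauss u y.1 * p m y.1) * (gauss v y.2 * q m y.2) =
          gauss u y.1 * gauss v y.2 * ∑ m, p m y.1 * q m y.2 := by
        rw [Finset.mul_sum]
        exact Finset.sum_congr rfl fun m _ => by ring
      rw [h2]
      ring
    simp only [e]
    rw [integral_add (hint (by fun_prop)) (hint (by fun_prop)),
      integral_add (hint (by fun_prop)) (hint (by fun_prop)), integral_const_mul,
      integral_const_mul, integral_sub (hint (by fun_prop)) (hint (by fun_prop)),
      integral_sub (hint (by fun_prop)) (hint (by fun_prop)),
      integral_finsetSum _ fun m _ => hint (by have := hp m; have := hq m; fun_prop)]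
  have hlim := ((tendsto_finsetSum Finset.univ fun m _ => (hPm m).mul (hQm m)).add
    ((hJt.sub (hcut.mul (hQm i))).const_mul (2 * u : ℂ))).add
    ((hJt.sub ((hPm j).mul hcvt)).const_mul (2 * v : ℂ))
  simp only [hbox] at hlim
  refine tendsto_nhds_unique hlim ?_
  simpa using hb1.neg.sub hb2

/-! ### The factorization along complete paths -/

section Laplace

variable {X : Type*} [TopologicalSpace X] [ChartedSpace ℂ X]
  {dx : OneForm X} {e : OpenPartialHomeomorph X ℂ} {B : Bidifferential X} {I : Set ℝ}
  {γ η : ℝ → X} {ξ : ℝ → ℂ} {δ : ℂ}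

theorem fIntegrand_eq (hγ : IsSteepestDescent dx e I γ) (u : ℝ) {s : ℝ} (hs : s ∈ I) :
    fIntegrand dx γ ξ u s = gauss u s * ξ s * (2 * s) := by
  rw [fIntegrand, hγ.deriv_x s hs, gauss]

theorem checkIntegrand_eq (u v : ℝ) (y : ℝ × ℝ) :
    checkIntegrand B γ η δ u v y = gauss u y.1 * gauss v y.2 *
      (pathKernel B γ η y.1 y.2 - δ / ((y.1 : ℂ) - y.2) ^ 2) := by
  rw [checkIntegrand, gauss, gauss, ← Complex.ofReal_mul, ← Real.exp_add, pathKernel]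
  congr 3
  ring_nf

theorem ae_fst_ne_snd : ∀ᵐ y : ℝ × ℝ, y.1 ≠ y.2 := by
  rw [Measure.volume_eq_prod]
  refine (Measure.ae_prod_iff_ae_ae ?_).2 (.of_forall fun x => ?_)
  · exact (isClosed_eq continuous_fst continuous_snd).isOpen_compl.measurableSet
  · filter_upwards [Measure.ae_ne volume x] with y hy using Ne.symm hy

theorem integral_gauss {u : ℝ} : ∫ s, gauss u s = (√(Real.pi / u) : ℝ) := by
  rw [← integral_gaussian]
  exact integral_ofReal

variable [IsManifold 𝓘(ℂ, ℂ) ω X] [T2Space X] [CompactSpace X] [ConnectedSpace X]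
  {g : ℕ} {A C : Fin g → ℝ → X} {b : ℕ} {a : Fin b → X} {ζ : Fin b → OpenPartialHomeomorph X ℂ}

/-- The factorization of the double Laplace transform along complete steepest descent paths. -/
theorem checkLaplace_factorization (hB : B.IsBergmanKernel) (hAC : IsCanonicalHomologyBasis g A C)
    (hBA : B.IsNormalizedOn A) (hdx : dx.IsMeromorphic) (ha : Function.Injective a)
    (ha_range : range a = {p | 0 < dx.order p}) (hζ : ∀ i, IsBranchCoordinate dx (a i) (ζ i))
    {γ : Fin b → ℝ → X} {ξ : Fin b → Fin b → ℝ → ℂ} {i j : Fin b} {u v : ℝ} (hu : 0 < u)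
    (hv : 0 < v) (hi : IsSteepestDescent dx (ζ i) univ (γ i))
    (hj : IsSteepestDescent dx (ζ j) univ (γ j))
    (hξi : ∀ k, IsXiAlong B (ζ k) univ (γ i) (kron i k) (ξ i k))
    (hξj : ∀ k, IsXiAlong B (ζ k) univ (γ j) (kron j k) (ξ j k))
    (hF : ∀ k, Integrable (fIntegrand dx (γ i) (ξ i k) u))
    (hG : ∀ k, Integrable (fIntegrand dx (γ j) (ξ j k) v))
    (hJ : Integrable (checkIntegrand B (γ i) (γ j) (kron i j) u v)) :
    checkLaplace B (γ i) (γ j) (kron i j) univ u v =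
      (u * v / (u + v) : ℝ) * (kron i j -
        ∑ k, fLaplace dx (γ i) (ξ i k) univ u * fLaplace dx (γ j) (ξ j k) univ v) := by
  choose p hpc hp _ using exists_dxi_regularPart ha hζ hdx hB uniqueDiffOn_univ ordConnected_univ
    univ_mem hi
  choose q hqc hq _ using exists_dxi_regularPart ha hζ hdx hB uniqueDiffOn_univ ordConnected_univ
    univ_mem hj
  simp only [continuousOn_univ, mem_univ, forall_const] at hpc hp hqc hq
  obtain ⟨K, hK, hKe, hKp, hKq, hid⟩ := exists_smooth_kernel hB hAC hBA hdx ha ha_range hζ hi hj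
    hpc hqc hp hq
  have hae : checkIntegrand B (γ i) (γ j) (kron i j) u v =ᵐ[volume]
      fun y => gauss u y.1 * gauss v y.2 * K y := by
    filter_upwards [ae_fst_ne_snd] with y hy
    rw [checkIntegrand_eq, hKe y hy]
  have hFe : ∀ k, fIntegrand dx (γ i) (ξ i k) u = fun s : ℝ => gauss u s * ξ i k s * (2 * s) :=
    fun k => funext fun s => fIntegrand_eq hi u (mem_univ s)
  have hGe : ∀ k, fIntegrand dx (γ j) (ξ j k) v = fun s : ℝ => gauss v s * ξ j k s * (2 * s) :=
    fun k => funext fun s => fIntegrand_eq hj v (mem_univ s)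
  have hu' : (√u : ℂ) ≠ 0 := by exact_mod_cast (Real.sqrt_pos.2 hu).ne'
  have hv' : (√v : ℂ) ≠ 0 := by exact_mod_cast (Real.sqrt_pos.2 hv).ne'
  have hpi' : (√Real.pi : ℂ) ≠ 0 := by exact_mod_cast (Real.sqrt_pos.2 Real.pi_pos).ne'
  have hu2 : (u : ℂ) = √u ^ 2 := by exact_mod_cast (Real.sq_sqrt hu.le).symm
  have hv2 : (v : ℂ) = √v ^ 2 := by exact_mod_cast (Real.sq_sqrt hv.le).symm
  have hpi2 : (Real.pi : ℂ) = √Real.pi ^ 2 := by exact_mod_cast (Real.sq_sqrt Real.pi_pos.le).symm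
  have huv : (√u : ℂ) ^ 2 + √v ^ 2 ≠ 0 := by
    rw [← hu2, ← hv2]
    exact_mod_cast (add_pos hu hv).ne'
  have key := laplace_factorization hK hpc hqc hKp hKq hid
    (fun m s hs => by
      have h := (hξi m).deriv s (mem_univ s) hs
      rw [hasDerivWithinAt_univ, hp m s hs] at h
      exact h)
    (fun m s hs => by
      have h := (hξj m).deriv s (mem_univ s) hs
      rw [hasDerivWithinAt_univ, hq m s hs] at h
      exact h)
    (fun m => (hξi m).polar) (fun m => (hξj m).polar) hu hv (fun m => hFe m ▸ hF m)
    (fun m => hGe m ▸ hG m) (hJ.congr hae) (cu := √Real.pi / √u) (cv := √Real.pi / √v)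
    (P := fun m => 2 * √u * √Real.pi * (kron i m * 1 + -fLaplace dx (γ i) (ξ i m) univ u))
    (Q := fun m => 2 * √v * √Real.pi * (kron j m * 1 + -fLaplace dx (γ j) (ξ j m) univ v))
    (by rw [integral_gauss, Real.sqrt_div Real.pi_pos.le]; push_cast; rfl)
    (by rw [integral_gauss, Real.sqrt_div Real.pi_pos.le]; push_cast; rfl)
    (fun m => by
      rw [fLaplace, setIntegral_univ, hFe, hu2]
      push_cast
      field_simp
      ring)
    (fun m => by
      rw [fLaplace, setIntegral_univ, hGe, hv2]
      push_cast
      field_simp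
      ring)
  have hsum : ∀ x y : Fin b → ℂ, ∑ m, 2 * (√u : ℂ) * √Real.pi * x m *
      (2 * (√v : ℂ) * √Real.pi * y m) = 4 * √u * √v * √Real.pi ^ 2 * ∑ m, x m * y m := by
    intro x y
    rw [Finset.mul_sum]
    exact Finset.sum_congr rfl fun m _ => by ring
  rw [hsum, sum_kron_add_mul_kron_add] at key
  simp only [neg_mul_neg] at key
  rw [checkLaplace, univ_prod_univ, setIntegral_univ, integral_congr_ae hae, Real.sqrt_mul hu.le]
  generalize (∫ y : ℝ × ℝ, gauss u y.1 * gauss v y.2 * K y) = J at key ⊢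
  generalize (∑ k, fLaplace dx (γ i) (ξ i k) univ u * fLaplace dx (γ j) (ξ j k) univ v) = T at key ⊢
  push_cast
  rw [kron_comm j i] at key
  rw [hpi2, hu2, hv2]
  rw [hu2, hv2] at key
  generalize (√u : ℂ) = x at *
  generalize (√v : ℂ) = y at *
  generalize (√Real.pi : ℂ) = z at *
  generalize fLaplace dx (γ i) (ξ i j) univ u = F at *
  generalize fLaplace dx (γ j) (ξ j i) univ v = G at *
  have h1 : 2 * (x ^ 2 + y ^ 2) * J = 4 * x * y * z ^ 2 * (kron i j - T) := by
    field_simp at key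
    linear_combination key
  field_simp
  linear_combination h1 / 2

end Laplace

/-! ### Gaussian moments and Watson's lemma -/

theorem integrable_exp_mul_pow {u : ℝ} (hu : 0 < u) (n : ℕ) :
    Integrable fun s : ℝ => Real.exp (-u * s ^ 2) * s ^ n := by
  have h := integrable_rpow_mul_exp_neg_mul_sq hu (s := n) (by linarith [n.cast_nonneg (α := ℝ)])
  simpa only [Real.rpow_natCast, mul_comm] using h

theorem integral_exp_mul_pow_add_two {u : ℝ} (hu : 0 < u) (n : ℕ) :
    ∫ s : ℝ, Real.exp (-u * s ^ 2) * s ^ (n + 2) =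
      (n + 1) / (2 * u) * ∫ s : ℝ, Real.exp (-u * s ^ 2) * s ^ n := by
  have h := integral_eq_zero_of_hasDerivAt_of_integrable
    (f := fun s : ℝ => Real.exp (-u * s ^ 2) * s ^ (n + 1))
    (f' := fun s => (n + 1) * (Real.exp (-u * s ^ 2) * s ^ n) -
      2 * u * (Real.exp (-u * s ^ 2) * s ^ (n + 2))) (fun s => ?_)
    (((integrable_exp_mul_pow hu n).const_mul _).sub ((integrable_exp_mul_pow hu _).const_mul _))
    (integrable_exp_mul_pow hu _)
  · rw [integral_sub ((integrable_exp_mul_pow hu n).const_mul _)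
      ((integrable_exp_mul_pow hu _).const_mul _), integral_const_mul, integral_const_mul] at h
    generalize (∫ s : ℝ, Real.exp (-u * s ^ 2) * s ^ (n + 2)) = x at h ⊢
    generalize (∫ s : ℝ, Real.exp (-u * s ^ 2) * s ^ n) = y at h ⊢
    field_simp
    linear_combination -h
  · have h1 := (((hasDerivAt_id' s).fun_pow 2).const_mul (-u)).exp.fun_mul
      ((hasDerivAt_id' s).fun_pow (n + 1))
    refine h1.congr_deriv ?_
    rw [show n + 1 - 1 = n from rfl]
    push_cast
    ring

theorem integral_exp_mul_pow_odd {u : ℝ} (hu : 0 < u) (n : ℕ) :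
    ∫ s : ℝ, Real.exp (-u * s ^ 2) * s ^ (2 * n + 1) = 0 := by
  induction n with
  | zero =>
    have h := integral_neg_eq_self (fun s : ℝ => Real.exp (-u * s ^ 2) * s ^ (2 * 0 + 1)) volume
    have e : ∀ s : ℝ, Real.exp (-u * (-s) ^ 2) * (-s) ^ (2 * 0 + 1) =
      -(Real.exp (-u * s ^ 2) * s ^ (2 * 0 + 1)) := fun s => by ring_nf
    simp only [e, integral_neg] at h
    linarith
  | succ n ih => rw [show 2 * (n + 1) + 1 = (2 * n + 1) + 2 by ring,
      integral_exp_mul_pow_add_two hu, ih, mul_zero]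

theorem doubleFactorial_two_mul_succ_sub_one (n : ℕ) :
    (2 * (n + 1) - 1).doubleFactorial = (2 * n + 1) * (2 * n - 1).doubleFactorial := by
  rcases n with _ | n
  · rfl
  · rw [show 2 * (n + 1 + 1) - 1 = (2 * n + 1) + 2 by omega, Nat.doubleFactorial_add_two,
      show 2 * (n + 1) - 1 = 2 * n + 1 by omega]
    ring

theorem integral_exp_mul_pow_even {u : ℝ} (hu : 0 < u) (n : ℕ) :
    ∫ s : ℝ, Real.exp (-u * s ^ 2) * s ^ (2 * n) =
      √(Real.pi / u) * ((2 * n - 1).doubleFactorial / (2 * u) ^ n) := by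
  induction n with
  | zero => simpa using integral_gaussian u
  | succ n ih =>
    rw [show 2 * (n + 1) = 2 * n + 2 by ring, integral_exp_mul_pow_add_two hu, ih,
      show 2 * n + 2 = 2 * (n + 1) by ring, doubleFactorial_two_mul_succ_sub_one]
    push_cast
    field_simp
    ring

theorem gauss_mul_pow (u s : ℝ) (n : ℕ) :
    gauss u s * (s : ℂ) ^ n = (Real.exp (-u * s ^ 2) * s ^ n : ℝ) := by
  rw [gauss]; push_cast; rfl

theorem integrable_gauss_mul_pow {u : ℝ} (hu : 0 < u) (n : ℕ) :
    Integrable fun s : ℝ => gauss u s * (s : ℂ) ^ n := by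
  simp only [gauss_mul_pow]
  exact (integrable_exp_mul_pow hu n).ofReal

theorem sum_range_two_mul {M : Type*} [AddCommMonoid M] (f : ℕ → M) (N : ℕ) :
    ∑ d ∈ Finset.range (2 * N), f d = ∑ n ∈ Finset.range N, (f (2 * n) + f (2 * n + 1)) := by
  induction N with
  | zero => simp
  | succ N ih => rw [show 2 * (N + 1) = 2 * N + 1 + 1 by ring, Finset.sum_range_succ,
      Finset.sum_range_succ, Finset.sum_range_succ, ih, add_assoc]

/-- The normalized Gaussian moments. -/
def gaussMoment (u : ℝ) (d : ℕ) : ℂ := √u / √Real.pi * ∫ s : ℝ, gauss u s * (s : ℂ) ^ d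

theorem gaussMoment_odd {u : ℝ} (hu : 0 < u) (n : ℕ) : gaussMoment u (2 * n + 1) = 0 := by
  simp only [gaussMoment, gauss_mul_pow]
  rw [integral_complex_ofReal, integral_exp_mul_pow_odd hu, Complex.ofReal_zero, mul_zero]

theorem gaussMoment_even {u : ℝ} (hu : 0 < u) (n : ℕ) :
    gaussMoment u (2 * n) = (2 * n - 1).doubleFactorial / (2 * u) ^ n := by
  have hu' : (√u : ℂ) ≠ 0 := by exact_mod_cast (Real.sqrt_pos.2 hu).ne'
  have hpi' : (√Real.pi : ℂ) ≠ 0 := by exact_mod_cast (Real.sqrt_pos.2 Real.pi_pos).ne'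
  simp only [gaussMoment, gauss_mul_pow]
  rw [integral_complex_ofReal, integral_exp_mul_pow_even hu, Real.sqrt_div Real.pi_pos.le]
  push_cast
  field_simp

/-- The moments control Gaussian integrals of functions with a zero at the origin. -/
theorem sqrt_mul_integral_exp_mul_pow {u : ℝ} (hu : 0 < u) (n : ℕ) :
    √u * ∫ s : ℝ, Real.exp (-u * s ^ 2) * s ^ (2 * n) =
      √Real.pi * ((2 * n - 1).doubleFactorial / 2 ^ n) * (u⁻¹) ^ n := by
  rw [integral_exp_mul_pow_even hu, Real.sqrt_div Real.pi_pos.le]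
  have := (Real.sqrt_pos.2 hu).ne'
  rw [mul_pow, inv_pow]
  field_simp

/-- Away from the origin every power is dominated by a given higher power. -/
theorem pow_le_div_pow_mul_pow {ε t : ℝ} (hε : 0 < ε) (ht : ε ≤ t) {d n : ℕ} (hd : d ≤ n) :
    t ^ d ≤ (ε⁻¹) ^ (n - d) * t ^ n := by
  have h : (ε⁻¹) ^ (n - d) * t ^ n = (t / ε) ^ (n - d) * t ^ d := by
    rw [div_pow, inv_pow, ← pow_sub_mul_pow t hd]
    field_simp
  rw [h]
  have h1 : 1 ≤ t / ε := (one_le_div hε).2 ht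
  have h2 : 0 < t := hε.trans_le ht
  exact le_mul_of_one_le_left (by positivity) (one_le_pow₀ h1)

/-- Watson's lemma for Gaussian integrals over a finite arc: a Taylor expansion of the integrand at
the origin gives the asymptotic expansion of the integral. -/
theorem isBigO_integral_gauss {S : ℝ} (hS : 0 < S) {Ψ : ℝ → ℂ} (hΨ : ContinuousOn Ψ (Icc (-S) S))
    (c : ℕ → ℂ) (N : ℕ)
    (h : (fun s : ℝ => Ψ s - ∑ d ∈ Finset.range (2 * N), c d * (s : ℂ) ^ d) =O[𝓝 0]
      fun s : ℝ => s ^ (2 * N)) :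
    (fun u : ℝ => (√u / √Real.pi : ℂ) * (∫ s in Icc (-S) S, gauss u s * Ψ s) -
      ∑ n ∈ Finset.range N, c (2 * n) * ((2 * n - 1).doubleFactorial / (2 * u) ^ n))
      =O[atTop] fun u : ℝ => (u⁻¹) ^ N := by
  obtain ⟨C₁, hC₁, hb⟩ := h.exists_pos
  obtain ⟨ε, hε, hball⟩ := Metric.eventually_nhds_iff_ball.1 hb.bound
  obtain ⟨C₂, hC₂⟩ := isCompact_Icc.exists_bound_of_continuousOn hΨ
  set T : ℝ → ℂ := fun s => ∑ d ∈ Finset.range (2 * N), c d * (s : ℂ) ^ d with hT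
  set ε' := min ε S with hε'
  have hε'0 : 0 < ε' := lt_min hε hS
  -- the difference is bounded by a multiple of `s ^ (2 * N)` on the whole line
  let Θ : ℝ → ℂ := fun s => (Icc (-S) S).indicator Ψ s - T s
  let C₃ := ∑ d ∈ Finset.range (2 * N), ‖c d‖ * (ε'⁻¹) ^ (2 * N - d)
  let C := C₁ + (|C₂| * (ε'⁻¹) ^ (2 * N) + C₃)
  have hC₃ : 0 ≤ C₃ := Finset.sum_nonneg fun _ _ => by positivity
  have hbound : ∀ s, ‖Θ s‖ ≤ C * s ^ (2 * N) := by
    intro s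
    have hs2 : s ^ (2 * N) = |s| ^ (2 * N) := (Even.pow_abs (even_two_mul N) s).symm
    rcases lt_or_ge |s| ε' with hs | hs
    · have hsS : s ∈ Icc (-S) S := abs_le.1 (hs.le.trans (min_le_right _ _))
      have h1 := hball s (by rw [mem_ball_zero_iff]; exact hs.trans_le (min_le_left _ _))
      simp only [Θ, indicator_of_mem hsS]
      refine h1.trans ?_
      rw [norm_pow, Real.norm_eq_abs, ← hs2]
      have : 0 ≤ (|C₂| * (ε'⁻¹) ^ (2 * N) + C₃) * s ^ (2 * N) := by
        rw [hs2]; positivity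
      simp only [C]
      linarith
    · have h1 : ‖(Icc (-S) S).indicator Ψ s‖ ≤ |C₂| * ((ε'⁻¹) ^ (2 * N) * |s| ^ (2 * N)) := by
        have h2 : ‖(Icc (-S) S).indicator Ψ s‖ ≤ |C₂| := by
          by_cases hsS : s ∈ Icc (-S) S
          · rw [indicator_of_mem hsS]; exact (hC₂ s hsS).trans (le_abs_self _)
          · rw [indicator_of_notMem hsS, norm_zero]; exact abs_nonneg _
        have h3 := pow_le_div_pow_mul_pow hε'0 hs (Nat.zero_le (2 * N))
        rw [pow_zero, Nat.sub_zero] at h3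
        exact h2.trans (le_mul_of_one_le_right (abs_nonneg _) h3)
      have h4 : ‖T s‖ ≤ C₃ * |s| ^ (2 * N) := by
        simp only [hT, C₃]
        rw [Finset.sum_mul]
        refine norm_sum_le_of_le _ fun d hd => ?_
        rw [norm_mul, norm_pow, Complex.norm_real, Real.norm_eq_abs, mul_assoc]
        gcongr
        exact pow_le_div_pow_mul_pow hε'0 hs (Finset.mem_range.1 hd).le
      have h5 : 0 ≤ C₁ * |s| ^ (2 * N) := by positivity
      refine (norm_sub_le _ _).trans ?_
      rw [hs2]
      simp only [C]
      linarith
  have hTi : ∀ {u : ℝ} (_ : 0 < u), Integrable fun s => gauss u s * T s := by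
    intro u hu
    simp only [hT, Finset.mul_sum]
    refine integrable_finsetSum _ fun d _ => ?_
    refine ((integrable_gauss_mul_pow hu d).const_mul (c d)).congr (.of_forall fun s => ?_)
    ring
  have hΨi : ∀ u : ℝ, Integrable fun s => gauss u s * (Icc (-S) S).indicator Ψ s := by
    intro u
    have h1 : IntegrableOn (fun s => gauss u s * Ψ s) (Icc (-S) S) :=
      ((continuous_gauss u).continuousOn.mul hΨ).integrableOn_compact isCompact_Icc
    refine ((integrable_indicator_iff measurableSet_Icc).2 h1).congr (.of_forall fun s => ?_)
    exact indicator_mul_right _ _ _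
  refine IsBigO.of_bound (C * ((2 * N - 1).doubleFactorial / 2 ^ N)) ?_
  filter_upwards [eventually_gt_atTop 0] with u hu
  have hpi := Real.sqrt_pos.2 Real.pi_pos
  have e1 : ∫ s in Icc (-S) S, gauss u s * Ψ s =
      ∫ s, gauss u s * (Icc (-S) S).indicator Ψ s := by
    rw [← integral_indicator measurableSet_Icc]
    exact integral_congr_ae (.of_forall fun s => indicator_mul_right _ _ _)
  have e2 : ∑ n ∈ Finset.range N, c (2 * n) * ((2 * n - 1).doubleFactorial / (2 * u : ℂ) ^ n) =
      (√u / √Real.pi : ℂ) * ∫ s, gauss u s * T s := by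
    have e3 : ∫ s, gauss u s * T s =
        ∑ d ∈ Finset.range (2 * N), c d * ∫ s : ℝ, gauss u s * (s : ℂ) ^ d := by
      simp only [hT, Finset.mul_sum]
      rw [integral_finsetSum]
      · refine Finset.sum_congr rfl fun d _ => ?_
        rw [← integral_const_mul]
        exact integral_congr_ae (.of_forall fun s => by ring)
      · intro d _
        refine ((integrable_gauss_mul_pow hu d).const_mul (c d)).congr (.of_forall fun s => ?_)
        ring
    rw [e3, Finset.mul_sum, sum_range_two_mul]
    refine Finset.sum_congr rfl fun n _ => ?_
    rw [mul_left_comm, mul_left_comm _ (c (2 * n + 1)), ← gaussMoment, ← gaussMoment,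
      gaussMoment_odd hu, gaussMoment_even hu, mul_zero, add_zero]
  rw [e1, e2, ← mul_sub, ← integral_sub (hΨi u) (hTi hu), norm_mul]
  simp only [← mul_sub]
  have h6 : ‖∫ s, gauss u s * Θ s‖ ≤ C * ∫ s : ℝ, Real.exp (-u * s ^ 2) * s ^ (2 * N) := by
    rw [← integral_const_mul]
    refine norm_integral_le_of_norm_le ((integrable_exp_mul_pow hu _).const_mul C)
      (.of_forall fun s => ?_)
    rw [norm_mul, gauss, Complex.norm_real, Real.norm_of_nonneg (Real.exp_pos _).le]
    calc _ ≤ Real.exp (-u * s ^ 2) * (C * s ^ (2 * N)) := by gcongr; exact hbound s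
      _ = _ := by ring
  have h7 : ‖(√u / √Real.pi : ℂ)‖ = √u / √Real.pi := by
    rw [norm_div, Complex.norm_real, Complex.norm_real, Real.norm_of_nonneg (Real.sqrt_nonneg _),
      Real.norm_of_nonneg (Real.sqrt_nonneg _)]
  rw [h7]
  calc _ ≤ √u / √Real.pi * (C * ∫ s : ℝ, Real.exp (-u * s ^ 2) * s ^ (2 * N)) := by gcongr
    _ = C / √Real.pi * (√u * ∫ s : ℝ, Real.exp (-u * s ^ 2) * s ^ (2 * N)) := by ring
    _ = _ := by
      rw [sqrt_mul_integral_exp_mul_pow hu, Real.norm_of_nonneg (by positivity)]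
      field_simp

/-! ### Asymptotics of the transforms of ξ -/

/-- The coefficients of `s ↦ 2 s ξ(s)`, where `ξ = δ / s + R(0) - ∑ c d s ^ (d + 1) / (d + 1)`. -/
def xiCoeff (δ R₀ : ℂ) (c : ℕ → ℂ) : ℕ → ℂ
  | 0 => 2 * δ
  | 1 => 2 * R₀
  | d + 2 => -2 * c d / (d + 1)

/-- Taylor expansions may be integrated. -/
theorem isBigO_primitive {S : ℝ} (hS : 0 < S) {R p : ℝ → ℂ} (hR : ContinuousOn R (Icc (-S) S))
    (hp : ContinuousOn p (Icc (-S) S))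
    (hRd : ∀ s ∈ Icc (-S) S, s ≠ 0 → HasDerivWithinAt R (-p s) (Icc (-S) S) s) (c : ℕ → ℂ) (M : ℕ)
    (h : (fun s : ℝ => p s - ∑ d ∈ Finset.range M, c d * (s : ℂ) ^ d) =O[𝓝 0]
      fun s : ℝ => s ^ M) :
    (fun s : ℝ => R s - R 0 + ∑ d ∈ Finset.range M, c d / (d + 1) * (s : ℂ) ^ (d + 1)) =O[𝓝 0]
      fun s : ℝ => s ^ (M + 1) := by
  obtain ⟨C, hC, hb⟩ := h.exists_pos
  obtain ⟨ε, hε, hball⟩ := Metric.eventually_nhds_iff_ball.1 hb.bound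
  refine IsBigO.of_bound C ?_
  filter_upwards [Metric.ball_mem_nhds (0 : ℝ) (lt_min hε hS)] with s hs
  rw [mem_ball_zero_iff, Real.norm_eq_abs, lt_min_iff] at hs
  obtain ⟨hs1, hs2⟩ := hs
  have habs : ∀ {t}, t ∈ uIcc 0 s → |t| ≤ |s| := fun {t} ht => by
    simpa using abs_sub_left_of_mem_uIcc ht
  have hsub : uIcc 0 s ⊆ Icc (-S) S := fun t ht => abs_le.1 ((habs ht).trans hs2.le)
  have hpc : ContinuousOn (fun t : ℝ => -p t + ∑ d ∈ Finset.range M, c d * (t : ℂ) ^ d)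
      (uIcc 0 s) := (hp.mono hsub).neg.add (Continuous.continuousOn (by fun_prop))
  have hFTC := integral_eq_of_hasDerivAt_off_countable
    (fun t : ℝ => R t + ∑ d ∈ Finset.range M, c d / (d + 1) * (t : ℂ) ^ (d + 1))
    (fun t => -p t + ∑ d ∈ Finset.range M, c d * (t : ℂ) ^ d) (a := 0) (b := s)
    (countable_singleton 0)
    ((hR.mono hsub).add (Continuous.continuousOn (by fun_prop))) (fun t ht => ?_)
    hpc.intervalIntegrable
  · have h0 : ∑ d ∈ Finset.range M, c d / (d + 1) * ((0 : ℝ) : ℂ) ^ (d + 1) = 0 :=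
      Finset.sum_eq_zero fun d _ => by simp
    rw [h0, add_zero, add_sub_right_comm] at hFTC
    rw [← hFTC]
    refine (intervalIntegral.norm_integral_le_of_norm_le_const (C := C * |s| ^ M)
      fun t ht => ?_).trans_eq ?_
    · have ht' := habs (uIoc_subset_uIcc ht)
      have h1 := hball t (by rw [mem_ball_zero_iff]; exact ht'.trans_lt hs1)
      rw [neg_add_eq_sub, norm_sub_rev]
      refine h1.trans ?_
      rw [norm_pow, Real.norm_eq_abs]
      gcongr
    · rw [sub_zero, norm_pow, Real.norm_eq_abs]
      ring
  · have ht0 : t ≠ 0 := ht.2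
    have ht1 : t ∈ uIcc 0 s := Ioo_subset_Icc_self ht.1
    have ht2 : |t| < S := (habs ht1).trans_lt hs2
    obtain ⟨h1, h2⟩ := abs_lt.1 ht2
    have h3 := (hRd t (hsub ht1) ht0).hasDerivAt (Icc_mem_nhds h1 h2)
    refine h3.fun_add (HasDerivAt.fun_sum fun d _ => ?_)
    have h4 : HasDerivAt (fun s : ℝ => (s : ℂ)) 1 t := Complex.ofRealCLM.hasDerivAt
    refine ((h4.fun_pow (d + 1)).const_mul (c d / (d + 1))).congr_deriv ?_
    have : (d + 1 : ℂ) ≠ 0 := by exact_mod_cast d.succ_ne_zero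
    rw [show d + 1 - 1 = d from rfl]
    push_cast
    field_simp

/-- The even part of the integrand `ξ dx`: if `R` is the primitive of `-p`, which is `ξ - δ / s` along
the path, then `2 s ξ = 2 δ + 2 s R` has the Taylor coefficients `xiCoeff`. -/
theorem isBigO_xi {S : ℝ} (hS : 0 < S) {R p : ℝ → ℂ} (hR : ContinuousOn R (Icc (-S) S))
    (hp : ContinuousOn p (Icc (-S) S))
    (hRd : ∀ s ∈ Icc (-S) S, s ≠ 0 → HasDerivWithinAt R (-p s) (Icc (-S) S) s) (δ : ℂ) (c : ℕ → ℂ)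
    (h : ∀ M, (fun s : ℝ => p s - ∑ d ∈ Finset.range M, c d * (s : ℂ) ^ d) =O[𝓝 0]
      fun s : ℝ => s ^ M) (N : ℕ) :
    (fun s : ℝ => (2 * δ + 2 * s * R s) -
      ∑ d ∈ Finset.range (2 * N), xiCoeff δ (R 0) c d * (s : ℂ) ^ d) =O[𝓝 0]
      fun s : ℝ => s ^ (2 * N) := by
  rcases N with _ | N
  · have hc : ContinuousAt (fun s : ℝ => 2 * δ + 2 * s * R s) 0 := by
      have := hR.continuousAt (Icc_mem_nhds (by linarith : -S < 0) hS)
      fun_prop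
    simpa using hc.norm.isBoundedUnder_le.isBigO_one ℝ
  · have h1 := isBigO_primitive hS hR hp hRd c (2 * N) (h _)
    have h2 : (fun s : ℝ => (2 * s : ℂ)) =O[𝓝 0] fun s : ℝ => s :=
      IsBigO.of_bound 2 (.of_forall fun s => by simp)
    refine ((h2.mul h1).congr_left fun s => ?_).congr_right fun s => ?_
    · rw [show 2 * (N + 1) = 2 * N + 1 + 1 by ring, Finset.sum_range_succ', Finset.sum_range_succ']
      simp only [xiCoeff]
      have e : ∑ d ∈ Finset.range (2 * N), -2 * c d / (d + 1) * (s : ℂ) ^ (d + 1 + 1) =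
          -(2 * s * ∑ d ∈ Finset.range (2 * N), c d / (d + 1) * (s : ℂ) ^ (d + 1)) := by
        rw [Finset.mul_sum, ← Finset.sum_neg_distrib]
        exact Finset.sum_congr rfl fun d _ => by ring
      rw [e]
      ring
    · ring

section Laplace

variable {X : Type*} [TopologicalSpace X] [ChartedSpace ℂ X] [IsManifold 𝓘(ℂ, ℂ) ω X] [T2Space X]
  {dx : OneForm X} {b : ℕ} {a : Fin b → X} {ζ : Fin b → OpenPartialHomeomorph X ℂ}
  {B : Bidifferential X} {γ : Fin b → ℝ → X} {r : ℝ}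

/-- The Laplace transform of `ξ` over a finite arc has the asymptotic expansion `fSeries`. -/
theorem isBigO_fLaplace_sub (ha : Function.Injective a) (hζ : ∀ i, IsBranchCoordinate dx (a i) (ζ i))
    (hdx : dx.IsMeromorphic) (hB : B.IsBergmanKernel) (hr : 0 < r) {i : Fin b}
    (hi : IsSteepestDescent dx (ζ i) (Icc (-r) r) (γ i)) {k : Fin b} {ξ : ℝ → ℂ}
    (hξ : IsXiAlong B (ζ k) (Icc (-r) r) (γ i) (kron i k) ξ) (N : ℕ) :
    (fun u : ℝ => fLaplace dx (γ i) ξ (Icc (-r) r) u -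
        ∑ n ∈ Finset.range N, (fSeries B ζ i k).coeff n * ((u : ℂ)⁻¹) ^ n)
      =O[atTop] fun u : ℝ => (u⁻¹) ^ N := by
  have hlt : -r < r := by linarith
  have hI0 : Icc (-r) r ∈ 𝓝 (0 : ℝ) := Icc_mem_nhds (by linarith) hr
  obtain ⟨p, hpc, hp, h, ρ, hρ, hh, hev⟩ := exists_dxi_regularPart ha hζ hdx hB
    (uniqueDiffOn_Icc hlt) ordConnected_Icc hI0 hi k
  obtain ⟨R, hR, hRξ, hRd⟩ := exists_continuous_primitive (r := p) (fun s hs hs0 => by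
    have h1 := hξ.deriv s hs hs0
    rwa [hp s hs hs0] at h1) hξ.polar
  have hT : ∀ M, (fun s : ℝ => p s - ∑ d ∈ Finset.range M, bergmanCoeff B ζ i d k 0 * (s : ℂ) ^ d)
      =O[𝓝 0] fun s : ℝ => s ^ M := by
    intro M
    obtain ⟨K, hK⟩ := norm_sub_sum_le (h := fun w z => h (w, z))
      (c := fun d l => bergmanCoeff B ζ i d k l) hρ hh M
    refine IsBigO.of_bound (2 * |K|) ?_
    filter_upwards [hev, Metric.ball_mem_nhds (0 : ℝ) (half_pos hρ)] with s h1 h2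
    rw [mem_ball_zero_iff] at h2
    have h3 := hK s 0 (by rw [Complex.norm_real]; exact h2.le) (by rw [norm_zero]; positivity)
    have e : ∑ d ∈ Finset.range M, ∑ l ∈ Finset.range M,
        bergmanCoeff B ζ i d k l * (s : ℂ) ^ d * 0 ^ l =
        ∑ d ∈ Finset.range M, bergmanCoeff B ζ i d k 0 * (s : ℂ) ^ d := by
      refine Finset.sum_congr rfl fun d hd => ?_
      rw [Finset.sum_eq_single_of_mem 0 (Finset.mem_range.2 (Nat.zero_lt_of_lt
        (Finset.mem_range.1 hd))) fun l _ hl => by rw [zero_pow hl, mul_zero]]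
      simp
    rw [e] at h3
    rw [h1]
    refine h3.trans ?_
    have h4 : ‖(0 : ℂ)‖ ^ M ≤ ‖(s : ℂ)‖ ^ M := by
      gcongr
      simp
    have h5 : ‖(s ^ M : ℝ)‖ = ‖(s : ℂ)‖ ^ M := by rw [norm_pow, Complex.norm_real]
    rw [h5]
    calc K * (‖(s : ℂ)‖ ^ M + ‖(0 : ℂ)‖ ^ M) ≤ |K| * (‖(s : ℂ)‖ ^ M + ‖(s : ℂ)‖ ^ M) :=
          mul_le_mul (le_abs_self K) (by gcongr) (by positivity) (abs_nonneg K)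
      _ = _ := by ring
  have hW := isBigO_integral_gauss hr (Ψ := fun s => 2 * kron i k + 2 * s * R s) (by fun_prop)
    (xiCoeff (kron i k) (R 0) fun d => bergmanCoeff B ζ i d k 0) N
    (isBigO_xi hr hR hpc hRd (kron i k) _ hT N)
  refine (hW.const_mul_left (1 / 2)).congr' ?_ .rfl
  filter_upwards [eventually_gt_atTop 0] with u hu
  have huc : (u : ℂ) ≠ 0 := by exact_mod_cast hu.ne'
  have e1 : ∫ s in Icc (-r) r, fIntegrand dx (γ i) ξ u s =
      ∫ s in Icc (-r) r, gauss u s * (2 * kron i k + 2 * s * R s) := by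
    refine setIntegral_congr_ae measurableSet_Icc ?_
    filter_upwards [Measure.ae_ne volume (0 : ℝ)] with s hs hsI
    have hsc : (s : ℂ) ≠ 0 := by exact_mod_cast hs
    rw [fIntegrand_eq hi u hsI, hRξ s hs]
    field_simp
    ring
  rw [fLaplace, e1, mul_sub, Finset.mul_sum]
  congr 1
  · push_cast
    ring
  · refine Finset.sum_congr rfl fun n _ => ?_
    rw [fSeries, PowerSeries.coeff_mk]
    rcases n with _ | n
    · simp [xiCoeff]
    · have h2 : (2 * n + 1 : ℂ) ≠ 0 := by exact_mod_cast (2 * n).succ_ne_zero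
      rw [doubleFactorial_two_mul_succ_sub_one, show 2 * (n + 1) = 2 * n + 2 by ring]
      simp only [xiCoeff, hatCoeff]
      rw [bergmanCoeff_comm ha hζ hB k i]
      push_cast
      simp only [Nat.doubleFactorial, Nat.cast_one, one_mul, zero_add, inv_pow]
      field_simp
      ring

end Laplace

/-! ### Asymptotics of the double transform -/

/-- Away from the origin a monomial of two variables is dominated by even powers of higher degree
in each variable. -/
theorem abs_pow_mul_abs_pow_le {ε : ℝ} (hε : 0 < ε) {x y : ℝ} (hxy : ε ≤ |x| ∨ ε ≤ |y|) {N d l : ℕ}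
    (hd : d ≤ 2 * N) (hl : l ≤ 2 * N) :
    |x| ^ d * |y| ^ l ≤
      (1 + ε⁻¹) ^ (2 * N) * (x ^ (2 * N) + y ^ (2 * N) + x ^ (2 * N) * y ^ (2 * N)) := by
  wlog h : ε ≤ |x| generalizing x y d l
  · have h1 := this hxy.symm hl hd (hxy.resolve_left h)
    linarith
  rw [← Even.pow_abs (even_two_mul N) x, ← Even.pow_abs (even_two_mul N) y]
  have hinv : 0 < ε⁻¹ := inv_pos.2 hε
  have h1 : |x| ^ d ≤ (1 + ε⁻¹) ^ (2 * N) * |x| ^ (2 * N) := by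
    refine (pow_le_div_pow_mul_pow hε h hd).trans ?_
    gcongr
    calc (ε⁻¹) ^ (2 * N - d) ≤ (1 + ε⁻¹) ^ (2 * N - d) := by gcongr; linarith
      _ ≤ (1 + ε⁻¹) ^ (2 * N) := pow_le_pow_right₀ (by linarith) (Nat.sub_le _ _)
  have h2 : |y| ^ l ≤ 1 + |y| ^ (2 * N) := by
    rcases le_total |y| 1 with h3 | h3
    · have := pow_le_one₀ (n := l) (abs_nonneg y) h3
      have : 0 ≤ |y| ^ (2 * N) := by positivity
      linarith
    · have := pow_le_pow_right₀ h3 hl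
      linarith
  have h4 : 0 ≤ (1 + ε⁻¹) ^ (2 * N) * |y| ^ (2 * N) := by positivity
  calc |x| ^ d * |y| ^ l ≤ ((1 + ε⁻¹) ^ (2 * N) * |x| ^ (2 * N)) * (1 + |y| ^ (2 * N)) := by gcongr
    _ ≤ _ := by linarith

/-- Watson's lemma for Gaussian integrals over a square. -/
theorem isBigO_integral_gauss_gauss {S : ℝ} (hS : 0 < S) {K : ℝ × ℝ → ℂ}
    (hK : ContinuousOn K (Icc (-S) S ×ˢ Icc (-S) S)) (c : ℕ → ℕ → ℂ) (N : ℕ) {C₁ : ℝ}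
    (hb : ∀ᶠ y : ℝ × ℝ in 𝓝 0, y.1 ≠ y.2 →
      ‖K y - ∑ d ∈ Finset.range (2 * N), ∑ l ∈ Finset.range (2 * N),
        c d l * (y.1 : ℂ) ^ d * (y.2 : ℂ) ^ l‖ ≤ C₁ * (y.1 ^ (2 * N) + y.2 ^ (2 * N))) :
    (fun w : ℝ × ℝ => (√w.1 / √Real.pi : ℂ) * (√w.2 / √Real.pi : ℂ) *
        (∫ y in Icc (-S) S ×ˢ Icc (-S) S, gauss w.1 y.1 * gauss w.2 y.2 * K y) -
      ∑ k ∈ Finset.range N, ∑ l ∈ Finset.range N, c (2 * k) (2 * l) *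
        ((2 * k - 1).doubleFactorial / (2 * w.1) ^ k) *
        ((2 * l - 1).doubleFactorial / (2 * w.2) ^ l))
      =O[atTop ×ˢ atTop] fun w : ℝ × ℝ => (w.1⁻¹) ^ N + (w.2⁻¹) ^ N := by
  obtain ⟨ε, hε, hball⟩ := Metric.eventually_nhds_iff_ball.1 hb
  have hIm : MeasurableSet (Icc (-S) S ×ˢ Icc (-S) S) := measurableSet_Icc.prod measurableSet_Icc
  have hIc : IsCompact (Icc (-S) S ×ˢ Icc (-S) S) := isCompact_Icc.prod isCompact_Icc
  obtain ⟨C₂, hC₂⟩ := hIc.exists_bound_of_continuousOn hK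
  set T : ℝ × ℝ → ℂ := fun y => ∑ d ∈ Finset.range (2 * N), ∑ l ∈ Finset.range (2 * N),
    c d l * (y.1 : ℂ) ^ d * (y.2 : ℂ) ^ l with hT
  set ε' := min ε S with hε'
  have hε'0 : 0 < ε' := lt_min hε hS
  let Θ : ℝ × ℝ → ℂ := fun y => (Icc (-S) S ×ˢ Icc (-S) S).indicator K y - T y
  let E : ℝ × ℝ → ℝ := fun y => y.1 ^ (2 * N) + y.2 ^ (2 * N) + y.1 ^ (2 * N) * y.2 ^ (2 * N)
  let C₃ := ∑ d ∈ Finset.range (2 * N), ∑ l ∈ Finset.range (2 * N), ‖c d l‖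
  let C := |C₁| + (|C₂| * (1 + ε'⁻¹) ^ (2 * N) + C₃ * (1 + ε'⁻¹) ^ (2 * N))
  have hC₃ : 0 ≤ C₃ := Finset.sum_nonneg fun _ _ => Finset.sum_nonneg fun _ _ => norm_nonneg _
  have hpos : ∀ x : ℝ, 0 ≤ x ^ (2 * N) := fun x => (even_two_mul N).pow_nonneg x
  have hE : ∀ y, 0 ≤ E y := fun y =>
    add_nonneg (add_nonneg (hpos _) (hpos _)) (mul_nonneg (hpos _) (hpos _))
  have hinv : 0 < ε'⁻¹ := inv_pos.2 hε'0
  have hC : 0 ≤ C := by positivity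
  have hbound : ∀ y : ℝ × ℝ, y.1 ≠ y.2 → ‖Θ y‖ ≤ C * E y := by
    intro y hy
    by_cases hs : |y.1| < ε' ∧ |y.2| < ε'
    · have hsS : y ∈ Icc (-S) S ×ˢ Icc (-S) S :=
        ⟨abs_le.1 (hs.1.le.trans (min_le_right _ _)), abs_le.1 (hs.2.le.trans (min_le_right _ _))⟩
      have h1 := hball y (by
        rw [mem_ball_zero_iff, Prod.norm_def]
        exact (max_lt hs.1 hs.2).trans_le (min_le_left _ _)) hy
      simp only [Θ, indicator_of_mem hsS]
      refine h1.trans ?_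
      have h2 : C₁ * (y.1 ^ (2 * N) + y.2 ^ (2 * N)) ≤ |C₁| * E y :=
        mul_le_mul (le_abs_self _) (le_add_of_nonneg_right (mul_nonneg (hpos _) (hpos _)))
          (add_nonneg (hpos _) (hpos _)) (abs_nonneg _)
      refine h2.trans (mul_le_mul_of_nonneg_right ?_ (hE y))
      exact le_add_of_nonneg_right (by positivity)
    · have hs' : ε' ≤ |y.1| ∨ ε' ≤ |y.2| := by
        by_contra! h
        exact hs h
      have h1 : ‖(Icc (-S) S ×ˢ Icc (-S) S).indicator K y‖ ≤
          |C₂| * ((1 + ε'⁻¹) ^ (2 * N) * E y) := by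
        have h2 : ‖(Icc (-S) S ×ˢ Icc (-S) S).indicator K y‖ ≤ |C₂| := by
          by_cases hsS : y ∈ Icc (-S) S ×ˢ Icc (-S) S
          · rw [indicator_of_mem hsS]; exact (hC₂ y hsS).trans (le_abs_self _)
          · rw [indicator_of_notMem hsS, norm_zero]; exact abs_nonneg _
        have h3 := abs_pow_mul_abs_pow_le hε'0 hs' (Nat.zero_le (2 * N)) (Nat.zero_le (2 * N))
        rw [pow_zero, pow_zero, one_mul] at h3
        exact h2.trans (le_mul_of_one_le_right (abs_nonneg _) h3)
      have h4 : ‖T y‖ ≤ C₃ * ((1 + ε'⁻¹) ^ (2 * N) * E y) := by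
        simp only [hT, C₃]
        rw [Finset.sum_mul]
        refine norm_sum_le_of_le _ fun d hd => ?_
        rw [Finset.sum_mul]
        refine norm_sum_le_of_le _ fun l hl => ?_
        rw [norm_mul, norm_mul, norm_pow, norm_pow, Complex.norm_real, Complex.norm_real,
          Real.norm_eq_abs, Real.norm_eq_abs, mul_assoc]
        exact mul_le_mul_of_nonneg_left (abs_pow_mul_abs_pow_le hε'0 hs'
          (Finset.mem_range.1 hd).le (Finset.mem_range.1 hl).le) (norm_nonneg _)
      have h5 : 0 ≤ |C₁| * E y := mul_nonneg (abs_nonneg _) (hE y)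
      refine (norm_sub_le _ _).trans ?_
      simp only [C]
      linarith
  have hmono : ∀ {u v : ℝ} (_ : 0 < u) (_ : 0 < v) (d l : ℕ), Integrable fun y : ℝ × ℝ =>
      (gauss u y.1 * (y.1 : ℂ) ^ d) * (gauss v y.2 * (y.2 : ℂ) ^ l) := fun hu hv d l =>
    (integrable_gauss_mul_pow hu d).mul_prod (integrable_gauss_mul_pow hv l)
  have hmonoR : ∀ {u v : ℝ} (_ : 0 < u) (_ : 0 < v) (d l : ℕ), Integrable fun y : ℝ × ℝ =>
      (Real.exp (-u * y.1 ^ 2) * y.1 ^ d) * (Real.exp (-v * y.2 ^ 2) * y.2 ^ l) := fun hu hv d l =>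
    (integrable_exp_mul_pow hu d).mul_prod (integrable_exp_mul_pow hv l)
  have hTe : ∀ (u v : ℝ) (y : ℝ × ℝ), gauss u y.1 * gauss v y.2 * T y =
      ∑ d ∈ Finset.range (2 * N), ∑ l ∈ Finset.range (2 * N), c d l *
        ((gauss u y.1 * (y.1 : ℂ) ^ d) * (gauss v y.2 * (y.2 : ℂ) ^ l)) := by
    intro u v y
    simp only [hT, Finset.mul_sum]
    exact Finset.sum_congr rfl fun d _ => Finset.sum_congr rfl fun l _ => by ring
  have hTi : ∀ {u v : ℝ} (_ : 0 < u) (_ : 0 < v),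
      Integrable fun y : ℝ × ℝ => gauss u y.1 * gauss v y.2 * T y := by
    intro u v hu hv
    simp only [hTe]
    exact integrable_finsetSum _ fun d _ => integrable_finsetSum _ fun l _ =>
      (hmono hu hv d l).const_mul _
  have hKi : ∀ u v : ℝ, Integrable fun y : ℝ × ℝ =>
      gauss u y.1 * gauss v y.2 * (Icc (-S) S ×ˢ Icc (-S) S).indicator K y := by
    intro u v
    have hgu := continuous_gauss u
    have hgv := continuous_gauss v
    have h1 : IntegrableOn (fun y : ℝ × ℝ => gauss u y.1 * gauss v y.2 * K y)
        (Icc (-S) S ×ˢ Icc (-S) S) :=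
      ContinuousOn.integrableOn_compact hIc (ContinuousOn.mul
        (f := fun y : ℝ × ℝ => gauss u y.1 * gauss v y.2) (Continuous.continuousOn (by fun_prop)) hK)
    refine ((integrable_indicator_iff hIm).2 h1).congr (.of_forall fun s => ?_)
    exact indicator_mul_right _ _ _
  set μ : ℝ := (2 * N - 1).doubleFactorial / 2 ^ N with hμ
  have hμ0 : 0 ≤ μ := by positivity
  refine IsBigO.of_bound (C * (μ + μ ^ 2)) ?_
  filter_upwards [prod_mem_prod (Ioi_mem_atTop (1 : ℝ)) (Ioi_mem_atTop (0 : ℝ))] with w hw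
  obtain ⟨u, v⟩ := w
  obtain ⟨hu1, hv⟩ : 1 < u ∧ 0 < v := hw
  have hu : 0 < u := by linarith
  dsimp only
  have hpi := Real.sqrt_pos.2 Real.pi_pos
  have e1 : ∫ y in Icc (-S) S ×ˢ Icc (-S) S, gauss u y.1 * gauss v y.2 * K y =
      ∫ y : ℝ × ℝ, gauss u y.1 * gauss v y.2 * (Icc (-S) S ×ˢ Icc (-S) S).indicator K y := by
    rw [← integral_indicator hIm]
    exact integral_congr_ae (.of_forall fun s => indicator_mul_right _ _ _)
  have e2 : ∑ k ∈ Finset.range N, ∑ l ∈ Finset.range N, c (2 * k) (2 * l) *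
        ((2 * k - 1).doubleFactorial / (2 * u : ℂ) ^ k) *
        ((2 * l - 1).doubleFactorial / (2 * v : ℂ) ^ l) =
      (√u / √Real.pi : ℂ) * (√v / √Real.pi : ℂ) * ∫ y : ℝ × ℝ, gauss u y.1 * gauss v y.2 * T y := by
    have e3 : (√u / √Real.pi : ℂ) * (√v / √Real.pi : ℂ) *
        ∫ y : ℝ × ℝ, gauss u y.1 * gauss v y.2 * T y =
        ∑ d ∈ Finset.range (2 * N), ∑ l ∈ Finset.range (2 * N),
          c d l * gaussMoment u d * gaussMoment v l := by
      simp only [hTe]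
      rw [integral_finsetSum _ fun d _ => integrable_finsetSum _ fun l _ =>
        (hmono hu hv d l).const_mul _, Finset.mul_sum]
      refine Finset.sum_congr rfl fun d _ => ?_
      rw [integral_finsetSum _ fun l _ => (hmono hu hv d l).const_mul _, Finset.mul_sum]
      refine Finset.sum_congr rfl fun l _ => ?_
      rw [integral_const_mul, Measure.volume_eq_prod,
        integral_prod_mul (fun s : ℝ => gauss u s * (s : ℂ) ^ d)
          (fun s : ℝ => gauss v s * (s : ℂ) ^ l), gaussMoment, gaussMoment]
      ring
    rw [e3, sum_range_two_mul]
    refine Finset.sum_congr rfl fun k _ => ?_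
    simp only [gaussMoment_odd hu, mul_zero, zero_mul, Finset.sum_const_zero, add_zero]
    rw [sum_range_two_mul]
    refine Finset.sum_congr rfl fun l _ => ?_
    rw [gaussMoment_odd hv, gaussMoment_even hu, gaussMoment_even hv, mul_zero, add_zero]
  rw [e1, e2, ← mul_sub, ← integral_sub (hKi u v) (hTi hu hv), norm_mul]
  simp only [← mul_sub]
  have hEe : ∀ y : ℝ × ℝ, Real.exp (-u * y.1 ^ 2) * Real.exp (-v * y.2 ^ 2) * (C * E y) =
      C * ((Real.exp (-u * y.1 ^ 2) * y.1 ^ (2 * N)) * (Real.exp (-v * y.2 ^ 2) * y.2 ^ (2 * 0)) +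
        (Real.exp (-u * y.1 ^ 2) * y.1 ^ (2 * 0)) * (Real.exp (-v * y.2 ^ 2) * y.2 ^ (2 * N)) +
        (Real.exp (-u * y.1 ^ 2) * y.1 ^ (2 * N)) * (Real.exp (-v * y.2 ^ 2) * y.2 ^ (2 * N))) :=
    fun y => by simp only [E]; ring
  have hEi : Integrable fun y : ℝ × ℝ =>
      Real.exp (-u * y.1 ^ 2) * Real.exp (-v * y.2 ^ 2) * (C * E y) := by
    simp only [hEe]
    exact (((hmonoR hu hv _ _).add (hmonoR hu hv _ _)).add (hmonoR hu hv _ _)).const_mul C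
  have h6 : ‖∫ y : ℝ × ℝ, gauss u y.1 * gauss v y.2 * Θ y‖ ≤
      ∫ y : ℝ × ℝ, Real.exp (-u * y.1 ^ 2) * Real.exp (-v * y.2 ^ 2) * (C * E y) := by
    refine norm_integral_le_of_norm_le hEi ?_
    filter_upwards [ae_fst_ne_snd] with y hy
    rw [norm_mul, norm_mul, gauss, gauss, Complex.norm_real, Complex.norm_real,
      Real.norm_of_nonneg (Real.exp_pos _).le, Real.norm_of_nonneg (Real.exp_pos _).le]
    gcongr
    exact hbound y hy
  have hprod : ∀ d l : ℕ, ∫ y : ℝ × ℝ,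
      (Real.exp (-u * y.1 ^ 2) * y.1 ^ d) * (Real.exp (-v * y.2 ^ 2) * y.2 ^ l) =
      (∫ s : ℝ, Real.exp (-u * s ^ 2) * s ^ d) * ∫ s : ℝ, Real.exp (-v * s ^ 2) * s ^ l := by
    intro d l
    rw [Measure.volume_eq_prod]
    exact integral_prod_mul (fun s : ℝ => Real.exp (-u * s ^ 2) * s ^ d)
      (fun s : ℝ => Real.exp (-v * s ^ 2) * s ^ l)
  have h7 : ∀ u : ℝ, ‖(√u / √Real.pi : ℂ)‖ = √u / √Real.pi := by
    intro u
    rw [norm_div, Complex.norm_real, Complex.norm_real, Real.norm_of_nonneg (Real.sqrt_nonneg _),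
      Real.norm_of_nonneg (Real.sqrt_nonneg _)]
  rw [norm_mul, h7, h7]
  refine (mul_le_mul_of_nonneg_left h6 (by positivity)).trans ?_
  simp only [hEe]
  have hsum2 : Integrable fun y : ℝ × ℝ =>
      (Real.exp (-u * y.1 ^ 2) * y.1 ^ (2 * N)) * (Real.exp (-v * y.2 ^ 2) * y.2 ^ (2 * 0)) +
      (Real.exp (-u * y.1 ^ 2) * y.1 ^ (2 * 0)) * (Real.exp (-v * y.2 ^ 2) * y.2 ^ (2 * N)) :=
    (hmonoR hu hv _ _).add (hmonoR hu hv _ _)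
  rw [integral_const_mul, integral_add hsum2 (hmonoR hu hv _ _),
    integral_add (hmonoR hu hv _ _) (hmonoR hu hv _ _), hprod, hprod, hprod]
  have hNu := sqrt_mul_integral_exp_mul_pow hu N
  have hNv := sqrt_mul_integral_exp_mul_pow hv N
  have h0u := sqrt_mul_integral_exp_mul_pow hu 0
  have h0v := sqrt_mul_integral_exp_mul_pow hv 0
  simp only [pow_zero, mul_zero, zero_tsub, Nat.doubleFactorial, Nat.cast_one, div_one,
    mul_one] at h0u h0v ⊢
  rw [← hμ] at hNu hNv
  generalize (∫ s : ℝ, Real.exp (-u * s ^ 2) * s ^ (2 * N)) = mu at *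
  generalize (∫ s : ℝ, Real.exp (-v * s ^ 2) * s ^ (2 * N)) = mv at *
  generalize (∫ s : ℝ, Real.exp (-u * s ^ 2)) = nu at *
  generalize (∫ s : ℝ, Real.exp (-v * s ^ 2)) = nv at *
  have hu0 : 0 < (u⁻¹) ^ N := by positivity
  have hv0 : 0 < (v⁻¹) ^ N := by positivity
  have hule : (u⁻¹) ^ N ≤ 1 := pow_le_one₀ (by positivity) (inv_le_one_of_one_le₀ hu1.le)
  have e4 : √u / √Real.pi * (√v / √Real.pi) * (C * (mu * nv + nu * mv + mu * mv)) =
      C * (μ * (u⁻¹) ^ N + μ * (v⁻¹) ^ N + μ ^ 2 * (u⁻¹) ^ N * (v⁻¹) ^ N) := by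
    have e5 : √u / √Real.pi * (√v / √Real.pi) * (C * (mu * nv + nu * mv + mu * mv)) =
        C * ((√u * mu) * (√v * nv) + (√u * nu) * (√v * mv) + (√u * mu) * (√v * mv)) /
          √Real.pi ^ 2 := by
      field_simp
    rw [e5, hNu, hNv, h0u, h0v]
    field_simp
  rw [e4, Real.norm_of_nonneg (by positivity), mul_assoc C (μ + μ ^ 2)]
  refine mul_le_mul_of_nonneg_left ?_ hC
  have h8 : μ ^ 2 * (u⁻¹) ^ N * (v⁻¹) ^ N ≤ μ ^ 2 * 1 * (v⁻¹) ^ N := by gcongr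
  have h9 : 0 ≤ μ ^ 2 * (u⁻¹) ^ N := by positivity
  linarith

section Laplace

variable {X : Type*} [TopologicalSpace X] [ChartedSpace ℂ X] [IsManifold 𝓘(ℂ, ℂ) ω X] [T2Space X]
  {dx : OneForm X} {b : ℕ} {a : Fin b → X} {ζ : Fin b → OpenPartialHomeomorph X ℂ}
  {B : Bidifferential X} {γ : Fin b → ℝ → X} {r : ℝ}

/-- The double Laplace transform of the kernel over a finite arc has the asymptotic expansion with
coefficients `hatCoeff`. -/
theorem isBigO_checkLaplace_sub (ha : Function.Injective a)
    (hζ : ∀ i, IsBranchCoordinate dx (a i) (ζ i)) (hdx : dx.IsMeromorphic)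
    (hB : B.IsBergmanKernel) (hr : 0 < r) {i j : Fin b}
    (hi : IsSteepestDescent dx (ζ i) (Icc (-r) r) (γ i))
    (hj : IsSteepestDescent dx (ζ j) (Icc (-r) r) (γ j)) (N : ℕ) :
    (fun y : ℝ × ℝ => checkLaplace B (γ i) (γ j) (kron i j) (Icc (-r) r) y.1 y.2 -
        ∑ k ∈ Finset.range N, ∑ l ∈ Finset.range N,
          hatCoeff B ζ i k j l * ((y.1 : ℂ)⁻¹) ^ k * ((y.2 : ℂ)⁻¹) ^ l)
      =O[atTop ×ˢ atTop] fun y : ℝ × ℝ => (y.1⁻¹) ^ N + (y.2⁻¹) ^ N := by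
  have hlt : -r < r := by linarith
  have hI := uniqueDiffOn_Icc hlt
  have hI0 : Icc (-r) r ∈ 𝓝 (0 : ℝ) := Icc_mem_nhds (by linarith) hr
  have hIm : MeasurableSet (Icc (-r) r ×ˢ Icc (-r) r) := measurableSet_Icc.prod measurableSet_Icc
  obtain ⟨K, hK, hKH⟩ := exists_kernel (γ := γ) ha hζ hdx hB hI ordConnected_Icc hI0 hi hj
  have hKc : ContinuousOn K (Icc (-r) r ×ˢ Icc (-r) r) := by
    intro y hy
    obtain ⟨H, hH, hev⟩ := hKH y hy
    refine ContinuousWithinAt.congr_of_eventuallyEq (ContinuousAt.continuousWithinAt ?_) hev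
      (hev.self_of_nhdsWithin hy)
    exact ContinuousAt.comp (g := H) (f := fun y : ℝ × ℝ => ((y.1 : ℂ), (y.2 : ℂ))) (x := y)
      hH.continuousAt (by fun_prop)
  obtain ⟨h, ρ, hρ, hh⟩ := exists_regularPart ha hζ hB i j
  obtain ⟨C, hC⟩ := norm_sub_sum_le (h := fun w z => h (w, z))
    (c := fun d l => bergmanCoeff B ζ i d j l) hρ (fun w z hw hz => (hh w z hw hz).2.2.2.1) (2 * N)
  have hb : ∀ᶠ y : ℝ × ℝ in 𝓝 0, y.1 ≠ y.2 →
      ‖K y - ∑ d ∈ Finset.range (2 * N), ∑ l ∈ Finset.range (2 * N),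
        bergmanCoeff B ζ i d j l * (y.1 : ℂ) ^ d * (y.2 : ℂ) ^ l‖ ≤
        C * (y.1 ^ (2 * N) + y.2 ^ (2 * N)) := by
    have hFi := hi.eventually_follows_zero (hζ i).mem_maximalAtlas (hζ i).zero_mem hI hI0
    have hFj := hj.eventually_follows_zero (hζ j).mem_maximalAtlas (hζ j).zero_mem hI hI0
    have hF := (hFi.and hI0).prod_mk (hFj.and hI0)
    rw [← nhds_prod_eq] at hF
    filter_upwards [hF, Metric.ball_mem_nhds (0 : ℝ × ℝ) (half_pos hρ)] with y h1 h2 hy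
    obtain ⟨⟨h3, h4⟩, h5, h6⟩ := h1
    rw [mem_ball_zero_iff, Prod.norm_def, max_lt_iff] at h2
    have n1 : ‖(y.1 : ℂ)‖ ≤ ρ / 2 := by rw [Complex.norm_real]; exact h2.1.le
    have n2 : ‖(y.2 : ℂ)‖ ≤ ρ / 2 := by rw [Complex.norm_real]; exact h2.2.le
    obtain ⟨-, -, -, -, g1, g2⟩ := hh y.1 y.2 (by linarith) (by linarith)
    have g3 := g2 fun h => hy (by exact_mod_cast (g1 h).2)
    have g4 := hK y ⟨h4, h6⟩ fun _ => hy
    rw [pathKernel, h3.bidifferential h5 (hζ i).mem_maximalAtlas (hζ j).mem_maximalAtlas, g3,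
      add_sub_cancel_left] at g4
    have g5 := hC y.1 y.2 n1 n2
    rw [g4, Complex.norm_real, Complex.norm_real, Real.norm_eq_abs, Real.norm_eq_abs,
      Even.pow_abs (even_two_mul N), Even.pow_abs (even_two_mul N)] at g5
    exact g5
  have hW := isBigO_integral_gauss_gauss hr hKc (fun d l => bergmanCoeff B ζ i d j l) N hb
  refine (hW.const_mul_left (1 / 2)).congr' ?_ .rfl
  filter_upwards [prod_mem_prod (Ioi_mem_atTop (0 : ℝ)) (Ioi_mem_atTop (0 : ℝ))] with w hw
  obtain ⟨u, v⟩ := w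
  obtain ⟨hu, hv⟩ : 0 < u ∧ 0 < v := hw
  have huc : (u : ℂ) ≠ 0 := by exact_mod_cast hu.ne'
  have hvc : (v : ℂ) ≠ 0 := by exact_mod_cast hv.ne'
  have hpi' : (√Real.pi : ℂ) ≠ 0 := by exact_mod_cast (Real.sqrt_pos.2 Real.pi_pos).ne'
  have hpi2 : (Real.pi : ℂ) = √Real.pi ^ 2 := by exact_mod_cast (Real.sq_sqrt Real.pi_pos.le).symm
  have e1 : ∫ y in Icc (-r) r ×ˢ Icc (-r) r, checkIntegrand B (γ i) (γ j) (kron i j) u v y =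
      ∫ y in Icc (-r) r ×ˢ Icc (-r) r, gauss u y.1 * gauss v y.2 * K y := by
    refine setIntegral_congr_ae hIm ?_
    filter_upwards [ae_fst_ne_snd] with y hy hyI
    rw [checkIntegrand_eq, hK y hyI fun _ => hy]
  dsimp only
  rw [checkLaplace, e1, Real.sqrt_mul hu.le, mul_sub, Finset.mul_sum]
  congr 1
  · push_cast
    rw [hpi2]
    field_simp
  · refine Finset.sum_congr rfl fun k _ => ?_
    rw [Finset.mul_sum]
    refine Finset.sum_congr rfl fun l _ => ?_
    rw [hatCoeff]
    push_cast
    rw [inv_pow, inv_pow, mul_pow, mul_pow, pow_succ, pow_add]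
    field_simp

end Laplace

end

end SpectralCurve

theorem lemma4p1 {X : Type*} [TopologicalSpace X] [T2Space X] [CompactSpace X] [ConnectedSpace X]
    [ChartedSpace ℂ X] [IsManifold 𝓘(ℂ, ℂ) ω X]
    (g : ℕ) (A C : Fin g → ℝ → X) (hAC : IsCanonicalHomologyBasis g A C)
    (dx : OneForm X) (hdx : dx.IsMeromorphic)
    (b : ℕ) (a : Fin b → X) (ha : Function.Injective a)
    (ha_range : range a = {p | 0 < dx.order p}) (ha_simple : ∀ i, dx.order (a i) = 1)
    (ζ : Fin b → OpenPartialHomeomorph X ℂ) (hζ : ∀ i, IsBranchCoordinate dx (a i) (ζ i))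
    (B : Bidifferential X) (hB : B.IsBergmanKernel) (hBA : B.IsNormalizedOn A) :
    -- the Taylor expansions that define the coefficients of `B` exist
    (∀ i j, B.HasExpansion (ζ i) (ζ j) (kron i j) fun d l => bergmanCoeff B ζ i d j l) ∧
    -- the factorization, as an identity of power series in `1 / u` and `1 / v`
    (∀ i j,
      (MvPowerSeries.X 0 + MvPowerSeries.X 1) * checkSeries B ζ i j =
        MvPowerSeries.C (kron i j) -
          ∑ k, (fSeries B ζ i k).subst (MvPowerSeries.X 0 : MvPowerSeries (Fin 2) ℂ) *
            (fSeries B ζ j k).subst (MvPowerSeries.X 1 : MvPowerSeries (Fin 2) ℂ)) ∧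
    -- these series are the asymptotic expansions of the Laplace transforms along (finite arcs of)
    -- the steepest descent paths
    (∀ (γ : Fin b → ℝ → X) (r : ℝ), 0 < r →
      ∀ i, IsSteepestDescent dx (ζ i) (Icc (-r) r) (γ i) →
        ∀ k (ξ : ℝ → ℂ), IsXiAlong B (ζ k) (Icc (-r) r) (γ i) (kron i k) ξ → ∀ N : ℕ,
          (fun u : ℝ => fLaplace dx (γ i) ξ (Icc (-r) r) u -
              ∑ n ∈ Finset.range N, (fSeries B ζ i k).coeff n * ((u : ℂ)⁻¹) ^ n)
            =O[atTop] fun u : ℝ => (u⁻¹) ^ N) ∧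
    (∀ (γ : Fin b → ℝ → X) (r : ℝ), 0 < r →
      ∀ i j, IsSteepestDescent dx (ζ i) (Icc (-r) r) (γ i) →
        IsSteepestDescent dx (ζ j) (Icc (-r) r) (γ j) → ∀ N : ℕ,
          (fun y : ℝ × ℝ => checkLaplace B (γ i) (γ j) (kron i j) (Icc (-r) r) y.1 y.2 -
              ∑ k ∈ Finset.range N, ∑ l ∈ Finset.range N,
                hatCoeff B ζ i k j l * ((y.1 : ℂ)⁻¹) ^ k * ((y.2 : ℂ)⁻¹) ^ l)
            =O[atTop ×ˢ atTop] fun y : ℝ × ℝ => (y.1⁻¹) ^ N + (y.2⁻¹) ^ N) ∧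
    -- the factorization, as an identity of convergent Laplace transforms along complete paths
    (∀ (γ : Fin b → ℝ → X) (ξ : Fin b → Fin b → ℝ → ℂ) (i j : Fin b) (u v : ℝ), 0 < u → 0 < v →
      IsSteepestDescent dx (ζ i) univ (γ i) → IsSteepestDescent dx (ζ j) univ (γ j) →
      (∀ k, IsXiAlong B (ζ k) univ (γ i) (kron i k) (ξ i k)) →
      (∀ k, IsXiAlong B (ζ k) univ (γ j) (kron j k) (ξ j k)) →
      (∀ k, Integrable (fIntegrand dx (γ i) (ξ i k) u)) →
      (∀ k, Integrable (fIntegrand dx (γ j) (ξ j k) v)) →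
      Integrable (checkIntegrand B (γ i) (γ j) (kron i j) u v) →
      checkLaplace B (γ i) (γ j) (kron i j) univ u v =
        (u * v / (u + v) : ℝ) * (kron i j -
          ∑ k, fLaplace dx (γ i) (ξ i k) univ u * fLaplace dx (γ j) (ξ j k) univ v)) := by
  refine ⟨fun i j => hasExpansion_bergmanCoeff ha hζ hB i j,
    fun i j => formal_factorization hB hAC hBA hdx ha ha_range hζ i j,
    fun γ r hr i hi k ξ hξ N => isBigO_fLaplace_sub ha hζ hdx hB hr hi hξ N,
    fun γ r hr i j hi hj N => isBigO_checkLaplace_sub ha hζ hdx hB hr hi hj N,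
    fun γ ξ i j u v hu hv hi hj hξi hξj hF hG hJ =>
      checkLaplace_factorization hB hAC hBA hdx ha ha_range hζ hu hv hi hj hξi hξj hF hG hJ⟩
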